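/- Let $\mathbb T=\mathbb R/\mathbb Z$, let $F:\mathbb T\to\mathbb R$ be smooth, and let $T>0$, $M\ge 1$, $K,\kappa\in\mathbb R$, $\varepsilon_0\in(0,1/2)$. For $n\ge 1$ let $\mathbb T_n=\mathbb Z/n\mathbb Z$ and let $\{\eta_t\}_{t\ge0}$ be the weakly asymmetric exclusion process on $\{0,1\}^{\mathbb T_n}$ with generator $$L_nf(\eta)=\sum_{x,y\in\mathbb T_n}r_n(x,y)\,\eta(x)(1-\eta(y))\,[f(\eta^{x,y})-f(\eta)],\qquad r_n(x,x\pm1)=1\pm\tfrac1nF(\tfrac xn),$$ and $r_n(x,y)=0$ for sites that are not neighbours, where $\eta^{x,y}$ is $\eta$ with the values at $x$ and $y$ exchanged; only those $n$ are considered for which $r_n\ge0$ (this holds for all large $n$). Let $\rho$ be a smooth solution on $[0,T]\times\mathbb T$ of $$\partial_t\rho_t=\partial_{uu}^2\rho_t-2\,\partial_u\{\rho_t(1-\rho_t)F\},$$ with $\varepsilon_0<\rho_0(u)<1-\varepsilon_0$ for all $u$, and $n|\rho_t(\frac{x+1}n)-\rho_t(\frac xn)|\le\kappa$ for all $n\ge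 1$, all $x$ and all $t\in[0,T]$. Let $q:[0,T]\to\mathbb R$ be smooth with $\frac1M\le q\le M$. Let the process start from a probability measure $\mu^n$ whose relative entropy satisfies $H(\mu^n\mid\nu^n_{\rho_0})\le K$, where $\nu^n_{\rho_0}$ is the Bernoulli product measure with $\nu^n_{\rho_0}\{\eta(x)=1\}=\rho_0(x/n)$, and write $\mathbb P_{\mu^n}$, $\mathbb E_{\mu^n}$ for its law on càdlàg paths and the expectation. Put $$\Gamma_n(t)=\sqrt n\int_0^t\frac{\eta_{sn^2}(0)-\rho_s(0)}{q_s}\,ds,\qquad t\in[0,T].$$ Then for every $\lambda\in(1,2)$ there is a constant $C$, depending only on $F,K,\varepsilon_0,\kappa,T,M,\lambda$, such that $$\mathbb E_{\mu^n}\big[|\Gamma_n(t)-\Gamma_n(s)|^\lambda\big]\le C\,|t-s|^{3\lambda/4}$$ for all $0\le s<t\le T$ and all $n$ as above. Moreover, for fixed $\rho$ and $q$, the processes $\{\Gamma_n(t):t\in[0,T]\}$ have continuous trajectories, and their laws, over all such $n$ and $\mu^n$, form a tight family on $C([0,T],\mathbb R)$ with the uniform topology. -/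

import Mathlib

open MeasureTheory Filter Topology Set
open scoped NNReal ENNReal ContDiff

noncomputable section

namespace WASEP

/-- Configurations `{0,1}^{𝕋_n}` on the discrete torus `𝕋_n = ℤ/nℤ`; `true` means occupied. -/
abbrev Config (n : ℕ) : Type := ZMod n → Bool

/-- The occupation variable `η(x) ∈ {0,1}`, as a real number. -/
def occ {n : ℕ} (η : Config n) (x : ZMod n) : ℝ := if η x then 1 else 0

/-- The point `x/n` of the continuous torus, represented in `[0,1)`. Functions on the continuous
torus `ℝ/ℤ` are represented by `1`-periodic functions on `ℝ`. -/
def site (n : ℕ) (x : ZMod n) : ℝ := (x.val : ℝ) / n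

/-- The configuration `η^{x,y}`: the occupations of `x` and `y` are exchanged. -/
def exchange {n : ℕ} (η : Config n) (x y : ZMod n) : Config n :=
  fun z => η (Equiv.swap x y z)

/-- Jump rates `r_n(x, x ± 1) = 1 ± F(x/n)/n`, and `0` between sites that are not neighbours.
(For `n = 2`, where `x + 1 = x - 1`, the two rates add up.) -/
def rate (n : ℕ) (F : ℝ → ℝ) (x y : ZMod n) : ℝ :=
  (if y = x + 1 then 1 + F (site n x) / n else 0) +
    (if y = x - 1 then 1 - F (site n x) / n else 0)

/-- The generator
`L_n f(η) = ∑_{x,y} r_n(x,y) η(x) (1 - η(y)) [f(η^{x,y}) - f(η)]`. -/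
def generator (n : ℕ) [NeZero n] (F : ℝ → ℝ) (f : Config n → ℝ) (η : Config n) : ℝ :=
  ∑ x : ZMod n, ∑ y : ZMod n,
    rate n F x y * occ η x * (1 - occ η y) * (f (exchange η x y) - f η)

/-- The matrix of the generator: `L_n(η, ξ) = (L_n 1_{ξ})(η)`. -/
def generatorMatrix (n : ℕ) [NeZero n] (F : ℝ → ℝ) : Matrix (Config n) (Config n) ℝ :=
  Matrix.of fun η ξ => generator n F (Pi.single ξ 1) η

/-- The transition probabilities `p_t(η, ξ) = (e^{t L_n})(η, ξ)`. -/
def transition (n : ℕ) [NeZero n] (F : ℝ → ℝ) (t : ℝ) : Matrix (Config n) (Config n) ℝ :=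
  NormedSpace.exp (t • generatorMatrix n F)

/-- Càdlàg trajectories `[0,∞) → {0,1}^{𝕋_n}` (the state space is discrete). -/
def IsCadlag {n : ℕ} (w : ℝ≥0 → Config n) : Prop :=
  (∀ t, ContinuousWithinAt w (Ici t) t) ∧ ∀ t, ∃ l, Tendsto w (𝓝[<] t) (𝓝 l)

/-- The path space of càdlàg trajectories, with the σ-algebra generated by the coordinates. -/
abbrev Path (n : ℕ) : Type := {w : ℝ≥0 → Config n // IsCadlag w}

/-- `P` is the law on path space of the Markov process with generator `L_n` and initial
distribution `μ`: a probability measure whose finite-dimensional distributions are those given by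
`μ` and the semigroup `e^{t L_n}`. -/
structure IsLaw (n : ℕ) [NeZero n] (F : ℝ → ℝ) (μ : Measure (Config n)) (P : Measure (Path n)) :
    Prop where
  isProbabilityMeasure : IsProbabilityMeasure P
  finite_dimensional : ∀ (k : ℕ) (t : Fin (k + 1) → ℝ≥0) (σ : Fin (k + 1) → Config n),
    Monotone t → t 0 = 0 →
      P.real {w | ∀ i, w.1 (t i) = σ i} =
        μ.real {σ 0} * ∏ i : Fin k,
          transition n F ((t i.succ : ℝ) - (t i.castSucc : ℝ)) (σ i.castSucc) (σ i.succ)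

/-- The Bernoulli measure on `{0,1}` with parameter `p ∈ [0,1]`. -/
def bernoulli (p : ℝ) : Measure Bool :=
  ENNReal.ofReal p • Measure.dirac true + ENNReal.ofReal (1 - p) • Measure.dirac false

/-- The Bernoulli product measure on `{0,1}^{𝕋_n}` associated with a profile `r` on the torus:
`ν{η(x) = 1} = r(x/n)`. -/
def productMeasure (n : ℕ) [NeZero n] (r : ℝ → ℝ) : Measure (Config n) :=
  Measure.pi fun x => bernoulli (r (site n x))

/-- `ρ` is, on `[0,T]`, the (smooth) solution of
`∂ₜρ = ∂ᵤᵤρ - 2 ∂ᵤ{ρ(1-ρ)F}` on the torus. The initial profile is `ρ 0`. -/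
structure IsHydrodynamicSolution (F : ℝ → ℝ) (T : ℝ) (ρ : ℝ → ℝ → ℝ) : Prop where
  smooth : ContDiffOn ℝ ∞ (fun p : ℝ × ℝ => ρ p.1 p.2) (Icc 0 T ×ˢ univ)
  periodic : ∀ t ∈ Icc 0 T, Function.Periodic (ρ t) 1
  equation : ∀ t ∈ Icc 0 T, ∀ u : ℝ,
    derivWithin (fun s => ρ s u) (Icc 0 T) t =
      iteratedDeriv 2 (ρ t) u - 2 * deriv (fun v => ρ t v * (1 - ρ t v) * F v) u

/-- `n |ρ_t((x+1)/n) - ρ_t(x/n)| ≤ κ` for all `n`, all sites `x` and all `t ∈ [0,T]`. -/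
def GradientBound (T κ : ℝ) (ρ : ℝ → ℝ → ℝ) : Prop :=
  ∀ t ∈ Icc 0 T, ∀ n : ℕ, 0 < n → ∀ x : ℤ,
    (n : ℝ) * |ρ t (((x : ℝ) + 1) / n) - ρ t ((x : ℝ) / n)| ≤ κ

/-- A smooth weight `q` on `[0,T]` with `1/M ≤ q ≤ M`. -/
structure IsWeight (T M : ℝ) (q : ℝ → ℝ) : Prop where
  smooth : ContDiffOn ℝ ∞ q (Icc 0 T)
  lower : ∀ s ∈ Icc 0 T, 1 / M ≤ q s
  upper : ∀ s ∈ Icc 0 T, q s ≤ M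

/-- The rescaled (generalized) occupation time of the origin,
`Γ_n(t) = √n ∫₀ᵗ (η_{s n²}(0) - ρ_s(0)) / q_s ds`. -/
def occupationTime (n : ℕ) (ρ : ℝ → ℝ → ℝ) (q : ℝ → ℝ) (w : Path n) (t : ℝ) : ℝ :=
  √(n : ℝ) * ∫ s in (0 : ℝ)..t, (occ (w.1 (s * (n : ℝ) ^ 2).toNNReal) 0 - ρ s 0) / q s

/-- `C([0,T], ℝ)`, whose topology in Mathlib is the uniform one, with its Borel σ-algebra. -/
instance (T : ℝ) : MeasurableSpace C(Icc (0 : ℝ) T, ℝ) := borel _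

instance (T : ℝ) : BorelSpace C(Icc (0 : ℝ) T, ℝ) := ⟨rfl⟩

/-- The trajectory `{Γ_n(t) : t ∈ [0,T]}` as an element of `C([0,T], ℝ)`
(`0` if it were not continuous). -/
def occupationPath (n : ℕ) (T : ℝ) (ρ : ℝ → ℝ → ℝ) (q : ℝ → ℝ) (w : Path n) :
    C(Icc (0 : ℝ) T, ℝ) :=
  ContinuousMap.mkD (fun t : Icc (0 : ℝ) T => occupationTime n ρ q w t) 0

/-- `P` is a law of the exclusion process on `𝕋_n` (with nonnegative jump rates) whose initial
distribution `μ` has relative entropy at most `K` with respect to the Bernoulli product measure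
with profile `r`. -/
def IsAdmissibleLaw (n : ℕ) [NeZero n] (F r : ℝ → ℝ) (K : ℝ) (P : Measure (Path n)) : Prop :=
  (∀ x y : ZMod n, 0 ≤ rate n F x y) ∧
    ∃ μ : Measure (Config n), IsProbabilityMeasure μ ∧
      InformationTheory.klDiv μ (productMeasure n r) ≤ ENNReal.ofReal K ∧ IsLaw n F μ P

end WASEP

end

/-! Everything rests on one estimate, `WASEP.IsAdmissibleLaw.second_moment_le`: the second moment of
an increment of the occupation time over an interval of length τ is at most a constant times
τ^(3/2), with a constant independent of n, and of ρ beyond ε₀ and κ. Comparing |y|^λ with 1 + y² at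
the scale τ^(3/4) gives the moment bound for λ < 2. Since 3/2 > 1, a dyadic chaining argument of
Kolmogorov type gives tightness.

Second moment. Let G solve the backward discrete heat equation on [s,t] with source √n/q at the
origin and G = 0 at time t, and let Φ_r be the density field of G_r centred at a reference profile
a_r. The symmetric part of the exclusion current is a discrete gradient, so (∂_r + n²L)Φ equals
minus the integrand of the occupation time plus two remainders: fluctuations of the order-1/n
asymmetric current, and the error with which a solves the discrete hydrodynamic equation. The time
integral of (∂_r + n²L)Φ has second moment E[Φ_s²] plus the integrated carré du champ
(`IsLaw.integral_sq_additive`), which only uses two-time marginals. All terms are then controlled by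
the ℓ² norm and the Dirichlet energy of G. A one-dimensional Sobolev inequality shows that both are
of order τ^(3/2) (`heat_energy`), although the source has size √n.

Entropy. Expectations under the true law are taken through the entropy inequality: linear and
nearest-neighbour quadratic forms in the normalized fluctuations are sub-Gaussian under product
measures, hence have second moments bounded by their coefficients times the relative entropy plus
one. The entropy relative to the product measure of a_r stays bounded by Yau's method. Its time
derivative consists of a negative Dirichlet form of order n², a quadratic field with bounded
coefficients, and the flux error. In the quadratic field one factor is replaced, by summation by
parts, by its average over the whole torus. The average is harmless by the entropy inequality; the
gradients produced on the way are integrated by parts along bonds and absorbed by the Dirichlet form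
(`sum_mul_quadratic_le`). Gronwall's inequality concludes (`ent_lawAt_le`).

Uniformity in ρ. Only first differences of ρ are controlled. The reference profile is therefore made
of cell averages, which satisfy a discrete continuity equation exactly. The distance between the
true flux and n times the mean microscopic current is needed only in ℓ² in space and time, where it
is bounded by the integral of the squared second derivative of ρ; an energy estimate bounds this
integral by κ and F. A comparison principle keeps ρ away from 0 and 1. -/

noncomputable section

namespace WASEP

/-! ### Calculus for Bernoulli product weights -/

section ProductWeights

set_option linter.unusedSectionVars false

variable {ι : Type*} [Fintype ι] [DecidableEq ι]

/-- The weight of a configuration under the Bernoulli product measure with profile `a`. -/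
def bweight (a : ι → ℝ) (η : ι → Bool) : ℝ := ∏ x, if η x then a x else 1 - a x

/-- Expectation under the Bernoulli product measure with profile `a`. -/
def bmean (a : ι → ℝ) (f : (ι → Bool) → ℝ) : ℝ := ∑ η, bweight a η * f η

/-- The normalized fluctuation `ω_x = (η(x) - a(x)) / (a(x) (1 - a(x)))`. -/
def flu (a : ι → ℝ) (x : ι) (η : ι → Bool) : ℝ := if η x then (a x)⁻¹ else -(1 - a x)⁻¹

/-- The function `f` does not depend on the coordinate `x`. -/
def FreeOf (f : (ι → Bool) → ℝ) (x : ι) : Prop := ∀ η b, f (Function.update η x b) = f η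

/-- The profile `a` takes its values in `[ε, 1 - ε]`. -/
def Elliptic (ε : ℝ) (a : ι → ℝ) : Prop := ∀ x, ε ≤ a x ∧ a x ≤ 1 - ε

lemma Elliptic.pos {ε : ℝ} {a : ι → ℝ} (h : Elliptic ε a) (hε : 0 < ε) (x : ι) : 0 < a x :=
  hε.trans_le (h x).1

lemma Elliptic.one_sub_pos {ε : ℝ} {a : ι → ℝ} (h : Elliptic ε a) (hε : 0 < ε) (x : ι) :
    0 < 1 - a x := by
  linarith [(h x).2]

lemma bweight_pos {ε : ℝ} {a : ι → ℝ} (h : Elliptic ε a) (hε : 0 < ε) (η : ι → Bool) :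
    0 < bweight a η := by
  refine Finset.prod_pos fun x _ => ?_
  split_ifs
  · exact h.pos hε x
  · exact h.one_sub_pos hε x

lemma sum_bweight (a : ι → ℝ) : ∑ η, bweight a η = 1 := by
  have h := Finset.prod_univ_sum (fun _ : ι => (Finset.univ : Finset Bool))
    (fun x (b : Bool) => if b then a x else 1 - a x)
  rw [Fintype.piFinset_univ] at h
  unfold bweight
  rw [← h]
  simp

lemma bmean_const (a : ι → ℝ) (c : ℝ) : bmean a (fun _ => c) = c := by
  simp [bmean, ← Finset.sum_mul, sum_bweight]

lemma bmean_mono {ε : ℝ} {a : ι → ℝ} (h : Elliptic ε a) (hε : 0 < ε) {f g : (ι → Bool) → ℝ}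
    (hfg : ∀ η, f η ≤ g η) : bmean a f ≤ bmean a g :=
  Finset.sum_le_sum fun η _ => mul_le_mul_of_nonneg_left (hfg η) (bweight_pos h hε η).le

lemma bmean_smul (a : ι → ℝ) (c : ℝ) (f : (ι → Bool) → ℝ) :
    bmean a (fun η => c * f η) = c * bmean a f := by
  simp only [bmean, Finset.mul_sum]
  exact Finset.sum_congr rfl fun η _ => by ring

lemma bmean_pos {ε : ℝ} {a : ι → ℝ} (h : Elliptic ε a) (hε : 0 < ε) {f : (ι → Bool) → ℝ}
    (hf : ∀ η, 0 < f η) : 0 < bmean a f :=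
  Finset.sum_pos (fun η _ => mul_pos (bweight_pos h hε η) (hf η)) Finset.univ_nonempty

/-- Flipping the occupation of one site. -/
def flipSite (x : ι) : Equiv.Perm (ι → Bool) :=
  Function.Involutive.toPerm (fun η => Function.update η x (!(η x))) fun η => by
    ext y
    by_cases hy : y = x <;> simp [hy]

lemma bweight_eq (a : ι → ℝ) (x : ι) (η : ι → Bool) :
    bweight a η = (if η x then a x else 1 - a x) *
      ∏ y ∈ Finset.univ.erase x, if η y then a y else 1 - a y :=
  (Finset.mul_prod_erase Finset.univ _ (Finset.mem_univ x)).symm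

/-- Resampling one coordinate does not change expectations. -/
lemma bmean_resample (a : ι → ℝ) (x : ι) (f : (ι → Bool) → ℝ) :
    bmean a f = bmean a (fun η => a x * f (Function.update η x true)
      + (1 - a x) * f (Function.update η x false)) := by
  -- The identity holds after pairing η with its flip at x: the two weights of a pair are `a x` and
  -- `1 - a x` times a common product. Summation over η counts every pair twice on both sides.
  have key : ∀ η, bweight a η * f η + bweight a (flipSite x η) * f (flipSite x η)
      = bweight a η * (a x * f (Function.update η x true)
        + (1 - a x) * f (Function.update η x false)) +
        bweight a (flipSite x η) * (a x * f (Function.update (flipSite x η) x true)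
        + (1 - a x) * f (Function.update (flipSite x η) x false)) := by
    intro η
    have h1 : flipSite x η = Function.update η x (!(η x)) := rfl
    have h2 : (∏ y ∈ Finset.univ.erase x, if Function.update η x (!(η x)) y = true then a y
        else 1 - a y) = ∏ y ∈ Finset.univ.erase x, if η y then a y else 1 - a y :=
      Finset.prod_congr rfl fun y hy => by
        rw [Function.update_of_ne (Finset.ne_of_mem_erase hy)]
    rw [h1, bweight_eq a x η, bweight_eq a x (Function.update η x _), h2]
    simp only [Function.update_self, Function.update_idem]
    cases hx : η x
    · have h3 : Function.update η x false = η := by rw [← hx]; simp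
      simp [h3]; ring
    · have h3 : Function.update η x true = η := by rw [← hx]; simp
      simp [h3]; ring
  have h := Finset.sum_congr rfl fun η (_ : η ∈ Finset.univ) => key η
  simp only [Finset.sum_add_distrib] at h
  rw [Equiv.sum_comp (flipSite x) (fun η => bweight a η * f η),
    Equiv.sum_comp (flipSite x) (fun η => bweight a η * (a x * f (Function.update η x true)
        + (1 - a x) * f (Function.update η x false)))] at h
  unfold bmean
  linarith

lemma abs_flu_le {ε : ℝ} {a : ι → ℝ} (h : Elliptic ε a) (hε : 0 < ε) (x : ι) (η : ι → Bool) :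
    |flu a x η| ≤ ε⁻¹ := by
  unfold flu
  split_ifs
  · rw [abs_of_pos (inv_pos.2 (h.pos hε x))]
    exact inv_anti₀ hε (h x).1
  · rw [abs_neg, abs_of_pos (inv_pos.2 (h.one_sub_pos hε x))]
    exact inv_anti₀ hε (by linarith [(h x).2])

lemma flu_freeOf (a : ι → ℝ) {x y : ι} (hxy : x ≠ y) : FreeOf (flu a x) y := fun η b => by
  simp [flu, Function.update_of_ne hxy]

lemma FreeOf.mul {f g : (ι → Bool) → ℝ} {x : ι} (hf : FreeOf f x) (hg : FreeOf g x) :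
    FreeOf (fun η => f η * g η) x := fun η b => by
  simp only [hf η b, hg η b]

lemma FreeOf.comp {f : (ι → Bool) → ℝ} {x : ι} (hf : FreeOf f x) (φ : ℝ → ℝ) :
    FreeOf (fun η => φ (f η)) x := fun η b => by
  simp only [hf η b]

lemma FreeOf.sum {κ : Type*} (s : Finset κ) {f : κ → (ι → Bool) → ℝ} {x : ι}
    (hf : ∀ i ∈ s, FreeOf (f i) x) : FreeOf (fun η => ∑ i ∈ s, f i η) x := fun η b =>
  Finset.sum_congr rfl fun i hi => hf i hi η b

lemma freeOf_const (c : ℝ) (x : ι) : FreeOf (fun _ => c) x := fun _ _ => rfl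

/-- Two-point Hoeffding inequality. -/
lemma two_point_exp_le {p ε : ℝ} (hε : 0 < ε) (h1 : ε ≤ p) (h2 : p ≤ 1 - ε) (u : ℝ) :
    p * Real.exp (u * p⁻¹) + (1 - p) * Real.exp (u * -(1 - p)⁻¹) ≤
      Real.exp (ε⁻¹ ^ 2 / 2 * u ^ 2) := by
  set B := ε⁻¹ with hB
  have hBpos : 0 < B := inv_pos.2 hε
  have hp : 0 < p := by linarith
  have hq : 0 < 1 - p := by linarith
  -- The chord of exp over [-uB, uB] bounds the exponential at both values. Since p · p⁻¹ - (1 - p)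
  -- · (1 - p)⁻¹ = 0, the part of the chord linear in w averages out and cosh (uB) remains.
  have conv : ∀ w : ℝ, |w| ≤ B → Real.exp (u * w) ≤
      ((B + w) * Real.exp (u * B) + (B - w) * Real.exp (-(u * B))) / (2 * B) := by
    intro w hw
    obtain ⟨hw1, hw2⟩ := abs_le.1 hw
    have ha : 0 ≤ (B + w) / (2 * B) := div_nonneg (by linarith) (by linarith)
    have hb : 0 ≤ (B - w) / (2 * B) := div_nonneg (by linarith) (by linarith)
    have hc := convexOn_exp.2 (mem_univ (u * B)) (mem_univ (-(u * B))) ha hb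
      (by field_simp; ring)
    simp only [smul_eq_mul] at hc
    calc Real.exp (u * w) = Real.exp ((B + w) / (2 * B) * (u * B) +
          (B - w) / (2 * B) * -(u * B)) := by congr 1; field_simp; ring
      _ ≤ _ := hc
      _ = _ := by ring
  have c1 := conv p⁻¹ (by rw [abs_of_pos (inv_pos.2 hp)]; exact inv_anti₀ hε h1)
  have c2 := conv (-(1 - p)⁻¹) (by
    rw [abs_neg, abs_of_pos (inv_pos.2 hq)]; exact inv_anti₀ hε (by linarith))
  calc _ ≤ p * (((B + p⁻¹) * Real.exp (u * B) + (B - p⁻¹) * Real.exp (-(u * B))) / (2 * B)) +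
        (1 - p) * (((B + -(1 - p)⁻¹) * Real.exp (u * B) +
          (B - -(1 - p)⁻¹) * Real.exp (-(u * B))) / (2 * B)) := by gcongr
    _ = Real.cosh (u * B) := by
      rw [Real.cosh_eq]
      field_simp
      ring
    _ ≤ Real.exp ((u * B) ^ 2 / 2) := Real.cosh_le_exp_half_sq _
    _ = _ := by congr 1; ring

/-- Once the other sites are fixed, g and u are constants and `flu a x` is a centred two-valued
variable bounded by ε⁻¹, so the two-point inequality applies under the resampling of x. -/
lemma bmean_mul_exp_le {ε : ℝ} {a : ι → ℝ} (h : Elliptic ε a) (hε : 0 < ε) {x : ι}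
    {g u : (ι → Bool) → ℝ} (hg : FreeOf g x) (hu : FreeOf u x) (hg0 : ∀ η, 0 ≤ g η) :
    bmean a (fun η => g η * Real.exp (u η * flu a x η)) ≤
      bmean a (fun η => g η * Real.exp (ε⁻¹ ^ 2 / 2 * u η ^ 2)) := by
  rw [bmean_resample a x]
  refine bmean_mono h hε fun η => ?_
  have := mul_le_mul_of_nonneg_left (two_point_exp_le hε (h x).1 (h x).2 (u η)) (hg0 η)
  simp only [hg η, hu η, flu, Function.update_self, if_true]
  calc _ = g η * (a x * Real.exp (u η * (a x)⁻¹) +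
        (1 - a x) * Real.exp (u η * -(1 - a x)⁻¹)) := by simp; ring
    _ ≤ _ := this

/-- The exponential supermartingale obtained by integrating out the sites `s 0, s 1, …` in turn. -/
lemma bmean_exp_supermartingale {ε : ℝ} {a : ι → ℝ} (h : Elliptic ε a) (hε : 0 < ε) (m : ℕ)
    (s : ℕ → ι) (v : ℕ → (ι → Bool) → ℝ)
    (hs : ∀ i j, i < j → j < m → s j ≠ s i) (hv : ∀ i j, i ≤ j → j < m → FreeOf (v j) (s i)) :
    bmean a (fun η => Real.exp (∑ i ∈ Finset.range m,
      (v i η * flu a (s i) η - ε⁻¹ ^ 2 / 2 * v i η ^ 2))) ≤ 1 := by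
  -- Induction on the number d of terms kept, counted from the end. The new term k is integrated
  -- over the site `s k`; neither its own coefficient nor any later term depends on that site.
  have key : ∀ d, d ≤ m → bmean a (fun η => Real.exp (∑ i ∈ Finset.Ico (m - d) m,
      (v i η * flu a (s i) η - ε⁻¹ ^ 2 / 2 * v i η ^ 2))) ≤ 1 := by
    intro d
    induction d with
    | zero => intro _; simp [bmean_const]
    | succ d ih =>
      intro hd
      set k := m - (d + 1) with hk
      have hk1 : m - d = k + 1 := by omega
      have hkm : k < m := by omega
      have ih' := ih (by omega)
      rw [hk1] at ih'
      refine le_trans (le_of_eq_of_le ?_ (bmean_mul_exp_le h hε (x := s k)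
        (g := fun η => Real.exp (∑ i ∈ Finset.Ico (k + 1) m,
          (v i η * flu a (s i) η - ε⁻¹ ^ 2 / 2 * v i η ^ 2)) *
          Real.exp (-(ε⁻¹ ^ 2 / 2 * v k η ^ 2))) (u := v k) ?_ ?_ ?_)) (le_of_eq_of_le ?_ ih')
      · congr 1; ext η
        rw [Finset.sum_eq_sum_Ico_succ_bot hkm, ← Real.exp_add, ← Real.exp_add]
        congr 1; ring
      · refine FreeOf.mul (FreeOf.comp (FreeOf.sum _ fun i hi => ?_) Real.exp) ?_
        · have hi' := Finset.mem_Ico.1 hi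
          intro η b
          simp only [hv k i (by omega) hi'.2 η b, flu_freeOf a (hs k i (by omega) hi'.2) η b]
        · intro η b
          simp only [hv k k le_rfl hkm η b]
      · exact hv k k le_rfl hkm
      · intro η; positivity
      · congr 1; ext η
        rw [← Real.exp_add, ← Real.exp_add]
        congr 1; ring
  simpa using key m le_rfl

/-- Cauchy–Schwarz for Bernoulli expectations of exponentials. -/
lemma bmean_exp_add_le {ε : ℝ} {a : ι → ℝ} (h : Elliptic ε a) (hε : 0 < ε)
    {X Y : (ι → Bool) → ℝ} {A B : ℝ} (hX : bmean a (fun η => Real.exp (2 * X η)) ≤ A)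
    (hY : bmean a (fun η => Real.exp (2 * Y η)) ≤ B) :
    bmean a (fun η => Real.exp (X η + Y η)) ≤ √(A * B) := by
  refine Real.le_sqrt_of_sq_le ?_
  have hX0 := bmean_pos h hε (f := fun η => Real.exp (2 * X η)) fun η => Real.exp_pos _
  calc bmean a (fun η => Real.exp (X η + Y η)) ^ 2
      = (∑ η, (√(bweight a η) * Real.exp (X η)) * (√(bweight a η) * Real.exp (Y η))) ^ 2 := by
        unfold bmean
        congr 1
        refine Finset.sum_congr rfl fun η _ => ?_
        simp only [Real.exp_add]
        nth_rw 1 [← Real.mul_self_sqrt (bweight_pos h hε η).le]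
        ring
    _ ≤ (∑ η, (√(bweight a η) * Real.exp (X η)) ^ 2) *
        ∑ η, (√(bweight a η) * Real.exp (Y η)) ^ 2 := Finset.sum_mul_sq_le_sq_mul_sq _ _ _
    _ = bmean a (fun η => Real.exp (2 * X η)) * bmean a (fun η => Real.exp (2 * Y η)) := by
        unfold bmean
        congr 1 <;>
        · refine Finset.sum_congr rfl fun η _ => ?_
          rw [mul_pow, Real.sq_sqrt (bweight_pos h hε η).le, ← Real.exp_nat_mul]
          simp
    _ ≤ A * B := mul_le_mul hX hY (bmean_pos h hε fun η => Real.exp_pos _).le (hX0.le.trans hX)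

/-- Jensen: the exponential moment of an average is at most the largest of the exponential
moments. -/
lemma bmean_exp_average_le {ε : ℝ} {a : ι → ℝ} (h : Elliptic ε a) (hε : 0 < ε) {κ : Type*}
    (s : Finset κ) (hs : s.Nonempty) (X : κ → (ι → Bool) → ℝ) {A : ℝ}
    (hX : ∀ i ∈ s, bmean a (fun η => Real.exp (X i η)) ≤ A) :
    bmean a (fun η => Real.exp ((s.card : ℝ)⁻¹ * ∑ i ∈ s, X i η)) ≤ A := by
  have hc : (0 : ℝ) < s.card := by exact_mod_cast hs.card_pos
  calc bmean a (fun η => Real.exp ((s.card : ℝ)⁻¹ * ∑ i ∈ s, X i η))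
      ≤ bmean a (fun η => ∑ i ∈ s, (s.card : ℝ)⁻¹ * Real.exp (X i η)) := by
        refine bmean_mono h hε fun η => ?_
        have := convexOn_exp.map_sum_le (t := s) (w := fun _ => (s.card : ℝ)⁻¹)
          (p := fun i => X i η) (fun _ _ => by positivity) (by simp [hc.ne']) fun _ _ => mem_univ _
        simpa [Finset.mul_sum] using this
    _ = ∑ i ∈ s, (s.card : ℝ)⁻¹ * bmean a (fun η => Real.exp (X i η)) := by
        simp only [bmean, Finset.mul_sum]
        rw [Finset.sum_comm]
        exact Finset.sum_congr rfl fun i _ => Finset.sum_congr rfl fun η _ => by ring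
    _ ≤ ∑ i ∈ s, (s.card : ℝ)⁻¹ * A := by
        gcongr with i hi
        exact hX i hi
    _ = A := by
        rw [Finset.sum_const, nsmul_eq_mul]; field_simp

/-- Exponential integrability of squares of sub-Gaussian variables. -/
lemma bmean_exp_sq_le {ε : ℝ} {a : ι → ℝ} (h : Elliptic ε a) (hε : 0 < ε)
    {X : (ι → Bool) → ℝ} {A V γ : ℝ} (hA : 0 ≤ A)
    (hX : ∀ θ : ℝ, bmean a (fun η => Real.exp (θ * X η)) ≤ A * Real.exp (V * θ ^ 2))
    (hγ : 0 ≤ γ) (hγV : 8 * γ * V ≤ 1) :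
    bmean a (fun η => Real.exp (γ * X η ^ 2)) ≤ 2 * A := by
  have hpi : (0 : ℝ) < √Real.pi := Real.sqrt_pos.2 Real.pi_pos
  have sq2 : √γ ^ 2 = γ := Real.sq_sqrt hγ
  -- completing the square
  have hg : ∀ y : ℝ, Integrable (fun g : ℝ => Real.exp (-1 * g ^ 2 + 2 * y * g)) ∧
      ∫ g : ℝ, Real.exp (-1 * g ^ 2 + 2 * y * g) = √Real.pi * Real.exp (y ^ 2) := by
    intro y
    have e : (fun g : ℝ => Real.exp (-1 * g ^ 2 + 2 * y * g)) =
        fun g => Real.exp (y ^ 2) * (fun z : ℝ => Real.exp (-1 * z ^ 2)) (g - y) := by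
      ext g; simp only [← Real.exp_add]; congr 1; ring
    rw [e]
    refine ⟨((integrable_exp_neg_mul_sq one_pos).comp_sub_right y).const_mul _, ?_⟩
    rw [integral_const_mul, integral_sub_right_eq_self (fun z : ℝ => Real.exp (-1 * z ^ 2)) y,
      integral_gaussian, div_one, mul_comm]
  -- Linearization of the square: exp (γX²) is an average of exp (2√γ g X) over a Gaussian variable
  -- g, so that the sub-Gaussian hypothesis can be applied under the integral in g.
  have e1 : √Real.pi * bmean a (fun η => Real.exp (γ * X η ^ 2)) =
      ∫ g : ℝ, Real.exp (-1 * g ^ 2) * bmean a (fun η => Real.exp (2 * √γ * g * X η)) := by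
    have : ∀ g : ℝ, Real.exp (-1 * g ^ 2) * bmean a (fun η => Real.exp (2 * √γ * g * X η)) =
        ∑ η, bweight a η * Real.exp (-1 * g ^ 2 + 2 * (√γ * X η) * g) := by
      intro g
      unfold bmean
      rw [Finset.mul_sum]
      refine Finset.sum_congr rfl fun η _ => ?_
      rw [Real.exp_add]
      have : 2 * √γ * g * X η = 2 * (√γ * X η) * g := by ring
      simp only [this]; ring
    simp_rw [this]
    rw [integral_finsetSum _ fun η _ => (hg _).1.const_mul _]
    unfold bmean
    rw [Finset.mul_sum]
    refine Finset.sum_congr rfl fun η _ => ?_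
    rw [integral_const_mul, (hg _).2, mul_pow, sq2]; ring
  have hint : Integrable (fun g : ℝ => A * Real.exp (-(1 / 2) * g ^ 2)) :=
    (integrable_exp_neg_mul_sq (by norm_num)).const_mul _
  -- The hypothesis 8γV ≤ 1 makes the new exponent 4γV g² at most g²/2. Half of the Gaussian decay
  -- survives, at the price of a factor √2 that is rounded up to 2.
  have e2 : ∫ g : ℝ, Real.exp (-1 * g ^ 2) * bmean a (fun η => Real.exp (2 * √γ * g * X η)) ≤
      ∫ g : ℝ, A * Real.exp (-(1 / 2) * g ^ 2) := by
    refine integral_mono_of_nonneg (ae_of_all _ fun g => ?_) hint (ae_of_all _ fun g => ?_)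
    · exact mul_nonneg (Real.exp_pos _).le (bmean_pos h hε fun η => Real.exp_pos _).le
    · calc _ ≤ Real.exp (-1 * g ^ 2) * (A * Real.exp (V * (2 * √γ * g) ^ 2)) := by
            exact mul_le_mul_of_nonneg_left (hX _) (Real.exp_pos _).le
        _ = A * Real.exp (-1 * g ^ 2 + V * (2 * √γ * g) ^ 2) := by rw [Real.exp_add]; ring
        _ ≤ A * Real.exp (-(1 / 2) * g ^ 2) := by
            gcongr
            have : V * (2 * √γ * g) ^ 2 = 4 * γ * V * g ^ 2 := by rw [mul_pow, mul_pow, sq2]; ring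
            rw [this]
            nlinarith [sq_nonneg g]
  rw [← e1, integral_const_mul, integral_gaussian] at e2
  have e3 : √(Real.pi / (1 / 2)) ≤ √Real.pi * 2 := by
    rw [Real.sqrt_le_left (by positivity), mul_pow, Real.sq_sqrt Real.pi_pos.le]
    linarith [Real.pi_pos]
  have e4 : √Real.pi * bmean a (fun η => Real.exp (γ * X η ^ 2)) ≤ √Real.pi * (2 * A) := by
    nlinarith
  exact le_of_mul_le_mul_left e4 hpi

/-! ### Relative entropy and the entropy inequality -/

/-- Relative entropy of the weights `p` with respect to the Bernoulli product measure. -/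
def ent (a : ι → ℝ) (p : (ι → Bool) → ℝ) : ℝ :=
  ∑ η, p η * (Real.log (p η) - Real.log (bweight a η))

/-- The entropy inequality. -/
lemma sum_mul_le_ent_add_log {ε : ℝ} {a : ι → ℝ} (h : Elliptic ε a) (hε : 0 < ε)
    {p : (ι → Bool) → ℝ} (hp : ∀ η, 0 ≤ p η) (hp1 : ∑ η, p η = 1) (Y : (ι → Bool) → ℝ) :
    ∑ η, p η * Y η ≤ ent a p + Real.log (bmean a fun η => Real.exp (Y η)) := by
  set Z := bmean a fun η => Real.exp (Y η) with hZ
  have hZpos : 0 < Z := bmean_pos h hε fun η => Real.exp_pos _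
  -- This is log y ≤ y - 1 at y = w e^Y / (Z p), multiplied by p. The right-hand sides sum to zero
  -- because w e^Y / Z and p both have total mass one.
  have key : ∀ η, p η * Y η - p η * (Real.log (p η) - Real.log (bweight a η)) - p η * Real.log Z
      ≤ bweight a η * Real.exp (Y η) / Z - p η := by
    intro η
    have hw := bweight_pos h hε η
    rcases (hp η).eq_or_lt with h0 | h0
    · rw [← h0]; simp; positivity
    · have := Real.log_le_sub_one_of_pos (x := bweight a η * Real.exp (Y η) / Z / p η)
        (by positivity)
      rw [Real.log_div (by positivity) h0.ne', Real.log_div (by positivity) hZpos.ne',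
        Real.log_mul hw.ne' (Real.exp_pos _).ne', Real.log_exp] at this
      have := mul_le_mul_of_nonneg_left this h0.le
      have e : p η * (bweight a η * Real.exp (Y η) / Z / p η - 1) =
          bweight a η * Real.exp (Y η) / Z - p η := by field_simp
      rw [e] at this
      linarith
  have hsum := Finset.sum_le_sum fun η (_ : η ∈ Finset.univ) => key η
  simp only [Finset.sum_sub_distrib, ← Finset.sum_mul, ← Finset.sum_div, hp1] at hsum
  have hZ' : ∑ η, bweight a η * Real.exp (Y η) = Z := rfl
  rw [hZ', div_self hZpos.ne'] at hsum
  unfold ent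
  linarith

lemma ent_nonneg {ε : ℝ} {a : ι → ℝ} (h : Elliptic ε a) (hε : 0 < ε)
    {p : (ι → Bool) → ℝ} (hp : ∀ η, 0 ≤ p η) (hp1 : ∑ η, p η = 1) : 0 ≤ ent a p := by
  have := sum_mul_le_ent_add_log h hε hp hp1 (fun _ => 0)
  simpa [bmean_const] using this

/-- The entropy inequality for γY divided by γ: an exponential moment at a single scale becomes a
bound that is linear in the entropy. -/
lemma sum_mul_le_ent {ε : ℝ} {a : ι → ℝ} (h : Elliptic ε a) (hε : 0 < ε)
    {p : (ι → Bool) → ℝ} (hp : ∀ η, 0 ≤ p η) (hp1 : ∑ η, p η = 1) {Y : (ι → Bool) → ℝ}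
    {γ A : ℝ} (hγ : 0 < γ) (hA : bmean a (fun η => Real.exp (γ * Y η)) ≤ A) :
    ∑ η, p η * Y η ≤ γ⁻¹ * (ent a p + Real.log A) := by
  have h1 := sum_mul_le_ent_add_log h hε hp hp1 (fun η => γ * Y η)
  have h2 := Real.log_le_log (bmean_pos h hε fun η => Real.exp_pos (γ * Y η)) hA
  have h3 : ∑ η, p η * (γ * Y η) = γ * ∑ η, p η * Y η := by
    rw [Finset.mul_sum]; exact Finset.sum_congr rfl fun η _ => by ring
  rw [h3] at h1
  rw [inv_mul_eq_div, le_div_iff₀ hγ]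
  linarith

/-- Second moments of sub-Gaussian variables under a measure of bounded relative entropy. -/
lemma sum_mul_sq_le_ent {ε : ℝ} {a : ι → ℝ} (h : Elliptic ε a) (hε : 0 < ε)
    {p : (ι → Bool) → ℝ} (hp : ∀ η, 0 ≤ p η) (hp1 : ∑ η, p η = 1) {X : (ι → Bool) → ℝ} {V : ℝ}
    (hV : 0 ≤ V) (hX : ∀ θ : ℝ, bmean a (fun η => Real.exp (θ * X η)) ≤ Real.exp (V * θ ^ 2)) :
    ∑ η, p η * X η ^ 2 ≤ 8 * V * (ent a p + 1) := by
  have hent := ent_nonneg h hε hp hp1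
  -- The choice γ = 1/(8V) needs a positive variance proxy while V = 0 is allowed. The proxy is
  -- enlarged by δ, which is sent to zero at the end.
  have key : ∀ δ > 0, ∑ η, p η * X η ^ 2 ≤ 8 * (V + δ) * (ent a p + 1) := by
    intro δ hδ
    have h1 := bmean_exp_sq_le h hε (X := X) (A := 1) (V := V + δ) (γ := (8 * (V + δ))⁻¹)
      zero_le_one (fun θ => by
        rw [one_mul]; refine (hX θ).trans (Real.exp_le_exp.2 ?_); gcongr; linarith)
      (by positivity) (le_of_eq (by field_simp))
    have h2 := sum_mul_le_ent h hε hp hp1 (Y := fun η => X η ^ 2) (by positivity) h1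
    refine h2.trans ?_
    rw [inv_inv]
    gcongr
    linarith [Real.log_le_sub_one_of_pos (x := 2 * 1) (by norm_num)]
  have hlim : Tendsto (fun δ : ℝ => 8 * (V + δ) * (ent a p + 1)) (𝓝[>] 0)
      (𝓝 (8 * (V + 0) * (ent a p + 1))) := by
    refine Tendsto.mono_left ?_ nhdsWithin_le_nhds
    exact Continuous.tendsto (by fun_prop) 0
  rw [add_zero] at hlim
  exact ge_of_tendsto hlim (eventually_mem_nhdsWithin.mono fun δ hδ => key δ hδ)

end ProductWeights

/-! ### Exponential moments of linear, quadratic and cubic forms in the fluctuations -/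

section Forms

set_option linter.unusedSectionVars false

/-- Cauchy–Schwarz separates the supermartingale built on 2v, of mean at most 1, from its
compensator, whose exponential moment is the hypothesis. This version serves when the sum of the v
i² is random; a deterministic bound on that sum allows the simpler `bmean_exp_le_of_sum_sq_le`. -/
lemma bmean_exp_martingale_le {ι : Type*} [Fintype ι] [DecidableEq ι] {ε : ℝ} {a : ι → ℝ}
    (h : Elliptic ε a) (hε : 0 < ε) (m : ℕ)
    (s : ℕ → ι) (v : ℕ → (ι → Bool) → ℝ)
    (hs : ∀ i j, i < j → j < m → s j ≠ s i) (hv : ∀ i j, i ≤ j → j < m → FreeOf (v j) (s i))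
    {A : ℝ} (hA : bmean a (fun η => Real.exp (2 * (ε⁻¹ ^ 2 *
      ∑ i ∈ Finset.range m, v i η ^ 2))) ≤ A) :
    bmean a (fun η => Real.exp (∑ i ∈ Finset.range m, v i η * flu a (s i) η)) ≤ √A := by
  have h1 := bmean_exp_supermartingale h hε m s (fun i η => 2 * v i η) hs
    (fun i j hij hj => (hv i j hij hj).comp (fun t => 2 * t))
  have h2 := bmean_exp_add_le h hε (X := fun η => ∑ i ∈ Finset.range m,
    (v i η * flu a (s i) η - ε⁻¹ ^ 2 * v i η ^ 2))
    (Y := fun η => ε⁻¹ ^ 2 * ∑ i ∈ Finset.range m, v i η ^ 2) (A := 1) (B := A) ?_ hA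
  · rw [one_mul] at h2
    refine le_of_eq_of_le ?_ h2
    congr 1; ext η; congr 1
    rw [Finset.sum_sub_distrib, Finset.mul_sum]; ring
  · refine le_of_eq_of_le ?_ h1
    congr 1; ext η; congr 1
    rw [Finset.mul_sum]
    exact Finset.sum_congr rfl fun i _ => by ring

lemma bmean_exp_le_of_sum_sq_le {ι : Type*} [Fintype ι] [DecidableEq ι] {ε : ℝ} {a : ι → ℝ}
    (h : Elliptic ε a) (hε : 0 < ε) (m : ℕ)
    (s : ℕ → ι) (v : ℕ → (ι → Bool) → ℝ)
    (hs : ∀ i j, i < j → j < m → s j ≠ s i) (hv : ∀ i j, i ≤ j → j < m → FreeOf (v j) (s i))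
    {A : ℝ} (hA : ∀ η, ∑ i ∈ Finset.range m, v i η ^ 2 ≤ A) :
    bmean a (fun η => Real.exp (∑ i ∈ Finset.range m, v i η * flu a (s i) η)) ≤
      Real.exp (ε⁻¹ ^ 2 / 2 * A) := by
  have h1 := bmean_exp_supermartingale h hε m s v hs hv
  calc _ ≤ bmean a (fun η => Real.exp (ε⁻¹ ^ 2 / 2 * A) * Real.exp (∑ i ∈ Finset.range m,
      (v i η * flu a (s i) η - ε⁻¹ ^ 2 / 2 * v i η ^ 2))) := by
        refine bmean_mono h hε fun η => ?_
        rw [← Real.exp_add, Finset.sum_sub_distrib, ← Finset.mul_sum]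
        refine Real.exp_le_exp.2 ?_
        have := mul_le_mul_of_nonneg_left (hA η) (by positivity : 0 ≤ ε⁻¹ ^ 2 / 2)
        linarith
    _ ≤ _ := by
        rw [bmean_smul]
        exact mul_le_of_le_one_right (Real.exp_pos _).le h1

variable {n : ℕ} [NeZero n]

lemma sum_range_natCast (f : ZMod n → ℝ) : ∑ i ∈ Finset.range n, f (i : ZMod n) = ∑ x, f x := by
  symm
  refine Finset.sum_bij' (fun x _ => x.val) (fun i _ => (i : ZMod n)) ?_ ?_ ?_ ?_ ?_
  · intro x _; exact Finset.mem_range.2 (ZMod.val_lt x)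
  · intro i _; exact Finset.mem_univ _
  · intro x _; exact ZMod.natCast_zmod_val x
  · intro i hi; exact ZMod.val_cast_of_lt (Finset.mem_range.1 hi)
  · intro x _; rw [ZMod.natCast_zmod_val x]

lemma natCast_ne_of_lt {i j : ℕ} (hi : i < n) (hj : j < n) (hij : i ≠ j) :
    (i : ZMod n) ≠ (j : ZMod n) := fun h => hij (by
  have := congrArg ZMod.val h
  rwa [ZMod.val_cast_of_lt hi, ZMod.val_cast_of_lt hj] at this)

/-- Linear forms are sub-Gaussian. -/
lemma bmean_exp_linear_le {ε : ℝ} {a : ZMod n → ℝ} (h : Elliptic ε a) (hε : 0 < ε)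
    (c : ZMod n → ℝ) (θ : ℝ) :
    bmean a (fun η => Real.exp (θ * ∑ x, c x * flu a x η)) ≤
      Real.exp (ε⁻¹ ^ 2 / 2 * (∑ x, c x ^ 2) * θ ^ 2) := by
  have h1 := bmean_exp_le_of_sum_sq_le h hε n (fun i => (i : ZMod n))
    (fun i _ => θ * c i) (fun i j hij hj => natCast_ne_of_lt hj (by omega) (by omega))
    (fun i j _ _ => freeOf_const _ _) (A := θ ^ 2 * ∑ x, c x ^ 2) (fun η => by
      rw [sum_range_natCast (fun x => (θ * c x) ^ 2), Finset.mul_sum]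
      exact le_of_eq (Finset.sum_congr rfl fun x _ => by ring))
  refine le_of_eq_of_le ?_ (h1.trans (le_of_eq ?_))
  · congr 1; ext η
    rw [sum_range_natCast (fun x => θ * c x * flu a x η), Finset.mul_sum]
    congr 1
    exact Finset.sum_congr rfl fun x _ => by ring
  · congr 1; ring

lemma sq_flu_le {ε : ℝ} {a : ZMod n → ℝ} (h : Elliptic ε a) (hε : 0 < ε) (x : ZMod n)
    (η : ZMod n → Bool) : flu a x η ^ 2 ≤ ε⁻¹ ^ 2 := by
  rw [← sq_abs]
  exact pow_le_pow_left₀ (abs_nonneg _) (abs_flu_le h hε x η) 2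

lemma sum_eq_range_add_last (hn : 2 ≤ n) (f : ZMod n → ℝ) :
    ∑ x, f x = ∑ i ∈ Finset.range (n - 1), f (i : ZMod n) + f ((n - 1 : ℕ) : ZMod n) := by
  rw [← sum_range_natCast f]
  obtain ⟨m, rfl⟩ : ∃ m, n = m + 1 := ⟨n - 1, by omega⟩
  rw [Finset.sum_range_succ, Nat.add_sub_cancel]

/-- Nearest-neighbour quadratic forms are sub-Gaussian. -/
lemma bmean_exp_quadratic_le {ε : ℝ} {a : ZMod n → ℝ} (h : Elliptic ε a) (hε : 0 < ε)
    (hn : 2 ≤ n) (c : ZMod n → ℝ) (θ : ℝ) :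
    bmean a (fun η => Real.exp (θ * ∑ x, c x * (flu a x η * flu a (x + 1) η))) ≤
      Real.exp (ε⁻¹ ^ 4 * (∑ x, c x ^ 2) * θ ^ 2) := by
  have hlast : ((n - 1 : ℕ) : ZMod n) + 1 = ((0 : ℕ) : ZMod n) := by
    have : ((n - 1 : ℕ) : ZMod n) + 1 = ((n - 1 + 1 : ℕ) : ZMod n) := by push_cast; rfl
    rw [this, Nat.sub_add_cancel (by omega)]; simp
  have hsplit : ∑ x, c x ^ 2 = ∑ i ∈ Finset.range (n - 1), c i ^ 2 + c ((n - 1 : ℕ) : ZMod n) ^ 2 :=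
    sum_eq_range_add_last hn (fun x => c x ^ 2)
  -- In the order 0, 1, …, n - 1 the factor ω_{i+1} is free of the sites already integrated out,
  -- which treats every bond except {n - 1, 0}. That bond is handled by a one-step supermartingale,
  -- and Cauchy–Schwarz, hence the factors 2θ, joins the two.
  have h1 := bmean_exp_le_of_sum_sq_le h hε (n - 1) (fun i => (i : ZMod n))
    (fun i η => 2 * θ * c i * flu a ((i + 1 : ℕ) : ZMod n) η)
    (fun i j hij hj => natCast_ne_of_lt (by omega) (by omega) (by omega))
    (fun i j hij hj => (freeOf_const _ _).mul
      (flu_freeOf a (natCast_ne_of_lt (by omega) (by omega) (by omega))))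
    (A := 4 * θ ^ 2 * ε⁻¹ ^ 2 * ∑ i ∈ Finset.range (n - 1), c i ^ 2) (fun η => by
      rw [Finset.mul_sum]
      refine Finset.sum_le_sum fun i _ => ?_
      have := sq_flu_le h hε ((i + 1 : ℕ) : ZMod n) η
      calc _ = 4 * θ ^ 2 * c i ^ 2 * flu a ((i + 1 : ℕ) : ZMod n) η ^ 2 := by ring
        _ ≤ 4 * θ ^ 2 * c i ^ 2 * ε⁻¹ ^ 2 := by gcongr
        _ = _ := by ring)
  have h2 := bmean_exp_le_of_sum_sq_le h hε 1 (fun _ => ((n - 1 : ℕ) : ZMod n))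
    (fun _ η => 2 * θ * c ((n - 1 : ℕ) : ZMod n) * flu a ((0 : ℕ) : ZMod n) η)
    (fun i j hij hj => by omega)
    (fun i j hij hj => (freeOf_const _ _).mul
      (flu_freeOf a (natCast_ne_of_lt (by omega) (by omega) (by omega))))
    (A := 4 * θ ^ 2 * ε⁻¹ ^ 2 * c ((n - 1 : ℕ) : ZMod n) ^ 2) (fun η => by
      rw [Finset.sum_range_one]
      have := sq_flu_le h hε ((0 : ℕ) : ZMod n) η
      calc _ = 4 * θ ^ 2 * c ((n - 1 : ℕ) : ZMod n) ^ 2 * flu a ((0 : ℕ) : ZMod n) η ^ 2 := by ring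
        _ ≤ 4 * θ ^ 2 * c ((n - 1 : ℕ) : ZMod n) ^ 2 * ε⁻¹ ^ 2 := by gcongr
        _ = _ := by ring)
  have h3 := bmean_exp_add_le h hε
    (X := fun η => ∑ i ∈ Finset.range (n - 1),
      θ * (c i * (flu a i η * flu a ((i + 1 : ℕ) : ZMod n) η)))
    (Y := fun η => θ * (c ((n - 1 : ℕ) : ZMod n) *
      (flu a ((n - 1 : ℕ) : ZMod n) η * flu a ((0 : ℕ) : ZMod n) η)))
    (le_of_eq_of_le (by
      congr 1; ext η; rw [Finset.mul_sum]; congr 1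
      exact Finset.sum_congr rfl fun i _ => by ring) h1)
    (le_of_eq_of_le (by
      congr 1; ext η; rw [Finset.sum_range_one]; congr 1; ring) h2)
  refine le_of_eq_of_le ?_ (h3.trans (le_of_eq ?_))
  · congr 1; ext η
    rw [sum_eq_range_add_last hn (fun x => c x * (flu a x η * flu a (x + 1) η)), hlast, mul_add,
      Finset.mul_sum]
    congr 2
    exact Finset.sum_congr rfl fun i _ => by push_cast; rfl
  · rw [← Real.exp_add, Real.sqrt_eq_iff_mul_self_eq (Real.exp_pos _).le (Real.exp_pos _).le,
      ← Real.exp_add, hsplit]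
    congr 1; ring

/-- Exponential moments of sums of squares of linear forms. -/
lemma bmean_exp_sum_sq_linear_le {ε : ℝ} {a : ZMod n → ℝ} (h : Elliptic ε a) (hε : 0 < ε)
    {κ : Type*} (s : Finset κ) (hs : s.Nonempty) (hsn : s.card ≤ n)
    (c : κ → ZMod n → ℝ) {Λ γ : ℝ} (hc : ∀ z ∈ s, ∀ w, |c z w| ≤ Λ) (hγ : 0 ≤ γ)
    (hγΛ : 4 * γ * (n : ℝ) ^ 2 * ε⁻¹ ^ 2 * Λ ^ 2 ≤ 1) :
    bmean a (fun η => Real.exp (γ * ∑ z ∈ s, (∑ w, c z w * flu a w η) ^ 2)) ≤ 2 := by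
  have hcard : (0 : ℝ) < s.card := by exact_mod_cast hs.card_pos
  have hcn : (s.card : ℝ) ≤ n := by exact_mod_cast hsn
  -- Jensen reduces the sum to single squares multiplied by `s.card * γ`. One factor n in the
  -- condition on γ comes from the cardinality, the other from the variance of a form with n
  -- coefficients bounded by Λ.
  have h1 := bmean_exp_average_le h hε s hs
    (fun z η => s.card * γ * (∑ w, c z w * flu a w η) ^ 2) (A := 2) (fun z hz => by
      have := bmean_exp_sq_le h hε (X := fun η => ∑ w, c z w * flu a w η) (A := 1)
        (V := ε⁻¹ ^ 2 / 2 * ∑ x, c z x ^ 2) (γ := s.card * γ) zero_le_one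
        (fun θ => by rw [one_mul]; exact bmean_exp_linear_le h hε (c z) θ) (by positivity) ?_
      · simpa using this
      · have hsum : ∑ x, c z x ^ 2 ≤ n * Λ ^ 2 := by
          calc ∑ x, c z x ^ 2 ≤ ∑ _x : ZMod n, Λ ^ 2 := Finset.sum_le_sum fun x _ => by
                rw [← sq_abs]; exact pow_le_pow_left₀ (abs_nonneg _) (hc z hz x) 2
            _ = _ := by simp [ZMod.card]
        calc 8 * (s.card * γ) * (ε⁻¹ ^ 2 / 2 * ∑ x, c z x ^ 2)
            ≤ 8 * (n * γ) * (ε⁻¹ ^ 2 / 2 * (n * Λ ^ 2)) := by gcongr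
          _ = 4 * γ * (n : ℝ) ^ 2 * ε⁻¹ ^ 2 * Λ ^ 2 := by ring
          _ ≤ 1 := hγΛ)
  refine le_of_eq_of_le ?_ h1
  congr 1; ext η; congr 1
  rw [← Finset.mul_sum, ← mul_assoc, ← mul_assoc, inv_mul_cancel₀ hcard.ne', one_mul]

lemma natCast_add_one (i : ℕ) :
    ((i : ZMod n) + 1) = ((i + 1 : ℕ) : ZMod n) := by push_cast; rfl

/-- Cubic forms `∑ c(z,w) ω_z ω_{z+1} ω_w` with coefficients of order `1/n` have bounded
exponential moments. -/
lemma bmean_exp_cubic_le {ε : ℝ} {a : ZMod n → ℝ} (h : Elliptic ε a) (hε : 0 < ε)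
    (hn : 2 ≤ n) (c : ZMod n → ZMod n → ℝ) {Λ γ : ℝ} (hΛ : 0 ≤ Λ)
    (hc : ∀ z w, |c z w| ≤ Λ / n) (hc0 : ∀ z, c z z = 0) (hc1 : ∀ z, c z (z + 1) = 0)
    (hγ : 0 ≤ γ) (hγΛ : 32 * γ ^ 2 * ε⁻¹ ^ 6 * Λ ^ 2 ≤ 1) :
    bmean a (fun η => Real.exp (γ * ∑ z, flu a z η * flu a (z + 1) η *
      ∑ w, c z w * flu a w η)) ≤ 2 * Real.exp (γ * Λ * ε⁻¹ ^ 3) := by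
  have hn0 : (0 : ℝ) < n := by exact_mod_cast (by omega : 0 < n)
  -- the coefficients pointing forward and backward in the order of `0, 1, …, n - 1`
  set cf : ℕ → ZMod n → ℝ := fun i w => if i + 1 < w.val then c i w else 0 with hcf
  set cb : ℕ → ZMod n → ℝ := fun i w => if w.val < i then c i w else 0 with hcb
  have hcf_le : ∀ i w, |cf i w| ≤ Λ / n := by
    intro i w; simp only [hcf]; split_ifs
    · exact hc _ _
    · simp; positivity
  have hcb_le : ∀ i w, |cb i w| ≤ Λ / n := by
    intro i w; simp only [hcb]; split_ifs
    · exact hc _ _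
    · simp; positivity
  -- The indices w = i and w = i + 1, missed by both parts, carry the coefficients that vanish by
  -- hypothesis.
  have hsplit : ∀ i < n - 1, ∀ w, c i w = cf i w + cb i w := by
    intro i hi w
    simp only [hcf, hcb]
    rcases lt_trichotomy w.val i with h1 | h1 | h1
    · rw [if_neg (by omega), if_pos h1, zero_add]
    · have : w = (i : ZMod n) := by rw [← h1, ZMod.natCast_zmod_val]
      rw [if_neg (by omega), if_neg (by omega), this, hc0]; simp
    · rcases (Nat.succ_le_of_lt h1).eq_or_lt with h2 | h2
      · have : w = (i : ZMod n) + 1 := by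
          rw [natCast_add_one, ← Nat.succ_eq_add_one, h2, ZMod.natCast_zmod_val]
        rw [if_neg (by omega), if_neg (by omega), this, hc1]; simp
      · rw [if_pos (by omega), if_neg (by omega), add_zero]
  have hne : (Finset.range (n - 1)).Nonempty := ⟨0, Finset.mem_range.2 (by omega)⟩
  -- The compensator of either half. The constant 8γ²ε⁻⁴ is 2ε⁻² from `bmean_exp_martingale_le`
  -- times 4γ²ε⁻² from the coefficient 2γω with |ω| ≤ ε⁻¹; the assumption on γ is exactly what makes
  -- it admissible for coefficients of size Λ/n.
  have hsq : ∀ (d : ℕ → ZMod n → ℝ), (∀ i w, |d i w| ≤ Λ / n) →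
      bmean a (fun η => Real.exp ((8 * γ ^ 2 * ε⁻¹ ^ 4) * ∑ i ∈ Finset.range (n - 1),
        (∑ w, d i w * flu a w η) ^ 2)) ≤ 2 := by
    intro d hd
    refine bmean_exp_sum_sq_linear_le h hε _ hne (by simp) d (Λ := Λ / n)
      (fun i _ w => hd i w) (by positivity) ?_
    calc 4 * (8 * γ ^ 2 * ε⁻¹ ^ 4) * (n : ℝ) ^ 2 * ε⁻¹ ^ 2 * (Λ / n) ^ 2
        = 32 * γ ^ 2 * ε⁻¹ ^ 6 * Λ ^ 2 := by field_simp; ring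
      _ ≤ 1 := hγΛ
  have hcomp : ∀ (d : ℕ → ZMod n → ℝ) (s : ℕ → ZMod n),
      ∀ i η, (2 * γ * flu a (s i) η * ∑ w, d i w * flu a w η) ^ 2 ≤
        4 * γ ^ 2 * ε⁻¹ ^ 2 * (∑ w, d i w * flu a w η) ^ 2 := by
    intro d s i η
    have := sq_flu_le h hε (s i) η
    calc _ = 4 * γ ^ 2 * flu a (s i) η ^ 2 * (∑ w, d i w * flu a w η) ^ 2 := by ring
      _ ≤ _ := by gcongr
  -- forward part
  have hF : bmean a (fun η => Real.exp (2 * ∑ i ∈ Finset.range (n - 1),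
      γ * (flu a i η * flu a ((i + 1 : ℕ) : ZMod n) η * ∑ w, cf i w * flu a w η))) ≤ √2 := by
    -- The left end point i of the bond is integrated out at step i; what multiplies ω_i involves
    -- only sites to its right.
    have := bmean_exp_martingale_le h hε (n - 1) (fun i => (i : ZMod n))
      (fun i η => 2 * γ * flu a ((i + 1 : ℕ) : ZMod n) η * ∑ w, cf i w * flu a w η)
      (fun i j hij hj => natCast_ne_of_lt (by omega) (by omega) (by omega))
      (fun i j hij hj => by
        refine FreeOf.mul (FreeOf.mul (freeOf_const _ _)
          (flu_freeOf a (natCast_ne_of_lt (by omega) (by omega) (by omega))))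
          (FreeOf.sum _ fun w _ => ?_)
        by_cases hw : j + 1 < w.val
        · refine (freeOf_const _ _).mul (flu_freeOf a fun hwi => ?_)
          rw [hwi, ZMod.val_cast_of_lt (by omega)] at hw
          omega
        · simp only [hcf, if_neg hw, zero_mul]; exact freeOf_const _ _)
      (A := 2) ((bmean_mono h hε fun η => Real.exp_le_exp.2 ?_).trans (hsq cf hcf_le))
    · refine le_of_eq_of_le ?_ this
      congr 1; ext η; rw [Finset.mul_sum]; congr 1
      exact Finset.sum_congr rfl fun i _ => by ring
    · calc _ ≤ 2 * (ε⁻¹ ^ 2 * ∑ i ∈ Finset.range (n - 1),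
            4 * γ ^ 2 * ε⁻¹ ^ 2 * (∑ w, cf i w * flu a w η) ^ 2) := by
            gcongr with i _
            exact hcomp cf (fun i => ((i + 1 : ℕ) : ZMod n)) i η
        _ = _ := by rw [← Finset.mul_sum]; ring
  -- backward part
  have hB : bmean a (fun η => Real.exp (2 * ∑ i ∈ Finset.range (n - 1),
      γ * (flu a i η * flu a ((i + 1 : ℕ) : ZMod n) η * ∑ w, cb i w * flu a w η))) ≤ √2 := by
    -- The order is reversed: step k integrates out the right end point of the bond {i, i + 1} with
    -- i = n - 2 - k, and what multiplies it involves only i and sites below i.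
    have := bmean_exp_martingale_le h hε (n - 1) (fun k => ((n - 1 - 1 - k + 1 : ℕ) : ZMod n))
      (fun k η => 2 * γ * flu a ((n - 1 - 1 - k : ℕ) : ZMod n) η *
        ∑ w, cb (n - 1 - 1 - k) w * flu a w η)
      (fun i j hij hj => natCast_ne_of_lt (by omega) (by omega) (by omega))
      (fun i j hij hj => by
        refine FreeOf.mul (FreeOf.mul (freeOf_const _ _)
          (flu_freeOf a (natCast_ne_of_lt (by omega) (by omega) (by omega))))
          (FreeOf.sum _ fun w _ => ?_)
        by_cases hw : w.val < n - 1 - 1 - j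
        · refine (freeOf_const _ _).mul (flu_freeOf a fun hwi => ?_)
          rw [hwi, ZMod.val_cast_of_lt (by omega)] at hw
          omega
        · simp only [hcb, if_neg hw, zero_mul]; exact freeOf_const _ _)
      (A := 2) ((bmean_mono h hε fun η => Real.exp_le_exp.2 ?_).trans (hsq cb hcb_le))
    · refine le_of_eq_of_le ?_ this
      congr 1; ext η; rw [Finset.mul_sum]; congr 1
      rw [← Finset.sum_range_reflect]
      exact Finset.sum_congr rfl fun i _ => by ring
    · rw [Finset.sum_range_reflect (fun i => (2 * γ * flu a ((i : ℕ) : ZMod n) η *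
        ∑ w, cb i w * flu a w η) ^ 2) (n - 1)]
      calc _ ≤ 2 * (ε⁻¹ ^ 2 * ∑ i ∈ Finset.range (n - 1),
            4 * γ ^ 2 * ε⁻¹ ^ 2 * (∑ w, cb i w * flu a w η) ^ 2) := by
            gcongr with i _
            exact hcomp cb (fun i => (i : ZMod n)) i η
        _ = _ := by rw [← Finset.mul_sum]; ring
  have hFB := bmean_exp_add_le h hε hF hB
  -- The bond {n - 1, 0} fits neither order. Its contribution is bounded pointwise, n coefficients
  -- of size Λ/n giving Λε⁻³, and this is the source of the exponential factor in the conclusion.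
  have hlast : ∀ η, γ * (flu a ((n - 1 : ℕ) : ZMod n) η * flu a (((n - 1 : ℕ) : ZMod n) + 1) η *
      ∑ w, c ((n - 1 : ℕ) : ZMod n) w * flu a w η) ≤ γ * Λ * ε⁻¹ ^ 3 := by
    intro η
    have hsum : |∑ w, c ((n - 1 : ℕ) : ZMod n) w * flu a w η| ≤ Λ * ε⁻¹ := by
      calc _ ≤ ∑ w, |c ((n - 1 : ℕ) : ZMod n) w * flu a w η| := Finset.abs_sum_le_sum_abs _ _
        _ ≤ ∑ _w : ZMod n, Λ / n * ε⁻¹ := Finset.sum_le_sum fun w _ => by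
            rw [abs_mul]
            exact mul_le_mul (hc _ _) (abs_flu_le h hε _ _) (abs_nonneg _) (by positivity)
        _ = _ := by simp [ZMod.card]; field_simp
    rw [mul_assoc γ Λ]
    refine mul_le_mul_of_nonneg_left ((le_abs_self _).trans ?_) hγ
    rw [abs_mul, abs_mul]
    calc _ ≤ ε⁻¹ * ε⁻¹ * (Λ * ε⁻¹) := by
          gcongr
          · exact abs_flu_le h hε _ _
          · exact abs_flu_le h hε _ _
      _ = _ := by ring
  calc _ ≤ bmean a (fun η => Real.exp (γ * Λ * ε⁻¹ ^ 3) *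
        Real.exp (∑ i ∈ Finset.range (n - 1),
      γ * (flu a i η * flu a ((i + 1 : ℕ) : ZMod n) η * ∑ w, cf i w * flu a w η) +
        ∑ i ∈ Finset.range (n - 1),
      γ * (flu a i η * flu a ((i + 1 : ℕ) : ZMod n) η * ∑ w, cb i w * flu a w η))) := by
        refine bmean_mono h hε fun η => ?_
        rw [← Real.exp_add]
        refine Real.exp_le_exp.2 ?_
        rw [sum_eq_range_add_last hn, mul_add, add_comm]
        refine add_le_add (hlast η) (le_of_eq ?_)
        rw [Finset.mul_sum, ← Finset.sum_add_distrib]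
        refine Finset.sum_congr rfl fun i hi => ?_
        rw [natCast_add_one, ← mul_add, ← mul_add,
          ← Finset.sum_add_distrib]
        congr 2
        exact Finset.sum_congr rfl fun w _ => by
          rw [hsplit i (Finset.mem_range.1 hi) w]; ring
    _ ≤ Real.exp (γ * Λ * ε⁻¹ ^ 3) * √(√2 * √2) := by
        rw [bmean_smul]
        exact mul_le_mul_of_nonneg_left hFB (Real.exp_pos _).le
    _ ≤ 2 * Real.exp (γ * Λ * ε⁻¹ ^ 3) := by
        rw [Real.mul_self_sqrt (by norm_num), mul_comm]
        gcongr
        rw [Real.sqrt_le_left (by norm_num)]; norm_num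

end Forms

/-! ### The quadratic field is controlled by the Dirichlet form and the entropy -/

section Replacement

set_option linter.unusedSectionVars false

variable {n : ℕ} [NeZero n]

/-- The density of the weights `p` with respect to the Bernoulli product measure. -/
def density (a : ZMod n → ℝ) (p : Config n → ℝ) (η : Config n) : ℝ := p η / bweight a η

/-- The part of the Dirichlet form of `√f` carried by the bond `{x, x+1}`. -/
def bondForm (a : ZMod n → ℝ) (p : Config n → ℝ) (x : ZMod n) : ℝ :=
  ∑ η : Config n, if η x = true ∧ η (x + 1) = false then
    bweight a η * (√(density a p (exchange η x (x + 1))) - √(density a p η)) ^ 2 else 0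

/-- The normalized gradient of the bond `{x, y}`, antisymmetric under the exchange. -/
def bondGrad (a : ZMod n → ℝ) (x y : ZMod n) (η : Config n) : ℝ :=
  if η x then (if η y then 0 else (a x * (1 - a y))⁻¹)
  else (if η y then -((1 - a x) * a y)⁻¹ else 0)

/-- Multiplied by the weight, `bondGrad` is antisymmetric under the exchange, whereas ω_x - ω_y is
not unless a x = a y. The discrepancy is a quadratic term with coefficient a x - a y, of order 1/n
for the profiles in use. -/
lemma bondGrad_eq {ε : ℝ} {a : ZMod n → ℝ} (h : Elliptic ε a) (hε : 0 < ε) (x y : ZMod n)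
    (η : Config n) : bondGrad a x y η =
      flu a x η - flu a y η + (a x - a y) * (flu a x η * flu a y η) := by
  have h1 := (h.pos hε x).ne'
  have h2 := (h.pos hε y).ne'
  have h3 := (h.one_sub_pos hε x).ne'
  have h4 := (h.one_sub_pos hε y).ne'
  unfold bondGrad flu
  cases η x <;> cases η y <;> simp <;> field_simp <;> ring

lemma exchange_apply_left (η : Config n) (x y : ZMod n) : exchange η x y x = η y := by
  simp [exchange]

lemma exchange_apply_right (η : Config n) (x y : ZMod n) : exchange η x y y = η x := by
  simp [exchange]

lemma exchange_apply_of_ne (η : Config n) {x y z : ZMod n} (hx : z ≠ x) (hy : z ≠ y) :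
    exchange η x y z = η z := by
  simp [exchange, Equiv.swap_apply_of_ne_of_ne hx hy]

lemma exchange_exchange (η : Config n) (x y : ZMod n) : exchange (exchange η x y) x y = η := by
  ext z; simp [exchange]

/-- The exchange of two sites, as a permutation of the configurations. -/
def exchangePerm (x y : ZMod n) : Equiv.Perm (Config n) :=
  Function.Involutive.toPerm (fun η => exchange η x y) fun η => exchange_exchange η x y

lemma sum_exchange (x y : ZMod n) (f : Config n → ℝ) :
    ∑ η, f (exchange η x y) = ∑ η, f η :=
  Equiv.sum_comp (exchangePerm x y) f

lemma exchange_eq_update (η : Config n) (x y : ZMod n) :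
    exchange η x y = Function.update (Function.update η x (η y)) y (η x) := by
  ext z
  by_cases hy : z = y
  · subst hy; simp [exchange]
  · by_cases hx : z = x
    · subst hx; rw [Function.update_of_ne hy]; simp [exchange]
    · rw [exchange_apply_of_ne η hx hy, Function.update_of_ne hy, Function.update_of_ne hx]

lemma FreeOf.exchange {f : Config n → ℝ} {x y : ZMod n} (hx : FreeOf f x) (hy : FreeOf f y)
    (η : Config n) : f (exchange η x y) = f η := by
  rw [exchange_eq_update, hy, hx]

lemma bweight_eq_two (a : ZMod n → ℝ) {x y : ZMod n} (hxy : x ≠ y) (η : Config n) :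
    bweight a η = (if η x then a x else 1 - a x) * ((if η y then a y else 1 - a y) *
      ∏ z ∈ (Finset.univ.erase x).erase y, if η z then a z else 1 - a z) := by
  rw [bweight_eq a x, ← Finset.mul_prod_erase (Finset.univ.erase x) _
    (Finset.mem_erase.2 ⟨hxy.symm, Finset.mem_univ y⟩)]

lemma bweight_exchange (a : ZMod n → ℝ) {x y : ZMod n} (hxy : x ≠ y) (η : Config n)
    (hx : η x = true) (hy : η y = false) :
    bweight a (exchange η x y) * (a x * (1 - a y)) = bweight a η * ((1 - a x) * a y) := by
  rw [bweight_eq_two a hxy, bweight_eq_two a hxy η, exchange_apply_left, exchange_apply_right,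
    hx, hy]
  have : (∏ z ∈ (Finset.univ.erase x).erase y, if exchange η x y z then a z else 1 - a z) =
      ∏ z ∈ (Finset.univ.erase x).erase y, if η z then a z else 1 - a z :=
    Finset.prod_congr rfl fun z hz => by
      have h1 := (Finset.mem_erase.1 hz)
      rw [exchange_apply_of_ne η (Finset.ne_of_mem_erase h1.2) h1.1]
  rw [this]
  simp only [if_true, Bool.false_eq_true, if_false]
  ring

lemma add_one_ne_self (hn : 2 ≤ n) (x : ZMod n) : x ≠ x + 1 := by
  have : Fact (1 < n) := ⟨by omega⟩
  simp

/-- Integration by parts along a bond. -/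
lemma sum_mul_bondGrad_le {ε : ℝ} {a : ZMod n → ℝ} (h : Elliptic ε a) (hε : 0 < ε) (hn : 2 ≤ n)
    {p : Config n → ℝ} (hp : ∀ η, 0 ≤ p η) (x : ZMod n) {u : Config n → ℝ}
    (hu : FreeOf u x) (hu' : FreeOf u (x + 1)) {δ : ℝ} (hδ : 0 < δ) :
    ∑ η, p η * (u η * bondGrad a x (x + 1) η) ≤
      δ * bondForm a p x + ε⁻¹ ^ 6 / (2 * δ) * ∑ η, p η * u η ^ 2 := by
  set y := x + 1 with hy
  have hxy : x ≠ y := add_one_ne_self hn x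
  have hax := h.pos hε x
  have hay := h.pos hε y
  have hbx := h.one_sub_pos hε x
  have hby := h.one_sub_pos hε y
  have hε1 : ε ≤ 1 := by linarith [(h x).1, (h x).2]
  have hB1 : 1 ≤ ε⁻¹ := (one_le_inv₀ hε).2 hε1
  set f := density a p with hf
  have hf0 : ∀ η, 0 ≤ f η := fun η => div_nonneg (hp η) (bweight_pos h hε η).le
  have hpf : ∀ η, p η = bweight a η * f η := fun η => by
    simp only [hf, density]; field_simp [(bweight_pos h hε η).ne']
  -- the two halves of the sum
  have e1 : ∀ η, p η * (u η * bondGrad a x y η) =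
      (if η x = true ∧ η y = false then p η * u η * (a x * (1 - a y))⁻¹ else 0) -
      (if η x = false ∧ η y = true then p η * u η * ((1 - a x) * a y)⁻¹ else 0) := by
    intro η
    unfold bondGrad
    cases η x <;> cases η y <;> simp <;> ring
  -- The exchange preserves u and carries configurations with the particle at y to those with the
  -- particle at x, so both halves become sums over the same set.
  have e2 : ∑ η : Config n, (if η x = false ∧ η y = true then
        p η * u η * ((1 - a x) * a y)⁻¹ else 0) =
      ∑ η : Config n, if η x = true ∧ η y = false then
        p (exchange η x y) * u η * ((1 - a x) * a y)⁻¹ else 0 := by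
    rw [← sum_exchange x y]
    refine Finset.sum_congr rfl fun η _ => ?_
    rw [exchange_apply_left, exchange_apply_right, hu.exchange hu']
    exact if_congr (and_comm) rfl rfl
  have e3 : ∑ η : Config n, (if η x = false ∧ η y = true then p η * u η ^ 2 else 0) =
      ∑ η : Config n, if η x = true ∧ η y = false then p (exchange η x y) * u η ^ 2 else 0 := by
    rw [← sum_exchange x y]
    refine Finset.sum_congr rfl fun η _ => ?_
    rw [exchange_apply_left, exchange_apply_right, hu.exchange hu']
    exact if_congr (and_comm) rfl rfl
  have key : ∀ η : Config n,
      (if η x = true ∧ η y = false then p η * u η * (a x * (1 - a y))⁻¹ else 0) -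
      (if η x = true ∧ η y = false then
        p (exchange η x y) * u η * ((1 - a x) * a y)⁻¹ else 0) ≤
      δ * (if η x = true ∧ η y = false then
        bweight a η * (√(f (exchange η x y)) - √(f η)) ^ 2 else 0) +
      ε⁻¹ ^ 6 / (2 * δ) * ((if η x = true ∧ η y = false then p η * u η ^ 2 else 0) +
        (if η x = true ∧ η y = false then p (exchange η x y) * u η ^ 2 else 0)) := by
    intro η
    by_cases hη : η x = true ∧ η y = false
    swap
    · simp [hη]
    simp only [if_pos hη]
    have hw := bweight_exchange a hxy η hη.1 hη.2
    have hwp := bweight_pos h hε η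
    have hwp' := bweight_pos h hε (exchange η x y)
    set k := (a x * (1 - a y))⁻¹ with hk
    have hk0 : 0 < k := by positivity
    have hkB : k ≤ ε⁻¹ ^ 2 := by
      rw [hk, inv_pow, pow_two]
      refine inv_anti₀ (by positivity) ?_
      exact mul_le_mul (h x).1 (by linarith [(h y).2]) hε.le hax.le
    have hp' : p (exchange η x y) * ((1 - a x) * a y)⁻¹ =
        bweight a η * f (exchange η x y) * k := by
      rw [hpf, hk]
      field_simp
      linear_combination f (exchange η x y) * hw
    -- Returning from the weight of η to that of the exchanged configuration costs ε⁻². With k² ≤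
    -- ε⁻⁴ this makes the constant ε⁻⁶.
    have hpp : bweight a η * f (exchange η x y) ≤ ε⁻¹ ^ 2 * p (exchange η x y) := by
      rw [hpf (exchange η x y), ← mul_assoc]
      refine mul_le_mul_of_nonneg_right ?_ (hf0 _)
      have : bweight a η = bweight a (exchange η x y) * (a x * (1 - a y)) *
          ((1 - a x) * a y)⁻¹ := by
        rw [hw]; field_simp
      rw [this]
      have i1 : a x * (1 - a y) ≤ 1 := by nlinarith
      have i2 : ((1 - a x) * a y)⁻¹ ≤ ε⁻¹ ^ 2 := by
        rw [inv_pow, pow_two]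
        refine inv_anti₀ (by positivity) ?_
        exact mul_le_mul (by linarith [(h x).2]) (h y).1 hε.le hbx.le
      calc _ ≤ bweight a (exchange η x y) * 1 * ε⁻¹ ^ 2 := by gcongr
        _ = _ := by ring
    set r := √(f η) with hr
    set r' := √(f (exchange η x y)) with hr'
    have hr2 : r ^ 2 = f η := Real.sq_sqrt (hf0 _)
    have hr2' : r' ^ 2 = f (exchange η x y) := Real.sq_sqrt (hf0 _)
    -- Factor r² - r'² = (r - r')(r + r'). Young's inequality sends the difference to the Dirichlet
    -- form with weight δ and the sum to the term in u².
    have young : u η * k * (r ^ 2 - r' ^ 2) ≤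
        δ * (r' - r) ^ 2 + ε⁻¹ ^ 4 / (2 * δ) * (u η ^ 2 * (r ^ 2 + r' ^ 2)) := by
      have hk2 : k ^ 2 ≤ ε⁻¹ ^ 4 := by
        calc k ^ 2 ≤ (ε⁻¹ ^ 2) ^ 2 := pow_le_pow_left₀ hk0.le hkB 2
          _ = _ := by ring
      have s1 : u η * k * (r ^ 2 - r' ^ 2) ≤
          δ * (r' - r) ^ 2 + k ^ 2 / (4 * δ) * (u η ^ 2 * (r + r') ^ 2) := by
        have : 0 ≤ (2 * δ * (r' - r) + u η * k * (r + r')) ^ 2 / (4 * δ) := by positivity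
        have e : (2 * δ * (r' - r) + u η * k * (r + r')) ^ 2 / (4 * δ) =
          δ * (r' - r) ^ 2 + k ^ 2 / (4 * δ) * (u η ^ 2 * (r + r') ^ 2) -
            u η * k * (r ^ 2 - r' ^ 2) := by field_simp; ring
        linarith
      refine s1.trans (add_le_add le_rfl ?_)
      calc k ^ 2 / (4 * δ) * (u η ^ 2 * (r + r') ^ 2)
          ≤ ε⁻¹ ^ 4 / (4 * δ) * (u η ^ 2 * (2 * (r ^ 2 + r' ^ 2))) := by
            gcongr
            nlinarith [sq_nonneg (r - r')]
        _ = _ := by field_simp; ring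
    calc p η * u η * k - p (exchange η x y) * u η * ((1 - a x) * a y)⁻¹
        = bweight a η * (u η * k * (r ^ 2 - r' ^ 2)) := by
          rw [hr2, hr2', hpf η, mul_right_comm (p (exchange η x y)), hp']; ring
      _ ≤ bweight a η * (δ * (r' - r) ^ 2 +
          ε⁻¹ ^ 4 / (2 * δ) * (u η ^ 2 * (r ^ 2 + r' ^ 2))) := by gcongr
      _ = δ * (bweight a η * (r' - r) ^ 2) + ε⁻¹ ^ 4 / (2 * δ) * (u η ^ 2 *
          (p η + bweight a η * f (exchange η x y))) := by rw [hr2, hr2', hpf η]; ring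
      _ ≤ δ * (bweight a η * (r' - r) ^ 2) + ε⁻¹ ^ 4 / (2 * δ) * (u η ^ 2 *
          (ε⁻¹ ^ 2 * p η + ε⁻¹ ^ 2 * p (exchange η x y))) := by
          gcongr
          exact le_mul_of_one_le_left (hp η) (one_le_pow₀ hB1)
      _ = _ := by ring
  calc _ = ∑ η : Config n,
      ((if η x = true ∧ η y = false then p η * u η * (a x * (1 - a y))⁻¹ else 0) -
      (if η x = true ∧ η y = false then
        p (exchange η x y) * u η * ((1 - a x) * a y)⁻¹ else 0)) := by
        rw [Finset.sum_congr rfl fun η _ => e1 η, Finset.sum_sub_distrib, e2,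
          ← Finset.sum_sub_distrib]
    _ ≤ _ := Finset.sum_le_sum fun η _ => key η
    _ = δ * bondForm a p x + ε⁻¹ ^ 6 / (2 * δ) *
        (∑ η : Config n, ((if η x = true ∧ η y = false then p η * u η ^ 2 else 0) +
        (if η x = false ∧ η y = true then p η * u η ^ 2 else 0))) := by
        rw [Finset.sum_add_distrib, ← Finset.mul_sum, ← Finset.mul_sum, Finset.sum_add_distrib,
          ← e3, ← Finset.sum_add_distrib]
        rfl
    _ ≤ _ := by
        gcongr with η _
        have := mul_nonneg (hp η) (sq_nonneg (u η))
        cases η x <;> cases η y <;> simp [this]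

/-- Abel summation: with weights decreasing linearly to zero, the increments compare u 0 with the
average of u 0, …, u m. -/
lemma sum_range_sub_mul_sub (u : ℕ → ℝ) (m : ℕ) :
    ∑ i ∈ Finset.range m, ((m : ℝ) - i) * (u i - u (i + 1)) =
      (m + 1) * u 0 - ∑ i ∈ Finset.range (m + 1), u i := by
  induction m with
  | zero => simp
  | succ m ih =>
    have h1 : ∑ i ∈ Finset.range (m + 1), (((m + 1 : ℕ) : ℝ) - i) * (u i - u (i + 1)) =
        ∑ i ∈ Finset.range (m + 1), ((m : ℝ) - i) * (u i - u (i + 1)) +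
        ∑ i ∈ Finset.range (m + 1), (u i - u (i + 1)) := by
      rw [← Finset.sum_add_distrib]
      exact Finset.sum_congr rfl fun i _ => by push_cast; ring
    rw [h1, Finset.sum_range_succ, ih, Finset.sum_range_sub', Finset.sum_range_succ _ (m + 1)]
    push_cast; ring

/-- The linearly decreasing kernel on the torus. -/
def tent (n : ℕ) (v : ZMod n) : ℝ := ((n - 2 - v.val : ℕ) : ℝ)

lemma tent_nonneg (v : ZMod n) : 0 ≤ tent n v := Nat.cast_nonneg _

lemma tent_le (hn : 2 ≤ n) (v : ZMod n) : tent n v ≤ n - 1 := by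
  have : ((n - 2 - v.val : ℕ) : ℝ) ≤ ((n - 1 : ℕ) : ℝ) := by exact_mod_cast (by omega)
  rwa [Nat.cast_sub (n := n) (m := 1) (by omega), Nat.cast_one] at this

/-- The walk goes leftwards from x and ends at x - (n - 2) = x + 2, so the average misses only x +
1, the partner of x in its bond. The truncated subtraction in `tent` makes the kernel vanish at n -
2 and n - 1, where the walk is already over. -/
lemma sum_tent_mul_sub (hn : 2 ≤ n) (u : ZMod n → ℝ) (x : ZMod n) :
    ∑ v, tent n v * (u (x - v) - u (x - v - 1)) = (n - 1) * u x - (∑ v, u v - u (x + 1)) := by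
  obtain ⟨m, hm⟩ : ∃ m, n = m + 2 := ⟨n - 2, by omega⟩
  have hm2 : n - 2 = m := by omega
  rw [← sum_range_natCast (fun v => tent n v * (u (x - v) - u (x - v - 1)))]
  have h1 : ∑ i ∈ Finset.range n, tent n (i : ZMod n) *
      (u (x - (i : ZMod n)) - u (x - (i : ZMod n) - 1)) =
      ∑ i ∈ Finset.range m, ((m : ℝ) - i) *
        (u (x - ((i : ℕ) : ZMod n)) - u (x - ((i + 1 : ℕ) : ZMod n))) := by
    have hsub : Finset.range m ⊆ Finset.range n := Finset.range_subset_range.2 (by omega)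
    rw [← Finset.sum_subset hsub]
    · refine Finset.sum_congr rfl fun i hi => ?_
      have hi' := Finset.mem_range.1 hi
      unfold tent
      rw [ZMod.val_cast_of_lt (by omega), hm2, Nat.cast_sub hi'.le]
      push_cast
      rw [sub_sub]
    · intro i hi hi'
      have h1 := Finset.mem_range.1 hi
      have h2 : ¬ i < m := fun h => hi' (Finset.mem_range.2 h)
      unfold tent
      rw [ZMod.val_cast_of_lt h1, show n - 2 - i = 0 by omega]
      simp
  have h2 : ∑ v, u v = ∑ i ∈ Finset.range (m + 1), u (x - ((i : ℕ) : ZMod n)) + u (x + 1) := by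
    rw [← Equiv.sum_comp (Equiv.subLeft x) u]
    simp only [Equiv.subLeft_apply]
    rw [← sum_range_natCast (fun v => u (x - v))]
    have : Finset.range n = Finset.range (m + 1 + 1) := by rw [hm]
    rw [this, Finset.sum_range_succ]
    congr 2
    have h3 : ((m + 1 : ℕ) : ZMod n) + 1 = 0 := by
      have : ((m + 1 : ℕ) : ZMod n) + 1 = ((m + 2 : ℕ) : ZMod n) := by push_cast; ring
      rw [this, ← hm, ZMod.natCast_self]
    linear_combination -h3
  rw [h1, sum_range_sub_mul_sub (fun i => u (x - ((i : ℕ) : ZMod n))), h2]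
  have hn' : (n : ℝ) = m + 2 := by rw [hm]; push_cast; ring
  rw [hn', Nat.cast_zero, sub_zero]
  ring

/-- Summation by parts: each fluctuation is replaced by the average over the torus. -/
lemma quadratic_replacement (hn : 2 ≤ n) (g u : ZMod n → ℝ) :
    (n - 1) * ∑ x, g x * (u x * u (x + 1)) =
      ∑ x, g x * u (x + 1) * (∑ v, u v - u (x + 1)) +
      ∑ z, (u (z + 1) - u z) * ∑ w, tent n (w - z - 2) * g (w - 1) * u w := by
  -- Terms are regrouped by the gradient they contain: z = x - v - 1 is its left site and w = x + 1
  -- the remaining factor, so that v = w - z - 2.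
  have h1 : ∑ x, g x * u (x + 1) * ∑ v, tent n v * (u (x - v) - u (x - v - 1)) =
      ∑ z, (u (z + 1) - u z) * ∑ w, tent n (w - z - 2) * g (w - 1) * u w := by
    simp only [Finset.mul_sum]
    rw [Finset.sum_comm]
    have : ∀ z, ∑ w, (u (z + 1) - u z) * (tent n (w - z - 2) * g (w - 1) * u w) =
        ∑ v, (u (z + 1) - u z) * (tent n v * g (z + 1 + v) * u (z + 2 + v)) := by
      intro z
      rw [← Equiv.sum_comp (Equiv.addLeft (z + 2))]
      refine Finset.sum_congr rfl fun v _ => ?_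
      simp only [Equiv.coe_addLeft]
      rw [show z + 2 + v - z - 2 = v by ring, show z + 2 + v - 1 = z + 1 + v by ring]
    simp only [this]
    rw [Finset.sum_comm (f := fun z v => (u (z + 1) - u z) *
      (tent n v * g (z + 1 + v) * u (z + 2 + v)))]
    refine Finset.sum_congr rfl fun v _ => ?_
    rw [← Equiv.sum_comp (Equiv.addRight (1 + v))]
    refine Finset.sum_congr rfl fun z _ => ?_
    simp only [Equiv.coe_addRight]
    rw [show z + (1 + v) - v = z + 1 by ring, show z + 1 - 1 = z by ring,
      show z + (1 + v) + 1 = z + 2 + v by ring, show z + (1 + v) = z + 1 + v by ring]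
    ring
  rw [← h1, ← Finset.sum_add_distrib, Finset.mul_sum]
  refine Finset.sum_congr rfl fun x _ => ?_
  rw [sum_tent_mul_sub hn]
  ring

/-- The constant in the bound of the quadratic field. -/
def replacementConst (ε Λ κ δ : ℝ) : ℝ :=
  4 * ε⁻¹ ^ 2 * (1 + Λ ^ 2) + 2 * Λ * ε⁻¹ ^ 2 + 2 * ε⁻¹ ^ 8 * (Λ + 1) ^ 2 / δ
    + 12 * ε⁻¹ ^ 3 * (κ * Λ + 1)

/-- The main estimate: the quadratic field is bounded by a small multiple of the Dirichlet form
plus a multiple of the entropy. -/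
theorem sum_mul_quadratic_le {ε : ℝ} {a : ZMod n → ℝ} (h : Elliptic ε a) (hε : 0 < ε)
    (hn : 3 ≤ n) {p : Config n → ℝ} (hp : ∀ η, 0 ≤ p η) (hp1 : ∑ η, p η = 1)
    {g : ZMod n → ℝ} {Λ κ δ : ℝ} (hΛ : 0 ≤ Λ) (hκ : 0 ≤ κ) (hδ : 0 < δ)
    (hg : ∀ x, |g x| ≤ Λ) (ha : ∀ x, |a x - a (x + 1)| ≤ κ / n) :
    ∑ η, p η * ∑ x, g x * (flu a x η * flu a (x + 1) η) ≤
      δ * (n : ℝ) ^ 2 * ∑ x, bondForm a p x + replacementConst ε Λ κ δ * (ent a p + 1) := by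
  have hn3 : (3 : ℝ) ≤ n := by exact_mod_cast hn
  have hn0 : (0 : ℝ) < n := by linarith
  have hn1 : (0 : ℝ) < n - 1 := by linarith
  have hent := ent_nonneg h hε hp hp1
  have hB : 0 < ε⁻¹ := inv_pos.2 hε
  have hlog2 : Real.log 2 ≤ 1 := by linarith [Real.log_le_sub_one_of_pos (x := 2) (by norm_num)]
  -- Normalized kernel: it is bounded by Λ and vanishes at w = z and w = z + 1, since w - z - 2 is
  -- then n - 2 or n - 1. Hence the form `hh z` is free of the bond {z, z + 1}, as integration by
  -- parts along that bond requires.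
  set c : ZMod n → ZMod n → ℝ := fun z w => ((n : ℝ) - 1)⁻¹ * (tent n (w - z - 2) * g (w - 1))
    with hc
  have hcle : ∀ z w, |c z w| ≤ Λ := by
    intro z w
    simp only [hc]
    rw [abs_mul, abs_mul, abs_of_nonneg (tent_nonneg _), abs_of_pos (inv_pos.2 hn1),
      inv_mul_le_iff₀ hn1]
    exact mul_le_mul (tent_le (by omega) _) (hg _) (abs_nonneg _) hn1.le
  have hc0 : ∀ z, c z z = 0 := by
    intro z
    have h2 : (z - z - 2 : ZMod n) = ((n - 2 : ℕ) : ZMod n) := by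
      rw [Nat.cast_sub (by omega)]; simp
    simp only [hc, tent]
    rw [h2, ZMod.val_cast_of_lt (by omega)]; simp
  have hc1 : ∀ z, c z (z + 1) = 0 := by
    intro z
    have h2 : (z + 1 - z - 2 : ZMod n) = ((n - 1 : ℕ) : ZMod n) := by
      rw [Nat.cast_sub (by omega)]; simp; ring
    simp only [hc, tent]
    rw [h2, ZMod.val_cast_of_lt (by omega), show n - 2 - (n - 1) = 0 by omega]; simp
  set hh : ZMod n → Config n → ℝ := fun z η => ∑ w, c z w * flu a w η with hhh
  have hfree : ∀ z y, (y = z ∨ y = z + 1) → FreeOf (hh z) y := by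
    intro z y hy
    refine FreeOf.sum _ fun w _ => ?_
    by_cases hw : w = y
    · have : c z w = 0 := by
        rw [hw]; rcases hy with rfl | rfl
        · exact hc0 _
        · exact hc1 _
      simp only [this, zero_mul]; exact freeOf_const _ _
    · exact (freeOf_const _ _).mul (flu_freeOf a hw)
  -- pointwise decomposition
  have hdec : ∀ η, ∑ x, g x * (flu a x η * flu a (x + 1) η) ≤
      (n : ℝ)⁻¹ * (∑ x, 1 * flu a x η) ^ 2 + (n : ℝ)⁻¹ * (∑ x, g (x - 1) * flu a x η) ^ 2
        + 2 * Λ * ε⁻¹ ^ 2 + ∑ z, -hh z η * bondGrad a z (z + 1) η +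
        ∑ z, flu a z η * flu a (z + 1) η * ∑ w, (a z - a (z + 1)) * c z w * flu a w η := by
    intro η
    have hrep := quadratic_replacement (n := n) (by omega) g (fun x => flu a x η)
    have e1 : ∑ z, (flu a (z + 1) η - flu a z η) *
        ∑ w, tent n (w - z - 2) * g (w - 1) * flu a w η =
        (n - 1) * (∑ z, -hh z η * bondGrad a z (z + 1) η +
        ∑ z, flu a z η * flu a (z + 1) η * ∑ w, (a z - a (z + 1)) * c z w * flu a w η) := by
      rw [← Finset.sum_add_distrib, Finset.mul_sum]
      refine Finset.sum_congr rfl fun z _ => ?_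
      have e2 : ∑ w, tent n (w - z - 2) * g (w - 1) * flu a w η = (n - 1) * hh z η := by
        simp only [hhh, hc, Finset.mul_sum]
        exact Finset.sum_congr rfl fun w _ => by field_simp
      have e3 : ∑ w, (a z - a (z + 1)) * c z w * flu a w η = (a z - a (z + 1)) * hh z η := by
        simp only [hhh, Finset.mul_sum]
        exact Finset.sum_congr rfl fun w _ => by ring
      rw [e2, e3, bondGrad_eq h hε]; ring
    have e4 : ∑ x, g x * flu a (x + 1) η = ∑ x, g (x - 1) * flu a x η := by
      rw [← Equiv.sum_comp (Equiv.addRight (1 : ZMod n)) (fun x => g (x - 1) * flu a x η)]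
      exact Finset.sum_congr rfl fun x _ => by simp
    have e5 : ∑ x, g x * flu a (x + 1) η * (∑ v, flu a v η - flu a (x + 1) η) ≤
        (n - 1) * ((n : ℝ)⁻¹ * (∑ x, 1 * flu a x η) ^ 2 +
          (n : ℝ)⁻¹ * (∑ x, g (x - 1) * flu a x η) ^ 2 + 2 * Λ * ε⁻¹ ^ 2) := by
      have e6 : ∑ x, g x * flu a (x + 1) η * (∑ v, flu a v η - flu a (x + 1) η) =
          (∑ x, g (x - 1) * flu a x η) * (∑ x, flu a x η) -
          ∑ x, g x * flu a (x + 1) η ^ 2 := by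
        rw [← e4, Finset.sum_mul, ← Finset.sum_sub_distrib]
        exact Finset.sum_congr rfl fun x _ => by ring
      have e7 : -∑ x, g x * flu a (x + 1) η ^ 2 ≤ n * (Λ * ε⁻¹ ^ 2) := by
        rw [← Finset.sum_neg_distrib]
        calc _ ≤ ∑ _x : ZMod n, Λ * ε⁻¹ ^ 2 := Finset.sum_le_sum fun x _ => by
              rw [← neg_mul]
              exact mul_le_mul ((neg_le_abs _).trans (hg x)) (sq_flu_le h hε _ _)
                (sq_nonneg _) hΛ
          _ = _ := by simp [ZMod.card]
      rw [e6]
      simp only [one_mul]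
      set S := ∑ x, flu a x η
      set G := ∑ x, g (x - 1) * flu a x η
      have e8 : 1 / 2 ≤ ((n : ℝ) - 1) * (n : ℝ)⁻¹ := by
        rw [← div_eq_mul_inv, le_div_iff₀ hn0]; linarith
      have e9 : G * S ≤ ((n : ℝ) - 1) * (n : ℝ)⁻¹ * (S ^ 2 + G ^ 2) := by
        nlinarith [sq_nonneg (G - S), sq_nonneg G, sq_nonneg S]
      have e10 : (n : ℝ) * (Λ * ε⁻¹ ^ 2) ≤ (n - 1) * (2 * Λ * ε⁻¹ ^ 2) := by
        have : 0 ≤ Λ * ε⁻¹ ^ 2 := by positivity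
        nlinarith
      nlinarith
    refine le_of_mul_le_mul_left ?_ hn1
    rw [hrep, e1]
    linarith
  -- expectations of the five terms
  have t1 : ∑ η, p η * (∑ x, 1 * flu a x η) ^ 2 ≤ n * (4 * ε⁻¹ ^ 2 * (ent a p + 1)) := by
    refine (sum_mul_sq_le_ent h hε hp hp1 (V := ε⁻¹ ^ 2 / 2 * ∑ _x : ZMod n, (1 : ℝ) ^ 2)
      (by positivity) fun θ => bmean_exp_linear_le h hε (fun _ => 1) θ).trans (le_of_eq ?_)
    simp [ZMod.card]; ring
  have t2 : ∑ η, p η * (∑ x, g (x - 1) * flu a x η) ^ 2 ≤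
      n * (4 * ε⁻¹ ^ 2 * Λ ^ 2 * (ent a p + 1)) := by
    refine (sum_mul_sq_le_ent h hε hp hp1 (V := ε⁻¹ ^ 2 / 2 * ∑ x : ZMod n, g (x - 1) ^ 2)
      (by positivity) fun θ => bmean_exp_linear_le h hε (fun x => g (x - 1)) θ).trans ?_
    have : ∑ x : ZMod n, g (x - 1) ^ 2 ≤ n * Λ ^ 2 := by
      calc _ ≤ ∑ _x : ZMod n, Λ ^ 2 := Finset.sum_le_sum fun x _ => by
            rw [← sq_abs]; exact pow_le_pow_left₀ (abs_nonneg _) (hg _) 2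
        _ = _ := by simp [ZMod.card]
    calc _ ≤ 8 * (ε⁻¹ ^ 2 / 2 * (n * Λ ^ 2)) * (ent a p + 1) := by gcongr
      _ = _ := by ring
  -- The sum of squares is of order n²; this will be cancelled by the factor 1/(δn²) that
  -- integration by parts with weight δn² leaves in front of it. The multiplier γ sits at the
  -- threshold of the exponential bound, with Λ + 1 in place of Λ to keep it positive.
  have t4 : ∑ η, p η * ∑ z, hh z η ^ 2 ≤
      4 * (n : ℝ) ^ 2 * ε⁻¹ ^ 2 * (Λ + 1) ^ 2 * (ent a p + 1) := by
    have hb := bmean_exp_sum_sq_linear_le h hε (Finset.univ : Finset (ZMod n))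
      Finset.univ_nonempty (by simp [ZMod.card]) c (Λ := Λ + 1)
      (γ := (4 * (n : ℝ) ^ 2 * ε⁻¹ ^ 2 * (Λ + 1) ^ 2)⁻¹)
      (fun z _ w => (hcle z w).trans (by linarith)) (by positivity)
      (le_of_eq (by field_simp))
    refine (sum_mul_le_ent h hε hp hp1 (by positivity) hb).trans ?_
    rw [inv_inv]
    gcongr
  have t4' : ∑ η, p η * ∑ z, -hh z η * bondGrad a z (z + 1) η ≤
      δ * (n : ℝ) ^ 2 * ∑ x, bondForm a p x +
        2 * ε⁻¹ ^ 8 * (Λ + 1) ^ 2 / δ * (ent a p + 1) := by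
    have hδn : 0 < δ * (n : ℝ) ^ 2 := by positivity
    calc _ = ∑ z, ∑ η, p η * (-hh z η * bondGrad a z (z + 1) η) := by
          simp only [Finset.mul_sum]; exact Finset.sum_comm
      _ ≤ ∑ z, (δ * (n : ℝ) ^ 2 * bondForm a p z + ε⁻¹ ^ 6 / (2 * (δ * (n : ℝ) ^ 2)) *
          ∑ η, p η * (-hh z η) ^ 2) := Finset.sum_le_sum fun z _ =>
            sum_mul_bondGrad_le h hε (by omega) hp z (u := fun η => -hh z η)
              ((hfree z z (Or.inl rfl)).comp _)
              ((hfree z (z + 1) (Or.inr rfl)).comp _) hδn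
      _ = δ * (n : ℝ) ^ 2 * ∑ x, bondForm a p x + ε⁻¹ ^ 6 / (2 * (δ * (n : ℝ) ^ 2)) *
          ∑ η, p η * ∑ z, hh z η ^ 2 := by
          rw [Finset.sum_add_distrib, ← Finset.mul_sum, ← Finset.mul_sum, Finset.sum_comm]
          congr 2
          refine Finset.sum_congr rfl fun η _ => ?_
          rw [Finset.mul_sum]
          simp
      _ ≤ δ * (n : ℝ) ^ 2 * ∑ x, bondForm a p x + ε⁻¹ ^ 6 / (2 * (δ * (n : ℝ) ^ 2)) *
          (4 * (n : ℝ) ^ 2 * ε⁻¹ ^ 2 * (Λ + 1) ^ 2 * (ent a p + 1)) := by gcongr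
      _ = _ := by
          have : ε⁻¹ ^ 6 / (2 * (δ * (n : ℝ) ^ 2)) *
            (4 * (n : ℝ) ^ 2 * ε⁻¹ ^ 2 * (Λ + 1) ^ 2 * (ent a p + 1)) =
            2 * ε⁻¹ ^ 8 * (Λ + 1) ^ 2 / δ * (ent a p + 1) := by
            generalize ε⁻¹ = B
            field_simp; ring
          rw [this]
  -- The correction in `bondGrad_eq` produces a cubic form. The factor a z - a (z + 1) makes its
  -- coefficients of order 1/n, the scale of `bmean_exp_cubic_le`; the 6 in γ satisfies 32/36 ≤ 1.
  have t5 : ∑ η, p η * ∑ z, flu a z η * flu a (z + 1) η *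
      ∑ w, (a z - a (z + 1)) * c z w * flu a w η ≤
      12 * ε⁻¹ ^ 3 * (κ * Λ + 1) * (ent a p + 1) := by
    have hL : 0 < κ * Λ + 1 := by positivity
    have hb := bmean_exp_cubic_le h hε (by omega) (fun z w => (a z - a (z + 1)) * c z w)
      (Λ := κ * Λ + 1) (γ := (6 * ε⁻¹ ^ 3 * (κ * Λ + 1))⁻¹) hL.le (fun z w => by
        rw [abs_mul]
        calc _ ≤ κ / n * Λ := mul_le_mul (ha z) (hcle z w) (abs_nonneg _) (by positivity)
          _ ≤ (κ * Λ + 1) / n := by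
            rw [div_mul_eq_mul_div]; gcongr; linarith)
      (fun z => by simp [hc0]) (fun z => by simp [hc1]) (by positivity) (by
        generalize ε⁻¹ = B at hB
        rw [inv_pow]
        field_simp
        norm_num)
    refine (sum_mul_le_ent h hε hp hp1 (by positivity) hb).trans ?_
    rw [inv_inv, Real.log_mul (by norm_num) (Real.exp_pos _).ne', Real.log_exp]
    have e : (6 * ε⁻¹ ^ 3 * (κ * Λ + 1))⁻¹ * (κ * Λ + 1) * ε⁻¹ ^ 3 ≤ 1 := by
      generalize ε⁻¹ = B at hB
      field_simp
      norm_num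
    calc _ ≤ 6 * ε⁻¹ ^ 3 * (κ * Λ + 1) * (2 * (ent a p + 1)) := by
          gcongr
          linarith
      _ = _ := by ring
  have t3 : ∑ η, p η * (2 * Λ * ε⁻¹ ^ 2) ≤ 2 * Λ * ε⁻¹ ^ 2 * (ent a p + 1) := by
    rw [← Finset.sum_mul, hp1, one_mul]
    exact le_mul_of_one_le_right (by positivity) (by linarith)
  calc _ ≤ ∑ η, p η * ((n : ℝ)⁻¹ * (∑ x, 1 * flu a x η) ^ 2 +
        (n : ℝ)⁻¹ * (∑ x, g (x - 1) * flu a x η) ^ 2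
        + 2 * Λ * ε⁻¹ ^ 2 + ∑ z, -hh z η * bondGrad a z (z + 1) η +
        ∑ z, flu a z η * flu a (z + 1) η * ∑ w, (a z - a (z + 1)) * c z w * flu a w η) :=
        Finset.sum_le_sum fun η _ => mul_le_mul_of_nonneg_left (hdec η) (hp η)
    _ = (n : ℝ)⁻¹ * ∑ η, p η * (∑ x, 1 * flu a x η) ^ 2 +
        (n : ℝ)⁻¹ * ∑ η, p η * (∑ x, g (x - 1) * flu a x η) ^ 2 +
        ∑ η, p η * (2 * Λ * ε⁻¹ ^ 2) +
        ∑ η, p η * ∑ z, -hh z η * bondGrad a z (z + 1) η +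
        ∑ η, p η * ∑ z, flu a z η * flu a (z + 1) η *
          ∑ w, (a z - a (z + 1)) * c z w * flu a w η := by
        simp only [mul_add, Finset.sum_add_distrib]
        congr 4
        · rw [Finset.mul_sum]; exact Finset.sum_congr rfl fun η _ => by ring
        · rw [Finset.mul_sum]; exact Finset.sum_congr rfl fun η _ => by ring
    _ ≤ (n : ℝ)⁻¹ * (n * (4 * ε⁻¹ ^ 2 * (ent a p + 1))) +
        (n : ℝ)⁻¹ * (n * (4 * ε⁻¹ ^ 2 * Λ ^ 2 * (ent a p + 1))) +
        2 * Λ * ε⁻¹ ^ 2 * (ent a p + 1) + (δ * (n : ℝ) ^ 2 * ∑ x, bondForm a p x +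
        2 * ε⁻¹ ^ 8 * (Λ + 1) ^ 2 / δ * (ent a p + 1)) +
        12 * ε⁻¹ ^ 3 * (κ * Λ + 1) * (ent a p + 1) := by gcongr
    _ = _ := by
        unfold replacementConst
        rw [inv_mul_cancel_left₀ hn0.ne', inv_mul_cancel_left₀ hn0.ne']
        ring

end Replacement

/-! ### Entropy production -/

section Production

set_option linter.unusedSectionVars false

variable {n : ℕ} [NeZero n]

/-- The rate of jumps from `x` to `x + 1`. -/
def rateRight (n : ℕ) (F : ℝ → ℝ) (x : ZMod n) : ℝ := 1 + F (site n x) / n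

/-- The rate of jumps from `x + 1` to `x`. -/
def rateLeft (n : ℕ) (F : ℝ → ℝ) (x : ZMod n) : ℝ := 1 - F (site n (x + 1)) / n

/-- The total rate of the exchange across the bond `{x, x+1}`. -/
def bondRate (n : ℕ) (F : ℝ → ℝ) (x : ZMod n) (η : Config n) : ℝ :=
  rateRight n F x * (occ η x * (1 - occ η (x + 1))) +
    rateLeft n F x * (occ η (x + 1) * (1 - occ η x))

lemma exchange_comm (η : Config n) (x y : ZMod n) : exchange η x y = exchange η y x := by
  ext z; simp only [exchange]; rw [Equiv.swap_comm]

/-- Shifting the sum over leftward jumps by one site lets both directions across a bond share the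
same exchange. -/
lemma generator_eq_sum_bonds (F : ℝ → ℝ) (f : Config n → ℝ) (η : Config n) :
    generator n F f η = ∑ x, bondRate n F x η * (f (exchange η x (x + 1)) - f η) := by
  unfold generator rate
  have h1 : ∀ x : ZMod n, ∑ y : ZMod n,
      ((if y = x + 1 then 1 + F (site n x) / n else 0) +
        (if y = x - 1 then 1 - F (site n x) / n else 0)) * occ η x * (1 - occ η y) *
        (f (exchange η x y) - f η) =
      (1 + F (site n x) / n) * occ η x * (1 - occ η (x + 1)) *
        (f (exchange η x (x + 1)) - f η) +
      (1 - F (site n x) / n) * occ η x * (1 - occ η (x - 1)) *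
        (f (exchange η x (x - 1)) - f η) := by
    intro x
    simp only [add_mul, Finset.sum_add_distrib, ite_mul, zero_mul, Finset.sum_ite_eq',
      Finset.mem_univ, if_true]
  simp only [h1, Finset.sum_add_distrib]
  rw [← Equiv.sum_comp (Equiv.addRight (1 : ZMod n)) (fun x =>
    (1 - F (site n x) / n) * occ η x * (1 - occ η (x - 1)) * (f (exchange η x (x - 1)) - f η)),
    ← Finset.sum_add_distrib]
  refine Finset.sum_congr rfl fun x _ => ?_
  simp only [Equiv.coe_addRight, add_sub_cancel_right]
  rw [exchange_comm η (x + 1) x]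
  unfold bondRate rateRight rateLeft
  ring

lemma generatorMatrix_mulVec (F : ℝ → ℝ) (f : Config n → ℝ) :
    (generatorMatrix n F).mulVec f = generator n F f := by
  ext η
  simp only [Matrix.mulVec, dotProduct, generatorMatrix, Matrix.of_apply]
  simp only [generator_eq_sum_bonds, Finset.sum_mul]
  rw [Finset.sum_comm]
  refine Finset.sum_congr rfl fun x _ => ?_
  simp only [mul_assoc, ← Finset.mul_sum, sub_mul, Finset.sum_sub_distrib]
  congr 2 <;> simp [Pi.single_apply]

lemma vecMul_generatorMatrix_sum (F : ℝ → ℝ) (p f : Config n → ℝ) :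
    ∑ η, (Matrix.vecMul p (generatorMatrix n F)) η * f η = ∑ η, p η * generator n F f η := by
  rw [← generatorMatrix_mulVec]
  exact (Matrix.dotProduct_mulVec p (generatorMatrix n F) f).symm

/-- The mean current across the bond `{x, x+1}` under the product measure with profile `a`. -/
def meanCurrent (n : ℕ) (F : ℝ → ℝ) (a : ZMod n → ℝ) (x : ZMod n) : ℝ :=
  rateRight n F x * (a x * (1 - a (x + 1))) - rateLeft n F x * ((1 - a x) * a (x + 1))

/-- This is log y ≤ y - 1 at y = √(v/u), doubled and multiplied by u. Applying the inequality to the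
square root is what retains the Dirichlet form of √f. -/
lemma mul_log_sub_log_le {u v : ℝ} (hu : 0 < u) (hv : 0 < v) :
    u * (Real.log v - Real.log u) ≤ v - u - (√v - √u) ^ 2 := by
  have h := Real.log_le_sub_one_of_pos (x := √v / √u) (by positivity)
  rw [Real.log_div (by positivity) (by positivity), Real.log_sqrt hv.le, Real.log_sqrt hu.le] at h
  have hu2 : √u ^ 2 = u := Real.sq_sqrt hu.le
  have hv2 : √v ^ 2 = v := Real.sq_sqrt hv.le
  have h2 := mul_le_mul_of_nonneg_left h hu.le
  have e : u * (√v / √u - 1) = √u * √v - u := by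
    have : 0 < √u := by positivity
    field_simp
    linear_combination (-√v) * hu2
  rw [e] at h2
  nlinarith

lemma occ_of_true {η : Config n} {x : ZMod n} (h : η x = true) : occ η x = 1 := by simp [occ, h]

lemma occ_of_false {η : Config n} {x : ZMod n} (h : η x = false) : occ η x = 0 := by simp [occ, h]

/-- The adjoint of the bond generator applied to the constant function. -/
lemma sum_bweight_bondRate {ε : ℝ} {a : ZMod n → ℝ} (h : Elliptic ε a) (hε : 0 < ε)
    (hn : 2 ≤ n) (F : ℝ → ℝ) (p : Config n → ℝ) (x : ZMod n) :
    ∑ η, bweight a η * (bondRate n F x η *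
      (density a p (exchange η x (x + 1)) - density a p η)) =
      -∑ η, p η * (meanCurrent n F a x * bondGrad a x (x + 1) η) := by
  set y := x + 1 with hy
  have hxy : x ≠ y := add_one_ne_self hn x
  have hax := h.pos hε x
  have hay := h.pos hε y
  have hbx := h.one_sub_pos hε x
  have hby := h.one_sub_pos hε y
  -- The exchange is moved from the density onto rate and weight. The weight ratio of
  -- `bweight_exchange` then turns the difference of gain and loss into the mean current times the
  -- bond gradient.
  have e1 : ∑ η, bweight a η * (bondRate n F x η * density a p (exchange η x y)) =
      ∑ η, bweight a (exchange η x y) * (bondRate n F x (exchange η x y) * density a p η) := by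
    rw [← sum_exchange x y]
    simp only [exchange_exchange]
  simp only [mul_sub, Finset.sum_sub_distrib]
  rw [e1, ← Finset.sum_sub_distrib, ← Finset.sum_neg_distrib]
  refine Finset.sum_congr rfl fun η _ => ?_
  have hw := bweight_pos h hε η
  unfold density bondRate meanCurrent bondGrad
  rw [← hy]
  have o1 : occ (exchange η x y) x = occ η y := by simp [occ, exchange_apply_left]
  have o2 : occ (exchange η x y) y = occ η x := by simp [occ, exchange_apply_right]
  rw [o1, o2]
  cases hx : η x <;> cases hy' : η y
  · simp [occ, hx, hy']
  · have hb := bweight_exchange a hxy (exchange η x y) (by rw [exchange_apply_left, hy'])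
      (by rw [exchange_apply_right, hx])
    rw [exchange_exchange] at hb
    have hb' : bweight a (exchange η x y) =
        bweight a η * (a x * (1 - a y)) / ((1 - a x) * a y) := by
      rw [eq_div_iff (by positivity), ← hb]
    rw [hb', occ_of_false hx, occ_of_true hy']
    simp
    field_simp
  · have hb := bweight_exchange a hxy η hx hy'
    have hb' : bweight a (exchange η x y) =
        bweight a η * ((1 - a x) * a y) / (a x * (1 - a y)) := by
      rw [eq_div_iff (by positivity), ← hb]
    rw [hb', occ_of_true hx, occ_of_false hy']
    simp
    field_simp
    ring
  · simp [occ, hx, hy']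

/-- Entropy dissipation for a fixed reference product measure. -/
lemma sum_generator_log_le {ε : ℝ} {a : ZMod n → ℝ} (h : Elliptic ε a) (hε : 0 < ε)
    (hn : 2 ≤ n) (F : ℝ → ℝ) (hR : ∀ x, 1 / 2 ≤ rateRight n F x) (hL : ∀ x, 0 ≤ rateLeft n F x)
    {p : Config n → ℝ} (hp : ∀ η, 0 < p η) :
    ∑ η, p η * generator n F (fun η => Real.log (p η) - Real.log (bweight a η)) η ≤
      -(1 / 2) * ∑ x, bondForm a p x -
        ∑ η, p η * ∑ x, meanCurrent n F a x * bondGrad a x (x + 1) η := by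
  have hf : ∀ η, 0 < density a p η := fun η => div_pos (hp η) (bweight_pos h hε η)
  have hlog : ∀ η, Real.log (p η) - Real.log (bweight a η) = Real.log (density a p η) := fun η =>
    (Real.log_div (hp η).ne' (bweight_pos h hε η).ne').symm
  have hpf : ∀ η, p η = bweight a η * density a p η := fun η => by
    simp only [density]; field_simp [(bweight_pos h hε η).ne']
  simp only [hlog, generator_eq_sum_bonds]
  simp only [Finset.mul_sum]
  rw [Finset.sum_comm, Finset.sum_comm (f := fun (η : Config n) (x : ZMod n) =>
    p η * (meanCurrent n F a x * bondGrad a x (x + 1) η)), ← Finset.sum_sub_distrib]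
  refine Finset.sum_le_sum fun x _ => ?_
  rw [sub_eq_add_neg, ← sum_bweight_bondRate h hε hn F p x, bondForm, Finset.mul_sum,
    ← Finset.sum_add_distrib]
  refine Finset.sum_le_sum fun η _ => ?_
  have hw := bweight_pos h hε η
  have hR0 : 0 ≤ rateRight n F x := by linarith [hR x]
  have hr : 0 ≤ bondRate n F x η := by
    unfold bondRate
    have := hL x
    cases hx : η x <;> cases hy : η (x + 1) <;> simp [occ, hx, hy, hR0, this]
  set f := density a p η with hfdef
  set f' := density a p (exchange η x (x + 1)) with hfdef'
  have key := mul_log_sub_log_le (hf η) (hf (exchange η x (x + 1)))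
  rw [← hfdef, ← hfdef'] at key
  calc p η * (bondRate n F x η * (Real.log f' - Real.log f))
      = bweight a η * bondRate n F x η * (f * (Real.log f' - Real.log f)) := by
        rw [hpf η]; ring
    _ ≤ bweight a η * bondRate n F x η * (f' - f - (√f' - √f) ^ 2) :=
        mul_le_mul_of_nonneg_left key (by positivity)
    _ = -(bondRate n F x η * (bweight a η * (√f' - √f) ^ 2)) +
        bweight a η * (bondRate n F x η * (f' - f)) := by ring
    _ ≤ _ := by
        gcongr
        -- The bond form only counts configurations with a particle at x and a hole at x + 1. There
        -- the rate is the rightward one, at least 1/2; elsewhere the dissipation is discarded.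
        split_ifs with hη
        · have : bondRate n F x η = rateRight n F x := by
            unfold bondRate; rw [occ_of_true hη.1, occ_of_false hη.2]; ring
          rw [this]
          have h2 : 0 ≤ bweight a η * (√f' - √f) ^ 2 := by positivity
          nlinarith [hR x]
        · have h2 : 0 ≤ bweight a η * (√f' - √f) ^ 2 := by positivity
          have := mul_nonneg hr h2
          linarith

/-- Entropy production: the time derivative of the relative entropy along the evolution is
bounded linearly in the entropy, up to the error `e` of the discrete continuity equation. -/
theorem entropy_production_le {ε : ℝ} {a : ZMod n → ℝ} (h : Elliptic ε a) (hε : 0 < ε)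
    (hn : 3 ≤ n) (F : ℝ → ℝ) (hR : ∀ x, 1 / 2 ≤ rateRight n F x) (hL : ∀ x, 0 ≤ rateLeft n F x)
    {p : Config n → ℝ} (hp : ∀ η, 0 < p η) (hp1 : ∑ η, p η = 1)
    {J a' : ZMod n → ℝ} {Λ κ : ℝ} (hΛ : 0 ≤ Λ) (hκ : 0 ≤ κ)
    (ha : ∀ x, |a x - a (x + 1)| ≤ κ / n) (hJ : ∀ x, |J x| ≤ Λ)
    (ha' : ∀ x, a' x = -(n * (J x - J (x - 1)))) :
    (n : ℝ) ^ 2 * ∑ η, p η * generator n F (fun η => Real.log (p η) - Real.log (bweight a η)) η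
      - ∑ η, p η * ∑ x, a' x * flu a x η ≤
      replacementConst ε (Λ * κ) κ (1 / 4) * (ent a p + 1) +
        2 * ε⁻¹ ^ 6 * ∑ x, (J x - n * meanCurrent n F a x) ^ 2 := by
  have hn0 : (0 : ℝ) < n := by exact_mod_cast (by omega : 0 < n)
  have hdis := sum_generator_log_le h hε (by omega) F hR hL hp
  -- When the flux terms J (ω_x - ω_{x+1}) are rewritten with `bondGrad_eq`, this quadratic field is
  -- left over; the gradient bound of a cancels the factor n. Here and in the next estimate the
  -- Dirichlet form gets the factor 1/4, and together they exhaust the available 1/2.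
  have hquad := sum_mul_quadratic_le h hε hn (fun η => (hp η).le) hp1
    (g := fun x => -(n * J x * (a x - a (x + 1)))) (Λ := Λ * κ) (κ := κ) (δ := 1 / 4)
    (by positivity) hκ (by norm_num) (fun x => by
      rw [abs_neg, abs_mul, abs_mul, abs_of_pos hn0]
      calc _ ≤ n * Λ * (κ / n) := by
            gcongr
            · exact hJ x
            · exact ha x
        _ = Λ * κ := by field_simp) ha
  -- Integration by parts at weight n²/4 makes the flux error enter squared and without a power of
  -- n, so ℓ² control of that error is enough.
  have hlin : ∑ η, p η * ∑ x, n * (J x - n * meanCurrent n F a x) * bondGrad a x (x + 1) η ≤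
      1 / 4 * (n : ℝ) ^ 2 * ∑ x, bondForm a p x +
        2 * ε⁻¹ ^ 6 * ∑ x, (J x - n * meanCurrent n F a x) ^ 2 := by
    simp only [Finset.mul_sum]
    rw [Finset.sum_comm, ← Finset.sum_add_distrib]
    refine Finset.sum_le_sum fun x _ => ?_
    refine (sum_mul_bondGrad_le h hε (by omega) (fun η => (hp η).le) x (freeOf_const _ _)
      (freeOf_const _ _) (δ := 1 / 4 * (n : ℝ) ^ 2) (by positivity)).trans (le_of_eq ?_)
    rw [← Finset.sum_mul, hp1]
    congr 1
    generalize ε⁻¹ = B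
    field_simp
    norm_num
  have hpt : ∀ η, -(n : ℝ) ^ 2 * ∑ x, meanCurrent n F a x * bondGrad a x (x + 1) η -
      ∑ x, a' x * flu a x η =
      ∑ x, n * (J x - n * meanCurrent n F a x) * bondGrad a x (x + 1) η +
      ∑ x, -(n * J x * (a x - a (x + 1))) * (flu a x η * flu a (x + 1) η) := by
    intro η
    have e1 : ∑ x, a' x * flu a x η = -∑ x, n * J x * (flu a x η - flu a (x + 1) η) := by
      have e2 : ∑ x, J (x - 1) * flu a x η = ∑ x, J x * flu a (x + 1) η := by
        rw [← Equiv.sum_comp (Equiv.addRight (1 : ZMod n)) (fun x => J (x - 1) * flu a x η)]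
        exact Finset.sum_congr rfl fun x _ => by simp
      simp only [ha', mul_sub, Finset.sum_sub_distrib, sub_mul, neg_mul, Finset.sum_neg_distrib,
        mul_assoc, ← Finset.mul_sum, e2]
    rw [e1, sub_neg_eq_add, Finset.mul_sum, ← Finset.sum_add_distrib, ← Finset.sum_add_distrib]
    refine Finset.sum_congr rfl fun x _ => ?_
    rw [bondGrad_eq h hε]; ring
  have hsum : -(n : ℝ) ^ 2 * ∑ η, p η * ∑ x, meanCurrent n F a x * bondGrad a x (x + 1) η -
      ∑ η, p η * ∑ x, a' x * flu a x η =
      ∑ η, p η * ∑ x, n * (J x - n * meanCurrent n F a x) * bondGrad a x (x + 1) η +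
      ∑ η, p η * ∑ x, -(n * J x * (a x - a (x + 1))) * (flu a x η * flu a (x + 1) η) := by
    rw [Finset.mul_sum, ← Finset.sum_sub_distrib, ← Finset.sum_add_distrib]
    refine Finset.sum_congr rfl fun η _ => ?_
    have := congrArg (fun t => p η * t) (hpt η)
    linarith
  have hdis' := mul_le_mul_of_nonneg_left hdis (by positivity : (0 : ℝ) ≤ (n : ℝ) ^ 2)
  have hbf : 0 ≤ ∑ x, bondForm a p x := Finset.sum_nonneg fun x _ => Finset.sum_nonneg fun η _ => by
    split_ifs
    · exact mul_nonneg (bweight_pos h hε η).le (sq_nonneg _)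
    · exact le_rfl
  nlinarith

end Production

/-! ### The semigroup -/

section MatrixExp

variable {m : Type*} [Fintype m] [DecidableEq m]

open scoped Matrix.Norms.Operator in
lemma hasDerivAt_exp_smul_apply (Q : Matrix m m ℝ) (t : ℝ) (i j : m) :
    HasDerivAt (fun t : ℝ => NormedSpace.exp (t • Q) i j)
      ((NormedSpace.exp (t • Q) * Q) i j) t := by
  have h := hasDerivAt_exp_smul_const (𝕂 := ℝ) Q t
  have h1 := (ContinuousLinearMap.hasFDerivAt (x := NormedSpace.exp (t • Q))
    (LinearMap.toContinuousLinearMap (Matrix.entryLinearMap ℝ ℝ i j))).comp_hasDerivAt t h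
  exact h1

open scoped Matrix.Norms.Operator in
lemma exp_smul_mul_comm (Q : Matrix m m ℝ) (t : ℝ) :
    NormedSpace.exp (t • Q) * Q = Q * NormedSpace.exp (t • Q) :=
  ((Commute.refl Q).smul_left t).exp_left.eq

open scoped Matrix.Norms.Operator in
lemma exp_add_smul (Q : Matrix m m ℝ) (s t : ℝ) :
    NormedSpace.exp ((s + t) • Q) = NormedSpace.exp (s • Q) * NormedSpace.exp (t • Q) := by
  rw [add_smul]
  exact NormedSpace.exp_add_of_commute (((Commute.refl Q).smul_left s).smul_right t)

open scoped Matrix.Norms.Operator in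
-- All terms of the exponential series are entrywise nonnegative and the zeroth one is the identity.
lemma one_le_exp_of_nonneg {A : Matrix m m ℝ} (hA : ∀ i j, 0 ≤ A i j) (i j : m) :
    (1 : Matrix m m ℝ) i j ≤ NormedSpace.exp A i j := by
  have hs := NormedSpace.exp_series_hasSum_exp' (𝕂 := ℝ) A
  have hs' : HasSum (fun k : ℕ => ((k.factorial : ℝ)⁻¹ • A ^ k) i j) (NormedSpace.exp A i j) :=
    hs.map (Matrix.entryLinearMap ℝ ℝ i j)
      (LinearMap.continuous_of_finiteDimensional (Matrix.entryLinearMap ℝ ℝ i j))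
  have hpow : ∀ (k : ℕ) (i j : m), 0 ≤ (A ^ k) i j := by
    intro k
    induction k with
    | zero => intro i j; rw [pow_zero, Matrix.one_apply]; split_ifs <;> simp
    | succ k ih =>
      intro i j
      rw [pow_succ, Matrix.mul_apply]
      exact Finset.sum_nonneg fun l _ => mul_nonneg (ih i l) (hA l j)
  have := hs'.summable.sum_le_tsum {0} (fun k _ => by
    rw [Matrix.smul_apply, smul_eq_mul]; exact mul_nonneg (by positivity) (hpow k i j))
  rw [hs'.tsum_eq] at this
  simpa using this

open scoped Matrix.Norms.Operator in
/-- The exponential of a matrix with nonnegative off-diagonal entries has nonnegative entries and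
a positive diagonal. -/
lemma exp_smul_nonneg {Q : Matrix m m ℝ} (hQ : ∀ i j, i ≠ j → 0 ≤ Q i j) {t : ℝ} (ht : 0 ≤ t) :
    (∀ i j, 0 ≤ NormedSpace.exp (t • Q) i j) ∧ ∀ i, 0 < NormedSpace.exp (t • Q) i i := by
  -- Adding c to the diagonal makes the whole matrix nonnegative. The scalar part commutes with
  -- everything and only contributes the positive factor exp (-tc).
  set c : ℝ := ∑ i, |Q i i| with hc
  have hdiag : ∀ i, 0 ≤ Q i i + c := by
    intro i
    have : |Q i i| ≤ c := Finset.single_le_sum (f := fun i => |Q i i|)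
      (fun i _ => abs_nonneg _) (Finset.mem_univ i)
    linarith [neg_abs_le (Q i i)]
  set A : Matrix m m ℝ := t • (Q + c • (1 : Matrix m m ℝ)) with hA
  have hA0 : ∀ i j, 0 ≤ A i j := by
    intro i j
    rw [hA, Matrix.smul_apply, Matrix.add_apply, Matrix.smul_apply, smul_eq_mul, smul_eq_mul]
    refine mul_nonneg ht ?_
    by_cases hij : i = j
    · subst hij; simpa using hdiag i
    · simpa [Matrix.one_apply_ne hij] using hQ i j hij
  have hexp : NormedSpace.exp (t • Q) = Real.exp (-(t * c)) • NormedSpace.exp A := by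
    have e1 : t • Q = Matrix.diagonal (fun _ => -(t * c)) + A := by
      ext i j
      rw [hA, Matrix.add_apply, Matrix.smul_apply, Matrix.smul_apply, Matrix.add_apply,
        Matrix.smul_apply]
      by_cases hij : i = j
      · subst hij; simp; ring
      · simp [hij]
    have e2 : Commute (Matrix.diagonal (fun _ => -(t * c))) A := by
      ext i j
      rw [Matrix.diagonal_mul, Matrix.mul_diagonal, mul_comm]
    rw [e1, Matrix.exp_add_of_commute _ _ e2, Matrix.exp_diagonal]
    ext i j
    rw [Matrix.diagonal_mul, Pi.coe_exp, Matrix.smul_apply, smul_eq_mul, ← Real.exp_eq_exp_ℝ]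
  have h1 := one_le_exp_of_nonneg hA0
  have hone : ∀ i j, (0 : ℝ) ≤ (1 : Matrix m m ℝ) i j := by
    intro i j; rw [Matrix.one_apply]; split_ifs <;> simp
  rw [hexp]
  refine ⟨fun i j => ?_, fun i => ?_⟩
  · rw [Matrix.smul_apply, smul_eq_mul]
    exact mul_nonneg (Real.exp_pos _).le ((hone i j).trans (h1 i j))
  · rw [Matrix.smul_apply, smul_eq_mul]
    have := h1 i i
    rw [Matrix.one_apply_eq] at this
    exact mul_pos (Real.exp_pos _) (by linarith)

/-- Conservation of mass: since Q annihilates constants, the row sums of exp (sQ) have zero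
derivative in s. -/
lemma exp_smul_mulVec_one {Q : Matrix m m ℝ} (hQ : Q.mulVec 1 = 0) (t : ℝ) :
    (NormedSpace.exp (t • Q)).mulVec 1 = 1 := by
  ext i
  have hd : ∀ s, HasDerivAt (fun s : ℝ => ∑ j, NormedSpace.exp (s • Q) i j) 0 s := by
    intro s
    have h1 : HasDerivAt (fun s : ℝ => ∑ j, NormedSpace.exp (s • Q) i j)
        (∑ j, (NormedSpace.exp (s • Q) * Q) i j) s :=
      HasDerivAt.fun_sum fun j _ => hasDerivAt_exp_smul_apply Q s i j
    have h2 : ∑ j, (NormedSpace.exp (s • Q) * Q) i j = 0 := by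
      have h3 : ((NormedSpace.exp (s • Q) * Q).mulVec 1) i = 0 := by
        rw [← Matrix.mulVec_mulVec, hQ]; simp
      simpa [Matrix.mulVec, dotProduct] using h3
    rwa [h2] at h1
  have hconst := is_const_of_deriv_eq_zero (fun s => (hd s).differentiableAt)
    (fun s => (hd s).deriv) t 0
  simp only [Matrix.mulVec, dotProduct, Pi.one_apply, mul_one]
  rw [hconst]
  simp [Matrix.one_apply]

end MatrixExp

/-! ### Evolution of the law and propagation of the entropy bound -/

section Evolution

set_option linter.unusedSectionVars false

variable {n : ℕ} [NeZero n]

lemma bondRate_nonneg {F : ℝ → ℝ} (hR : ∀ x, 0 ≤ rateRight n F x)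
    (hL : ∀ x, 0 ≤ rateLeft n F x) (x : ZMod n) (η : Config n) : 0 ≤ bondRate n F x η := by
  unfold bondRate
  have h1 := hR x
  have h2 := hL x
  cases hx : η x <;> cases hy : η (x + 1) <;> simp [occ, hx, hy, h1, h2]

lemma generatorMatrix_off_diag {F : ℝ → ℝ} (hR : ∀ x, 0 ≤ rateRight n F x)
    (hL : ∀ x, 0 ≤ rateLeft n F x) (η ξ : Config n) (h : η ≠ ξ) :
    0 ≤ generatorMatrix n F η ξ := by
  simp only [generatorMatrix, Matrix.of_apply, generator_eq_sum_bonds]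
  refine Finset.sum_nonneg fun x _ => mul_nonneg (bondRate_nonneg hR hL x η) ?_
  rw [Pi.single_eq_of_ne h, sub_zero, Pi.single_apply]
  split_ifs <;> simp

lemma generatorMatrix_mulVec_one (F : ℝ → ℝ) : (generatorMatrix n F).mulVec 1 = 0 := by
  rw [generatorMatrix_mulVec]
  ext η
  simp [generator]

/-- The law at the macroscopic time `r` of the process started from the weights `p`. -/
def lawAt (n : ℕ) [NeZero n] (F : ℝ → ℝ) (p : Config n → ℝ) (r : ℝ) : Config n → ℝ :=
  Matrix.vecMul p (transition n F (r * (n : ℝ) ^ 2))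

lemma hasDerivAt_transition (F : ℝ → ℝ) (η ξ : Config n) (r : ℝ) :
    HasDerivAt (fun r : ℝ => transition n F (r * (n : ℝ) ^ 2) η ξ)
      ((n : ℝ) ^ 2 * (transition n F (r * (n : ℝ) ^ 2) * generatorMatrix n F) η ξ) r := by
  have h1 := hasDerivAt_exp_smul_apply (generatorMatrix n F) (r * (n : ℝ) ^ 2) η ξ
  have h2 : HasDerivAt (fun r : ℝ => r * (n : ℝ) ^ 2) ((n : ℝ) ^ 2) r := by
    simpa using (hasDerivAt_id r).mul_const ((n : ℝ) ^ 2)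
  have h3 := h1.comp r h2
  rw [mul_comm] at h3
  exact h3

lemma hasDerivAt_lawAt (F : ℝ → ℝ) (p : Config n → ℝ) (η : Config n) (r : ℝ) :
    HasDerivAt (fun r => lawAt n F p r η)
      ((n : ℝ) ^ 2 * (Matrix.vecMul (lawAt n F p r) (generatorMatrix n F)) η) r := by
  have h1 : HasDerivAt (fun r => ∑ ξ, p ξ * transition n F (r * (n : ℝ) ^ 2) ξ η)
      (∑ ξ, p ξ * ((n : ℝ) ^ 2 *
        (transition n F (r * (n : ℝ) ^ 2) * generatorMatrix n F) ξ η)) r :=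
    HasDerivAt.fun_sum fun ξ _ => (hasDerivAt_transition F ξ η r).const_mul _
  refine h1.congr_deriv ?_
  have h2 : Matrix.vecMul (lawAt n F p r) (generatorMatrix n F) =
      Matrix.vecMul p (transition n F (r * (n : ℝ) ^ 2) * generatorMatrix n F) :=
    Matrix.vecMul_vecMul _ _ _
  rw [h2]
  simp only [Matrix.vecMul, dotProduct, Finset.mul_sum]
  exact Finset.sum_congr rfl fun ξ _ => by ring

lemma continuous_lawAt (F : ℝ → ℝ) (p : Config n → ℝ) (η : Config n) :
    Continuous fun r => lawAt n F p r η :=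
  continuous_iff_continuousAt.2 fun r => (hasDerivAt_lawAt F p η r).continuousAt

lemma transition_zero (F : ℝ → ℝ) : transition n F 0 = 1 := by
  simp [transition]

lemma lawAt_zero (F : ℝ → ℝ) (p : Config n → ℝ) : lawAt n F p 0 = p := by
  simp [lawAt, transition_zero]

lemma sum_lawAt (F : ℝ → ℝ) (p : Config n → ℝ) (r : ℝ) : ∑ η, lawAt n F p r η = ∑ η, p η := by
  have h1 : ∑ η, lawAt n F p r η = lawAt n F p r ⬝ᵥ 1 := by simp [dotProduct]
  have h2 : p ⬝ᵥ 1 = ∑ η, p η := by simp [dotProduct]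
  rw [h1, lawAt, ← Matrix.dotProduct_mulVec, transition,
    exp_smul_mulVec_one (generatorMatrix_mulVec_one F), h2]

lemma lawAt_nonneg {F : ℝ → ℝ} (hR : ∀ x, 0 ≤ rateRight n F x)
    (hL : ∀ x, 0 ≤ rateLeft n F x) {p : Config n → ℝ} (hp : ∀ η, 0 ≤ p η) {r : ℝ} (hr : 0 ≤ r)
    (η : Config n) : 0 ≤ lawAt n F p r η := by
  have h := (exp_smul_nonneg (generatorMatrix_off_diag hR hL)
    (t := r * (n : ℝ) ^ 2) (by positivity)).1
  exact Finset.sum_nonneg fun ξ _ => mul_nonneg (hp ξ) (h ξ η)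

lemma lawAt_pos {F : ℝ → ℝ} (hR : ∀ x, 0 ≤ rateRight n F x)
    (hL : ∀ x, 0 ≤ rateLeft n F x) {p : Config n → ℝ} (hp : ∀ η, 0 < p η) {r : ℝ} (hr : 0 ≤ r)
    (η : Config n) : 0 < lawAt n F p r η := by
  have h := exp_smul_nonneg (generatorMatrix_off_diag hR hL)
    (t := r * (n : ℝ) ^ 2) (by positivity)
  exact Finset.sum_pos' (fun ξ _ => mul_nonneg (hp ξ).le (h.1 ξ η))
    ⟨η, Finset.mem_univ _, mul_pos (hp η) (h.2 η)⟩

/-- A reference profile `a` on the discrete torus that satisfies a discrete continuity equation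
with flux `J`. -/
structure ReferenceProfile (n : ℕ) [NeZero n] (T ε κ Λ : ℝ) (a J : ℝ → ZMod n → ℝ) : Prop where
  elliptic : ∀ r ∈ Icc 0 T, Elliptic ε (a r)
  grad_le : ∀ r ∈ Icc 0 T, ∀ x, |a r x - a r (x + 1)| ≤ κ / n
  flux_le : ∀ r ∈ Icc 0 T, ∀ x, |J r x| ≤ Λ
  flux_cont : ∀ x, ContinuousOn (fun r => J r x) (Icc 0 T)
  hasDeriv : ∀ r ∈ Icc 0 T, ∀ x,
    HasDerivWithinAt (fun s => a s x) (-(n * (J r x - J r (x - 1)))) (Icc 0 T) r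

/-- The squared error of the discrete continuity equation. -/
def fluxError (n : ℕ) [NeZero n] (F : ℝ → ℝ) (a J : ℝ → ZMod n → ℝ) (r : ℝ) : ℝ :=
  ∑ x, (J r x - n * meanCurrent n F (a r) x) ^ 2

lemma ReferenceProfile.continuousOn {T ε κ Λ : ℝ} {a J : ℝ → ZMod n → ℝ}
    (h : ReferenceProfile n T ε κ Λ a J) (x : ZMod n) : ContinuousOn (fun r => a r x) (Icc 0 T) :=
  fun r hr => (h.hasDeriv r hr x).continuousWithinAt

lemma ReferenceProfile.continuousOn_fluxError {T ε κ Λ : ℝ} {a J : ℝ → ZMod n → ℝ}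
    (h : ReferenceProfile n T ε κ Λ a J) (F : ℝ → ℝ) :
    ContinuousOn (fluxError n F a J) (Icc 0 T) := by
  unfold fluxError meanCurrent
  have h1 := h.continuousOn
  have h2 := h.flux_cont
  refine continuousOn_finsetSum _ fun x _ => ContinuousOn.pow ?_ 2
  have h3 := h1 x
  have h4 := h1 (x + 1)
  have h5 := h2 x
  fun_prop

/-- The normalization of `flu` is chosen for this: it is the derivative of the logarithm of a
one-site weight in its parameter. -/
lemma hasDerivWithinAt_log_bweight {ε : ℝ} (hε : 0 < ε) {a : ℝ → ZMod n → ℝ} {a' : ZMod n → ℝ}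
    {s : Set ℝ} {r : ℝ} (hr : r ∈ s) (hell : ∀ r ∈ s, Elliptic ε (a r))
    (ha : ∀ x, HasDerivWithinAt (fun r => a r x) (a' x) s r) (η : Config n) :
    HasDerivWithinAt (fun r => Real.log (bweight (a r) η)) (∑ x, a' x * flu (a r) x η) s r := by
  have e : ∀ r' ∈ s, Real.log (bweight (a r') η) =
      ∑ x, Real.log (if η x then a r' x else 1 - a r' x) := by
    intro r' hr'
    unfold bweight
    rw [Real.log_prod]
    intro x _
    split_ifs
    · exact ((hell r' hr').pos hε x).ne'
    · exact ((hell r' hr').one_sub_pos hε x).ne'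
  refine HasDerivWithinAt.congr ?_ e (e r hr)
  refine HasDerivWithinAt.fun_sum fun x _ => ?_
  unfold flu
  split_ifs
  · simpa [div_eq_mul_inv] using (ha x).log ((hell r hr).pos hε x).ne'
  · have := ((ha x).const_sub 1).log ((hell r hr).one_sub_pos hε x).ne'
    simpa [div_eq_mul_inv] using this

/-- Time derivative of the relative entropy. -/
lemma hasDerivWithinAt_ent {T ε κ Λ : ℝ} (hε : 0 < ε) {a J : ℝ → ZMod n → ℝ}
    (h : ReferenceProfile n T ε κ Λ a J) (F : ℝ → ℝ) {p : Config n → ℝ}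
    (hpos : ∀ r ∈ Icc 0 T, ∀ η, 0 < lawAt n F p r η) {r : ℝ} (hr : r ∈ Icc 0 T) :
    HasDerivWithinAt (fun r => ent (a r) (lawAt n F p r))
      ((n : ℝ) ^ 2 * ∑ η, lawAt n F p r η * generator n F (fun η =>
        Real.log (lawAt n F p r η) - Real.log (bweight (a r) η)) η -
        ∑ η, lawAt n F p r η * ∑ x, -(n * (J r x - J r (x - 1))) * flu (a r) x η) (Icc 0 T) r := by
  set p' : Config n → ℝ := fun η =>
    (n : ℝ) ^ 2 * (Matrix.vecMul (lawAt n F p r) (generatorMatrix n F)) η with hp'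
  have hd : ∀ η, HasDerivWithinAt (fun r => lawAt n F p r η) (p' η) (Icc 0 T) r :=
    fun η => (hasDerivAt_lawAt F p η r).hasDerivWithinAt
  have h1 : HasDerivWithinAt (fun r => ent (a r) (lawAt n F p r))
      (∑ η, (p' η * (Real.log (lawAt n F p r η) - Real.log (bweight (a r) η)) +
        lawAt n F p r η * (p' η / lawAt n F p r η -
          ∑ x, -(n * (J r x - J r (x - 1))) * flu (a r) x η))) (Icc 0 T) r := by
    unfold ent
    refine HasDerivWithinAt.fun_sum fun η _ => ?_
    exact (hd η).mul (((hd η).log (hpos r hr η).ne').sub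
      (hasDerivWithinAt_log_bweight hε hr h.elliptic (h.hasDeriv r hr) η))
  convert h1 using 1
  have e1 : ∀ η, lawAt n F p r η * (p' η / lawAt n F p r η -
      ∑ x, -(n * (J r x - J r (x - 1))) * flu (a r) x η) = p' η -
      lawAt n F p r η * ∑ x, -(n * (J r x - J r (x - 1))) * flu (a r) x η := by
    intro η
    rw [mul_sub, mul_div_cancel₀ _ (hpos r hr η).ne']
  -- The extra term from differentiating p log p disappears by conservation of mass.
  have e2 : ∑ η, p' η = 0 := by
    have := vecMul_generatorMatrix_sum F (lawAt n F p r) (fun _ => 1)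
    simp only [mul_one] at this
    rw [hp', ← Finset.mul_sum, this]
    simp [generator]
  rw [Finset.sum_add_distrib, Finset.sum_congr rfl fun η _ => e1 η, Finset.sum_sub_distrib, e2,
    zero_sub, ← vecMul_generatorMatrix_sum, Finset.mul_sum, sub_eq_add_neg]
  congr 1
  exact Finset.sum_congr rfl fun η _ => by simp only [hp']; ring

/-- The function exp (-Cr)(H r + 1) minus the primitive of S is antitone. Only the integral of S
enters the result, which matters because the flux error is controlled after integration in time and
not pointwise. -/
lemma gronwall_of_deriv_le {T C S₀ : ℝ} (hT : 0 ≤ T) (hC : 0 ≤ C) {H H' S : ℝ → ℝ}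
    (hH : ∀ r ∈ Icc 0 T, HasDerivWithinAt H (H' r) (Icc 0 T) r)
    (hS : ContinuousOn S (Icc 0 T)) (hS0 : ∀ r ∈ Icc 0 T, 0 ≤ S r)
    (hint : ∫ r in (0 : ℝ)..T, S r ≤ S₀)
    (hle : ∀ r ∈ Icc 0 T, H' r ≤ C * (H r + 1) + S r) (hH0 : 0 ≤ H 0 + 1) {r : ℝ}
    (hr : r ∈ Icc 0 T) : H r + 1 ≤ Real.exp (C * T) * (H 0 + 1 + S₀) := by
  set I : ℝ → ℝ := fun r => ∫ s in (0 : ℝ)..r, S s with hI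
  have hInt : IntervalIntegrable S volume 0 T := by
    apply ContinuousOn.intervalIntegrable; rwa [uIcc_of_le hT]
  have hIcont : ContinuousOn I (Icc 0 T) := by
    have := intervalIntegral.continuousOn_primitive_interval' hInt (left_mem_uIcc)
    rwa [uIcc_of_le hT] at this
  have hIder : ∀ r ∈ Ioo 0 T, HasDerivAt I (S r) r := by
    intro r hr
    refine intervalIntegral.integral_hasDerivAt_right
      (hInt.mono_set (by
        rw [uIcc_of_le hr.1.le, uIcc_of_le hT]; exact Icc_subset_Icc le_rfl hr.2.le))
      ?_ (hS.continuousAt (Icc_mem_nhds hr.1 hr.2))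
    exact hS.stronglyMeasurableAtFilter_nhdsWithin measurableSet_Icc r |>.filter_mono
      (by rw [nhdsWithin_eq_nhds.2 (Icc_mem_nhds hr.1 hr.2)])
  have hanti : AntitoneOn (fun r => Real.exp (-(C * r)) * (H r + 1) - I r) (Icc 0 T) := by
    have hexp : ∀ r, HasDerivAt (fun r => Real.exp (-(C * r))) (Real.exp (-(C * r)) * -C) r := by
      intro r
      have := ((hasDerivAt_id r).const_mul C).neg.exp
      simpa using this
    have hder : ∀ r ∈ Ioo 0 T, HasDerivAt (fun r => Real.exp (-(C * r)) * (H r + 1) - I r)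
        (Real.exp (-(C * r)) * -C * (H r + 1) + Real.exp (-(C * r)) * H' r - S r) r := by
      intro r hr
      have h1 := (hH r (Ioo_subset_Icc_self hr)).hasDerivAt (Icc_mem_nhds hr.1 hr.2)
      exact ((hexp r).mul (h1.add_const 1)).sub (hIder r hr)
    refine antitoneOn_of_deriv_nonpos (convex_Icc 0 T) ?_ ?_ ?_
    · refine ContinuousOn.sub (ContinuousOn.mul (by fun_prop) (ContinuousOn.add
        (fun r hr => (hH r hr).continuousWithinAt) continuousOn_const)) hIcont
    · rw [interior_Icc]
      exact fun r hr => (hder r hr).differentiableAt.differentiableWithinAt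
    · rw [interior_Icc]
      intro r hr
      rw [(hder r hr).deriv]
      have hr' := Ioo_subset_Icc_self hr
      have h1 : Real.exp (-(C * r)) ≤ 1 := Real.exp_le_one_iff.2 (by nlinarith [hr.1])
      have h2 := mul_le_mul_of_nonneg_left (hle r hr') (Real.exp_pos (-(C * r))).le
      have h3 := mul_le_mul_of_nonneg_right h1 (hS0 r hr')
      nlinarith
  have hle0 := hanti (left_mem_Icc.2 hT) hr hr.1
  simp only [mul_zero, neg_zero, Real.exp_zero, one_mul] at hle0
  have hI0 : I 0 = 0 := by simp [hI]
  have hIr : I r ≤ S₀ := by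
    refine le_trans ?_ hint
    have h1 := intervalIntegral.integral_mono_interval (μ := volume) (f := S) le_rfl hr.1 hr.2
      ?_ hInt
    · exact h1
    · filter_upwards [ae_restrict_mem measurableSet_Ioc] with s hs
      exact hS0 s (Ioc_subset_Icc_self hs)
  have hI0r : 0 ≤ I r := intervalIntegral.integral_nonneg hr.1 fun s hs =>
    hS0 s ⟨hs.1, hs.2.trans hr.2⟩
  have h3 : Real.exp (-(C * r)) * (H r + 1) ≤ H 0 + 1 + S₀ := by linarith
  have h4 : H r + 1 ≤ Real.exp (C * r) * (H 0 + 1 + S₀) := by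
    have := mul_le_mul_of_nonneg_left h3 (Real.exp_pos (C * r)).le
    rwa [← mul_assoc, ← Real.exp_add, add_neg_cancel, Real.exp_zero, one_mul] at this
  refine h4.trans (mul_le_mul_of_nonneg_right (Real.exp_le_exp.2 ?_) (by linarith))
  exact mul_le_mul_of_nonneg_left hr.2 hC

lemma replacementConst_nonneg {ε Λ κ δ : ℝ} (hε : 0 < ε) (hΛ : 0 ≤ Λ) (hκ : 0 ≤ κ) (hδ : 0 < δ) :
    0 ≤ replacementConst ε Λ κ δ := by
  unfold replacementConst; positivity

/-- The bound of the relative entropy along the evolution. -/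
def entropyBound (T ε κ Λ K S₀ : ℝ) : ℝ :=
  Real.exp (replacementConst ε (Λ * κ) κ (1 / 4) * T) * (K + 1 + 2 * ε⁻¹ ^ 6 * S₀)

/-- Gronwall's inequality applied to `entropy_production_le`. Strict positivity of the initial
weights persists and keeps the logarithms differentiable. -/
lemma ent_lawAt_le_of_pos {T ε κ Λ S₀ : ℝ} (hT : 0 ≤ T) (hε : 0 < ε) (hκ : 0 ≤ κ) (hΛ : 0 ≤ Λ)
    (hn : 3 ≤ n) {a J : ℝ → ZMod n → ℝ} (h : ReferenceProfile n T ε κ Λ a J) {F : ℝ → ℝ}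
    (hR : ∀ x, 1 / 2 ≤ rateRight n F x) (hL : ∀ x, 0 ≤ rateLeft n F x)
    (hS : ∫ r in (0 : ℝ)..T, fluxError n F a J r ≤ S₀)
    {p : Config n → ℝ} (hp : ∀ η, 0 < p η) (hp1 : ∑ η, p η = 1) {r : ℝ} (hr : r ∈ Icc 0 T) :
    ent (a r) (lawAt n F p r) ≤ entropyBound T ε κ Λ (ent (a 0) p) S₀ := by
  have hR0 : ∀ x, 0 ≤ rateRight n F x := fun x => by linarith [hR x]
  have hpos : ∀ r ∈ Icc 0 T, ∀ η, 0 < lawAt n F p r η := fun r hr η =>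
    lawAt_pos hR0 hL hp hr.1 η
  have h0 : (0 : ℝ) ∈ Icc 0 T := left_mem_Icc.2 hT
  have hent0 := ent_nonneg (h.elliptic 0 h0) hε (fun η => (hp η).le) hp1
  have hgr := gronwall_of_deriv_le hT
    (replacementConst_nonneg hε (by positivity : 0 ≤ Λ * κ) hκ (by norm_num : (0 : ℝ) < 1 / 4))
    (H := fun r => ent (a r) (lawAt n F p r)) (S := fun r => 2 * ε⁻¹ ^ 6 * fluxError n F a J r)
    (S₀ := 2 * ε⁻¹ ^ 6 * S₀)
    (fun r hr => hasDerivWithinAt_ent hε h F hpos hr)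
    (continuousOn_const.mul (h.continuousOn_fluxError F))
    (fun r _ => mul_nonneg (by positivity) (Finset.sum_nonneg fun x _ => sq_nonneg _))
    (by rw [intervalIntegral.integral_const_mul]; gcongr)
    (fun r hr => entropy_production_le (h.elliptic r hr) hε hn F hR hL (hpos r hr)
      (by rw [sum_lawAt, hp1]) hΛ hκ (h.grad_le r hr) (h.flux_le r hr) (fun x => rfl))
    (by simp only [lawAt_zero]; linarith) hr
  simp only [lawAt_zero] at hgr
  unfold entropyBound
  linarith

/-- The relative entropy with respect to the reference profile stays bounded. -/
theorem ent_lawAt_le {T ε κ Λ S₀ : ℝ} (hT : 0 ≤ T) (hε : 0 < ε) (hκ : 0 ≤ κ) (hΛ : 0 ≤ Λ)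
    (hn : 3 ≤ n) {a J : ℝ → ZMod n → ℝ} (h : ReferenceProfile n T ε κ Λ a J) {F : ℝ → ℝ}
    (hR : ∀ x, 1 / 2 ≤ rateRight n F x) (hL : ∀ x, 0 ≤ rateLeft n F x)
    (hS : ∫ r in (0 : ℝ)..T, fluxError n F a J r ≤ S₀)
    {p : Config n → ℝ} (hp : ∀ η, 0 ≤ p η) (hp1 : ∑ η, p η = 1) {r : ℝ} (hr : r ∈ Icc 0 T) :
    ent (a r) (lawAt n F p r) ≤ entropyBound T ε κ Λ (ent (a 0) p) S₀ := by
  have h0 : (0 : ℝ) ∈ Icc 0 T := left_mem_Icc.2 hT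
  -- Mixing in a fraction δ of the reference weights makes the initial law positive. Both sides are
  -- continuous in δ, because x log x is continuous at 0, and δ is sent to 0.
  set q : ℝ → Config n → ℝ := fun δ η => (1 - δ) * p η + δ * bweight (a 0) η with hq
  have hcont_ent : ∀ (b : ZMod n → ℝ) (f : ℝ → Config n → ℝ),
      (∀ η, Continuous fun δ => f δ η) → Continuous fun δ => ent b (f δ) := by
    intro b f hf
    unfold ent
    refine continuous_finsetSum _ fun η _ => ?_
    simp only [mul_sub]
    exact (Real.continuous_mul_log.comp (hf η)).sub ((hf η).mul continuous_const)
  have hqc : ∀ η, Continuous fun δ => q δ η := fun η => by simp only [hq]; fun_prop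
  have hlc : ∀ η, Continuous fun δ => lawAt n F (q δ) r η := fun η => by
    simp only [lawAt, Matrix.vecMul, dotProduct]
    exact continuous_finsetSum _ fun ξ _ => (hqc ξ).mul continuous_const
  have hq0 : q 0 = p := by ext η; simp [hq]
  have hl1 := (hcont_ent (a r) (fun δ => lawAt n F (q δ) r) hlc).tendsto 0
  have hl2 : Tendsto (fun δ => entropyBound T ε κ Λ (ent (a 0) (q δ)) S₀) (𝓝 0)
      (𝓝 (entropyBound T ε κ Λ (ent (a 0) (q 0)) S₀)) := by
    unfold entropyBound
    have := (hcont_ent (a 0) q hqc)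
    exact Continuous.tendsto (by fun_prop) 0
  rw [hq0] at hl2
  simp only [hq0] at hl1
  have : (𝓝[Ioo 0 1] (0 : ℝ)).NeBot := by
    rw [nhdsWithin_Ioo_eq_nhdsGT one_pos]; infer_instance
  refine le_of_tendsto_of_tendsto (hl1.mono_left nhdsWithin_le_nhds)
    (hl2.mono_left nhdsWithin_le_nhds) (b := 𝓝[Ioo 0 1] (0 : ℝ)) ?_
  · filter_upwards [self_mem_nhdsWithin] with δ hδ
    refine ent_lawAt_le_of_pos hT hε hκ hΛ hn h hR hL hS (fun η => ?_) ?_ hr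
    · have := bweight_pos (h.elliptic 0 h0) hε η
      have h1 : 0 ≤ (1 - δ) * p η := mul_nonneg (by linarith [hδ.2]) (hp η)
      have h2 := mul_pos hδ.1 this
      simp only [hq]; linarith
    · simp only [hq, Finset.sum_add_distrib, ← Finset.mul_sum, hp1, sum_bweight]; ring

end Evolution

/-! ### Regularity of the hydrodynamic solution -/

section Regularity

lemma uniqueDiffOn_strip {T : ℝ} (hT : 0 < T) :
    UniqueDiffOn ℝ (Icc 0 T ×ˢ (univ : Set ℝ)) :=
  (uniqueDiffOn_Icc hT).prod uniqueDiffOn_univ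

/-- The partial derivative in the direction `e` on the strip `[0,T] × ℝ`. -/
def partialOn (T : ℝ) (g : ℝ × ℝ → ℝ) (e p : ℝ × ℝ) : ℝ :=
  fderivWithin ℝ g (Icc 0 T ×ˢ univ) p e

lemma contDiffOn_partialOn {T : ℝ} (hT : 0 < T) {g : ℝ × ℝ → ℝ}
    (hg : ContDiffOn ℝ ∞ g (Icc 0 T ×ˢ univ)) (e : ℝ × ℝ) :
    ContDiffOn ℝ ∞ (partialOn T g e) (Icc 0 T ×ˢ univ) :=
  (hg.fderivWithin (uniqueDiffOn_strip hT) (m := ∞) (by simp)).clm_apply contDiffOn_const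

lemma hasFDerivWithinAt_strip {T : ℝ} {g : ℝ × ℝ → ℝ}
    (hg : ContDiffOn ℝ ∞ g (Icc 0 T ×ˢ univ)) {t : ℝ} (ht : t ∈ Icc 0 T) (u : ℝ) :
    HasFDerivWithinAt g (fderivWithin ℝ g (Icc 0 T ×ˢ univ) (t, u)) (Icc 0 T ×ˢ univ) (t, u) :=
  ((hg.differentiableOn (by simp)) (t, u) ⟨ht, mem_univ _⟩).hasFDerivWithinAt

lemma hasDerivAt_partialOn_space {T : ℝ} {g : ℝ × ℝ → ℝ}
    (hg : ContDiffOn ℝ ∞ g (Icc 0 T ×ˢ univ)) {t : ℝ} (ht : t ∈ Icc 0 T) (u : ℝ) :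
    HasDerivAt (fun u => g (t, u)) (partialOn T g (0, 1) (t, u)) u := by
  have h1 : HasDerivWithinAt (fun u : ℝ => (t, u)) (0, 1) univ u :=
    ((hasDerivAt_const u t).prodMk (hasDerivAt_id u)).hasDerivWithinAt
  have h2 := (hasFDerivWithinAt_strip hg ht u).comp_hasDerivWithinAt u h1
    (fun v _ => ⟨ht, mem_univ _⟩)
  exact hasDerivWithinAt_univ.1 h2

lemma hasDerivWithinAt_partialOn_time {T : ℝ} {g : ℝ × ℝ → ℝ}
    (hg : ContDiffOn ℝ ∞ g (Icc 0 T ×ˢ univ)) {t : ℝ} (ht : t ∈ Icc 0 T) (u : ℝ) :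
    HasDerivWithinAt (fun s => g (s, u)) (partialOn T g (1, 0) (t, u)) (Icc 0 T) t := by
  have h1 : HasDerivWithinAt (fun s : ℝ => (s, u)) (1, 0) (Icc 0 T) t :=
    ((hasDerivAt_id t).prodMk (hasDerivAt_const t u)).hasDerivWithinAt
  exact (hasFDerivWithinAt_strip hg ht u).comp_hasDerivWithinAt t h1
    (fun s hs => mk_mem_prod hs (mem_univ _))

/-- Second derivatives within the closed strip are symmetric because each of its points lies in the
closure of the interior. The energy estimate needs the mixed derivative in both orders. -/
lemma partialOn_comm {T : ℝ} (hT : 0 < T) {g : ℝ × ℝ → ℝ}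
    (hg : ContDiffOn ℝ ∞ g (Icc 0 T ×ˢ univ)) {t : ℝ} (ht : t ∈ Icc 0 T) (u : ℝ) (e e' : ℝ × ℝ) :
    partialOn T (partialOn T g e) e' (t, u) = partialOn T (partialOn T g e') e (t, u) := by
  set S : Set (ℝ × ℝ) := Icc 0 T ×ˢ univ with hS
  have hmem : (t, u) ∈ S := ⟨ht, mem_univ _⟩
  have hcl : (t, u) ∈ closure (interior S) := by
    rw [hS, interior_prod_eq, interior_univ, interior_Icc, closure_prod_eq, closure_Ioo hT.ne,
      closure_univ]
    exact hmem
  have hsymm := (hg (t, u) hmem).isSymmSndFDerivWithinAt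
    (by rw [minSmoothness_of_isRCLikeNormedField]; exact ENat.LEInfty.out)
    (uniqueDiffOn_strip hT) hcl hmem
  have hd : DifferentiableWithinAt ℝ (fderivWithin ℝ g S) S (t, u) :=
    (hg.fderivWithin (uniqueDiffOn_strip hT) (m := ∞) (by simp)).differentiableOn (by simp)
      (t, u) hmem
  have key : ∀ e e' : ℝ × ℝ, partialOn T (partialOn T g e) e' (t, u) =
      fderivWithin ℝ (fderivWithin ℝ g S) S (t, u) e' e := by
    intro e e'
    have h1 : HasFDerivWithinAt (fun p => fderivWithin ℝ g S p e)
        ((fderivWithin ℝ (fderivWithin ℝ g S) S (t, u)).flip e) S (t, u) := by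
      have := hd.hasFDerivWithinAt.clm_apply (hasFDerivWithinAt_const e (t, u) S)
      simpa using this
    have h2 := h1.fderivWithin (uniqueDiffOn_strip hT (t, u) hmem)
    change fderivWithin ℝ (fun p => fderivWithin ℝ g S p e) S (t, u) e' = _
    rw [h2]; rfl
  rw [key, key]
  exact hsymm e' e

/-- A classical solution of the hydrodynamic equation together with its derivatives, all extended
continuously to all times. -/
structure ClassicalSolution (F : ℝ → ℝ) (T : ℝ) (ρ ρu ρuu ρt ρtu : ℝ → ℝ → ℝ) : Prop where
  cont : Continuous fun p : ℝ × ℝ => ρ p.1 p.2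
  cont_u : Continuous fun p : ℝ × ℝ => ρu p.1 p.2
  cont_uu : Continuous fun p : ℝ × ℝ => ρuu p.1 p.2
  cont_t : Continuous fun p : ℝ × ℝ => ρt p.1 p.2
  cont_tu : Continuous fun p : ℝ × ℝ => ρtu p.1 p.2
  periodic : ∀ t ∈ Icc 0 T, Function.Periodic (ρ t) 1
  deriv_u : ∀ t ∈ Icc 0 T, ∀ u, HasDerivAt (ρ t) (ρu t u) u
  deriv_uu : ∀ t ∈ Icc 0 T, ∀ u, HasDerivAt (ρu t) (ρuu t u) u
  deriv_t : ∀ t ∈ Icc 0 T, ∀ u, HasDerivWithinAt (fun s => ρ s u) (ρt t u) (Icc 0 T) t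
  deriv_tu : ∀ t ∈ Icc 0 T, ∀ u, HasDerivAt (ρt t) (ρtu t u) u
  deriv_ut : ∀ t ∈ Icc 0 T, ∀ u, HasDerivWithinAt (fun s => ρu s u) (ρtu t u) (Icc 0 T) t
  equation : ∀ t ∈ Icc 0 T, ∀ u, ρt t u =
    ρuu t u - 2 * ((1 - 2 * ρ t u) * ρu t u * F u + ρ t u * (1 - ρ t u) * deriv F u)

/-- Truncation of the time to `[0,T]`. -/
def clampTime (T t : ℝ) : ℝ := max 0 (min t T)

lemma clampTime_mem {T : ℝ} (hT : 0 ≤ T) (t : ℝ) : clampTime T t ∈ Icc 0 T :=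
  ⟨le_max_left _ _, max_le hT (min_le_right _ _)⟩

lemma clampTime_of_mem {T t : ℝ} (ht : t ∈ Icc 0 T) : clampTime T t = t := by
  rw [clampTime, min_eq_left ht.2, max_eq_right ht.1]

lemma continuous_clampTime (T : ℝ) : Continuous (clampTime T) := by
  unfold clampTime; fun_prop

lemma continuous_clamp {T : ℝ} (hT : 0 ≤ T) {g : ℝ × ℝ → ℝ}
    (hg : ContinuousOn g (Icc 0 T ×ˢ univ)) :
    Continuous fun p : ℝ × ℝ => g (clampTime T p.1, p.2) :=
  hg.comp_continuous (by have := continuous_clampTime T; fun_prop)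
    fun p => ⟨clampTime_mem hT _, mem_univ _⟩

/-- Smoothness is available on [0,T] only. Evaluation at the clamped time extends the solution and
its derivatives continuously to all times, so that later integrands are globally continuous; the
equation itself is kept on [0,T]. -/
theorem IsHydrodynamicSolution.exists_classical {F : ℝ → ℝ} (hF : ContDiff ℝ ∞ F) {T : ℝ}
    (hT : 0 < T) {ρ : ℝ → ℝ → ℝ} (h : IsHydrodynamicSolution F T ρ) :
    ∃ ρc ρu ρuu ρt ρtu, ClassicalSolution F T ρc ρu ρuu ρt ρtu ∧ ∀ t ∈ Icc 0 T, ρc t = ρ t := by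
  set g : ℝ × ℝ → ℝ := fun p => ρ p.1 p.2 with hg
  have hg0 : ContDiffOn ℝ ∞ g (Icc 0 T ×ˢ univ) := h.smooth
  have hgu := contDiffOn_partialOn hT hg0 (0, 1)
  have hguu := contDiffOn_partialOn hT hgu (0, 1)
  have hgt := contDiffOn_partialOn hT hg0 (1, 0)
  have hgtu := contDiffOn_partialOn hT hgt (0, 1)
  have hcl : ∀ {t}, t ∈ Icc 0 T → clampTime T t = t := fun ht => clampTime_of_mem ht
  refine ⟨fun t u => g (clampTime T t, u), fun t u => partialOn T g (0, 1) (clampTime T t, u),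
    fun t u => partialOn T (partialOn T g (0, 1)) (0, 1) (clampTime T t, u),
    fun t u => partialOn T g (1, 0) (clampTime T t, u),
    fun t u => partialOn T (partialOn T g (1, 0)) (0, 1) (clampTime T t, u),
    ⟨continuous_clamp hT.le hg0.continuousOn, continuous_clamp hT.le hgu.continuousOn,
      continuous_clamp hT.le hguu.continuousOn, continuous_clamp hT.le hgt.continuousOn,
      continuous_clamp hT.le hgtu.continuousOn, ?_, ?_, ?_, ?_, ?_, ?_, ?_⟩, ?_⟩
  · intro t ht; simp only [hcl ht, hg]; exact h.periodic t ht
  · intro t ht u; simp only [hcl ht]; exact hasDerivAt_partialOn_space hg0 ht u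
  · intro t ht u; simp only [hcl ht]; exact hasDerivAt_partialOn_space hgu ht u
  · intro t ht u
    rw [hcl ht]
    exact (hasDerivWithinAt_partialOn_time hg0 ht u).congr (fun s hs => by rw [hcl hs])
      (by rw [hcl ht])
  · intro t ht u; simp only [hcl ht]; exact hasDerivAt_partialOn_space hgt ht u
  · intro t ht u
    rw [hcl ht, partialOn_comm hT hg0 ht]
    exact (hasDerivWithinAt_partialOn_time hgu ht u).congr (fun s hs => by rw [hcl hs])
      (by rw [hcl ht])
  · intro t ht u
    simp only [hcl ht]
    have e1 := (hasDerivWithinAt_partialOn_time hg0 ht u).derivWithin (uniqueDiffOn_Icc hT t ht)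
    have e2 := h.equation t ht u
    have d1 : ∀ u, HasDerivAt (ρ t) (partialOn T g (0, 1) (t, u)) u := fun u =>
      hasDerivAt_partialOn_space hg0 ht u
    have d2 := hasDerivAt_partialOn_space hgu ht u
    have d3 : iteratedDeriv 2 (ρ t) u = partialOn T (partialOn T g (0, 1)) (0, 1) (t, u) := by
      rw [iteratedDeriv_succ, iteratedDeriv_one, funext fun u => (d1 u).deriv]
      exact d2.deriv
    have dF : HasDerivAt F (deriv F u) u := (hF.differentiable (by simp) u).hasDerivAt
    have d4 := (((d1 u).mul ((d1 u).const_sub 1)).mul dF).deriv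
    have d5 : deriv (fun v => ρ t v * (1 - ρ t v) * F v) u =
        (1 - 2 * ρ t u) * partialOn T g (0, 1) (t, u) * F u +
          ρ t u * (1 - ρ t u) * deriv F u := by
      refine Eq.trans d4 ?_
      simp only [Pi.mul_apply]
      ring
    rw [d3, d5] at e2
    rw [← e1, e2]
  · intro t ht; simp only [hcl ht, hg]

end Regularity

/-! ### A priori bounds for the hydrodynamic solution -/

section APriori

lemma intervalIntegral_swap {g : ℝ → ℝ → ℝ} (hg : Continuous (Function.uncurry g)) {a b c d : ℝ}
    (hab : a ≤ b) (hcd : c ≤ d) :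
    ∫ x in a..b, ∫ y in c..d, g x y = ∫ y in c..d, ∫ x in a..b, g x y := by
  simp only [intervalIntegral.integral_of_le hab, intervalIntegral.integral_of_le hcd]
  refine integral_integral_swap ?_
  rw [Measure.prod_restrict]
  exact (hg.continuousOn.integrableOn_compact (isCompact_Icc.prod isCompact_Icc)).mono_set
    (prod_mono Ioc_subset_Icc_self Ioc_subset_Icc_self)

lemma hasDerivWithinAt_integral_Icc {T : ℝ} {g : ℝ → ℝ} (hg : ContinuousOn g (Icc 0 T)) {r : ℝ}
    (hr : r ∈ Icc 0 T) :
    HasDerivWithinAt (fun r => ∫ s in (0 : ℝ)..r, g s) (g r) (Icc 0 T) r := by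
  have hT : 0 ≤ T := hr.1.trans hr.2
  have hc : Continuous fun s => g (clampTime T s) :=
    hg.comp_continuous (continuous_clampTime T) (clampTime_mem hT)
  have h1 := (hc.integral_hasStrictDerivAt 0 r).hasDerivAt.hasDerivWithinAt (s := Icc 0 T)
  have e : ∀ r ∈ Icc 0 T, ∫ s in (0 : ℝ)..r, g s = ∫ s in (0 : ℝ)..r, g (clampTime T s) := by
    intro r hr
    refine intervalIntegral.integral_congr fun s hs => ?_
    rw [uIcc_of_le hr.1] at hs
    simp only [clampTime_of_mem (⟨hs.1, hs.2.trans hr.2⟩ : s ∈ Icc 0 T)]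
  rw [clampTime_of_mem hr] at h1
  exact h1.congr e (e r hr)

lemma sub_eq_integral_of_hasDerivWithinAt {T : ℝ} {f f' : ℝ → ℝ}
    (hf : ∀ t ∈ Icc 0 T, HasDerivWithinAt f (f' t) (Icc 0 T) t) (hf' : ContinuousOn f' (Icc 0 T))
    {r : ℝ} (hr : r ∈ Icc 0 T) : ∫ s in (0 : ℝ)..r, f' s = f r - f 0 := by
  have hsub : Icc 0 r ⊆ Icc 0 T := Icc_subset_Icc le_rfl hr.2
  refine intervalIntegral.integral_eq_sub_of_hasDerivAt_of_le hr.1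
    (fun t ht => ((hf t (hsub ht)).continuousWithinAt).mono hsub) (fun t ht => ?_) ?_
  · exact (hf t (hsub (Ioo_subset_Icc_self ht))).hasDerivAt
      (Icc_mem_nhds ht.1 (ht.2.trans_le hr.2))
  · apply ContinuousOn.intervalIntegrable; rw [uIcc_of_le hr.1]; exact hf'.mono hsub

/-- A negative second derivative would make the minimum a local maximum too. The function would then
be locally constant and its second derivative zero. -/
lemma second_deriv_nonneg_of_isMin {f f' : ℝ → ℝ} {f'' u : ℝ} (hf : ∀ v, HasDerivAt f (f' v) v)
    (hf' : HasDerivAt f' f'' u) (hmin : ∀ v, f u ≤ f v) : 0 ≤ f'' := by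
  by_contra hneg
  push Not at hneg
  have hloc : IsLocalMin f u := Eventually.of_forall hmin
  have h0 : f' u = 0 := hloc.hasDerivAt_eq_zero (hf u)
  have hd : deriv f = f' := funext fun v => (hf v).deriv
  have hmax := isLocalMax_of_deriv_deriv_neg (f := f) (x₀ := u)
    (by rw [hd, hf'.deriv]; exact hneg) (by rw [hd, h0]) (hf u).continuousAt
  have hconst : f =ᶠ[𝓝 u] fun _ => f u := by
    filter_upwards [hmax] with v hv using le_antisymm hv (hmin v)
  have h1 : f' =ᶠ[𝓝 u] fun _ => 0 := by
    have := hconst.deriv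
    rw [hd] at this
    simpa using this
  have h2 := h1.deriv_eq
  rw [hf'.deriv] at h2
  simp at h2
  linarith

variable {F : ℝ → ℝ} {T : ℝ} {ρ ρu ρuu ρt ρtu : ℝ → ℝ → ℝ}

/-- Particle–hole symmetry: holes solve the same equation with drift -F. Upper bounds thus follow
from lower bounds. -/
lemma ClassicalSolution.one_sub (h : ClassicalSolution F T ρ ρu ρuu ρt ρtu) :
    ClassicalSolution (fun u => -F u) T (fun t u => 1 - ρ t u) (fun t u => -ρu t u)
      (fun t u => -ρuu t u) (fun t u => -ρt t u) (fun t u => -ρtu t u) where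
  cont := continuous_const.sub h.cont
  cont_u := h.cont_u.neg
  cont_uu := h.cont_uu.neg
  cont_t := h.cont_t.neg
  cont_tu := h.cont_tu.neg
  periodic t ht u := by simp only [h.periodic t ht u]
  deriv_u t ht u := (h.deriv_u t ht u).const_sub 1
  deriv_uu t ht u := (h.deriv_uu t ht u).neg
  deriv_t t ht u := (h.deriv_t t ht u).const_sub 1
  deriv_tu t ht u := (h.deriv_tu t ht u).neg
  deriv_ut t ht u := (h.deriv_ut t ht u).neg
  equation t ht u := by
    rw [h.equation t ht u]
    have : deriv (fun u => -F u) u = -deriv F u := deriv.fun_neg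
    rw [this]; ring

/-- Comparison principle: a lower bound of the solution. -/
lemma ClassicalSolution.lower_bound (h : ClassicalSolution F T ρ ρu ρuu ρt ρtu) {C : ℝ}
    (hF : ∀ u, |deriv F u| ≤ C) {ε : ℝ} (hε : ε ∈ Ioo (0 : ℝ) 1) (h0 : ∀ u, ε < ρ 0 u)
    {t : ℝ} (ht : t ∈ Icc 0 T) (u : ℝ) : ε * Real.exp (-((2 * C + 1) * t)) < ρ t u := by
  have hC : 0 ≤ C := (abs_nonneg _).trans (hF 0)
  -- The barrier is ε exp (-ct). Where the solution first touches it, the first derivative vanishes,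
  -- the second is nonnegative and the drift is at least -2C times the barrier, so the rate 2C + 1
  -- contradicts contact.
  set c := 2 * C + 1 with hc
  set m : ℝ → ℝ := fun t => ε * Real.exp (-(c * t)) with hm
  have hmc : Continuous m := by simp only [hm]; fun_prop
  by_contra hcon
  push Not at hcon
  -- By periodicity it suffices to look for contact points over one period. They form a compact set,
  -- which has a point of smallest time.
  set Z : Set (ℝ × ℝ) := (Icc 0 T ×ˢ Icc 0 1) ∩ {p | ρ p.1 p.2 ≤ m p.1} with hZ
  have hZc : IsCompact Z := (isCompact_Icc.prod isCompact_Icc).inter_right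
    (isClosed_le h.cont (hmc.comp continuous_fst))
  have hfract : ∀ s ∈ Icc 0 T, ∀ v, ρ s (Int.fract v) = ρ s v := by
    intro s hs v
    have := (h.periodic s hs).sub_zsmul_eq ⌊v⌋ (x := v)
    rw [← this]; congr 1; rw [zsmul_one]; rfl
  have hmem : ∀ s ∈ Icc 0 T, ∀ v, ρ s v ≤ m s → (s, Int.fract v) ∈ Z := fun s hs v hv =>
    ⟨⟨hs, ⟨Int.fract_nonneg v, (Int.fract_lt_one v).le⟩⟩, by
      simp only [mem_ofPred_eq]; rw [hfract s hs]; exact hv⟩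
  obtain ⟨⟨τ, u₀⟩, hτ, hmin⟩ := hZc.exists_isMinOn ⟨_, hmem t ht u hcon⟩ continuous_fst.continuousOn
  have hτT : τ ∈ Icc 0 T := hτ.1.1
  have hbefore : ∀ s, 0 ≤ s → s < τ → ∀ v, m s < ρ s v := by
    intro s hs hsτ v
    by_contra hv
    push Not at hv
    have := hmin (hmem s ⟨hs, hsτ.le.trans hτT.2⟩ v hv)
    simp only [mem_ofPred_eq] at this
    linarith
  have hτ0 : 0 < τ := by
    rcases hτT.1.eq_or_lt with h1 | h1
    · have h2 : ρ τ u₀ ≤ m τ := hτ.2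
      rw [← h1] at h2
      have h3 : m 0 = ε := by simp [hm]
      linarith [h0 u₀]
    · exact h1
  have hge : ∀ v, m τ ≤ ρ τ v := by
    intro v
    have hc1 : Tendsto (fun s => ρ s v) (𝓝[<] τ) (𝓝 (ρ τ v)) :=
      ((h.cont.comp (Continuous.prodMk_left v)).tendsto τ).mono_left nhdsWithin_le_nhds
    have hc2 : Tendsto m (𝓝[<] τ) (𝓝 (m τ)) := (hmc.tendsto τ).mono_left nhdsWithin_le_nhds
    refine le_of_tendsto_of_tendsto hc2 hc1 ?_
    filter_upwards [Ioo_mem_nhdsLT hτ0] with s hs using (hbefore s hs.1.le hs.2 v).le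
  have heq : ρ τ u₀ = m τ := le_antisymm hτ.2 (hge u₀)
  have hminu : ∀ v, ρ τ u₀ ≤ ρ τ v := fun v => heq ▸ hge v
  have hloc : IsLocalMin (ρ τ) u₀ := Eventually.of_forall hminu
  have hu0 : ρu τ u₀ = 0 := hloc.hasDerivAt_eq_zero (h.deriv_u τ hτT u₀)
  have huu0 : 0 ≤ ρuu τ u₀ :=
    second_deriv_nonneg_of_isMin (h.deriv_u τ hτT) (h.deriv_uu τ hτT u₀) hminu
  have hmd : HasDerivAt m (-(c * m τ)) τ := by
    have := (((hasDerivAt_id τ).const_mul c).neg.exp).const_mul ε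
    refine this.congr_deriv ?_
    simp only [hm, id, Pi.neg_apply]; ring
  have hfd : HasDerivWithinAt (fun s => ρ s u₀ - m s) (ρt τ u₀ - -(c * m τ)) (Icc 0 τ) τ :=
    ((h.deriv_t τ hτT u₀).mono (Icc_subset_Icc le_rfl hτT.2)).sub hmd.hasDerivWithinAt
  have hnonpos : ρt τ u₀ - -(c * m τ) ≤ 0 := by
    have htend := hasDerivWithinAt_iff_tendsto_slope.1 hfd
    have hset : Icc 0 τ \ {τ} = Ico 0 τ := by
      ext s; simp only [Set.mem_sdiff, mem_Icc, mem_singleton_iff, mem_Ico]; grind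
    rw [hset] at htend
    have : (𝓝[Ico 0 τ] τ).NeBot := by
      rw [nhdsWithin_Ico_eq_nhdsLT hτ0]; infer_instance
    refine le_of_tendsto htend ?_
    filter_upwards [self_mem_nhdsWithin] with s hs
    rw [slope_def_field]
    refine div_nonpos_of_nonneg_of_nonpos ?_ (by linarith [hs.2])
    have := hbefore s hs.1 hs.2 u₀
    linarith
  have hmpos : 0 < m τ := mul_pos hε.1 (Real.exp_pos _)
  have hm1 : m τ < 1 := by
    have : Real.exp (-(c * τ)) ≤ 1 := Real.exp_le_one_iff.2 (by nlinarith)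
    simp only [hm]; nlinarith [hε.1, hε.2]
  rw [h.equation τ hτT u₀, hu0, heq] at hnonpos
  have hFb := abs_le.1 (hF u₀)
  have : m τ * (1 - m τ) * deriv F u₀ ≤ m τ * C := by
    have h1 : m τ * (1 - m τ) * deriv F u₀ ≤ m τ * (1 - m τ) * C :=
      mul_le_mul_of_nonneg_left hFb.2 (mul_nonneg hmpos.le (by linarith))
    nlinarith [mul_nonneg hmpos.le hC]
  nlinarith

/-- The ellipticity constant of the solution on `[0,T]`. -/
def ellipticity (C T ε : ℝ) : ℝ := ε * Real.exp (-((2 * C + 1) * T))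

lemma ClassicalSolution.mem_Icc (h : ClassicalSolution F T ρ ρu ρuu ρt ρtu) {C : ℝ}
    (hF : ∀ u, |deriv F u| ≤ C) {ε : ℝ} (hε : ε ∈ Ioo (0 : ℝ) (1 / 2))
    (h0 : ∀ u, ρ 0 u ∈ Ioo ε (1 - ε)) {t : ℝ} (ht : t ∈ Icc 0 T) (u : ℝ) :
    ellipticity C T ε ≤ ρ t u ∧ ρ t u ≤ 1 - ellipticity C T ε := by
  have hC : 0 ≤ C := (abs_nonneg _).trans (hF 0)
  have hε' : ε ∈ Ioo (0 : ℝ) 1 := ⟨hε.1, hε.2.trans (by norm_num)⟩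
  have h1 := h.lower_bound hF hε' (fun u => (h0 u).1) ht u
  have hF' : ∀ u, |deriv (fun u => -F u) u| ≤ C := fun u => by
    rw [deriv.fun_neg, abs_neg]; exact hF u
  have h2 := h.one_sub.lower_bound hF' hε' (fun u => by linarith [(h0 u).2]) ht u
  have h3 : ellipticity C T ε ≤ ε * Real.exp (-((2 * C + 1) * t)) := by
    unfold ellipticity
    have := ht.2
    have := hε.1
    gcongr
  constructor <;> linarith

/-- The spatial derivative inherits the discrete gradient bound. -/
lemma ClassicalSolution.abs_deriv_le (h : ClassicalSolution F T ρ ρu ρuu ρt ρtu) {κ : ℝ}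
    (hκ : GradientBound T κ ρ) {t : ℝ} (ht : t ∈ Icc 0 T) (u : ℝ) : |ρu t u| ≤ κ := by
  -- The mean value theorem on the grid cell of length 1/(N + 1) that contains u; continuity of the
  -- derivative then lets N tend to infinity.
  have key : ∀ N : ℕ, ∃ ξ, |ξ - u| ≤ 1 / ((N : ℝ) + 1) ∧ |ρu t ξ| ≤ κ := by
    intro N
    have hN : (0 : ℝ) < (N : ℝ) + 1 := by positivity
    set x : ℤ := ⌊u * ((N : ℝ) + 1)⌋ with hx
    have hlt : (x : ℝ) / ((N : ℝ) + 1) < ((x : ℝ) + 1) / ((N : ℝ) + 1) := by gcongr; linarith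
    obtain ⟨ξ, hξ, hslope⟩ := exists_hasDerivAt_eq_slope (ρ t) (ρu t) hlt
      (fun v _ => (h.deriv_u t ht v).continuousAt.continuousWithinAt)
      (fun v _ => h.deriv_u t ht v)
    refine ⟨ξ, ?_, ?_⟩
    · have h1 : (x : ℝ) ≤ u * ((N : ℝ) + 1) := Int.floor_le _
      have h2 : u * ((N : ℝ) + 1) < x + 1 := Int.lt_floor_add_one _
      have h3 : (x : ℝ) / ((N : ℝ) + 1) ≤ u := (div_le_iff₀ hN).2 h1
      have h4 : u < ((x : ℝ) + 1) / ((N : ℝ) + 1) := (lt_div_iff₀ hN).2 h2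
      have h5 : ((x : ℝ) + 1) / ((N : ℝ) + 1) = x / ((N : ℝ) + 1) + 1 / ((N : ℝ) + 1) := by ring
      rw [abs_le]
      constructor <;> linarith [hξ.1, hξ.2]
    · have h1 := hκ t ht (N + 1) (Nat.succ_pos N) x
      push_cast at h1
      have h2 : ((x : ℝ) + 1) / ((N : ℝ) + 1) - x / ((N : ℝ) + 1) = ((N : ℝ) + 1)⁻¹ := by
        field_simp; ring
      rw [hslope, h2, div_inv_eq_mul, abs_mul, abs_of_pos hN, mul_comm]
      exact h1
  choose ξ hξ1 hξ2 using key
  have hlim : Tendsto ξ atTop (𝓝 u) := by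
    rw [tendsto_iff_dist_tendsto_zero]
    refine squeeze_zero (fun _ => dist_nonneg) (fun N => ?_) tendsto_one_div_add_atTop_nhds_zero_nat
    rw [Real.dist_eq]; exact hξ1 N
  have hc : Continuous fun v => |ρu t v| := (h.cont_u.comp (Continuous.prodMk_right t)).abs
  exact le_of_tendsto ((hc.tendsto u).comp hlim) (Eventually.of_forall hξ2)

lemma ClassicalSolution.deriv_periodic (h : ClassicalSolution F T ρ ρu ρuu ρt ρtu) {t : ℝ}
    (ht : t ∈ Icc 0 T) : Function.Periodic (ρu t) 1 := by
  intro u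
  have h1 := (h.deriv_u t ht (u + 1)).comp_add_const u 1
  have h2 : (fun v => ρ t (v + 1)) = ρ t := funext (h.periodic t ht)
  rw [h2] at h1
  exact h1.unique (h.deriv_u t ht u)

lemma ClassicalSolution.deriv2_periodic (h : ClassicalSolution F T ρ ρu ρuu ρt ρtu) {t : ℝ}
    (ht : t ∈ Icc 0 T) : Function.Periodic (ρuu t) 1 := by
  intro u
  have h1 := (h.deriv_uu t ht (u + 1)).comp_add_const u 1
  have h2 : (fun v => ρu t (v + 1)) = ρu t := funext (h.deriv_periodic ht)
  rw [h2] at h1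
  exact h1.unique (h.deriv_uu t ht u)

lemma ClassicalSolution.time_periodic (h : ClassicalSolution F T ρ ρu ρuu ρt ρtu) (hT : 0 < T)
    {t : ℝ} (ht : t ∈ Icc 0 T) : Function.Periodic (ρt t) 1 := by
  intro u
  have h1 := (h.deriv_t t ht (u + 1)).congr (fun s hs => (h.periodic s hs u).symm)
    (h.periodic t ht u).symm
  exact (uniqueDiffOn_Icc hT t ht).eq_deriv _ h1 (h.deriv_t t ht u)

/-- Energy estimate for the spatial derivative. -/
lemma ClassicalSolution.energy_le (h : ClassicalSolution F T ρ ρu ρuu ρt ρtu) (hT : 0 < T)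
    {C κ : ℝ} (hF : ∀ u, |F u| ≤ C) (hF' : ∀ u, |deriv F u| ≤ C)
    (hρ : ∀ t ∈ Icc 0 T, ∀ u, 0 ≤ ρ t u ∧ ρ t u ≤ 1) (hκ : ∀ t ∈ Icc 0 T, ∀ u, |ρu t u| ≤ κ) :
    ∫ t in (0 : ℝ)..T, ∫ u in (0 : ℝ)..1, ρuu t u ^ 2 ≤ κ ^ 2 + (2 * C * (κ + 1)) ^ 2 * T := by
  have hC : 0 ≤ C := (abs_nonneg _).trans (hF 0)
  have h0 : (0 : ℝ) ∈ Icc 0 T := left_mem_Icc.2 hT.le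
  have hT' : T ∈ Icc 0 T := right_mem_Icc.2 hT.le
  have cu : ∀ t, Continuous (ρu t) := fun t => h.cont_u.comp (Continuous.prodMk_right t)
  have cuu : ∀ t, Continuous (ρuu t) := fun t => h.cont_uu.comp (Continuous.prodMk_right t)
  have ct : ∀ t, Continuous (ρt t) := fun t => h.cont_t.comp (Continuous.prodMk_right t)
  have ctu : ∀ t, Continuous (ρtu t) := fun t => h.cont_tu.comp (Continuous.prodMk_right t)
  set b₀ := 2 * C * (κ + 1) with hb0
  have gu : Continuous (Function.uncurry ρu) := h.cont_u
  have guu : Continuous (Function.uncurry ρuu) := h.cont_uu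
  have gtu : Continuous (Function.uncurry ρtu) := h.cont_tu
  have g1 : Continuous (Function.uncurry fun t u => 2 * (ρu t u * ρtu t u)) := by
    simp only [Function.uncurry_def] at *; fun_prop
  have g2 : Continuous (Function.uncurry fun t u => ρuu t u ^ 2) := by
    simp only [Function.uncurry_def] at *; fun_prop
  have guu2 : ∀ t, Continuous fun u => ρuu t u ^ 2 := fun t => (cuu t).pow 2
  -- the time derivative of the energy
  have e1 : ∫ u in (0 : ℝ)..1, (ρu T u ^ 2 - ρu 0 u ^ 2) =
      ∫ t in (0 : ℝ)..T, ∫ u in (0 : ℝ)..1, 2 * (ρu t u * ρtu t u) := by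
    rw [intervalIntegral_swap (g := fun t u => 2 * (ρu t u * ρtu t u))
      g1 hT.le zero_le_one]
    refine intervalIntegral.integral_congr fun u _ => ?_
    refine (sub_eq_integral_of_hasDerivWithinAt (f := fun t => ρu t u ^ 2)
      (f' := fun t => 2 * (ρu t u * ρtu t u)) (fun t ht => ?_) ?_ hT').symm
    · have := (h.deriv_ut t ht u).pow 2
      refine this.congr_deriv ?_
      simp; ring
    · exact (continuous_const.mul ((h.cont_u.comp (Continuous.prodMk_left u)).mul
        (h.cont_tu.comp (Continuous.prodMk_left u)))).continuousOn
  -- Integration by parts, with boundary terms cancelling by periodicity, gives -2 ρ_uu ρ_t.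
  -- Inserting ρ_t = ρ_uu - b with |b| ≤ b₀ and 2 ρ_uu b ≤ ρ_uu² + b² leaves b₀² - ρ_uu².
  have e2 : ∀ t ∈ Icc 0 T, ∫ u in (0 : ℝ)..1, 2 * (ρu t u * ρtu t u) ≤
      b₀ ^ 2 - ∫ u in (0 : ℝ)..1, ρuu t u ^ 2 := by
    intro t ht
    have hparts := intervalIntegral.integral_mul_deriv_eq_deriv_mul (a := 0) (b := 1)
      (u := ρu t) (v := ρt t) (u' := ρuu t) (v' := ρtu t)
      (fun u _ => h.deriv_uu t ht u) (fun u _ => h.deriv_tu t ht u)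
      ((cuu t).intervalIntegrable _ _) ((ctu t).intervalIntegrable _ _)
    have p1 : ρu t 1 = ρu t 0 := by simpa using h.deriv_periodic ht 0
    have p2 : ρt t 1 = ρt t 0 := by simpa using h.time_periodic hT ht 0
    rw [p1, p2, sub_self, zero_sub] at hparts
    rw [intervalIntegral.integral_const_mul, hparts, mul_neg, ← intervalIntegral.integral_const_mul,
      ← intervalIntegral.integral_neg]
    have hc : (∫ _u in (0 : ℝ)..1, b₀ ^ 2) = b₀ ^ 2 := by simp
    rw [← hc, ← intervalIntegral.integral_sub (by simp)
      ((guu2 t).intervalIntegrable _ _)]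
    refine intervalIntegral.integral_mono_on zero_le_one
      ((continuous_const.mul ((cuu t).mul (ct t))).neg.intervalIntegrable _ _)
      ((continuous_const.sub ((cuu t).pow 2)).intervalIntegrable _ _) fun u _ => ?_
    rw [h.equation t ht u]
    set b := 2 * ((1 - 2 * ρ t u) * ρu t u * F u + ρ t u * (1 - ρ t u) * deriv F u) with hb
    have hbb : |b| ≤ b₀ := by
      have q1 : |1 - 2 * ρ t u| ≤ 1 := abs_le.2 ⟨by linarith [(hρ t ht u).2],
        by linarith [(hρ t ht u).1]⟩
      have q2 : |ρ t u * (1 - ρ t u)| ≤ 1 := abs_le.2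
        ⟨by nlinarith [(hρ t ht u).1, (hρ t ht u).2], by nlinarith [(hρ t ht u).1, (hρ t ht u).2]⟩
      have q3 := hκ t ht u
      have q4 : 0 ≤ κ := (abs_nonneg (ρu t u)).trans q3
      rw [hb, abs_mul, abs_two, hb0, mul_assoc 2 C]
      refine mul_le_mul_of_nonneg_left ?_ (by norm_num : (0 : ℝ) ≤ 2)
      calc _ ≤ |(1 - 2 * ρ t u) * ρu t u * F u| + |ρ t u * (1 - ρ t u) * deriv F u| :=
            abs_add_le _ _
        _ ≤ 1 * κ * C + 1 * C := by
            rw [abs_mul, abs_mul, abs_mul _ (deriv F u)]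
            refine add_le_add (mul_le_mul (mul_le_mul q1 q3 (abs_nonneg _) zero_le_one) (hF u)
              (abs_nonneg _) (by positivity)) (mul_le_mul q2 (hF' u) (abs_nonneg _) zero_le_one)
        _ = C * (κ + 1) := by ring
    have hb2 : b ^ 2 ≤ b₀ ^ 2 := sq_le_sq' (by linarith [abs_le.1 hbb]) (abs_le.1 hbb).2
    nlinarith [sq_nonneg (ρuu t u - b)]
  have c2 : Continuous fun t => ∫ u in (0 : ℝ)..1, ρuu t u ^ 2 :=
    intervalIntegral.continuous_parametric_intervalIntegral_of_continuous'
      (f := fun t u => ρuu t u ^ 2) g2 0 1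
  have c1 : Continuous fun t => ∫ u in (0 : ℝ)..1, 2 * (ρu t u * ρtu t u) :=
    intervalIntegral.continuous_parametric_intervalIntegral_of_continuous'
      (f := fun t u => 2 * (ρu t u * ρtu t u)) g1 0 1
  have c3 : Continuous fun t => b₀ ^ 2 - ∫ u in (0 : ℝ)..1, ρuu t u ^ 2 := continuous_const.sub c2
  have e3 : ∫ t in (0 : ℝ)..T, ∫ u in (0 : ℝ)..1, 2 * (ρu t u * ρtu t u) ≤
      ∫ t in (0 : ℝ)..T, (b₀ ^ 2 - ∫ u in (0 : ℝ)..1, ρuu t u ^ 2) :=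
    intervalIntegral.integral_mono_on hT.le (c1.intervalIntegrable 0 T)
      (c3.intervalIntegrable 0 T) e2
  rw [← e1, intervalIntegral.integral_sub (by simp) (c2.intervalIntegrable 0 T)] at e3
  have e4 : -κ ^ 2 ≤ ∫ u in (0 : ℝ)..1, (ρu T u ^ 2 - ρu 0 u ^ 2) := by
    have hc : (∫ _u in (0 : ℝ)..1, -κ ^ 2) = -κ ^ 2 := by simp
    rw [← hc]
    refine intervalIntegral.integral_mono_on zero_le_one (by simp)
      ((((cu T).pow 2).sub ((cu 0).pow 2)).intervalIntegrable _ _) fun u _ => ?_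
    have := hκ 0 h0 u
    have h2 : ρu 0 u ^ 2 ≤ κ ^ 2 := sq_le_sq' (by linarith [abs_le.1 this]) (abs_le.1 this).2
    nlinarith [sq_nonneg (ρu T u)]
  have e5 : (∫ _t in (0 : ℝ)..T, b₀ ^ 2) = b₀ ^ 2 * T := by simp [mul_comm]
  rw [e5] at e3
  linarith

end APriori

/-! ### Cell averages of the hydrodynamic solution -/

section CellAverages

set_option linter.unusedSectionVars false

/-- The average of `g` over the cell `[u, u + 1/n]`. -/
def cellAvg (n : ℕ) (g : ℝ → ℝ) (u : ℝ) : ℝ := n * ∫ y in (0 : ℝ)..1 / n, g (u + y)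

lemma cellAvg_sub_const {n : ℕ} (hn : 0 < n) {g : ℝ → ℝ} (hg : Continuous g) (u c : ℝ) :
    cellAvg n g u - c = n * ∫ y in (0 : ℝ)..1 / n, (g (u + y) - c) := by
  have hn0 : (n : ℝ) ≠ 0 := by exact_mod_cast hn.ne'
  have h1 : Continuous fun y => g (u + y) := by fun_prop
  rw [intervalIntegral.integral_sub (h1.intervalIntegrable _ _) (by simp), mul_sub, cellAvg]
  simp
  field_simp

lemma abs_cellAvg_sub_le {n : ℕ} (hn : 0 < n) {g : ℝ → ℝ} (hg : Continuous g) {u c δ : ℝ}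
    (h : ∀ y ∈ Icc (0 : ℝ) (1 / n), |g (u + y) - c| ≤ δ) : |cellAvg n g u - c| ≤ δ := by
  have hn0 : (0 : ℝ) < n := by exact_mod_cast hn
  rw [cellAvg_sub_const hn hg, abs_mul, abs_of_pos hn0]
  have h1 := intervalIntegral.norm_integral_le_of_norm_le_const (a := 0) (b := 1 / (n : ℝ))
    (f := fun y => g (u + y) - c) (C := δ) (fun y hy => by
      rw [uIoc_of_le (by positivity)] at hy
      exact h y ⟨hy.1.le, hy.2⟩)
  rw [Real.norm_eq_abs, sub_zero, abs_of_pos (by positivity : (0 : ℝ) < 1 / n)] at h1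
  calc (n : ℝ) * |∫ y in (0 : ℝ)..1 / n, (g (u + y) - c)| ≤ n * (δ * (1 / n)) := by gcongr
    _ = δ := by field_simp

variable {n : ℕ} [NeZero n]

lemma val_add_one (hn : 2 ≤ n) (x : ZMod n) :
    (x + 1).val = if x.val + 1 = n then 0 else x.val + 1 := by
  have : Fact (1 < n) := ⟨by omega⟩
  have hx := ZMod.val_lt x
  rw [ZMod.val_add, ZMod.val_one]
  split_ifs with h
  · rw [h, Nat.mod_self]
  · exact Nat.mod_eq_of_lt (by omega)

/-- Representatives lie in [0,1), so the step from the last site to 0 moves back by almost one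
period; periodicity absorbs the jump. -/
lemma periodic_site_add_one (hn : 2 ≤ n) {g : ℝ → ℝ} (hg : Function.Periodic g 1) (x : ZMod n)
    (c : ℝ) : g (site n (x + 1) + c) = g (site n x + 1 / n + c) := by
  have hn0 : (n : ℝ) ≠ 0 := by exact_mod_cast (by omega : n ≠ 0)
  unfold site
  rw [val_add_one hn]
  split_ifs with h
  · have h1 : (x.val : ℝ) / n + 1 / n = 1 := by
      rw [← add_div, div_eq_one_iff_eq hn0]; exact_mod_cast h
    rw [h1, ← hg (_ + c)]; congr 1; simp; ring
  · congr 1; push_cast; ring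

lemma periodic_site_sub_one (hn : 2 ≤ n) {g : ℝ → ℝ} (hg : Function.Periodic g 1) (x : ZMod n) :
    g (site n (x - 1) + 1 / n) = g (site n x) := by
  have := periodic_site_add_one hn hg (x - 1) 0
  simp only [sub_add_cancel, add_zero] at this
  exact this.symm

lemma sum_integral_cells (hn : 0 < n) {g : ℝ → ℝ} (hg : Continuous g)
    (hper : Function.Periodic g 1) (c : ℝ) :
    ∑ x : ZMod n, ∫ u in (site n x + c)..(site n x + 1 / n + c), g u = ∫ u in (0 : ℝ)..1, g u := by
  have hn0 : (n : ℝ) ≠ 0 := by exact_mod_cast hn.ne'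
  have h1 := intervalIntegral.sum_integral_adjacent_intervals (μ := volume) (f := g)
    (a := fun k : ℕ => (k : ℝ) / n + c) (n := n) (fun k _ => hg.intervalIntegrable _ _)
  rw [← sum_range_natCast (fun x : ZMod n => ∫ u in (site n x + c)..(site n x + 1 / n + c), g u)]
  have h2 : ∀ k ∈ Finset.range n, ∫ u in (site n (k : ZMod n) + c)..
      (site n (k : ZMod n) + 1 / n + c), g u =
      ∫ u in ((k : ℝ) / n + c)..(((k + 1 : ℕ) : ℝ) / n + c), g u := by
    intro k hk
    unfold site
    rw [ZMod.val_cast_of_lt (Finset.mem_range.1 hk)]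
    push_cast
    rw [add_div]
  rw [Finset.sum_congr rfl h2, h1]
  simp only [Nat.cast_zero, zero_div, zero_add, div_self hn0]
  rw [add_comm (1 : ℝ) c, hper.intervalIntegral_add_eq c 0, zero_add]

/-- The macroscopic flux. -/
def macroFlux (F : ℝ → ℝ) (ρ ρu : ℝ → ℝ → ℝ) (t u : ℝ) : ℝ :=
  -ρu t u + 2 * (ρ t u * (1 - ρ t u) * F u)

/-- The discrete profile of cell averages. -/
def cellProfile (n : ℕ) (ρ : ℝ → ℝ → ℝ) (t : ℝ) (x : ZMod n) : ℝ := cellAvg n (ρ t) (site n x)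

/-- The flux through the right end of a cell. -/
def cellFlux (n : ℕ) (F : ℝ → ℝ) (ρ ρu : ℝ → ℝ → ℝ) (t : ℝ) (x : ZMod n) : ℝ :=
  macroFlux F ρ ρu t (site n x + 1 / n)

variable {F : ℝ → ℝ} {T : ℝ} {ρ ρu ρuu ρt ρtu : ℝ → ℝ → ℝ}

lemma ClassicalSolution.continuous_space (h : ClassicalSolution F T ρ ρu ρuu ρt ρtu) (t : ℝ) :
    Continuous (ρ t) := h.cont.comp (Continuous.prodMk_right t)

lemma ClassicalSolution.lipschitz (h : ClassicalSolution F T ρ ρu ρuu ρt ρtu) {κ : ℝ}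
    (hκ : ∀ t ∈ Icc 0 T, ∀ u, |ρu t u| ≤ κ) {t : ℝ} (ht : t ∈ Icc 0 T) (u v : ℝ) :
    |ρ t u - ρ t v| ≤ κ * |u - v| := by
  have := (convex_univ (𝕜 := ℝ) (E := ℝ)).norm_image_sub_le_of_norm_hasDerivWithin_le
    (f := ρ t) (f' := ρu t) (C := κ) (fun w _ => (h.deriv_u t ht w).hasDerivWithinAt)
    (fun w _ => hκ t ht w) (mem_univ v) (mem_univ u)
  exact this

lemma ClassicalSolution.hasDerivAt_macroFlux (h : ClassicalSolution F T ρ ρu ρuu ρt ρtu)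
    (hF : Differentiable ℝ F) {t : ℝ} (ht : t ∈ Icc 0 T) (u : ℝ) :
    HasDerivAt (macroFlux F ρ ρu t) (-ρt t u) u := by
  have d1 := h.deriv_u t ht u
  have d2 := h.deriv_uu t ht u
  have d3 := (d2.neg).add ((((d1.mul (d1.const_sub 1)).mul (hF u).hasDerivAt)).const_mul 2)
  refine d3.congr_deriv ?_
  rw [h.equation t ht u]
  simp only [Pi.mul_apply]
  ring

/-- Finite-volume identity: the mass of a cell changes only through the fluxes at its two ends. Cell
averages thus satisfy the discrete continuity equation without error, which is why they, and not
point values, form the reference profile. -/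
lemma ClassicalSolution.cellProfile_hasDeriv (h : ClassicalSolution F T ρ ρu ρuu ρt ρtu)
    (hT : 0 < T) (hn : 2 ≤ n) (hF : Differentiable ℝ F) (hFper : Function.Periodic F 1)
    {t : ℝ} (ht : t ∈ Icc 0 T) (x : ZMod n) :
    HasDerivWithinAt (fun s => cellProfile n ρ s x)
      (-(n * (cellFlux n F ρ ρu t x - cellFlux n F ρ ρu t (x - 1)))) (Icc 0 T) t := by
  set u := site n x with hu
  have h0 : (0 : ℝ) ∈ Icc 0 T := left_mem_Icc.2 hT.le
  have hn0 : (0 : ℝ) < n := by exact_mod_cast (by omega : 0 < n)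
  have hJper : ∀ s ∈ Icc 0 T, Function.Periodic (macroFlux F ρ ρu s) 1 := fun s hs v => by
    simp only [macroFlux, h.periodic s hs v, h.deriv_periodic hs v, hFper v]
  have hct : Continuous (Function.uncurry ρt) := h.cont_t
  -- the mass balance of a cell
  have hbal : ∀ s ∈ Icc 0 T, ∫ y in (0 : ℝ)..1 / n, ρt s (u + y) =
      -(macroFlux F ρ ρu s (u + 1 / n) - macroFlux F ρ ρu s u) := by
    intro s hs
    have hc : Continuous fun y => ρt s (u + y) :=
      (h.cont_t.comp (Continuous.prodMk_right s)).comp (by fun_prop)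
    have := intervalIntegral.integral_eq_sub_of_hasDerivAt (a := 0) (b := 1 / (n : ℝ))
      (f := fun y => macroFlux F ρ ρu s (u + y)) (f' := fun y => -ρt s (u + y))
      (fun y _ => (h.hasDerivAt_macroFlux hF hs (u + y)).comp_const_add u y)
      (hc.neg.intervalIntegrable _ _)
    rw [intervalIntegral.integral_neg, add_zero] at this
    linarith
  have hJ1 : ∀ s ∈ Icc 0 T, cellFlux n F ρ ρu s (x - 1) = macroFlux F ρ ρu s u := fun s hs =>
    periodic_site_sub_one hn (hJper s hs) x
  -- Fubini writes the cell average as the primitive of a continuous function of time, which avoids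
  -- differentiating under the integral sign.
  have hint : ∀ r ∈ Icc 0 T, cellProfile n ρ r x = cellProfile n ρ 0 x +
      ∫ s in (0 : ℝ)..r, n * ∫ y in (0 : ℝ)..1 / n, ρt s (u + y) := by
    intro r hr
    have hg : Continuous (Function.uncurry fun s y => ρt s (u + y)) := by
      simp only [Function.uncurry_def] at *
      exact hct.comp (f := fun p : ℝ × ℝ => (p.1, u + p.2)) (by fun_prop)
    rw [intervalIntegral.integral_const_mul, intervalIntegral_swap hg hr.1 (by positivity)]
    have e : ∀ y, ∫ s in (0 : ℝ)..r, ρt s (u + y) = ρ r (u + y) - ρ 0 (u + y) := fun y =>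
      sub_eq_integral_of_hasDerivWithinAt (f := fun s => ρ s (u + y))
        (f' := fun s => ρt s (u + y)) (fun s hs => h.deriv_t s hs (u + y))
        (h.cont_t.comp (Continuous.prodMk_left (u + y))).continuousOn hr
    simp only [e]
    have c1 : ∀ s, Continuous fun y => ρ s (u + y) := fun s =>
      (h.continuous_space s).comp (by fun_prop)
    rw [intervalIntegral.integral_sub ((c1 r).intervalIntegrable _ _)
      ((c1 0).intervalIntegrable _ _)]
    simp only [cellProfile, cellAvg, ← hu]
    ring
  have hcont : ContinuousOn (fun s => (n : ℝ) * ∫ y in (0 : ℝ)..1 / n, ρt s (u + y)) (Icc 0 T) := by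
    refine (continuous_const.mul ?_).continuousOn
    refine intervalIntegral.continuous_parametric_intervalIntegral_of_continuous'
      (f := fun s y => ρt s (u + y)) ?_ 0 (1 / (n : ℝ))
    exact hct.comp (f := fun p : ℝ × ℝ => (p.1, u + p.2)) (by fun_prop)
  have hd := (hasDerivWithinAt_integral_Icc hcont ht).const_add (cellProfile n ρ 0 x)
  rw [hbal t ht] at hd
  refine (hd.congr hint (hint t ht)).congr_deriv ?_
  rw [hJ1 t ht, cellFlux, ← hu]; ring

/-- `(∫ f)² ≤ (b - a) ∫ f²`. -/
lemma sq_integral_le {f : ℝ → ℝ} {a b : ℝ} (hf : IntervalIntegrable f volume a b)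
    (hf2 : IntervalIntegrable (fun x => f x ^ 2) volume a b) (hab : a ≤ b) :
    (∫ x in a..b, f x) ^ 2 ≤ (b - a) * ∫ x in a..b, f x ^ 2 := by
  rcases hab.eq_or_lt with rfl | hlt
  · simp
  have hpos : 0 < b - a := by linarith
  set I := ∫ x in a..b, f x with hI
  set c := I / (b - a) with hc
  have h1 : 0 ≤ ∫ x in a..b, (f x - c) ^ 2 :=
    intervalIntegral.integral_nonneg hab fun x _ => sq_nonneg _
  have h2 : ∫ x in a..b, (f x - c) ^ 2 = (∫ x in a..b, f x ^ 2) - 2 * c * I + c ^ 2 * (b - a) := by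
    have e : ∀ x, (f x - c) ^ 2 = f x ^ 2 - 2 * c * f x + c ^ 2 := fun x => by ring
    have hf3 : IntervalIntegrable (fun x => 2 * c * f x) volume a b := hf.const_mul _
    have hf4 : IntervalIntegrable (fun x => f x ^ 2 - 2 * c * f x) volume a b := hf2.sub hf3
    simp only [e]
    rw [intervalIntegral.integral_add hf4 (by simp), intervalIntegral.integral_sub hf2 hf3,
      intervalIntegral.integral_const_mul, intervalIntegral.integral_const, smul_eq_mul]
    ring
  rw [h2] at h1
  have h3 : c * (b - a) = I := by rw [hc]; field_simp
  generalize (∫ x in a..b, f x ^ 2) = S at *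
  have h4 : 0 ≤ S - c * I := by
    have : c ^ 2 * (b - a) = c * I := by rw [pow_two, mul_assoc, h3]
    linarith
  have h5 := mul_nonneg hpos.le h4
  have h6 : (b - a) * (S - c * I) = (b - a) * S - I ^ 2 := by
    rw [mul_sub, ← mul_assoc, mul_comm (b - a) c, h3, pow_two]
  linarith

/-- Cauchy–Schwarz for the increment of ρ_u as an integral of ρ_uu. Enlarging the domain to a window
of length 2δ makes the bound independent of ξ. -/
lemma ClassicalSolution.sq_deriv_sub_le (h : ClassicalSolution F T ρ ρu ρuu ρt ρtu) {t : ℝ}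
    (ht : t ∈ Icc 0 T) {z ξ δ : ℝ} (hδ : 0 ≤ δ) (hξ : |ξ - z| ≤ δ) :
    (ρu t ξ - ρu t z) ^ 2 ≤ 2 * δ * ∫ u in (z - δ)..(z + δ), ρuu t u ^ 2 := by
  have hc : Continuous (ρuu t) := h.cont_uu.comp (Continuous.prodMk_right t)
  have hc2 : Continuous fun u => ρuu t u ^ 2 := hc.pow 2
  obtain ⟨h1, h2⟩ := abs_le.1 hξ
  have key : ∀ a b, z - δ ≤ a → a ≤ b → b ≤ z + δ →
      (ρu t b - ρu t a) ^ 2 ≤ 2 * δ * ∫ u in (z - δ)..(z + δ), ρuu t u ^ 2 := by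
    intro a b ha hab hb
    have e := intervalIntegral.integral_eq_sub_of_hasDerivAt (a := a) (b := b) (f := ρu t)
      (f' := ρuu t) (fun u _ => h.deriv_uu t ht u) (hc.intervalIntegrable _ _)
    rw [← e]
    refine (sq_integral_le (hc.intervalIntegrable _ _) (hc2.intervalIntegrable _ _) hab).trans ?_
    have h3 : ∫ x in a..b, ρuu t x ^ 2 ≤ ∫ u in (z - δ)..(z + δ), ρuu t u ^ 2 :=
      intervalIntegral.integral_mono_interval ha hab hb (ae_of_all _ fun u => sq_nonneg _)
        (hc2.intervalIntegrable _ _)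
    have h4 : 0 ≤ ∫ x in a..b, ρuu t x ^ 2 :=
      intervalIntegral.integral_nonneg hab fun u _ => sq_nonneg _
    exact mul_le_mul (by linarith) h3 h4 (by linarith)
  rcases le_total z ξ with hz | hz
  · exact key z ξ (by linarith) hz (by linarith)
  · have := key ξ z (by linarith) hz (by linarith)
    nlinarith

set_option maxHeartbeats 1000000 in
-- The rescaled difference of neighbouring cell averages is an average of values of ρ_u within 1/n
-- of the common end point, so the gradient error squared costs ∫ρ_uu²/n over two cells. The drift
-- error is O(1/n) by the Lipschitz bounds. The sum over n cells stays bounded once ∫ρ_uu² is.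
lemma ClassicalSolution.cell_error_le (h : ClassicalSolution F T ρ ρu ρuu ρt ρtu)
    (hn : 2 ≤ n) (hF : Differentiable ℝ F) (hFper : Function.Periodic F 1)
    {C κ : ℝ} (hFC : ∀ u, |F u| ≤ C) (hF' : ∀ u, |deriv F u| ≤ C)
    (hρ : ∀ t ∈ Icc 0 T, ∀ u, 0 ≤ ρ t u ∧ ρ t u ≤ 1) (hκ : ∀ t ∈ Icc 0 T, ∀ u, |ρu t u| ≤ κ)
    {t : ℝ} (ht : t ∈ Icc 0 T) (x : ZMod n) :
    (cellFlux n F ρ ρu t x - n * meanCurrent n F (cellProfile n ρ t) x) ^ 2 ≤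
      4 / n * (∫ u in (site n x)..(site n x + 1 / n + 1 / n), ρuu t u ^ 2) +
        2 * (C * (2 + 4 * κ)) ^ 2 / n := by
  have hn0 : (0 : ℝ) < n := by exact_mod_cast (by omega : 0 < n)
  have hn1 : (1 : ℝ) ≤ n := by exact_mod_cast (by omega : 1 ≤ n)
  have hC : 0 ≤ C := (abs_nonneg _).trans (hFC 0)
  have hκ0 : 0 ≤ κ := (abs_nonneg _).trans (hκ t ht 0)
  have hc := h.continuous_space t
  set z := site n x + 1 / n with hz
  set A := cellProfile n ρ t x with hA
  set B := cellProfile n ρ t (x + 1) with hB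
  have hBz : B = cellAvg n (ρ t) z := by
    simp only [hB, cellProfile, cellAvg]
    congr 1
    exact intervalIntegral.integral_congr fun y _ =>
      periodic_site_add_one hn (h.periodic t ht) x y
  set R := ∫ u in (z - 1 / n)..(z + 1 / n), ρuu t u ^ 2 with hR
  have hR0 : 0 ≤ R := intervalIntegral.integral_nonneg (by
    have : (0 : ℝ) < 1 / n := by positivity
    linarith) fun u _ => sq_nonneg _
  -- the gradient
  have g1 : |n * (B - A) - ρu t z| ≤ √(2 / n * R) := by
    have e1 : n * (B - A) = cellAvg n (fun v => n * (ρ t v - ρ t (v - 1 / n))) z := by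
      rw [hBz, hA]
      simp only [cellProfile, cellAvg]
      rw [intervalIntegral.integral_const_mul]
      have c1 : Continuous fun y => ρ t (z + y) := by fun_prop
      have c2 : Continuous fun y => ρ t (z + y - 1 / n) := by fun_prop
      rw [intervalIntegral.integral_sub (c1.intervalIntegrable _ _) (c2.intervalIntegrable _ _)]
      have e2 : ∀ y, z + y - 1 / (n : ℝ) = site n x + y := fun y => by rw [hz]; ring
      simp only [e2]
      ring
    rw [e1]
    refine abs_cellAvg_sub_le (by omega) (by fun_prop) fun y hy => ?_
    have hlt : z + y - 1 / n < z + y := by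
      have : (0 : ℝ) < 1 / n := by positivity
      linarith
    obtain ⟨ξ, hξ, hs⟩ := exists_hasDerivAt_eq_slope (ρ t) (ρu t) hlt hc.continuousOn
      (fun v _ => h.deriv_u t ht v)
    have e2 : (n : ℝ) * (ρ t (z + y) - ρ t (z + y - 1 / n)) = ρu t ξ := by
      rw [hs]; field_simp; ring
    rw [e2]
    refine Real.abs_le_sqrt ?_
    have := h.sq_deriv_sub_le ht (z := z) (ξ := ξ) (δ := 1 / n) (by positivity)
      (abs_le.2 ⟨by linarith [hξ.1, hy.1], by linarith [hξ.2, hy.2]⟩)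
    calc _ ≤ _ := this
      _ = _ := by rw [hR]; ring
  -- the drift
  have a1 : |A - ρ t z| ≤ κ / n := abs_cellAvg_sub_le (by omega) hc fun y hy => by
    refine (h.lipschitz hκ ht _ _).trans ?_
    rw [div_eq_mul_one_div]
    gcongr
    rw [abs_le]; constructor <;> linarith [hy.1, hy.2]
  have b1 : |B - ρ t z| ≤ κ / n := by
    rw [hBz]
    refine abs_cellAvg_sub_le (by omega) hc fun y hy => ?_
    refine (h.lipschitz hκ ht _ _).trans ?_
    rw [div_eq_mul_one_div]
    gcongr
    rw [abs_le]; constructor <;> linarith [hy.1, hy.2]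
  have hhalf : ∀ v, |ρ t v - 1 / 2| ≤ 1 / 2 := fun v =>
    abs_le.2 ⟨by linarith [(hρ t ht v).1], by linarith [(hρ t ht v).2]⟩
  have A01 : 0 ≤ A ∧ A ≤ 1 := by
    have := abs_le.1 (abs_cellAvg_sub_le (n := n) (by omega) hc (u := site n x) (c := 1 / 2)
      fun y _ => hhalf _)
    exact ⟨by linarith [this.1, hA.le, hA.ge, show A = cellAvg n (ρ t) (site n x) from rfl],
      by linarith [this.2, show A = cellAvg n (ρ t) (site n x) from rfl]⟩
  have B01 : 0 ≤ B ∧ B ≤ 1 := by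
    have := abs_le.1 (abs_cellAvg_sub_le (n := n) (by omega) hc (u := z) (c := 1 / 2)
      fun y _ => hhalf _)
    exact ⟨by linarith [this.1], by linarith [this.2]⟩
  have f1 : |F (site n x) - F z| ≤ C / n := by
    have := (convex_univ (𝕜 := ℝ) (E := ℝ)).norm_image_sub_le_of_norm_hasDerivWithin_le
      (f := F) (f' := deriv F) (C := C) (fun w _ => (hF w).hasDerivAt.hasDerivWithinAt)
      (fun w _ => hF' w) (mem_univ z) (mem_univ (site n x))
    refine this.trans (le_of_eq ?_)
    have e : site n x - z = -(1 / n) := by rw [hz]; ring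
    rw [e, norm_neg, Real.norm_of_nonneg (by positivity)]; ring
  have f2 : F (site n (x + 1)) = F z := by
    have := periodic_site_add_one hn hFper x 0
    rwa [add_zero, add_zero] at this
  have prod_le : ∀ p q r s : ℝ, 0 ≤ p → p ≤ 1 → 0 ≤ s → s ≤ 1 →
      |p * q - r * s| ≤ |p - r| + |q - s| := by
    intro p q r s hp0 hp1 hs0 hs1
    have e : p * q - r * s = p * (q - s) + (p - r) * s := by ring
    rw [e]
    refine (abs_add_le _ _).trans ?_
    rw [abs_mul, abs_mul, abs_of_nonneg hp0, abs_of_nonneg hs0]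
    nlinarith [abs_nonneg (q - s), abs_nonneg (p - r)]
  set m := ρ t z with hm
  have m01 := hρ t ht z
  have d1 : |A * (1 - B) - m * (1 - m)| ≤ 2 * κ / n := by
    refine (prod_le _ _ _ _ A01.1 A01.2 (by linarith [m01.2]) (by linarith [m01.1])).trans ?_
    have e : 1 - B - (1 - m) = -(B - m) := by ring
    rw [e, abs_neg]
    have : 2 * κ / n = κ / n + κ / n := by ring
    linarith
  have d2 : |(1 - A) * B - m * (1 - m)| ≤ 2 * κ / n := by
    rw [mul_comm m]
    refine (prod_le _ _ _ _ (by linarith [A01.2]) (by linarith [A01.1]) m01.1 m01.2).trans ?_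
    have e : 1 - A - (1 - m) = -(A - m) := by ring
    rw [e, abs_neg]
    have : 2 * κ / n = κ / n + κ / n := by ring
    linarith
  have d3 : |2 * (m * (1 - m) * F z) - F (site n x) * (A * (1 - B)) -
      F (site n (x + 1)) * ((1 - A) * B)| ≤ C * (2 + 4 * κ) / n := by
    rw [f2]
    have e : 2 * (m * (1 - m) * F z) - F (site n x) * (A * (1 - B)) - F z * ((1 - A) * B) =
        -((F (site n x) - F z) * (A * (1 - B)) + F z * (A * (1 - B) - m * (1 - m)) +
          F z * ((1 - A) * B - m * (1 - m))) := by ring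
    rw [e, abs_neg]
    have AB : |A * (1 - B)| ≤ 1 := abs_le.2 ⟨by nlinarith [A01.1, A01.2, B01.1, B01.2],
      by nlinarith [A01.1, A01.2, B01.1, B01.2]⟩
    refine (abs_add_le _ _).trans ((add_le_add (abs_add_le _ _) le_rfl).trans ?_)
    rw [abs_mul (F (site n x) - F z), abs_mul (F z), abs_mul (F z)]
    calc _ ≤ C / n * 1 + C * (2 * κ / n) + C * (2 * κ / n) := by
          have := hFC z
          refine add_le_add (add_le_add ?_ ?_) ?_
          · exact mul_le_mul f1 AB (abs_nonneg _) (by positivity)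
          · exact mul_le_mul this d1 (abs_nonneg _) hC
          · exact mul_le_mul this d2 (abs_nonneg _) hC
      _ = C * (1 + 4 * κ) / n := by ring
      _ ≤ _ := by gcongr; norm_num
  have hsplit : cellFlux n F ρ ρu t x - n * meanCurrent n F (cellProfile n ρ t) x =
      (n * (B - A) - ρu t z) + (2 * (m * (1 - m) * F z) - F (site n x) * (A * (1 - B)) -
      F (site n (x + 1)) * ((1 - A) * B)) := by
    simp only [cellFlux, macroFlux, meanCurrent, rateRight, rateLeft, ← hz, ← hA, ← hB, ← hm]
    field_simp
    ring
  rw [hsplit]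
  set P := n * (B - A) - ρu t z
  set Q := 2 * (m * (1 - m) * F z) - F (site n x) * (A * (1 - B)) -
      F (site n (x + 1)) * ((1 - A) * B)
  have P2 : P ^ 2 ≤ 2 / n * R := by
    have := pow_le_pow_left₀ (abs_nonneg P) g1 2
    rwa [sq_abs, Real.sq_sqrt (by positivity)] at this
  have Q2 : Q ^ 2 ≤ (C * (2 + 4 * κ)) ^ 2 / n := by
    have := pow_le_pow_left₀ (abs_nonneg Q) d3 2
    rw [sq_abs, div_pow] at this
    refine this.trans ?_
    gcongr
    nlinarith
  have hRe : R = ∫ u in (site n x)..(z + 1 / n), ρuu t u ^ 2 := by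
    rw [hR]; congr 1; rw [hz]; ring
  rw [← hRe]
  have e : 4 / (n : ℝ) * R = 2 * (2 / n * R) := by ring
  have e' : 2 * (C * (2 + 4 * κ)) ^ 2 / (n : ℝ) = 2 * ((C * (2 + 4 * κ)) ^ 2 / n) := by ring
  rw [e, e']
  nlinarith [sq_nonneg (P - Q)]

/-- The total error of the discrete continuity equation. -/
def fluxErrorBound (T C κ : ℝ) : ℝ :=
  8 * (κ ^ 2 + (2 * C * (κ + 1)) ^ 2 * T) + 2 * (C * (2 + 4 * κ)) ^ 2 * T

/-- The two-cell windows cover the torus twice, and the energy estimate bounds the time integral of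
∫ρ_uu². The result is uniform in n. -/
theorem ClassicalSolution.integral_fluxError_le (h : ClassicalSolution F T ρ ρu ρuu ρt ρtu)
    (hT : 0 < T) (hn : 2 ≤ n) (hF : Differentiable ℝ F) (hFper : Function.Periodic F 1)
    {C κ : ℝ} (hFC : ∀ u, |F u| ≤ C) (hF' : ∀ u, |deriv F u| ≤ C)
    (hρ : ∀ t ∈ Icc 0 T, ∀ u, 0 ≤ ρ t u ∧ ρ t u ≤ 1) (hκ : ∀ t ∈ Icc 0 T, ∀ u, |ρu t u| ≤ κ)
    (hcont : ContinuousOn (fluxError n F (cellProfile n ρ) (cellFlux n F ρ ρu)) (Icc 0 T)) :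
    ∫ t in (0 : ℝ)..T, fluxError n F (cellProfile n ρ) (cellFlux n F ρ ρu) t ≤
      fluxErrorBound T C κ := by
  have hn0 : (0 : ℝ) < n := by exact_mod_cast (by omega : 0 < n)
  have hn1 : (1 : ℝ) ≤ n := by exact_mod_cast (by omega : 1 ≤ n)
  have guu : Continuous (Function.uncurry fun t u => ρuu t u ^ 2) := by
    have := h.cont_uu
    simp only [Function.uncurry_def]; fun_prop
  have c2 : Continuous fun t => ∫ u in (0 : ℝ)..1, ρuu t u ^ 2 :=
    intervalIntegral.continuous_parametric_intervalIntegral_of_continuous' guu 0 1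
  have hpt : ∀ t ∈ Icc 0 T, fluxError n F (cellProfile n ρ) (cellFlux n F ρ ρu) t ≤
      8 * (∫ u in (0 : ℝ)..1, ρuu t u ^ 2) + 2 * (C * (2 + 4 * κ)) ^ 2 := by
    intro t ht
    have hc2 : Continuous fun u => ρuu t u ^ 2 :=
      (h.cont_uu.comp (Continuous.prodMk_right t)).pow 2
    have hper : Function.Periodic (fun u => ρuu t u ^ 2) 1 := fun u => by
      simp only [h.deriv2_periodic ht u]
    have hsum : ∑ x : ZMod n, ∫ u in (site n x)..(site n x + 1 / n + 1 / n), ρuu t u ^ 2 =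
        2 * ∫ u in (0 : ℝ)..1, ρuu t u ^ 2 := by
      have s1 := sum_integral_cells (n := n) (by omega) hc2 hper 0
      have s2 := sum_integral_cells (n := n) (by omega) hc2 hper (1 / n)
      rw [two_mul, ← s1]
      nth_rw 2 [s1]
      rw [← s2, ← Finset.sum_add_distrib]
      refine Finset.sum_congr rfl fun x _ => ?_
      rw [add_zero, add_zero, intervalIntegral.integral_add_adjacent_intervals
        (hc2.intervalIntegrable _ _) (hc2.intervalIntegrable _ _)]
    have hI : 0 ≤ ∫ u in (0 : ℝ)..1, ρuu t u ^ 2 :=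
      intervalIntegral.integral_nonneg zero_le_one fun u _ => sq_nonneg _
    calc _ ≤ ∑ x : ZMod n, (4 / n * (∫ u in (site n x)..(site n x + 1 / n + 1 / n), ρuu t u ^ 2) +
          2 * (C * (2 + 4 * κ)) ^ 2 / n) := Finset.sum_le_sum fun x _ =>
            h.cell_error_le hn hF hFper hFC hF' hρ hκ ht x
      _ = 8 * (1 / n) * (∫ u in (0 : ℝ)..1, ρuu t u ^ 2) + 2 * (C * (2 + 4 * κ)) ^ 2 := by
          rw [Finset.sum_add_distrib, ← Finset.mul_sum, hsum]
          simp [ZMod.card]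
          field_simp
          ring
      _ ≤ 8 * 1 * (∫ u in (0 : ℝ)..1, ρuu t u ^ 2) + 2 * (C * (2 + 4 * κ)) ^ 2 := by
          gcongr
          rw [div_le_one hn0]; exact hn1
      _ = _ := by ring
  have c3 : Continuous fun t => 8 * (∫ u in (0 : ℝ)..1, ρuu t u ^ 2) := continuous_const.mul c2
  have c4 : Continuous fun t =>
    8 * (∫ u in (0 : ℝ)..1, ρuu t u ^ 2) + 2 * (C * (2 + 4 * κ)) ^ 2 := c3.add continuous_const
  have hi : IntervalIntegrable (fluxError n F (cellProfile n ρ) (cellFlux n F ρ ρu)) volume 0 T :=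
    ContinuousOn.intervalIntegrable (by rwa [uIcc_of_le hT.le])
  have h1 := intervalIntegral.integral_mono_on hT.le hi (c4.intervalIntegrable 0 T) hpt
  refine h1.trans ?_
  rw [intervalIntegral.integral_add (c3.intervalIntegrable _ _) (by simp),
    intervalIntegral.integral_const_mul, intervalIntegral.integral_const, sub_zero, smul_eq_mul]
  have h2 := h.energy_le hT hFC hF' hρ hκ
  unfold fluxErrorBound
  nlinarith

theorem ClassicalSolution.referenceProfile (h : ClassicalSolution F T ρ ρu ρuu ρt ρtu)
    (hT : 0 < T) (hn : 2 ≤ n) (hF : Differentiable ℝ F) (hFper : Function.Periodic F 1)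
    {C κ ε : ℝ} (hFC : ∀ u, |F u| ≤ C) (hε : 0 < ε)
    (hρ : ∀ t ∈ Icc 0 T, ∀ u, ε ≤ ρ t u ∧ ρ t u ≤ 1 - ε)
    (hκ : ∀ t ∈ Icc 0 T, ∀ u, |ρu t u| ≤ κ) :
    ReferenceProfile n T ε κ (κ + 2 * C) (cellProfile n ρ) (cellFlux n F ρ ρu) where
  elliptic t ht x := by
    have := abs_le.1 (abs_cellAvg_sub_le (n := n) (by omega) (h.continuous_space t)
      (u := site n x) (c := 1 / 2) (δ := 1 / 2 - ε)
      fun y _ => abs_le.2 ⟨by linarith [(hρ t ht (site n x + y)).1],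
        by linarith [(hρ t ht (site n x + y)).2]⟩)
    unfold cellProfile
    exact ⟨by linarith [this.1], by linarith [this.2]⟩
  grad_le t ht x := by
    have hn0 : (0 : ℝ) < n := by exact_mod_cast (by omega : 0 < n)
    have hc := h.continuous_space t
    have e : cellProfile n ρ t x - cellProfile n ρ t (x + 1) =
        cellAvg n (fun v => ρ t v - ρ t (v + 1 / n)) (site n x) - 0 := by
      simp only [cellProfile, cellAvg]
      have c1 : Continuous fun y => ρ t (site n x + y) := by fun_prop
      have c2 : Continuous fun y => ρ t (site n x + y + 1 / n) := by fun_prop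
      rw [intervalIntegral.integral_sub (c1.intervalIntegrable _ _) (c2.intervalIntegrable _ _),
        sub_zero, mul_sub]
      congr 2
      refine intervalIntegral.integral_congr fun y _ => ?_
      rw [periodic_site_add_one hn (h.periodic t ht) x y]
      congr 1; ring
    rw [e]
    refine abs_cellAvg_sub_le (by omega) (by fun_prop) fun y _ => ?_
    rw [sub_zero]
    refine (h.lipschitz hκ ht _ _).trans (le_of_eq ?_)
    have : site n x + y - (site n x + y + 1 / n) = -(1 / n) := by ring
    rw [this, abs_neg, abs_of_pos (by positivity)]; ring
  flux_le t ht x := by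
    have hC : 0 ≤ C := (abs_nonneg _).trans (hFC 0)
    unfold cellFlux macroFlux
    set z := site n x + 1 / n
    have hz := hρ t ht z
    refine (abs_add_le _ _).trans ?_
    rw [abs_neg, abs_mul, abs_two, abs_mul]
    have q : |ρ t z * (1 - ρ t z)| ≤ 1 := abs_le.2 ⟨by nlinarith, by nlinarith⟩
    have := mul_le_mul q (hFC z) (abs_nonneg _) zero_le_one
    linarith [hκ t ht z]
  flux_cont x := by
    unfold cellFlux macroFlux
    have h1 : Continuous fun r => ρ r (site n x + 1 / n) :=
      h.cont.comp (Continuous.prodMk_left _)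
    have h2 : Continuous fun r => ρu r (site n x + 1 / n) :=
      h.cont_u.comp (Continuous.prodMk_left _)
    exact Continuous.continuousOn (by fun_prop)
  hasDeriv t ht x := h.cellProfile_hasDeriv hT hn hF hFper ht x

lemma ClassicalSolution.abs_cellProfile_sub_le (h : ClassicalSolution F T ρ ρu ρuu ρt ρtu)
    (hn : 0 < n) {κ : ℝ} (hκ : ∀ t ∈ Icc 0 T, ∀ u, |ρu t u| ≤ κ) {t : ℝ} (ht : t ∈ Icc 0 T)
    (x : ZMod n) : |cellProfile n ρ t x - ρ t (site n x)| ≤ κ / n := by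
  have hκ0 : 0 ≤ κ := (abs_nonneg _).trans (hκ t ht 0)
  refine abs_cellAvg_sub_le hn (h.continuous_space t) fun y hy => ?_
  refine (h.lipschitz hκ ht _ _).trans ?_
  rw [add_sub_cancel_left, abs_of_nonneg hy.1, div_eq_mul_one_div]
  exact mul_le_mul_of_nonneg_left hy.2 hκ0

end CellAverages

/-! ### The path space -/

section PathSpace

set_option linter.unusedSectionVars false

variable {n : ℕ} [NeZero n]

/-- The configuration at the macroscopic time `r`. -/
def obs (w : Path n) (r : ℝ) : Config n := w.1 (r * (n : ℝ) ^ 2).toNNReal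

/-- By right continuity the value at t is the limit of the values at grid points approaching t from
the right; evaluation along a countable grid is jointly measurable. -/
lemma measurable_eval : Measurable fun p : ℝ≥0 × Path n => p.2.1 p.1 := by
  have h1 : ∀ N : ℕ, Measurable fun p : ℝ≥0 × Path n =>
      p.2.1 (((⌊p.1 * (N + 1 : ℝ≥0)⌋₊ : ℝ≥0) + 1) / (N + 1)) := by
    intro N
    have hk : Measurable fun q : ℕ × Path n => q.2.1 (((q.1 : ℝ≥0) + 1) / (N + 1)) :=
      measurable_from_prod_countable_right fun k =>
        (measurable_pi_apply (((k : ℝ≥0) + 1) / (N + 1))).comp measurable_subtype_coe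
    have hm : Measurable fun p : ℝ≥0 × Path n => (⌊p.1 * (N + 1 : ℝ≥0)⌋₊, p.2) :=
      (Nat.measurable_floor.comp (measurable_fst.mul_const _)).prodMk measurable_snd
    exact hk.comp hm
  refine measurable_of_tendsto_metrizable h1 (tendsto_pi_nhds.2 fun p => ?_)
  obtain ⟨t, w⟩ := p
  have h2 := (w.2.1 t).tendsto
  refine h2.comp (tendsto_nhdsWithin_iff.2 ⟨?_, Eventually.of_forall fun N => ?_⟩)
  · have hlim : Tendsto (fun N : ℕ => t + 1 / ((N : ℝ≥0) + 1)) atTop (𝓝 t) := by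
      have := (tendsto_one_div_add_atTop_nhds_zero_nat (𝕜 := ℝ≥0)).const_add t
      simpa using this
    refine tendsto_of_tendsto_of_tendsto_of_le_of_le tendsto_const_nhds hlim
      (fun N => ?_) (fun N => ?_)
    · rw [le_div_iff₀ (by positivity)]
      exact (Nat.lt_floor_add_one _).le
    · rw [div_le_iff₀ (by positivity), add_mul, one_div, inv_mul_cancel₀ (by positivity)]
      gcongr
      exact Nat.floor_le (by positivity)
  · rw [mem_Ici, le_div_iff₀ (by positivity)]
    exact (Nat.lt_floor_add_one _).le

lemma measurable_obs : Measurable fun p : ℝ × Path n => obs p.2 p.1 :=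
  measurable_eval.comp (f := fun p : ℝ × Path n => ((p.1 * (n : ℝ) ^ 2).toNNReal, p.2))
    ((measurable_fst.mul_const _).real_toNNReal.prodMk measurable_snd)

lemma obs_eventually_eq (w : Path n) (r : ℝ) : ∀ᶠ r' in 𝓝[≥] r, obs w r' = obs w r := by
  have h1 : ∀ᶠ t in 𝓝[≥] (r * (n : ℝ) ^ 2).toNNReal, w.1 t = w.1 (r * (n : ℝ) ^ 2).toNNReal :=
    (w.2.1 _).tendsto ((isOpen_discrete {w.1 (r * (n : ℝ) ^ 2).toNNReal}).mem_nhds rfl)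
  have h2 : Tendsto (fun r' : ℝ => (r' * (n : ℝ) ^ 2).toNNReal) (𝓝[≥] r)
      (𝓝[≥] (r * (n : ℝ) ^ 2).toNNReal) := by
    refine tendsto_nhdsWithin_iff.2 ⟨?_, ?_⟩
    · have : Continuous fun r' : ℝ => (r' * (n : ℝ) ^ 2).toNNReal := by fun_prop
      exact this.continuousWithinAt
    · filter_upwards [self_mem_nhdsWithin] with r' hr'
      exact Real.toNNReal_le_toNNReal (mul_le_mul_of_nonneg_right hr' (by positivity))
  exact h2.eventually h1

/-- An observable depending continuously on time, along a path. -/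
lemma measurable_observable {A : ℝ → Config n → ℝ} (hA : ∀ η, Continuous fun r => A r η) :
    Measurable fun p : ℝ × Path n => A p.1 (obs p.2 p.1) := by
  have h1 : Measurable fun q : ℝ × Config n => A q.1 q.2 :=
    measurable_from_prod_countable_left fun η => (hA η).measurable
  exact h1.comp (measurable_fst.prodMk measurable_obs)

lemma continuousWithinAt_observable {A : ℝ → Config n → ℝ} (hA : ∀ η, Continuous fun r => A r η)
    (w : Path n) (r : ℝ) : ContinuousWithinAt (fun r => A r (obs w r)) (Ici r) r := by
  refine ((hA (obs w r)).continuousWithinAt).congr_of_eventuallyEq ?_ rfl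
  filter_upwards [obs_eventually_eq w r] with r' hr'
  rw [hr']

lemma exists_bound_observable {A : ℝ → Config n → ℝ} (hA : ∀ η, Continuous fun r => A r η)
    (s t : ℝ) : ∃ B, 0 ≤ B ∧ ∀ r ∈ Icc s t, ∀ η, |A r η| ≤ B := by
  have h1 : Continuous fun r => ∑ η, |A r η| := by fun_prop
  obtain ⟨B, hB⟩ := isCompact_Icc.exists_bound_of_continuousOn (s := Icc s t) h1.continuousOn
  refine ⟨max B 0, le_max_right _ _, fun r hr η => ?_⟩
  have h2 := hB r hr
  rw [Real.norm_eq_abs] at h2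
  exact ((Finset.single_le_sum (f := fun η => |A r η|) (fun _ _ => abs_nonneg _)
    (Finset.mem_univ η)).trans (le_abs_self _)).trans (h2.trans (le_max_left _ _))

lemma intervalIntegrable_of_bound {f : ℝ → ℝ} (hf : Measurable f) {s t B : ℝ} (hst : s ≤ t)
    (hB : ∀ r ∈ Icc s t, |f r| ≤ B) : IntervalIntegrable f volume s t := by
  rw [intervalIntegrable_iff_integrableOn_Ioc_of_le hst]
  refine Integrable.of_bound hf.aestronglyMeasurable B ?_
  exact ae_restrict_of_forall_mem measurableSet_Ioc fun r hr => hB r ⟨hr.1.le, hr.2⟩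

lemma intervalIntegrable_observable {A : ℝ → Config n → ℝ} (hA : ∀ η, Continuous fun r => A r η)
    (w : Path n) {s t : ℝ} (hst : s ≤ t) :
    IntervalIntegrable (fun r => A r (obs w r)) volume s t := by
  obtain ⟨B, -, hB⟩ := exists_bound_observable hA s t
  exact intervalIntegrable_of_bound ((measurable_observable hA).comp measurable_prodMk_right) hst
    fun r hr => hB r hr _

/-- Fubini for path functionals. -/
lemma integral_intervalIntegral_swap {Ω : Type*} [MeasurableSpace Ω] {P : Measure Ω}
    [IsProbabilityMeasure P] {g : ℝ → Ω → ℝ}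
    (hg : Measurable fun p : ℝ × Ω => g p.1 p.2) {s t B : ℝ} (hst : s ≤ t)
    (hB : ∀ r ∈ Icc s t, ∀ w, |g r w| ≤ B) :
    ∫ w, (∫ r in s..t, g r w) ∂P = ∫ r in s..t, (∫ w, g r w ∂P) := by
  simp only [intervalIntegral.integral_of_le hst]
  refine (integral_integral_swap (f := g) ?_).symm
  have h1 : ((volume : Measure ℝ).restrict (Ioc s t)).prod P =
      ((volume : Measure ℝ).prod P).restrict (Ioc s t ×ˢ univ) := by
    rw [← Measure.prod_restrict, Measure.restrict_univ]
  refine Integrable.of_bound hg.aestronglyMeasurable B ?_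
  rw [h1]
  exact ae_restrict_of_forall_mem (measurableSet_Ioc.prod MeasurableSet.univ) fun p hp =>
    hB p.1 ⟨hp.1.1.le, hp.1.2⟩ p.2

lemma intervalIntegral_indicator_Ioi {f : ℝ → ℝ} {s t r : ℝ} (hr : r ∈ Icc s t) :
    ∫ r' in s..t, (Ioi r).indicator f r' = ∫ r' in r..t, f r' := by
  rw [intervalIntegral.integral_of_le (hr.1.trans hr.2), intervalIntegral.integral_of_le hr.2,
    setIntegral_indicator measurableSet_Ioi]
  congr 2
  ext y
  simp only [mem_inter_iff, mem_Ioc, mem_Ioi]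
  exact ⟨fun h => ⟨h.2, h.1.2⟩, fun h => ⟨⟨hr.1.trans_lt h.1, h.2⟩, h.1⟩⟩

/-- `(∫ f)² = 2 ∫ f(r) ∫_r f` for a right-continuous function. -/
lemma sq_integral_eq {f : ℝ → ℝ} (hf : Measurable f) (hr : ∀ r, ContinuousWithinAt f (Ici r) r)
    {s t B : ℝ} (hst : s ≤ t) (hB : ∀ r ∈ Icc s t, |f r| ≤ B) :
    (∫ r in s..t, f r) ^ 2 = 2 * ∫ r in s..t, f r * ∫ r' in s..t, (Ioi r).indicator f r' := by
  have hB0 : 0 ≤ B := (abs_nonneg _).trans (hB s (left_mem_Icc.2 hst))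
  have hint : ∀ a ∈ Icc s t, ∀ b ∈ Icc s t, IntervalIntegrable f volume a b := fun a ha b hb =>
    (intervalIntegrable_of_bound hf hst hB).mono_set (by
      rw [uIcc_of_le hst]; exact uIcc_subset_Icc ha hb)
  have hs : s ∈ Icc s t := left_mem_Icc.2 hst
  have ht : t ∈ Icc s t := right_mem_Icc.2 hst
  set Z : ℝ → ℝ := fun r => ∫ r' in s..r, f r' with hZ
  have hZc : ContinuousOn Z (Icc s t) := by
    have := intervalIntegral.continuousOn_primitive_interval' (hint s hs t ht)
      (by rw [uIcc_of_le hst]; exact hs)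
    rwa [uIcc_of_le hst] at this
  have hd : ∀ r ∈ Ioo s t, HasDerivWithinAt Z (f r) (Ioi r) r := fun r hr' => by
    have h1 := intervalIntegral.integral_hasDerivWithinAt_right (a := s) (b := r)
      (hint s hs r ⟨hr'.1.le, hr'.2.le⟩) (s := Ici r) (t := Ioi r)
      ⟨univ, univ_mem, hf.aestronglyMeasurable⟩ ((hr r).mono Ioi_subset_Ici_self)
    exact h1.mono Ioi_subset_Ici_self
  -- The path may jump, so only a right derivative is available and the fundamental theorem is used
  -- in its one-sided form.
  have hd2 : ∀ r ∈ Ioo s t, HasDerivWithinAt (fun r => (Z t - Z r) ^ 2)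
      (-(2 * (f r * (Z t - Z r)))) (Ioi r) r := fun r hr' => by
    refine (((hd r hr').const_sub (Z t)).pow 2).congr_deriv ?_
    simp only [Nat.cast_ofNat, Nat.add_one_sub_one, pow_one]
    ring
  have hgc : ContinuousOn (fun r => Z t - Z r) (Icc s t) := continuousOn_const.sub hZc
  have hi : IntervalIntegrable (fun r => -(2 * (f r * (Z t - Z r)))) volume s t :=
    (((hint s hs t ht).mul_continuousOn (by rwa [uIcc_of_le hst])).const_mul 2).neg
  have hFTC := intervalIntegral.integral_eq_sub_of_hasDeriv_right (a := s) (b := t)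
    (f := fun r => (Z t - Z r) ^ 2) (by rw [uIcc_of_le hst]; exact hgc.pow 2)
    (by rw [min_eq_left hst, max_eq_right hst]; exact hd2) hi
  rw [intervalIntegral.integral_neg, intervalIntegral.integral_const_mul] at hFTC
  have e1 : Z s = 0 := by simp [hZ]
  have e2 : ∫ r in s..t, f r * (Z t - Z r) =
      ∫ r in s..t, f r * ∫ r' in s..t, (Ioi r).indicator f r' := by
    refine intervalIntegral.integral_congr fun r hr' => ?_
    rw [uIcc_of_le hst] at hr'
    simp only [hZ]
    rw [intervalIntegral_indicator_Ioi hr',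
      ← intervalIntegral.integral_add_adjacent_intervals (hint s hs r hr') (hint r hr' t ht)]
    ring
  rw [← e2]
  simp only [sub_self, e1, sub_zero] at hFTC
  change Z t ^ 2 = _
  linarith

end PathSpace

/-! ### Finite-dimensional distributions -/

section TwoTimes

variable {n : ℕ} [NeZero n] {F : ℝ → ℝ} {μ : Measure (Config n)} {P : Measure (Path n)}

/-- `IsLaw` prescribes joint laws at times starting from 0, so the three times 0, r, r' are used and
the initial state is summed out. -/
lemma IsLaw.integral_two_times (h : IsLaw n F μ P) {r r' : ℝ} (hr : 0 ≤ r) (hr' : r ≤ r')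
    (φ : Config n → Config n → ℝ) :
    ∫ w, φ (obs w r) (obs w r') ∂P = ∑ η, lawAt n F (fun η => μ.real {η}) r η *
      ∑ ξ, transition n F ((r' - r) * (n : ℝ) ^ 2) η ξ * φ η ξ := by
  have := h.isProbabilityMeasure
  set X : Path n → Config n × Config n × Config n := fun w => (w.1 0, obs w r, obs w r') with hX
  have hXm : Measurable X :=
    ((measurable_pi_apply _).comp measurable_subtype_coe).prodMk
      ((measurable_obs.comp measurable_prodMk_left).prodMk
        (measurable_obs.comp measurable_prodMk_left))
  have hlaw : ∀ z η ξ, (P.map X).real {(z, η, ξ)} = μ.real {z} *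
      (transition n F (r * (n : ℝ) ^ 2) z η * transition n F ((r' - r) * (n : ℝ) ^ 2) η ξ) := by
    intro z η ξ
    have hr2 : 0 ≤ r * (n : ℝ) ^ 2 := by positivity
    have hr2' : 0 ≤ r' * (n : ℝ) ^ 2 := mul_nonneg (hr.trans hr') (by positivity)
    have hle : (r * (n : ℝ) ^ 2).toNNReal ≤ (r' * (n : ℝ) ^ 2).toNNReal :=
      Real.toNNReal_le_toNNReal (mul_le_mul_of_nonneg_right hr' (by positivity))
    have h1 := h.finite_dimensional 2 ![0, (r * (n : ℝ) ^ 2).toNNReal, (r' * (n : ℝ) ^ 2).toNNReal]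
      ![z, η, ξ] (by
        rw [Fin.monotone_iff_le_succ]
        intro i
        fin_cases i
        · simp
        · simpa using hle) rfl
    rw [map_measureReal_apply hXm (measurableSet_singleton _)]
    have e : X ⁻¹' {(z, η, ξ)} = {w | ∀ i, w.1 ((![0, (r * (n : ℝ) ^ 2).toNNReal,
        (r' * (n : ℝ) ^ 2).toNNReal] : Fin 3 → ℝ≥0) i) = (![z, η, ξ] : Fin 3 → Config n) i} := by
      ext w
      simp [hX, Fin.forall_fin_succ, obs]
    rw [e, h1, Fin.prod_univ_two]
    simp [hr2, hr2', sub_mul]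
  have e1 : ∫ w, φ (obs w r) (obs w r') ∂P = ∫ z, φ z.2.1 z.2.2 ∂(P.map X) := by
    rw [integral_map hXm.aemeasurable (Measurable.of_discrete).aestronglyMeasurable]
  have : IsProbabilityMeasure (P.map X) := Measure.isProbabilityMeasure_map hXm.aemeasurable
  rw [e1, integral_fintype Integrable.of_finite, Fintype.sum_prod_type]
  simp only [Fintype.sum_prod_type, hlaw, smul_eq_mul]
  rw [Finset.sum_comm]
  refine Finset.sum_congr rfl fun η _ => ?_
  rw [lawAt, Matrix.vecMul, dotProduct, Finset.sum_mul]
  refine Finset.sum_congr rfl fun z _ => ?_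
  rw [Finset.mul_sum]
  exact Finset.sum_congr rfl fun ξ _ => by ring

lemma IsLaw.integral_one_time (h : IsLaw n F μ P) {r : ℝ} (hr : 0 ≤ r) (φ : Config n → ℝ) :
    ∫ w, φ (obs w r) ∂P = ∑ η, lawAt n F (fun η => μ.real {η}) r η * φ η := by
  rw [h.integral_two_times hr le_rfl (fun η _ => φ η)]
  simp [transition_zero, Matrix.one_apply]

end TwoTimes

/-! ### Second moments of additive functionals -/

section AdditiveFunctionals

set_option linter.unusedSectionVars false

lemma integral_eq_sub_of_hasDerivWithinAt {s t : ℝ} (hst : s ≤ t) {f f' : ℝ → ℝ}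
    (hf : ∀ r ∈ Icc s t, HasDerivWithinAt f (f' r) (Icc s t) r)
    (hf' : ContinuousOn f' (Icc s t)) : ∫ r in s..t, f' r = f t - f s := by
  refine intervalIntegral.integral_eq_sub_of_hasDerivAt_of_le hst
    (fun r hr => (hf r hr).continuousWithinAt) (fun r hr => ?_) ?_
  · exact (hf r (Ioo_subset_Icc_self hr)).hasDerivAt (Icc_mem_nhds hr.1 hr.2)
  · apply ContinuousOn.intervalIntegrable; rwa [uIcc_of_le hst]

variable {n : ℕ} [NeZero n] {F : ℝ → ℝ} {μ : Measure (Config n)} {P : Measure (Path n)}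

/-- The carré du champ of the generator. -/
def carre (n : ℕ) [NeZero n] (F : ℝ → ℝ) (f : Config n → ℝ) (η : Config n) : ℝ :=
  ∑ x, bondRate n F x η * (f (exchange η x (x + 1)) - f η) ^ 2

lemma generator_sq (f : Config n → ℝ) (η : Config n) :
    generator n F (fun η => f η ^ 2) η = 2 * f η * generator n F f η + carre n F f η := by
  simp only [generator_eq_sum_bonds, carre, Finset.mul_sum, ← Finset.sum_add_distrib]
  exact Finset.sum_congr rfl fun x _ => by ring

/-- The square of a time integral is twice an ordered double integral, whose expectation is read off
from the two-time law. The indicator keeps the inner domain fixed so that Fubini applies twice. -/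
lemma IsLaw.integral_sq_eq_correlation (h : IsLaw n F μ P) {A : ℝ → Config n → ℝ}
    (hA : ∀ η, Continuous fun r => A r η) {s t : ℝ} (hs : 0 ≤ s) (hst : s ≤ t) :
    ∫ w, (∫ r in s..t, A r (obs w r)) ^ 2 ∂P =
      2 * ∫ r in s..t, ∑ η, lawAt n F (fun η => μ.real {η}) r η *
        (A r η * ∫ r' in r..t, ∑ ξ, transition n F ((r' - r) * (n : ℝ) ^ 2) η ξ * A r' ξ) := by
  have := h.isProbabilityMeasure
  obtain ⟨B, hB0, hB⟩ := exists_bound_observable hA s t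
  have hm := measurable_observable hA
  set f : ℝ → Path n → ℝ := fun r w => A r (obs w r) with hf
  have hfw : ∀ w, Measurable fun r => f r w := fun w => hm.comp measurable_prodMk_right
  have hBf : ∀ r ∈ Icc s t, ∀ w, |f r w| ≤ B := fun r hr w => hB r hr _
  have hBi : ∀ r, ∀ r' ∈ Icc s t, ∀ w, |(Ioi r).indicator (fun r' => f r' w) r'| ≤ B := by
    intro r r' hr' w
    by_cases hlt : r' ∈ Ioi r
    · rw [indicator_of_mem hlt]; exact hBf r' hr' w
    · rw [indicator_of_notMem hlt, abs_zero]; exact hB0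
  have hpath : ∀ w, (∫ r in s..t, f r w) ^ 2 =
      2 * ∫ r in s..t, f r w * ∫ r' in s..t, (Ioi r).indicator (fun r' => f r' w) r' := fun w =>
    sq_integral_eq (hfw w) (continuousWithinAt_observable hA w) hst (fun r hr => hBf r hr w)
  have hind : Measurable fun p : (ℝ × Path n) × ℝ =>
      (Ioi p.1.1).indicator (fun r' => f r' p.1.2) p.2 := by
    have e : (fun p : (ℝ × Path n) × ℝ => (Ioi p.1.1).indicator (fun r' => f r' p.1.2) p.2) =
        {p : (ℝ × Path n) × ℝ | p.1.1 < p.2}.indicator fun p => f p.2 p.1.2 := by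
      ext p
      simp [indicator_apply]
    rw [e]
    refine Measurable.indicator ?_ (measurableSet_lt (by fun_prop) (by fun_prop))
    exact hm.comp (measurable_snd.prodMk (measurable_snd.comp measurable_fst))
  have hinner : Measurable fun p : ℝ × Path n =>
      ∫ r' in s..t, (Ioi p.1).indicator (fun r' => f r' p.2) r' := by
    simp only [intervalIntegral.integral_of_le hst]
    exact (hind.stronglyMeasurable.integral_prod_right'
      (ν := (volume : Measure ℝ).restrict (Ioc s t))).measurable
  have hinnerB : ∀ r w, |∫ r' in s..t, (Ioi r).indicator (fun r' => f r' w) r'| ≤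
      B * (t - s) := by
    intro r w
    have := intervalIntegral.norm_integral_le_of_norm_le_const (a := s) (b := t) (C := B)
      (f := (Ioi r).indicator (fun r' => f r' w)) (fun r' hr' => by
        rw [uIoc_of_le hst] at hr'
        exact hBi r r' ⟨hr'.1.le, hr'.2⟩ w)
    rwa [abs_of_nonneg (by linarith : 0 ≤ t - s)] at this
  rw [integral_congr_ae (ae_of_all _ hpath), integral_const_mul, integral_intervalIntegral_swap
    (g := fun r w => f r w * ∫ r' in s..t, (Ioi r).indicator (fun r' => f r' w) r')
    (hm.mul hinner) hst (B := B * (B * (t - s))) (fun r hr w => by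
      rw [abs_mul]; exact mul_le_mul (hBf r hr w) (hinnerB r w) (abs_nonneg _) hB0)]
  congr 1
  refine intervalIntegral.integral_congr fun r hr => ?_
  rw [uIcc_of_le hst] at hr
  have hr0 : 0 ≤ r := hs.trans hr.1
  simp only [← intervalIntegral.integral_const_mul]
  rw [integral_intervalIntegral_swap
    (g := fun r' w => f r w * (Ioi r).indicator (fun r' => f r' w) r') ?_ hst (B := B * B)
    (fun r' hr' w => by
      rw [abs_mul]; exact mul_le_mul (hBf r hr w) (hBi r r' hr' w) (abs_nonneg _) hB0)]
  · have e : ∀ r', ∫ w, f r w * (Ioi r).indicator (fun r' => f r' w) r' ∂P =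
        (Ioi r).indicator (fun r' => ∑ η, lawAt n F (fun η => μ.real {η}) r η *
          (A r η * ∑ ξ, transition n F ((r' - r) * (n : ℝ) ^ 2) η ξ * A r' ξ)) r' := by
      intro r'
      by_cases hlt : r' ∈ Ioi r
      · simp only [indicator_of_mem hlt]
        rw [h.integral_two_times hr0 (mem_Ioi.1 hlt).le (fun η ξ => A r η * A r' ξ)]
        refine Finset.sum_congr rfl fun η _ => ?_
        rw [Finset.mul_sum (a := A r η)]
        congr 1
        exact Finset.sum_congr rfl fun ξ _ => by ring
      · simp only [indicator_of_notMem hlt, mul_zero, integral_zero]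
    simp only [e]
    rw [intervalIntegral_indicator_Ioi hr]
    have hc : ∀ η, Continuous fun r' =>
        ∑ ξ, transition n F ((r' - r) * (n : ℝ) ^ 2) η ξ * A r' ξ := fun η =>
      continuous_finsetSum _ fun ξ _ => by
        have h1 : Continuous fun r : ℝ => transition n F (r * (n : ℝ) ^ 2) η ξ :=
          continuous_iff_continuousAt.2 fun r => (hasDerivAt_transition F η ξ r).continuousAt
        exact (h1.comp (continuous_id.sub continuous_const)).mul (hA ξ)
    exact intervalIntegral.integral_finsetSum fun η _ =>
      ((continuous_const.mul (continuous_const.mul (hc η))).intervalIntegrable _ _)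
  · have h1 : Measurable fun p : ℝ × Path n => f r p.2 :=
      (hm.comp measurable_prodMk_left).comp measurable_snd
    exact h1.mul (hind.comp
      (g := fun p : (ℝ × Path n) × ℝ => (Ioi p.1.1).indicator (fun r' => f r' p.1.2) p.2)
      (f := fun p : ℝ × Path n => ((r, p.2), p.1)) (by fun_prop))

variable {A Φ Φ' : ℝ → Config n → ℝ} {s t : ℝ}

/-- Duhamel's formula. -/
lemma integral_transition_eq
    (hA : ∀ η, Continuous fun r => A r η)
    (hΦ : ∀ r ∈ Icc s t, ∀ η, HasDerivWithinAt (fun r => Φ r η) (Φ' r η) (Icc s t) r)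
    (hAΦ : ∀ r ∈ Icc s t, ∀ η, A r η = Φ' r η + (n : ℝ) ^ 2 * generator n F (Φ r) η)
    (hend : ∀ η, Φ t η = 0) {r : ℝ} (hr : r ∈ Icc s t) (η : Config n) :
    ∫ r' in r..t, ∑ ξ, transition n F ((r' - r) * (n : ℝ) ^ 2) η ξ * A r' ξ = -Φ r η := by
  have hsub : Icc r t ⊆ Icc s t := Icc_subset_Icc_left hr.1
  have htr : ∀ r' ξ, HasDerivAt (fun r' : ℝ => transition n F ((r' - r) * (n : ℝ) ^ 2) η ξ)
      ((n : ℝ) ^ 2 * (transition n F ((r' - r) * (n : ℝ) ^ 2) * generatorMatrix n F) η ξ) r' :=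
    fun r' ξ => (hasDerivAt_transition F η ξ (r' - r)).comp_sub_const r' r
  have hd : ∀ r' ∈ Icc r t, HasDerivWithinAt
      (fun r' => ∑ ξ, transition n F ((r' - r) * (n : ℝ) ^ 2) η ξ * Φ r' ξ)
      (∑ ξ, transition n F ((r' - r) * (n : ℝ) ^ 2) η ξ * A r' ξ) (Icc r t) r' := by
    intro r' hr'
    have h1 := HasDerivWithinAt.fun_sum (u := Finset.univ) fun ξ _ =>
      ((htr r' ξ).hasDerivWithinAt (s := Icc r t)).mul ((hΦ r' (hsub hr') ξ).mono hsub)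
    refine h1.congr_deriv ?_
    rw [Finset.sum_add_distrib]
    have e : ∑ ξ, (n : ℝ) ^ 2 * (transition n F ((r' - r) * (n : ℝ) ^ 2) *
        generatorMatrix n F) η ξ * Φ r' ξ = ∑ ξ, transition n F ((r' - r) * (n : ℝ) ^ 2) η ξ *
          ((n : ℝ) ^ 2 * generator n F (Φ r') ξ) := by
      have := vecMul_generatorMatrix_sum F (transition n F ((r' - r) * (n : ℝ) ^ 2) η) (Φ r')
      simp only [mul_assoc, ← Finset.mul_sum, mul_left_comm _ ((n : ℝ) ^ 2)]
      congr 1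
    rw [e, ← Finset.sum_add_distrib]
    refine Finset.sum_congr rfl fun ξ _ => ?_
    rw [hAΦ r' (hsub hr') ξ]; ring
  have hc : Continuous fun r' => ∑ ξ, transition n F ((r' - r) * (n : ℝ) ^ 2) η ξ * A r' ξ :=
    continuous_finsetSum _ fun ξ _ =>
      (continuous_iff_continuousAt.2 fun r' => (htr r' ξ).continuousAt).mul (hA ξ)
  rw [integral_eq_sub_of_hasDerivWithinAt hr.2 hd hc.continuousOn]
  simp [hend, transition_zero, Matrix.one_apply]

/-- The variance of the additive functional of `(∂ᵣ + n² L) Φ`. -/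
theorem IsLaw.integral_sq_additive (h : IsLaw n F μ P) (hs : 0 ≤ s) (hst : s ≤ t)
    (hA : ∀ η, Continuous fun r => A r η)
    (hΦ : ∀ r ∈ Icc s t, ∀ η, HasDerivWithinAt (fun r => Φ r η) (Φ' r η) (Icc s t) r)
    (hAΦ : ∀ r ∈ Icc s t, ∀ η, A r η = Φ' r η + (n : ℝ) ^ 2 * generator n F (Φ r) η)
    (hend : ∀ η, Φ t η = 0) :
    ∫ w, (∫ r in s..t, A r (obs w r)) ^ 2 ∂P =
      ∑ η, lawAt n F (fun η => μ.real {η}) s η * Φ s η ^ 2 +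
        ∫ r in s..t, ∑ η, lawAt n F (fun η => μ.real {η}) r η *
          ((n : ℝ) ^ 2 * carre n F (Φ r) η) := by
  set p : Config n → ℝ := fun η => μ.real {η} with hp
  rw [h.integral_sq_eq_correlation hA hs hst]
  -- By Duhamel's formula the conditional expectation of the remaining integral, given the
  -- configuration at time r, is -Φ_r.
  have e1 : ∫ r in s..t, ∑ η, lawAt n F p r η *
        (A r η * ∫ r' in r..t, ∑ ξ, transition n F ((r' - r) * (n : ℝ) ^ 2) η ξ * A r' ξ) =
      ∫ r in s..t, ∑ η, lawAt n F p r η * (A r η * -Φ r η) := by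
    refine intervalIntegral.integral_congr fun r hr => ?_
    rw [uIcc_of_le hst] at hr
    simp only [integral_transition_eq hA hΦ hAΦ hend hr]
  rw [e1]
  have hΦc : ∀ η, ContinuousOn (fun r => Φ r η) (Icc s t) := fun η r hr =>
    (hΦ r hr η).continuousWithinAt
  have hlc : ∀ η, ContinuousOn (fun r => lawAt n F p r η) (Icc s t) := fun η =>
    (continuous_lawAt F p η).continuousOn
  have hAc : ∀ η, ContinuousOn (fun r => A r η) (Icc s t) := fun η => (hA η).continuousOn
  have c1 : ContinuousOn (fun r => ∑ η, lawAt n F p r η * (A r η * -Φ r η)) (Icc s t) :=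
    continuousOn_finsetSum _ fun η _ => (hlc η).mul ((hAc η).mul (hΦc η).neg)
  have c2 : ContinuousOn (fun r => ∑ η, lawAt n F p r η * ((n : ℝ) ^ 2 * carre n F (Φ r) η))
      (Icc s t) := by
    refine continuousOn_finsetSum _ fun η _ => (hlc η).mul (continuousOn_const.mul ?_)
    unfold carre
    exact continuousOn_finsetSum _ fun x _ =>
      continuousOn_const.mul (((hΦc _).sub (hΦc _)).pow 2)
  -- The derivative of E[Φ²] is E[2ΦΦ' + n²L(Φ²)]. Since L(Φ²) = 2ΦLΦ plus the carré du champ, this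
  -- is 2E[ΦA] plus n² times the mean carré du champ; integration up to Φ_t = 0 gives the identity.
  have hd : ∀ r ∈ Icc s t, HasDerivWithinAt (fun r => ∑ η, lawAt n F p r η * Φ r η ^ 2)
      (-(2 * ∑ η, lawAt n F p r η * (A r η * -Φ r η)) +
        ∑ η, lawAt n F p r η * ((n : ℝ) ^ 2 * carre n F (Φ r) η)) (Icc s t) r := by
    intro r hr
    have h1 := HasDerivWithinAt.fun_sum (u := Finset.univ) fun η _ =>
      ((hasDerivAt_lawAt F p η r).hasDerivWithinAt (s := Icc s t)).mul ((hΦ r hr η).pow 2)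
    refine h1.congr_deriv ?_
    rw [Finset.sum_add_distrib]
    have e : ∑ η, (n : ℝ) ^ 2 * (Matrix.vecMul (lawAt n F p r) (generatorMatrix n F)) η *
        Φ r η ^ 2 = ∑ η, lawAt n F p r η * ((n : ℝ) ^ 2 *
          generator n F (fun η => Φ r η ^ 2) η) := by
      have := vecMul_generatorMatrix_sum F (lawAt n F p r) (fun η => Φ r η ^ 2)
      simp only [mul_assoc, ← Finset.mul_sum, mul_left_comm _ ((n : ℝ) ^ 2)]
      congr 1
    simp only [Pi.pow_apply]
    rw [e, ← Finset.sum_add_distrib, Finset.mul_sum, ← Finset.sum_neg_distrib,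
      ← Finset.sum_add_distrib]
    refine Finset.sum_congr rfl fun η _ => ?_
    rw [hAΦ r hr η, generator_sq]
    simp only [Nat.cast_ofNat, Nat.add_one_sub_one, pow_one]
    ring
  have hi1 : IntervalIntegrable (fun r => ∑ η, lawAt n F p r η * (A r η * -Φ r η)) volume s t :=
    ContinuousOn.intervalIntegrable (by rwa [uIcc_of_le hst])
  have hi2 : IntervalIntegrable (fun r => ∑ η, lawAt n F p r η *
      ((n : ℝ) ^ 2 * carre n F (Φ r) η)) volume s t :=
    ContinuousOn.intervalIntegrable (by rwa [uIcc_of_le hst])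
  have hi3 : IntervalIntegrable (fun r => -(2 * ∑ η, lawAt n F p r η * (A r η * -Φ r η)))
      volume s t := (hi1.const_mul 2).neg
  have hFTC := integral_eq_sub_of_hasDerivWithinAt hst hd ((continuousOn_const.mul c1).neg.add c2)
  rw [intervalIntegral.integral_add hi3 hi2, intervalIntegral.integral_neg,
    intervalIntegral.integral_const_mul] at hFTC
  simp only [hend] at hFTC
  simp only [ne_eq, OfNat.ofNat_ne_zero, not_false_eq_true, zero_pow, mul_zero,
    Finset.sum_const_zero, zero_sub] at hFTC
  linarith

/-- The second moment of a time integral. -/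
lemma IsLaw.integral_sq_le (h : IsLaw n F μ P) (hs : 0 ≤ s) (hst : s ≤ t)
    (hA : ∀ η, Continuous fun r => A r η) :
    ∫ w, (∫ r in s..t, A r (obs w r)) ^ 2 ∂P ≤
      (t - s) * ∫ r in s..t, ∑ η, lawAt n F (fun η => μ.real {η}) r η * A r η ^ 2 := by
  have := h.isProbabilityMeasure
  have hA2 : ∀ η, Continuous fun r => A r η ^ 2 := fun η => (hA η).pow 2
  obtain ⟨B, hB0, hB⟩ := exists_bound_observable hA s t
  obtain ⟨B', hB0', hB'⟩ := exists_bound_observable hA2 s t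
  have hm := measurable_observable hA2
  have hsm : StronglyMeasurable fun w : Path n => ∫ r in s..t, A r (obs w r) ^ 2 := by
    simp only [intervalIntegral.integral_of_le hst]
    exact StronglyMeasurable.integral_prod_left' (μ := (volume : Measure ℝ).restrict (Ioc s t))
      (f := fun p : ℝ × Path n => A p.1 (obs p.2 p.1) ^ 2) hm.stronglyMeasurable
  have hi : Integrable (fun w : Path n => ∫ r in s..t, A r (obs w r) ^ 2) P := by
    refine Integrable.of_bound hsm.aestronglyMeasurable (B' * |t - s|) (ae_of_all _ fun w => ?_)
    refine intervalIntegral.norm_integral_le_of_norm_le_const fun r hr => ?_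
    rw [uIoc_of_le hst] at hr
    exact hB' r ⟨hr.1.le, hr.2⟩ _
  calc _ ≤ ∫ w, (t - s) * (∫ r in s..t, A r (obs w r) ^ 2) ∂P := by
        refine integral_mono_of_nonneg (ae_of_all _ fun w => sq_nonneg _) (hi.const_mul _)
          (ae_of_all _ fun w => ?_)
        exact sq_integral_le (intervalIntegrable_observable hA w hst)
          (intervalIntegrable_observable hA2 w hst) hst
    _ = _ := by
        rw [integral_const_mul, integral_intervalIntegral_swap
          (g := fun r w => A r (obs w r) ^ 2) hm hst (fun r hr w => hB' r hr _)]
        congr 1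
        refine intervalIntegral.integral_congr fun r hr => ?_
        rw [uIcc_of_le hst] at hr
        exact h.integral_one_time (hs.trans hr.1) fun η => A r η ^ 2

end AdditiveFunctionals

/-! ### The backward discrete heat equation with a source at the origin -/

section Heat

set_option linter.unusedSectionVars false

variable {n : ℕ} [NeZero n]

/-- The discrete Laplacian, accelerated by `n²`. -/
def lap (n : ℕ) (g : ZMod n → ℝ) (x : ZMod n) : ℝ :=
  (n : ℝ) ^ 2 * (g (x + 1) + g (x - 1) - 2 * g x)

/-- The discrete Dirichlet form, accelerated by `n²`. -/
def dirichlet (n : ℕ) [NeZero n] (g : ZMod n → ℝ) : ℝ := (n : ℝ) ^ 2 * ∑ x, (g (x + 1) - g x) ^ 2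

/-- The matrix of the discrete Laplacian. -/
def lapMatrix (n : ℕ) [NeZero n] : Matrix (ZMod n) (ZMod n) ℝ :=
  Matrix.of fun x y => lap n (Pi.single y 1) x

lemma lapMatrix_mulVec (g : ZMod n → ℝ) : (lapMatrix n).mulVec g = lap n g := by
  ext x
  have h : ∀ z : ZMod n, ∑ y, (Pi.single y 1 : ZMod n → ℝ) z * g y = g z := fun z => by
    simp [Pi.single_apply]
  simp only [Matrix.mulVec, dotProduct, lapMatrix, Matrix.of_apply, lap]
  rw [← h (x + 1), ← h (x - 1), ← h x]
  simp only [Finset.mul_sum, ← Finset.sum_add_distrib, ← Finset.sum_sub_distrib]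
  exact Finset.sum_congr rfl fun y _ => by ring

/-- Variation of constants. The semigroup is split as exp (-rL) exp (r'L), so that r enters the
integral only through its lower limit. -/
lemma exists_backward_heat {v : ℝ → ℝ} (hv : Continuous v) (t : ℝ) :
    ∃ G : ℝ → ZMod n → ℝ, (∀ x, G t x = 0) ∧ ∀ r x,
      HasDerivAt (fun r => G r x) (-lap n (G r) x - if x = 0 then √n * v r else 0) r := by
  set L := lapMatrix n with hL
  set I : ℝ → ZMod n → ℝ := fun r y =>
    ∫ r' in r..t, √n * v r' * NormedSpace.exp (r' • L) y 0 with hI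
  set G : ℝ → ZMod n → ℝ := fun r x => ∑ y, NormedSpace.exp ((-r) • L) x y * I r y with hG
  refine ⟨G, fun x => by simp [hG, hI], fun r x => ?_⟩
  have hce : ∀ y, Continuous fun r' : ℝ => √n * v r' * NormedSpace.exp (r' • L) y 0 := fun y =>
    (continuous_const.mul hv).mul (continuous_iff_continuousAt.2 fun r' =>
      (hasDerivAt_exp_smul_apply L r' y 0).continuousAt)
  have hId : ∀ y, HasDerivAt (fun r => I r y) (-(√n * v r * NormedSpace.exp (r • L) y 0)) r :=
    fun y => intervalIntegral.integral_hasDerivAt_left ((hce y).intervalIntegrable _ _)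
      ((hce y).stronglyMeasurableAtFilter _ _) (hce y).continuousAt
  have hEd : ∀ y, HasDerivAt (fun r : ℝ => NormedSpace.exp ((-r) • L) x y)
      (-(NormedSpace.exp ((-r) • L) * L) x y) r := fun y => by
    have := (hasDerivAt_exp_smul_apply L (-r) x y).comp r (hasDerivAt_neg r)
    rwa [mul_neg, mul_one] at this
  have hd := HasDerivAt.fun_sum (u := Finset.univ) fun y _ => (hEd y).mul (hId y)
  refine hd.congr_deriv ?_
  rw [Finset.sum_add_distrib]
  have e1 : ∑ y, -(NormedSpace.exp ((-r) • L) * L) x y * I r y = -lap n (G r) x := by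
    have h1 : G r = (NormedSpace.exp ((-r) • L)).mulVec (I r) := rfl
    rw [← lapMatrix_mulVec, h1, Matrix.mulVec_mulVec, ← hL, ← exp_smul_mul_comm]
    simp [Matrix.mulVec, dotProduct]
  have e2 : ∑ y, NormedSpace.exp ((-r) • L) x y * -(√n * v r * NormedSpace.exp (r • L) y 0) =
      -(√n * v r * (NormedSpace.exp ((-r) • L) * NormedSpace.exp (r • L)) x 0) := by
    rw [Matrix.mul_apply, Finset.mul_sum, ← Finset.sum_neg_distrib]
    exact Finset.sum_congr rfl fun y _ => by ring
  rw [e1, e2, ← exp_add_smul, neg_add_cancel, zero_smul, NormedSpace.exp_zero, Matrix.one_apply]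
  split_ifs <;> ring

lemma sum_mul_lap (g : ZMod n → ℝ) : ∑ x, g x * lap n g x = -dirichlet n g := by
  have h1 : ∑ x, g x * g (x - 1) = ∑ x, g (x + 1) * g x := by
    rw [← Equiv.sum_comp (Equiv.addRight (1 : ZMod n))]
    simp
  have h2 : ∑ x, g (x + 1) ^ 2 = ∑ x, g x ^ 2 :=
    Equiv.sum_comp (Equiv.addRight (1 : ZMod n)) (fun x => g x ^ 2)
  have e1 : ∑ x, g x * lap n g x =
      (n : ℝ) ^ 2 * (∑ x, g (x + 1) * g x + ∑ x, g x * g (x - 1) - 2 * ∑ x, g x ^ 2) := by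
    simp only [Finset.mul_sum, ← Finset.sum_add_distrib, ← Finset.sum_sub_distrib, lap]
    exact Finset.sum_congr rfl fun x _ => by ring
  have e2 : dirichlet n g =
      (n : ℝ) ^ 2 * (∑ x, g (x + 1) ^ 2 + ∑ x, g x ^ 2 - 2 * ∑ x, g (x + 1) * g x) := by
    simp only [dirichlet, Finset.mul_sum, ← Finset.sum_add_distrib, ← Finset.sum_sub_distrib]
    exact Finset.sum_congr rfl fun x _ => by ring
  rw [e1, e2, h1, h2]; ring

lemma sq_zero_le_sq_add_sum (g : ZMod n → ℝ) (x : ZMod n) :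
    g 0 ^ 2 ≤ g x ^ 2 + ∑ y, |g (y + 1) ^ 2 - g y ^ 2| := by
  have h1 : ∀ k : ℕ, k ≤ n → |g (k : ZMod n) ^ 2 - g 0 ^ 2| ≤ ∑ y, |g (y + 1) ^ 2 - g y ^ 2| := by
    intro k hk
    have e : g (k : ZMod n) ^ 2 - g 0 ^ 2 =
        ∑ j ∈ Finset.range k, (g ((j : ZMod n) + 1) ^ 2 - g (j : ZMod n) ^ 2) := by
      have := Finset.sum_range_sub (fun j : ℕ => g (j : ZMod n) ^ 2) k
      simp only [Nat.cast_add, Nat.cast_one, Nat.cast_zero] at this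
      exact this.symm
    rw [e, ← sum_range_natCast fun y : ZMod n => |g (y + 1) ^ 2 - g y ^ 2|]
    refine (Finset.abs_sum_le_sum_abs _ _).trans ?_
    exact Finset.sum_le_sum_of_subset_of_nonneg (Finset.range_mono hk) fun _ _ _ => abs_nonneg _
  have h2 := h1 x.val (ZMod.val_lt x).le
  rw [ZMod.natCast_rightInverse x] at h2
  linarith [neg_abs_le (g x ^ 2 - g 0 ^ 2)]

/-- A discrete Sobolev inequality. -/
lemma sobolev (g : ZMod n → ℝ) :
    n * g 0 ^ 2 ≤ ∑ x, g x ^ 2 + 2 * (√(∑ x, g x ^ 2) * √(dirichlet n g)) := by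
  set N := ∑ x, g x ^ 2 with hN
  set D := ∑ x, (g (x + 1) - g x) ^ 2 with hD
  have hN0 : 0 ≤ N := Finset.sum_nonneg fun _ _ => sq_nonneg _
  have h2 : ∑ x, g (x + 1) ^ 2 = N :=
    Equiv.sum_comp (Equiv.addRight (1 : ZMod n)) (fun x => g x ^ 2)
  have h3 : ∑ x, |g (x + 1) + g x| ^ 2 ≤ 4 * N := by
    have : ∑ x, |g (x + 1) + g x| ^ 2 ≤ ∑ x, (2 * g (x + 1) ^ 2 + 2 * g x ^ 2) :=
      Finset.sum_le_sum fun x _ => by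
        rw [sq_abs]; nlinarith [sq_nonneg (g (x + 1) - g x)]
    rw [Finset.sum_add_distrib, ← Finset.mul_sum, ← Finset.mul_sum, h2] at this
    linarith
  have h1 : ∑ y, |g (y + 1) ^ 2 - g y ^ 2| ≤ 2 * (√N * √D) := by
    have e : ∀ y, |g (y + 1) ^ 2 - g y ^ 2| = |g (y + 1) - g y| * |g (y + 1) + g y| := fun y => by
      rw [← abs_mul]; congr 1; ring
    simp only [e]
    have hcs := Real.sum_mul_le_sqrt_mul_sqrt Finset.univ
      (fun y : ZMod n => |g (y + 1) - g y|) (fun y => |g (y + 1) + g y|)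
    have h4 : √(4 * N) = 2 * √N := by
      rw [Real.sqrt_mul (by norm_num), show (4 : ℝ) = 2 ^ 2 by norm_num,
        Real.sqrt_sq (by norm_num)]
    simp only [sq_abs (g _ - g _)] at hcs
    calc _ ≤ _ := hcs
      _ ≤ √D * √(4 * N) := by gcongr
      _ = _ := by rw [h4]; ring
  have h5 : ∑ x : ZMod n, g 0 ^ 2 ≤ ∑ x, (g x ^ 2 + 2 * (√N * √D)) :=
    Finset.sum_le_sum fun x _ => (sq_zero_le_sq_add_sum g x).trans (by linarith)
  rw [Finset.sum_add_distrib] at h5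
  simp only [Finset.sum_const, Finset.card_univ, ZMod.card, nsmul_eq_mul] at h5
  have h6 : √(dirichlet n g) = n * √D := by
    rw [dirichlet, Real.sqrt_mul (by positivity), Real.sqrt_sq (by positivity)]
  rw [h6]
  linarith

/-- The constant of the energy estimate. -/
def heatConst (T M : ℝ) : ℝ := 4 * M ^ 2 * (((1 + √T) / 2) ^ 2 + 1 / 2)

/-- The origin of the exponent. With S the largest ℓ² norm and g the square root of the Dirichlet
energy, Sobolev gives √n|G(0)| ≤ √(S(S + 2g)), and Young with weights 1/z and z, z = τ^(1/4),
separates S from g. Over a time z⁴ the source contributes at most of order z³S + z⁶, after part of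
the energy is absorbed, hence S² and the integrated energy are of order z⁶ = τ^(3/2). -/
theorem heat_energy {v : ℝ → ℝ} (hv : Continuous v) {M T s t : ℝ} (hM : ∀ r ∈ Icc s t, |v r| ≤ M)
    (hst : s < t) (hT : t - s ≤ T) {G : ℝ → ZMod n → ℝ} (hend : ∀ x, G t x = 0)
    (hG : ∀ r x, HasDerivAt (fun r => G r x)
      (-lap n (G r) x - if x = 0 then √n * v r else 0) r) :
    (∀ r ∈ Icc s t, ∑ x, G r x ^ 2 ≤ heatConst T M * √√(t - s) ^ 6) ∧
      ∫ r in s..t, dirichlet n (G r) ≤ heatConst T M * √√(t - s) ^ 6 := by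
  have hτ : 0 < t - s := by linarith
  have hM0 : 0 ≤ M := (abs_nonneg _).trans (hM s (left_mem_Icc.2 hst.le))
  set z := √√(t - s) with hz
  have hz0 : 0 < z := Real.sqrt_pos.2 (Real.sqrt_pos.2 hτ)
  have hz2 : z ^ 2 = √(t - s) := Real.sq_sqrt (Real.sqrt_nonneg _)
  have hz4 : z ^ 4 = t - s := by
    rw [show z ^ 4 = (z ^ 2) ^ 2 by ring, hz2, Real.sq_sqrt hτ.le]
  have hzT : z ^ 2 ≤ √T := by rw [hz2]; exact Real.sqrt_le_sqrt hT
  have hGc : ∀ x, Continuous fun r => G r x := fun x =>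
    continuous_iff_continuousAt.2 fun r => (hG r x).continuousAt
  set N : ℝ → ℝ := fun r => ∑ x, G r x ^ 2 with hN
  set D : ℝ → ℝ := fun r => dirichlet n (G r) with hD
  have hNc : Continuous N := continuous_finsetSum _ fun x _ => (hGc x).pow 2
  have hDc : Continuous D := continuous_const.mul
    (continuous_finsetSum _ fun x _ => ((hGc _).sub (hGc _)).pow 2)
  have hN0 : ∀ r, 0 ≤ N r := fun r => Finset.sum_nonneg fun _ _ => sq_nonneg _
  have hD0 : ∀ r, 0 ≤ D r := fun r =>
    mul_nonneg (by positivity) (Finset.sum_nonneg fun _ _ => sq_nonneg _)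
  have hNd : ∀ r, HasDerivAt N (2 * D r - 2 * (√n * v r * G r 0)) r := by
    intro r
    have h1 := HasDerivAt.fun_sum (u := Finset.univ) fun x _ => (hG r x).pow 2
    refine h1.congr_deriv ?_
    have e : 2 * D r = -(2 * ∑ x, G r x * lap n (G r) x) := by rw [sum_mul_lap]; ring
    have e' : 2 * (√n * v r * G r 0) = 2 * ∑ x, if x = 0 then √n * v r * G r x else 0 := by simp
    rw [e, e', Finset.mul_sum, Finset.mul_sum, ← Finset.sum_neg_distrib,
      ← Finset.sum_sub_distrib]
    refine Finset.sum_congr rfl fun x _ => ?_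
    simp only [Nat.cast_ofNat, Nat.add_one_sub_one, pow_one]
    split_ifs <;> ring
  -- The norm is controlled by its own maximum: the energy identity at r₀ bounds S²/2 by S²/4 plus a
  -- term of order z⁶.
  obtain ⟨r₀, hr₀, hmax⟩ := isCompact_Icc.exists_isMaxOn (nonempty_Icc.2 hst.le)
    (hNc.continuousOn (s := Icc s t))
  set S := √(N r₀) with hS
  have hS0 : 0 ≤ S := Real.sqrt_nonneg _
  have hS2 : S ^ 2 = N r₀ := Real.sq_sqrt (hN0 _)
  -- the source is dominated by the energy
  have hsrc : ∀ r ∈ Icc s t, √n * v r * G r 0 ≤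
      M / 2 * (1 / z + z) * S + D r / 2 + M ^ 2 * z ^ 2 / 2 := by
    intro r hr
    have h1 := sobolev (G r)
    set g := √(D r) with hg
    have hg0 : 0 ≤ g := Real.sqrt_nonneg _
    have hg2 : g ^ 2 = D r := Real.sq_sqrt (hD0 r)
    have h2 : √(N r) ≤ S := Real.sqrt_le_sqrt (hmax hr)
    have h3 : (√n * |G r 0|) ^ 2 ≤ S * (S + 2 * g) := by
      rw [mul_pow, Real.sq_sqrt (by positivity), sq_abs]
      have h5 : N r ≤ S ^ 2 := by rw [hS2]; exact hmax hr
      have h6 : √(N r) * g ≤ S * g := by gcongr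
      have : ∑ x, G r x ^ 2 = N r := rfl
      rw [this] at h1
      change _ ≤ N r + 2 * (√(N r) * g) at h1
      linarith
    set y := √n * |G r 0| with hy
    have hy0 : 0 ≤ y := by positivity
    have h4 : y ≤ (1 / z * S + z * (S + 2 * g)) / 2 := by
      refine le_of_sq_le_sq ?_ (by positivity)
      refine h3.trans ?_
      have e : S * (S + 2 * g) = (1 / z * S) * (z * (S + 2 * g)) := by field_simp
      rw [e]
      nlinarith [sq_nonneg (1 / z * S - z * (S + 2 * g))]
    have h5 : √n * v r * G r 0 ≤ M * y := by
      calc √n * v r * G r 0 = v r * (√n * G r 0) := by ring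
        _ ≤ |v r * (√n * G r 0)| := le_abs_self _
        _ = |v r| * y := by rw [abs_mul, abs_mul, abs_of_nonneg (Real.sqrt_nonneg (n : ℝ))]
        _ ≤ M * y := mul_le_mul_of_nonneg_right (hM r hr) hy0
    have h6 : M * y ≤ M * ((1 / z * S + z * (S + 2 * g)) / 2) := by gcongr
    have h7 : M * ((1 / z * S + z * (S + 2 * g)) / 2) = M / 2 * (1 / z + z) * S + M * z * g := by
      ring
    rw [← hg2]
    nlinarith [sq_nonneg (g - M * z)]
  set c := (1 + √T) / 2 with hc
  have hc0 : 0 ≤ c := by positivity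
  -- the energy identity
  have hmain : ∀ r ∈ Icc s t, N r / 2 + (∫ r' in r..t, D r') / 2 ≤
      S ^ 2 / 4 + M ^ 2 * z ^ 6 * (c ^ 2 + 1 / 2) := by
    intro r hr
    have cG : Continuous fun r' => √n * v r' * G r' 0 := (continuous_const.mul hv).mul (hGc 0)
    have h1 := integral_eq_sub_of_hasDerivWithinAt hr.2
      (fun r' _ => (hNd r').hasDerivWithinAt (s := Icc r t))
      (((continuous_const.mul hDc).sub (continuous_const.mul cG)).continuousOn)
    have e2 : N t = 0 := by simp [hN, hend]
    have c2D : Continuous fun r' => 2 * D r' := continuous_const.mul hDc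
    have c2G : Continuous fun r' => 2 * (√n * v r' * G r' 0) := continuous_const.mul cG
    rw [intervalIntegral.integral_sub (c2D.intervalIntegrable _ _)
      (c2G.intervalIntegrable _ _), intervalIntegral.integral_const_mul,
      intervalIntegral.integral_const_mul, e2] at h1
    have cR : Continuous fun r' => M / 2 * (1 / z + z) * S + D r' / 2 + M ^ 2 * z ^ 2 / 2 := by
      fun_prop
    have h2 := intervalIntegral.integral_mono_on (μ := volume) hr.2 (cG.intervalIntegrable r t)
      (cR.intervalIntegrable r t) (fun r' hr' => hsrc r' ⟨hr.1.trans hr'.1, hr'.2⟩)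
    have e3 : ∫ r' in r..t, (M / 2 * (1 / z + z) * S + D r' / 2 + M ^ 2 * z ^ 2 / 2) =
        (t - r) * (M / 2 * (1 / z + z) * S + M ^ 2 * z ^ 2 / 2) + (∫ r' in r..t, D r') / 2 := by
      have c1 : Continuous fun r' => D r' / 2 := by fun_prop
      have c2 : Continuous fun r' => M / 2 * (1 / z + z) * S + D r' / 2 := by fun_prop
      rw [intervalIntegral.integral_add (c2.intervalIntegrable _ _) (by simp),
        intervalIntegral.integral_add (by simp) (c1.intervalIntegrable _ _),
        intervalIntegral.integral_div, intervalIntegral.integral_const,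
        intervalIntegral.integral_const, smul_eq_mul, smul_eq_mul]
      ring
    rw [e3] at h2
    have h4 : (t - r) * (M / 2 * (1 / z + z) * S + M ^ 2 * z ^ 2 / 2) ≤
        z ^ 4 * (M / 2 * (1 / z + z) * S + M ^ 2 * z ^ 2 / 2) := by
      rw [hz4]
      exact mul_le_mul_of_nonneg_right (by linarith [hr.1]) (by positivity)
    have e5 : z ^ 4 * (M / 2 * (1 / z + z) * S + M ^ 2 * z ^ 2 / 2) =
        M * z ^ 3 * ((1 + z ^ 2) / 2) * S + M ^ 2 * z ^ 6 / 2 := by field_simp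
    have h6 : M * z ^ 3 * ((1 + z ^ 2) / 2) * S ≤ M * z ^ 3 * c * S := by
      gcongr
      rw [hc]; linarith
    have h7 : M * z ^ 3 * c * S ≤ S ^ 2 / 4 + M ^ 2 * z ^ 6 * c ^ 2 := by
      nlinarith [sq_nonneg (S / 2 - M * z ^ 3 * c)]
    rw [e5] at h4
    linarith
  have hI0 : ∀ r ∈ Icc s t, 0 ≤ ∫ r' in r..t, D r' := fun r hr =>
    intervalIntegral.integral_nonneg hr.2 fun r' _ => hD0 r'
  have hSb : S ^ 2 ≤ heatConst T M * z ^ 6 := by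
    have h1 := hmain r₀ hr₀
    have h2 := hI0 r₀ hr₀
    rw [← hS2] at h1
    unfold heatConst
    rw [← hc]
    linarith
  refine ⟨fun r hr => ?_, ?_⟩
  · refine le_trans ?_ hSb
    rw [hS2]
    exact hmax hr
  · have h1 := hmain s (left_mem_Icc.2 hst.le)
    have h2 := hN0 s
    have h3 : heatConst T M * z ^ 6 = 4 * (M ^ 2 * z ^ 6 * (c ^ 2 + 1 / 2)) := by
      unfold heatConst; ring
    change ∫ r in s..t, D r ≤ _
    linarith

end Heat

/-! ### Linear functionals of the configuration -/

section LinearFunctionals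

set_option linter.unusedSectionVars false

variable {n : ℕ} [NeZero n]

lemma occ_sub_eq_flu {ε : ℝ} {a : ZMod n → ℝ} (h : Elliptic ε a) (hε : 0 < ε) (x : ZMod n)
    (η : Config n) : occ η x - a x = a x * (1 - a x) * flu a x η := by
  have h1 := (h.pos hε x).ne'
  have h2 := (h.one_sub_pos hε x).ne'
  unfold occ flu
  split_ifs
  · field_simp
  · field_simp; ring

/-- The density field of `g`, centered at the profile `a`. -/
def field (a g : ZMod n → ℝ) (η : Config n) : ℝ := ∑ x, g x * (occ η x - a x)

lemma field_exchange (a g : ZMod n → ℝ) (η : Config n) {x y : ZMod n} (hxy : x ≠ y) :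
    field a g (exchange η x y) - field a g η = (g y - g x) * (occ η x - occ η y) := by
  unfold field
  rw [← Finset.sum_sub_distrib]
  have e : ∀ z, g z * (occ (exchange η x y) z - a z) - g z * (occ η z - a z) =
      g z * (occ (exchange η x y) z - occ η z) := fun z => by ring
  simp only [e]
  rw [← Finset.sum_subset (Finset.subset_univ {x, y}) (fun z _ hz => by
    simp only [Finset.mem_insert, Finset.mem_singleton, not_or] at hz
    unfold occ
    rw [exchange_apply_of_ne η hz.1 hz.2]; ring), Finset.sum_pair hxy]
  unfold occ
  rw [exchange_apply_left, exchange_apply_right]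
  ring

/-- The microscopic current across the bond `{x, x+1}`. -/
def current (n : ℕ) (F : ℝ → ℝ) (x : ZMod n) (η : Config n) : ℝ :=
  rateRight n F x * (occ η x * (1 - occ η (x + 1))) -
    rateLeft n F x * ((1 - occ η x) * occ η (x + 1))

lemma bondRate_mul_sub (F : ℝ → ℝ) (x : ZMod n) (η : Config n) :
    bondRate n F x η * (occ η x - occ η (x + 1)) = current n F x η := by
  unfold bondRate current occ
  split_ifs <;> ring

lemma generator_field (hn : 2 ≤ n) (F : ℝ → ℝ) (a g : ZMod n → ℝ) (η : Config n) :
    generator n F (field a g) η = ∑ x, (g (x + 1) - g x) * current n F x η := by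
  rw [generator_eq_sum_bonds]
  refine Finset.sum_congr rfl fun x _ => ?_
  rw [field_exchange a g η (add_one_ne_self hn x), ← bondRate_mul_sub]
  ring

/-- The fluctuation of the asymmetric part of the current. -/
def driftFluct (n : ℕ) (F : ℝ → ℝ) (a : ZMod n → ℝ) (x : ZMod n) (η : Config n) : ℝ :=
  F (site n x) * (occ η x * (1 - occ η (x + 1)) - a x * (1 - a (x + 1))) +
    F (site n (x + 1)) * ((1 - occ η x) * occ η (x + 1) - (1 - a x) * a (x + 1))

/-- Gradient property: η(x)(1 - η(y)) - (1 - η(x))η(y) = η(x) - η(y). The symmetric current is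
therefore linear, and nonlinearity appears only in the asymmetric part, one power of n smaller. -/
lemma sq_mul_current (F : ℝ → ℝ) (a : ZMod n → ℝ) (x : ZMod n) (η : Config n) :
    (n : ℝ) ^ 2 * current n F x η =
      (n : ℝ) ^ 2 * ((occ η x - a x) - (occ η (x + 1) - a (x + 1))) + n * driftFluct n F a x η +
        n * (n * meanCurrent n F a x) := by
  have hn0 : (n : ℝ) ≠ 0 := by exact_mod_cast NeZero.ne n
  unfold current driftFluct meanCurrent rateRight rateLeft
  field_simp
  ring

lemma sum_grad_mul_grad (g h : ZMod n → ℝ) :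
    (n : ℝ) ^ 2 * ∑ x, (g (x + 1) - g x) * (h x - h (x + 1)) = ∑ x, lap n g x * h x := by
  have h1 : ∑ x, (g (x + 1) - g x) * h (x + 1) = ∑ x, (g x - g (x - 1)) * h x := by
    rw [← Equiv.sum_comp (Equiv.addRight (1 : ZMod n)) (fun x => (g x - g (x - 1)) * h x)]
    simp
  have h2 : ∑ x, (g (x + 1) - g x) * (h x - h (x + 1)) =
      ∑ x, (g (x + 1) - g x) * h x - ∑ x, (g x - g (x - 1)) * h x := by
    rw [← h1, ← Finset.sum_sub_distrib]
    exact Finset.sum_congr rfl fun x _ => by ring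
  rw [h2, ← Finset.sum_sub_distrib, Finset.mul_sum]
  exact Finset.sum_congr rfl fun x _ => by unfold lap; ring

lemma sum_mul_flux_sub (g J : ZMod n → ℝ) :
    ∑ x, g x * (J x - J (x - 1)) = -∑ x, (g (x + 1) - g x) * J x := by
  have h1 : ∑ x, g x * J (x - 1) = ∑ x, g (x + 1) * J x := by
    rw [← Equiv.sum_comp (Equiv.addRight (1 : ZMod n))]
    simp
  simp only [mul_sub, sub_mul, Finset.sum_sub_distrib, h1]
  ring

/-- The fluctuating part of the remainder. -/
def fluctRemainder (n : ℕ) [NeZero n] (F : ℝ → ℝ) (a g : ZMod n → ℝ) (η : Config n) : ℝ :=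
  ∑ x, n * (g (x + 1) - g x) * driftFluct n F a x η

/-- The deterministic part of the remainder. -/
def meanRemainder (n : ℕ) [NeZero n] (F : ℝ → ℝ) (a J g : ZMod n → ℝ) : ℝ :=
  ∑ x, n * (g (x + 1) - g x) * (J x - n * meanCurrent n F a x)

/-- The Laplacian produced by the generator cancels the one in the backward heat equation. What
survives is the source at the origin, the flux error paired with the gradient of g, and the drift
fluctuations paired with the same gradient. -/
lemma field_evolution (hn : 2 ≤ n) (F : ℝ → ℝ) (a J g : ZMod n → ℝ) (c : ℝ) (η : Config n) :
    ∑ x, ((-lap n g x - if x = 0 then c else 0) * (occ η x - a x) +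
        g x * (n * (J x - J (x - 1)))) + (n : ℝ) ^ 2 * generator n F (field a g) η =
      -(c * (occ η 0 - a 0)) - meanRemainder n F a J g + fluctRemainder n F a g η := by
  have h1 := sum_grad_mul_grad g fun x => occ η x - a x
  have h2 := sum_mul_flux_sub g J
  have e1 : (n : ℝ) ^ 2 * generator n F (field a g) η =
      ∑ x, lap n g x * (occ η x - a x) + fluctRemainder n F a g η +
        n * ∑ x, (g (x + 1) - g x) * (n * meanCurrent n F a x) := by
    rw [generator_field hn, ← h1, fluctRemainder, Finset.mul_sum, Finset.mul_sum, Finset.mul_sum,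
      ← Finset.sum_add_distrib, ← Finset.sum_add_distrib]
    refine Finset.sum_congr rfl fun x _ => ?_
    have := sq_mul_current F a x η
    calc (n : ℝ) ^ 2 * ((g (x + 1) - g x) * current n F x η)
        = (g (x + 1) - g x) * ((n : ℝ) ^ 2 * current n F x η) := by ring
      _ = _ := by rw [this]; ring
  have e2 : ∑ x, ((-lap n g x - if x = 0 then c else 0) * (occ η x - a x) +
        g x * (n * (J x - J (x - 1)))) = -∑ x, lap n g x * (occ η x - a x) -
        c * (occ η 0 - a 0) + n * ∑ x, g x * (J x - J (x - 1)) := by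
    have e3 : c * (occ η 0 - a 0) = ∑ x, if x = 0 then c * (occ η x - a x) else 0 := by simp
    rw [e3, Finset.mul_sum, ← Finset.sum_neg_distrib, ← Finset.sum_sub_distrib,
      ← Finset.sum_add_distrib]
    refine Finset.sum_congr rfl fun x _ => ?_
    split_ifs <;> ring
  have e4 : meanRemainder n F a J g = n * ∑ x, (g (x + 1) - g x) * J x -
      n * ∑ x, (g (x + 1) - g x) * (n * meanCurrent n F a x) := by
    rw [meanRemainder, Finset.mul_sum, Finset.mul_sum, ← Finset.sum_sub_distrib]
    exact Finset.sum_congr rfl fun x _ => by ring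
  rw [e1, e2, e4, h2]
  ring

end LinearFunctionals

/-! ### Second moments under a measure of bounded entropy -/

section SecondMoments

set_option linter.unusedSectionVars false

variable {n : ℕ} [NeZero n] {ε : ℝ} {a : ZMod n → ℝ} {p : Config n → ℝ}

lemma Elliptic.one_le_inv (h : Elliptic ε a) (hε : 0 < ε) : 1 ≤ ε⁻¹ := by
  rw [one_le_inv₀ hε]
  linarith [(h 0).1, (h 0).2]

lemma sum_mul_linear_sq_le (h : Elliptic ε a) (hε : 0 < ε) (hp : ∀ η, 0 ≤ p η)
    (hp1 : ∑ η, p η = 1) (c : ZMod n → ℝ) :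
    ∑ η, p η * (∑ x, c x * flu a x η) ^ 2 ≤ 8 * (ε⁻¹ ^ 4 * ∑ x, c x ^ 2) * (ent a p + 1) := by
  have h0 : 0 ≤ ∑ x, c x ^ 2 := Finset.sum_nonneg fun _ _ => sq_nonneg _
  have h1 := h.one_le_inv hε
  refine sum_mul_sq_le_ent h hε hp hp1 (by positivity) fun θ =>
    (bmean_exp_linear_le h hε c θ).trans (Real.exp_le_exp.2 ?_)
  have h2 : ε⁻¹ ^ 2 / 2 ≤ ε⁻¹ ^ 4 := by
    have := pow_le_pow_right₀ h1 (show 2 ≤ 4 by norm_num)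
    have h3 : 0 ≤ ε⁻¹ ^ 2 := by positivity
    linarith
  gcongr

lemma sum_mul_quadratic_sq_le (h : Elliptic ε a) (hε : 0 < ε) (hn : 2 ≤ n) (hp : ∀ η, 0 ≤ p η)
    (hp1 : ∑ η, p η = 1) (c : ZMod n → ℝ) :
    ∑ η, p η * (∑ x, c x * (flu a x η * flu a (x + 1) η)) ^ 2 ≤
      8 * (ε⁻¹ ^ 4 * ∑ x, c x ^ 2) * (ent a p + 1) := by
  have h0 : 0 ≤ ∑ x, c x ^ 2 := Finset.sum_nonneg fun _ _ => sq_nonneg _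
  exact sum_mul_sq_le_ent h hε hp hp1 (by positivity) fun θ => bmean_exp_quadratic_le h hε hn c θ

lemma sum_mul_field_sq_le (h : Elliptic ε a) (hε : 0 < ε) (hp : ∀ η, 0 ≤ p η)
    (hp1 : ∑ η, p η = 1) (g : ZMod n → ℝ) :
    ∑ η, p η * field a g η ^ 2 ≤ 8 * (ε⁻¹ ^ 4 * ∑ x, g x ^ 2) * (ent a p + 1) := by
  have e : ∀ η, field a g η = ∑ x, (g x * (a x * (1 - a x))) * flu a x η := fun η =>
    Finset.sum_congr rfl fun x _ => by rw [occ_sub_eq_flu h hε]; ring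
  simp only [e]
  refine (sum_mul_linear_sq_le h hε hp hp1 _).trans ?_
  have hent := ent_nonneg h hε hp hp1
  have hsum : ∑ x, (g x * (a x * (1 - a x))) ^ 2 ≤ ∑ x, g x ^ 2 := by
    refine Finset.sum_le_sum fun x _ => ?_
    rw [mul_pow]
    have h1 := h.pos hε x
    have h2 := h.one_sub_pos hε x
    have h3 : (a x * (1 - a x)) ^ 2 ≤ 1 := by
      rw [sq_le_one_iff₀ (by positivity)]; nlinarith
    nlinarith [sq_nonneg (g x)]
  gcongr

/-- Expansion around the profile: two linear terms and one nearest-neighbour product, precisely the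
forms with sub-Gaussian bounds. -/
lemma driftFluct_eq (h : Elliptic ε a) (hε : 0 < ε) (F : ℝ → ℝ) (x : ZMod n) (η : Config n) :
    driftFluct n F a x η =
      ((F (site n x) * (1 - a (x + 1)) - F (site n (x + 1)) * a (x + 1)) * (a x * (1 - a x))) *
        flu a x η +
      ((F (site n (x + 1)) * (1 - a x) - F (site n x) * a x) * (a (x + 1) * (1 - a (x + 1)))) *
        flu a (x + 1) η +
      (-(F (site n x) + F (site n (x + 1))) * (a x * (1 - a x) * (a (x + 1) * (1 - a (x + 1))))) *
        (flu a x η * flu a (x + 1) η) := by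
  have h1 := occ_sub_eq_flu h hε x η
  have h2 := occ_sub_eq_flu h hε (x + 1) η
  have e : driftFluct n F a x η =
      (F (site n x) * (1 - a (x + 1)) - F (site n (x + 1)) * a (x + 1)) * (occ η x - a x) +
      (F (site n (x + 1)) * (1 - a x) - F (site n x) * a x) * (occ η (x + 1) - a (x + 1)) -
      (F (site n x) + F (site n (x + 1))) * ((occ η x - a x) * (occ η (x + 1) - a (x + 1))) := by
    unfold driftFluct; ring
  rw [e, h1, h2]; ring

lemma abs_comb_le {f f' b b' C c : ℝ} (hf : |f| ≤ C) (hf' : |f'| ≤ C) (hb : |b| ≤ 1)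
    (hb' : |b'| ≤ 1) (hc : |c| ≤ 1) : |(f * b - f' * b') * c| ≤ 2 * C := by
  have hC : 0 ≤ C := (abs_nonneg _).trans hf
  rw [abs_mul]
  have h1 : |f * b - f' * b'| ≤ 2 * C := by
    refine (abs_sub _ _).trans ?_
    rw [abs_mul, abs_mul]
    have := mul_le_mul hf hb (abs_nonneg _) hC
    have := mul_le_mul hf' hb' (abs_nonneg _) hC
    linarith
  have := mul_le_mul h1 hc (abs_nonneg _) (by linarith)
  linarith

/-- All three coefficients of the drift fluctuation are at most 2C. The constant is 288 = 3 · 3 · 8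
· 4, from the square of a sum of three terms, the number of terms, the entropy bound and (2C)². -/
lemma sum_mul_fluctRemainder_sq_le (h : Elliptic ε a) (hε : 0 < ε) (hn : 2 ≤ n)
    (hp : ∀ η, 0 ≤ p η) (hp1 : ∑ η, p η = 1) {F : ℝ → ℝ} {C : ℝ} (hF : ∀ u, |F u| ≤ C)
    (g : ZMod n → ℝ) :
    ∑ η, p η * fluctRemainder n F a g η ^ 2 ≤
      288 * C ^ 2 * ε⁻¹ ^ 4 * (ent a p + 1) * dirichlet n g := by
  have hC : 0 ≤ C := (abs_nonneg _).trans (hF 0)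
  have hent := ent_nonneg h hε hp hp1
  have ha : ∀ x, |a x| ≤ 1 := fun x =>
    abs_le.2 ⟨by linarith [h.pos hε x], by linarith [h.one_sub_pos hε x]⟩
  have ha' : ∀ x, |1 - a x| ≤ 1 := fun x =>
    abs_le.2 ⟨by linarith [h.one_sub_pos hε x], by linarith [h.pos hε x]⟩
  have haa : ∀ x, |a x * (1 - a x)| ≤ 1 := fun x => by
    rw [abs_mul]; exact mul_le_one₀ (ha x) (abs_nonneg _) (ha' x)
  set α : ZMod n → ℝ := fun x =>
    (F (site n x) * (1 - a (x + 1)) - F (site n (x + 1)) * a (x + 1)) * (a x * (1 - a x)) with hα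
  set β : ZMod n → ℝ := fun x =>
    (F (site n (x + 1)) * (1 - a x) - F (site n x) * a x) * (a (x + 1) * (1 - a (x + 1))) with hβ
  set γ : ZMod n → ℝ := fun x =>
    -(F (site n x) + F (site n (x + 1))) * (a x * (1 - a x) * (a (x + 1) * (1 - a (x + 1)))) with hγ
  have bα : ∀ x, |α x| ≤ 2 * C := fun x => abs_comb_le (hF _) (hF _) (ha' _) (ha _) (haa _)
  have bβ : ∀ x, |β x| ≤ 2 * C := fun x => abs_comb_le (hF _) (hF _) (ha' _) (ha _) (haa _)
  have bγ : ∀ x, |γ x| ≤ 2 * C := fun x => by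
    have h1 : γ x = (F (site n x) * (-1) - F (site n (x + 1)) * 1) *
        (a x * (1 - a x) * (a (x + 1) * (1 - a (x + 1)))) := by simp only [hγ]; ring
    rw [h1]
    refine abs_comb_le (hF _) (hF _) (by simp) (by simp) ?_
    rw [abs_mul]; exact mul_le_one₀ (haa x) (abs_nonneg _) (haa _)
  have hsum : ∀ c : ZMod n → ℝ, (∀ x, |c x| ≤ 2 * C) →
      ∑ x, (n * (g (x + 1) - g x) * c x) ^ 2 ≤ 4 * C ^ 2 * dirichlet n g := by
    intro c hc
    rw [dirichlet, Finset.mul_sum, Finset.mul_sum]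
    refine Finset.sum_le_sum fun x _ => ?_
    have h1 : c x ^ 2 ≤ (2 * C) ^ 2 := by
      rw [← sq_abs]; exact pow_le_pow_left₀ (abs_nonneg _) (hc x) 2
    calc (n * (g (x + 1) - g x) * c x) ^ 2 = (n * (g (x + 1) - g x)) ^ 2 * c x ^ 2 := by ring
      _ ≤ (n * (g (x + 1) - g x)) ^ 2 * (2 * C) ^ 2 := by gcongr
      _ = _ := by ring
  set X : Config n → ℝ := fun η => ∑ x, (n * (g (x + 1) - g x) * α x) * flu a x η with hX
  set Y : Config n → ℝ := fun η => ∑ x, (n * (g x - g (x - 1)) * β (x - 1)) * flu a x η with hY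
  set Z : Config n → ℝ := fun η => ∑ x, (n * (g (x + 1) - g x) * γ x) *
    (flu a x η * flu a (x + 1) η) with hZ
  have hsplit : ∀ η, fluctRemainder n F a g η = X η + Y η + Z η := by
    intro η
    have e : Y η = ∑ x, (n * (g (x + 1) - g x) * β x) * flu a (x + 1) η := by
      simp only [hY]
      rw [← Equiv.sum_comp (Equiv.addRight (1 : ZMod n))]
      simp
    rw [e]
    simp only [hX, hZ, fluctRemainder]
    rw [← Finset.sum_add_distrib, ← Finset.sum_add_distrib]
    refine Finset.sum_congr rfl fun x _ => ?_
    rw [driftFluct_eq h hε]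
    simp only [hα, hβ, hγ]
    ring
  have hbound : ∀ S : ℝ, S ≤ 4 * C ^ 2 * dirichlet n g →
      8 * (ε⁻¹ ^ 4 * S) * (ent a p + 1) ≤
        8 * (ε⁻¹ ^ 4 * (4 * C ^ 2 * dirichlet n g)) * (ent a p + 1) := fun S hS => by gcongr
  have bX := (sum_mul_linear_sq_le h hε hp hp1 _).trans (hbound _ (hsum α bα))
  have bZ := (sum_mul_quadratic_sq_le h hε hn hp hp1 _).trans (hbound _ (hsum γ bγ))
  have bY := (sum_mul_linear_sq_le h hε hp hp1 (fun x => n * (g x - g (x - 1)) * β (x - 1))).trans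
    (hbound _ (by
      rw [← Equiv.sum_comp (Equiv.addRight (1 : ZMod n))]
      simp only [Equiv.coe_addRight, add_sub_cancel_right]
      exact hsum β bβ))
  have h3 : ∑ η, p η * fluctRemainder n F a g η ^ 2 ≤
      3 * (∑ η, p η * X η ^ 2 + ∑ η, p η * Y η ^ 2 + ∑ η, p η * Z η ^ 2) := by
    rw [← Finset.sum_add_distrib, ← Finset.sum_add_distrib, Finset.mul_sum]
    refine Finset.sum_le_sum fun η _ => ?_
    rw [hsplit]
    have : (X η + Y η + Z η) ^ 2 ≤ 3 * (X η ^ 2 + Y η ^ 2 + Z η ^ 2) := by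
      nlinarith [sq_nonneg (X η - Y η), sq_nonneg (Y η - Z η), sq_nonneg (X η - Z η)]
    calc _ ≤ p η * (3 * (X η ^ 2 + Y η ^ 2 + Z η ^ 2)) := mul_le_mul_of_nonneg_left this (hp η)
      _ = _ := by ring
  calc _ ≤ _ := h3
    _ ≤ 3 * (3 * (8 * (ε⁻¹ ^ 4 * (4 * C ^ 2 * dirichlet n g)) * (ent a p + 1))) := by linarith
    _ = _ := by ring

lemma carre_field_le (hn : 2 ≤ n) {F : ℝ → ℝ} (hR : ∀ x, |rateRight n F x| ≤ 2)
    (hL : ∀ x, |rateLeft n F x| ≤ 2) (g : ZMod n → ℝ) (η : Config n) :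
    (n : ℝ) ^ 2 * carre n F (field a g) η ≤ 2 * dirichlet n g := by
  unfold carre dirichlet
  rw [Finset.mul_sum, Finset.mul_sum, Finset.mul_sum]
  refine Finset.sum_le_sum fun x _ => ?_
  rw [field_exchange a g η (add_one_ne_self hn x)]
  have h1 : bondRate n F x η * (occ η x - occ η (x + 1)) ^ 2 ≤ 2 := by
    have h2 := (abs_le.1 (hR x)).2
    have h3 := (abs_le.1 (hL x)).2
    unfold bondRate occ
    split_ifs <;> norm_num <;> assumption
  calc _ = ((n : ℝ) ^ 2 * (g (x + 1) - g x) ^ 2) *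
        (bondRate n F x η * (occ η x - occ η (x + 1)) ^ 2) := by ring
    _ ≤ ((n : ℝ) ^ 2 * (g (x + 1) - g x) ^ 2) * 2 := by gcongr
    _ = _ := by ring

/-- Young's inequality with a free weight. Its later value τ^(3/4) balances an integrated energy of
order τ^(3/2) against a bounded flux error. -/
lemma abs_meanRemainder_le (F : ℝ → ℝ) (a J : ℝ → ZMod n → ℝ) (g : ZMod n → ℝ) (r : ℝ) {z : ℝ}
    (hz : 0 < z) :
    |meanRemainder n F (a r) (J r) g| ≤
      (dirichlet n g / z + z * fluxError n F a J r) / 2 := by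
  unfold meanRemainder dirichlet fluxError
  refine (Finset.abs_sum_le_sum_abs _ _).trans ?_
  rw [Finset.mul_sum, Finset.mul_sum, Finset.sum_div, ← Finset.sum_add_distrib, Finset.sum_div]
  refine Finset.sum_le_sum fun x _ => ?_
  rw [abs_mul]
  set A := n * (g (x + 1) - g x)
  set B := J r x - n * meanCurrent n F (a r) x
  have e : (n : ℝ) ^ 2 * (g (x + 1) - g x) ^ 2 = |A| ^ 2 := by rw [sq_abs]; ring
  rw [e, ← sq_abs B, le_div_iff₀ two_pos, div_add' _ _ _ hz.ne', le_div_iff₀ hz]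
  nlinarith [sq_nonneg (|A| - z * |B|)]

end SecondMoments

/-! ### The second moment of the occupation time around a reference profile -/

section ReferenceMoment

set_option linter.unusedSectionVars false

variable {n : ℕ} [NeZero n] {F : ℝ → ℝ} {μ : Measure (Config n)} {P : Measure (Path n)}

lemma measurable_additive {A : ℝ → Config n → ℝ} (hA : ∀ η, Continuous fun r => A r η) {s t : ℝ}
    (hst : s ≤ t) : Measurable fun w : Path n => ∫ r in s..t, A r (obs w r) := by
  simp only [intervalIntegral.integral_of_le hst]
  exact (StronglyMeasurable.integral_prod_left' (μ := (volume : Measure ℝ).restrict (Ioc s t))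
    (f := fun p : ℝ × Path n => A p.1 (obs p.2 p.1))
    (measurable_observable hA).stronglyMeasurable).measurable

lemma exists_bound_additive {A : ℝ → Config n → ℝ} (hA : ∀ η, Continuous fun r => A r η) {s t : ℝ}
    (hst : s ≤ t) : ∃ B, ∀ w : Path n, |∫ r in s..t, A r (obs w r)| ≤ B := by
  obtain ⟨B, -, hB⟩ := exists_bound_observable hA s t
  refine ⟨B * |t - s|, fun w => ?_⟩
  rw [← Real.norm_eq_abs]
  refine intervalIntegral.norm_integral_le_of_norm_le_const fun r hr => ?_
  rw [uIoc_of_le hst] at hr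
  exact hB r ⟨hr.1.le, hr.2⟩ _

lemma integrable_sq_additive [IsFiniteMeasure P] {A : ℝ → Config n → ℝ}
    (hA : ∀ η, Continuous fun r => A r η) {s t : ℝ} (hst : s ≤ t) :
    Integrable (fun w : Path n => (∫ r in s..t, A r (obs w r)) ^ 2) P := by
  obtain ⟨B, hB⟩ := exists_bound_additive hA hst
  refine Integrable.of_bound ((measurable_additive hA hst).pow_const 2).aestronglyMeasurable
    (B ^ 2) (ae_of_all _ fun w => ?_)
  rw [Real.norm_eq_abs, abs_pow]
  exact pow_le_pow_left₀ (abs_nonneg _) (hB w) 2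

/-- The constant of the second moment estimate. -/
def momentConst (T ε C M S₀ H : ℝ) : ℝ :=
  3 * (heatConst T M * (8 * ε⁻¹ ^ 4 * (H + 1) + 2) + (heatConst T M + S₀) ^ 2 / 4 +
    T * (288 * C ^ 2 * ε⁻¹ ^ 4 * (H + 1) * heatConst T M))

lemma heatConst_nonneg (T M : ℝ) : 0 ≤ heatConst T M := by unfold heatConst; positivity

/-- With Φ the density field of the backward heat solution and A = (∂_r + n²L)Φ, the integrand is V
= -A - D + R. The variance identity bounds the integral of A through the entropy bound at time s and
the carré du champ; R is treated by Cauchy–Schwarz in time and the entropy bound, the deterministic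
D by Young. Each contribution is of order τ^(3/2). -/
theorem IsLaw.second_moment_le (hlaw : IsLaw n F μ P) [IsProbabilityMeasure μ]
    {T ε κ Λ C M S₀ H : ℝ} (hε : 0 < ε) (hn : 3 ≤ n) {a J : ℝ → ZMod n → ℝ}
    (h : ReferenceProfile n T ε κ Λ a J) (hac : ∀ x, Continuous fun r => a r x)
    (hJc : ∀ x, Continuous fun r => J r x) (hF : ∀ u, |F u| ≤ C)
    (hR0 : ∀ x, 0 ≤ rateRight n F x) (hL0 : ∀ x, 0 ≤ rateLeft n F x)
    (hR : ∀ x, |rateRight n F x| ≤ 2) (hL : ∀ x, |rateLeft n F x| ≤ 2)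
    (hS : ∫ r in (0 : ℝ)..T, fluxError n F a J r ≤ S₀)
    (hH : ∀ r ∈ Icc 0 T, ent (a r) (lawAt n F (fun η => μ.real {η}) r) ≤ H)
    {v : ℝ → ℝ} (hv : Continuous v) (hM : ∀ r ∈ Icc 0 T, |v r| ≤ M) {s t : ℝ} (hs : 0 ≤ s)
    (hst : s < t) (ht : t ≤ T) :
    ∫ w, (∫ r in s..t, √n * v r * (occ (obs w r) 0 - a r 0)) ^ 2 ∂P ≤
      momentConst T ε C M S₀ H * √√(t - s) ^ 6 := by
  have := hlaw.isProbabilityMeasure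
  have hsub : Icc s t ⊆ Icc 0 T := Icc_subset_Icc hs ht
  have hst' := hst.le
  have hτT : t - s ≤ T := by linarith
  obtain ⟨G, hend, hG⟩ := exists_backward_heat (n := n) hv t
  obtain ⟨hN, hD⟩ := heat_energy hv (fun r hr => hM r (hsub hr)) hst hτT hend hG
  set z := √√(t - s) with hz
  have hz0 : 0 < z := Real.sqrt_pos.2 (Real.sqrt_pos.2 (by linarith))
  set K := heatConst T M with hK
  have hK0 : 0 ≤ K := heatConst_nonneg T M
  have hGc : ∀ x, Continuous fun r => G r x := fun x =>
    continuous_iff_continuousAt.2 fun r => (hG r x).continuousAt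
  set p : Config n → ℝ := fun η => μ.real {η} with hp
  have hp0 : ∀ η, 0 ≤ p η := fun η => measureReal_nonneg
  have hp1 : ∑ η, p η = 1 := by
    have := sum_measureReal_singleton (μ := μ) (Finset.univ : Finset (Config n))
    rw [hp, this]; simp
  have hq0 : ∀ r ∈ Icc s t, ∀ η, 0 ≤ lawAt n F p r η := fun r hr η =>
    lawAt_nonneg hR0 hL0 hp0 (hs.trans hr.1) η
  have hq1 : ∀ r, ∑ η, lawAt n F p r η = 1 := fun r => by rw [sum_lawAt, hp1]
  have hH0 : 0 ≤ H :=
    (ent_nonneg (h.elliptic s (hsub (left_mem_Icc.2 hst'))) hε (hq0 s (left_mem_Icc.2 hst'))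
      (hq1 s)).trans (hH s (hsub (left_mem_Icc.2 hst')))
  -- the three terms
  set D : ℝ → ℝ := fun r => meanRemainder n F (a r) (J r) (G r) with hDdef
  set R : ℝ → Config n → ℝ := fun r η => fluctRemainder n F (a r) (G r) η with hRdef
  set V : ℝ → Config n → ℝ := fun r η => √n * v r * (occ η 0 - a r 0) with hV
  set A : ℝ → Config n → ℝ := fun r η => -V r η - D r + R r η with hA
  have hDc : Continuous D := by
    simp only [hDdef, meanRemainder, meanCurrent]; fun_prop
  have hRc : ∀ η, Continuous fun r => R r η := fun η => by
    simp only [hRdef, fluctRemainder, driftFluct]; fun_prop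
  have hVc : ∀ η, Continuous fun r => V r η := fun η => by
    simp only [hV]; fun_prop
  have hAc : ∀ η, Continuous fun r => A r η := fun η => ((hVc η).neg.sub hDc).add (hRc η)
  have hdirc : Continuous fun r => dirichlet n (G r) := by
    simp only [dirichlet]; fun_prop
  have hdir0 : ∀ r, 0 ≤ dirichlet n (G r) := fun r =>
    mul_nonneg (by positivity) (Finset.sum_nonneg fun _ _ => sq_nonneg _)
  -- the martingale part
  have hΦ : ∀ r ∈ Icc s t, ∀ η, HasDerivWithinAt (fun r => field (a r) (G r) η)
      (∑ x, ((-lap n (G r) x - if x = 0 then √n * v r else 0) * (occ η x - a r x) +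
        G r x * (n * (J r x - J r (x - 1))))) (Icc s t) r := by
    intro r hr η
    refine (HasDerivWithinAt.fun_sum (u := Finset.univ) fun x _ =>
      (hG r x).hasDerivWithinAt.mul
        (((h.hasDeriv r (hsub hr) x).mono hsub).const_sub (occ η x))).congr_deriv ?_
    exact Finset.sum_congr rfl fun x _ => by ring
  have hAΦ : ∀ r ∈ Icc s t, ∀ η, A r η =
      (∑ x, ((-lap n (G r) x - if x = 0 then √n * v r else 0) * (occ η x - a r x) +
        G r x * (n * (J r x - J r (x - 1))))) + (n : ℝ) ^ 2 * generator n F (field (a r) (G r)) η :=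
    fun r _ η => (field_evolution (by omega) F (a r) (J r) (G r) (√n * v r) η).symm
  have bA : ∫ w, (∫ r in s..t, A r (obs w r)) ^ 2 ∂P ≤ K * (8 * ε⁻¹ ^ 4 * (H + 1) + 2) * z ^ 6 := by
    rw [hlaw.integral_sq_additive hs hst' hAc hΦ hAΦ (fun η => by simp [field, hend])]
    have hs' : s ∈ Icc s t := left_mem_Icc.2 hst'
    have b1 : ∑ η, lawAt n F p s η * field (a s) (G s) η ^ 2 ≤
        8 * (ε⁻¹ ^ 4 * (K * z ^ 6)) * (H + 1) := by
      refine (sum_mul_field_sq_le (h.elliptic s (hsub hs')) hε (hq0 s hs') (hq1 s) (G s)).trans ?_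
      have h1 := hN s hs'
      have h2 := hH s (hsub hs')
      have h3 : 0 ≤ ent (a s) (lawAt n F p s) :=
        ent_nonneg (h.elliptic s (hsub hs')) hε (hq0 s hs') (hq1 s)
      gcongr
    have b2 : ∫ r in s..t, ∑ η, lawAt n F p r η *
        ((n : ℝ) ^ 2 * carre n F (field (a r) (G r)) η) ≤ 2 * (K * z ^ 6) := by
      have hcc : Continuous fun r => ∑ η, lawAt n F p r η *
          ((n : ℝ) ^ 2 * carre n F (field (a r) (G r)) η) := by
        have := continuous_lawAt F p
        simp only [carre, field]
        fun_prop
      have h1 := intervalIntegral.integral_mono_on (μ := volume) hst' (hcc.intervalIntegrable s t)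
        ((continuous_const.mul hdirc).intervalIntegrable s t) (g := fun r => 2 * dirichlet n (G r))
        (fun r hr => by
          calc _ ≤ ∑ η, lawAt n F p r η * (2 * dirichlet n (G r)) :=
                Finset.sum_le_sum fun η _ => mul_le_mul_of_nonneg_left
                  (carre_field_le (by omega) hR hL (G r) η) (hq0 r hr η)
            _ = _ := by rw [← Finset.sum_mul, hq1, one_mul])
      rw [intervalIntegral.integral_const_mul] at h1
      linarith
    calc _ ≤ _ := add_le_add b1 b2
      _ = _ := by ring
  -- the fluctuating remainder
  have bR : ∫ w, (∫ r in s..t, R r (obs w r)) ^ 2 ∂P ≤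
      T * (288 * C ^ 2 * ε⁻¹ ^ 4 * (H + 1) * K) * z ^ 6 := by
    refine (hlaw.integral_sq_le hs hst' hRc).trans ?_
    have hcc : Continuous fun r => ∑ η, lawAt n F p r η * R r η ^ 2 := by
      have := continuous_lawAt F p
      fun_prop
    have h1 := intervalIntegral.integral_mono_on (μ := volume) hst' (hcc.intervalIntegrable s t)
      ((continuous_const.mul hdirc).intervalIntegrable s t)
      (g := fun r => 288 * C ^ 2 * ε⁻¹ ^ 4 * (H + 1) * dirichlet n (G r))
      (fun r hr => by
        refine (sum_mul_fluctRemainder_sq_le (h.elliptic r (hsub hr)) hε (by omega) (hq0 r hr)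
          (hq1 r) hF (G r)).trans ?_
        have h2 := hH r (hsub hr)
        have h3 := hdir0 r
        gcongr)
    rw [intervalIntegral.integral_const_mul] at h1
    have h4 : 0 ≤ ∫ r in s..t, ∑ η, lawAt n F p r η * R r η ^ 2 :=
      intervalIntegral.integral_nonneg hst' fun r hr => Finset.sum_nonneg fun η _ =>
        mul_nonneg (hq0 r hr η) (sq_nonneg _)
    calc _ ≤ T * ∫ r in s..t, ∑ η, lawAt n F p r η * R r η ^ 2 := by gcongr
      _ ≤ T * (288 * C ^ 2 * ε⁻¹ ^ 4 * (H + 1) * (K * z ^ 6)) := by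
          have hT0 : 0 ≤ T := by linarith
          refine mul_le_mul_of_nonneg_left (h1.trans ?_) hT0
          gcongr
      _ = _ := by ring
  -- the deterministic remainder
  have hfe : ContinuousOn (fluxError n F a J) (Icc 0 T) := h.continuousOn_fluxError F
  have hfe0 : ∀ r, 0 ≤ fluxError n F a J r := fun r => Finset.sum_nonneg fun _ _ => sq_nonneg _
  have hS' : ∫ r in s..t, fluxError n F a J r ≤ S₀ := by
    refine le_trans ?_ hS
    exact intervalIntegral.integral_mono_interval hs hst' ht (ae_of_all _ hfe0)
      (ContinuousOn.intervalIntegrable (by rwa [uIcc_of_le (by linarith)]))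
  have bD : (∫ r in s..t, D r) ^ 2 ≤ (K + S₀) ^ 2 / 4 * z ^ 6 := by
    have hfi : IntervalIntegrable (fluxError n F a J) volume s t :=
      ContinuousOn.intervalIntegrable (by rw [uIcc_of_le hst']; exact hfe.mono hsub)
    have hdi : IntervalIntegrable (fun r => dirichlet n (G r) / z ^ 3) volume s t :=
      (hdirc.intervalIntegrable s t).div_const _
    have h1 : |∫ r in s..t, D r| ≤
        ∫ r in s..t, (dirichlet n (G r) / z ^ 3 + z ^ 3 * fluxError n F a J r) / 2 := by
      refine (intervalIntegral.abs_integral_le_integral_abs hst').trans ?_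
      exact intervalIntegral.integral_mono_on hst' (hDc.abs.intervalIntegrable _ _)
        ((hdi.add (hfi.const_mul _)).div_const 2)
        fun r _ => abs_meanRemainder_le F a J (G r) r (by positivity)
    rw [intervalIntegral.integral_div, intervalIntegral.integral_add hdi (hfi.const_mul _),
      intervalIntegral.integral_div, intervalIntegral.integral_const_mul] at h1
    have h2 : |∫ r in s..t, D r| ≤ (K + S₀) / 2 * z ^ 3 := by
      have h3 : (∫ r in s..t, dirichlet n (G r)) / z ^ 3 ≤ K * z ^ 3 := by
        rw [div_le_iff₀ (by positivity)]
        calc _ ≤ _ := hD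
          _ = _ := by ring
      have h4 : z ^ 3 * ∫ r in s..t, fluxError n F a J r ≤ z ^ 3 * S₀ := by gcongr
      linarith
    have h5 := pow_le_pow_left₀ (abs_nonneg _) h2 2
    rw [sq_abs] at h5
    calc _ ≤ _ := h5
      _ = _ := by ring
  -- conclusion
  have hpt : ∀ w : Path n, (∫ r in s..t, V r (obs w r)) ^ 2 ≤
      3 * ((∫ r in s..t, A r (obs w r)) ^ 2 + (∫ r in s..t, D r) ^ 2 +
        (∫ r in s..t, R r (obs w r)) ^ 2) := by
    intro w
    have iA := intervalIntegrable_observable hAc w hst'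
    have iR := intervalIntegrable_observable hRc w hst'
    have iD := hDc.intervalIntegrable (μ := volume) s t
    have e : ∫ r in s..t, V r (obs w r) = -(∫ r in s..t, A r (obs w r)) - (∫ r in s..t, D r) +
        ∫ r in s..t, R r (obs w r) := by
      have iA' : IntervalIntegrable (fun r => -A r (obs w r)) volume s t := iA.neg
      have iAD : IntervalIntegrable (fun r => -A r (obs w r) - D r) volume s t := iA'.sub iD
      rw [← intervalIntegral.integral_neg, ← intervalIntegral.integral_sub iA' iD,
        ← intervalIntegral.integral_add iAD iR]
      refine intervalIntegral.integral_congr fun r _ => ?_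
      simp only [hA]
      ring
    rw [e]
    set x := ∫ r in s..t, A r (obs w r)
    set y := ∫ r in s..t, D r
    set u := ∫ r in s..t, R r (obs w r)
    nlinarith [sq_nonneg (x - y), sq_nonneg (x + u), sq_nonneg (y + u)]
  have iA2 := integrable_sq_additive (P := P) hAc hst'
  have iR2 := integrable_sq_additive (P := P) hRc hst'
  have iAD : Integrable (fun w : Path n => (∫ r in s..t, A r (obs w r)) ^ 2 +
      (∫ r in s..t, D r) ^ 2) P := iA2.add (integrable_const _)
  calc _ ≤ ∫ w, 3 * ((∫ r in s..t, A r (obs w r)) ^ 2 + (∫ r in s..t, D r) ^ 2 +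
        (∫ r in s..t, R r (obs w r)) ^ 2) ∂P :=
        integral_mono_of_nonneg (ae_of_all _ fun w => sq_nonneg _)
          ((iAD.add iR2).const_mul 3) (ae_of_all _ hpt)
    _ = 3 * (∫ w, (∫ r in s..t, A r (obs w r)) ^ 2 ∂P + (∫ r in s..t, D r) ^ 2 +
        ∫ w, (∫ r in s..t, R r (obs w r)) ^ 2 ∂P) := by
        rw [integral_const_mul, integral_add iAD iR2, integral_add iA2 (integrable_const _)]
        simp
    _ ≤ 3 * (K * (8 * ε⁻¹ ^ 4 * (H + 1) + 2) * z ^ 6 + (K + S₀) ^ 2 / 4 * z ^ 6 +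
        T * (288 * C ^ 2 * ε⁻¹ ^ 4 * (H + 1) * K) * z ^ 6) := by linarith
    _ = _ := by unfold momentConst; ring

end ReferenceMoment

/-! ### The initial entropy -/

section InitialEntropy

set_option linter.unusedSectionVars false

lemma isProbabilityMeasure_bernoulli {p : ℝ} (h0 : 0 ≤ p) (h1 : p ≤ 1) :
    IsProbabilityMeasure (bernoulli p) := by
  constructor
  simp only [bernoulli, Measure.coe_add, Measure.coe_smul, Pi.add_apply, Pi.smul_apply,
    measure_univ, smul_eq_mul, mul_one]
  rw [← ENNReal.ofReal_add h0 (by linarith)]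
  simp

lemma bernoulli_singleton (p : ℝ) (b : Bool) :
    bernoulli p {b} = ENNReal.ofReal (if b then p else 1 - p) := by
  cases b <;> simp [bernoulli]

lemma sum_measureReal_eq_one {α : Type*} [Fintype α] [MeasurableSpace α]
    [MeasurableSingletonClass α] (μ : Measure α) [IsProbabilityMeasure μ] :
    ∑ x, μ.real {x} = 1 := by
  have := sum_measureReal_singleton (μ := μ) (Finset.univ : Finset α)
  rw [this]; simp

variable {n : ℕ} [NeZero n]

/-- Finite divergence gives absolute continuity, and on a finite space the integral of the
log-likelihood ratio is the sum defining `ent`. The maximum with 0 reflects the truncation in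
`ENNReal.ofReal`. -/
lemma ent_le_of_klDiv_le {r : ℝ → ℝ} {ε K : ℝ} (hε : 0 < ε)
    (hr : Elliptic ε fun x => r (site n x)) {μ : Measure (Config n)} [IsProbabilityMeasure μ]
    (hK : InformationTheory.klDiv μ (productMeasure n r) ≤ ENNReal.ofReal K) :
    ent (fun x => r (site n x)) (fun η => μ.real {η}) ≤ max K 0 := by
  set a : ZMod n → ℝ := fun x => r (site n x) with ha
  have hb : ∀ x, IsProbabilityMeasure (bernoulli (a x)) := fun x =>
    isProbabilityMeasure_bernoulli (hr.pos hε x).le (by linarith [hr.one_sub_pos hε x])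
  set ν := productMeasure n r with hν
  have : IsProbabilityMeasure ν := by
    rw [hν, productMeasure]; infer_instance
  have hw : ∀ η, ν {η} = ENNReal.ofReal (bweight a η) := fun η => by
    rw [hν, productMeasure, Measure.pi_singleton, bweight, ENNReal.ofReal_prod_of_nonneg]
    · exact Finset.prod_congr rfl fun x _ => bernoulli_singleton _ _
    · intro x _
      split_ifs
      exacts [(hr.pos hε x).le, (hr.one_sub_pos hε x).le]
  obtain ⟨hac, hint⟩ := InformationTheory.klDiv_ne_top_iff.1
    (ne_top_of_le_ne_top ENNReal.ofReal_ne_top hK)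
  have h1 : ∫ η, llr μ ν η ∂μ ≤ max K 0 := by
    rw [← InformationTheory.toReal_klDiv_of_measure_eq hac (by simp)]
    refine (ENNReal.toReal_mono ENNReal.ofReal_ne_top hK).trans ?_
    rw [ENNReal.toReal_ofReal']
  refine le_trans (le_of_eq ?_) h1
  rw [integral_fintype hint, ent]
  refine Finset.sum_congr rfl fun η _ => ?_
  have hpos := bweight_pos hr hε η
  have h2 : μ {η} = μ.rnDeriv ν η * ν {η} := by
    conv_lhs => rw [← Measure.withDensity_rnDeriv_eq μ ν hac]
    rw [withDensity_apply _ (measurableSet_singleton η), lintegral_singleton]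
  have h3 : μ.real {η} = (μ.rnDeriv ν η).toReal * bweight a η := by
    rw [measureReal_def, h2, ENNReal.toReal_mul, hw, ENNReal.toReal_ofReal hpos.le]
  rw [smul_eq_mul, llr]
  rcases eq_or_ne (μ.rnDeriv ν η).toReal 0 with h4 | h4
  · rw [h3, h4]; simp
  · rw [h3, Real.log_mul h4 hpos.ne']; ring

/-- Change of the reference profile. -/
lemma ent_le_of_close {ε δ : ℝ} (hε : 0 < ε) {a b : ZMod n → ℝ} (ha : Elliptic ε a)
    (hb : Elliptic ε b) (hab : ∀ x, |b x - a x| ≤ δ) {p : Config n → ℝ} (hp : ∀ η, 0 ≤ p η)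
    (hp1 : ∑ η, p η = 1) : ent b p ≤ 2 * ent a p + n * (δ * ε⁻¹) ^ 2 := by
  have h1 := sum_mul_le_ent_add_log ha hε hp hp1
    (fun η => Real.log (bweight a η) - Real.log (bweight b η))
  have e1 : ent b p = ent a p +
      ∑ η, p η * (Real.log (bweight a η) - Real.log (bweight b η)) := by
    unfold ent
    rw [← Finset.sum_add_distrib]
    exact Finset.sum_congr rfl fun η _ => by ring
  -- The exponential moment factorizes over sites into a²/b + (1 - a)²/(1 - b) = 1 + (b - a)²/(b(1 -
  -- b)).
  have e2 : bmean a (fun η => Real.exp (Real.log (bweight a η) - Real.log (bweight b η))) =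
      ∏ x, (1 + (b x - a x) ^ 2 / (b x * (1 - b x))) := by
    unfold bmean
    have h := Finset.prod_univ_sum (fun _ : ZMod n => (Finset.univ : Finset Bool))
      (fun x (c : Bool) => (if c then a x else 1 - a x) *
        ((if c then a x else 1 - a x) / (if c then b x else 1 - b x)))
    rw [Fintype.piFinset_univ] at h
    have h2 : ∀ η, bweight a η *
        Real.exp (Real.log (bweight a η) - Real.log (bweight b η)) =
        ∏ x, ((if η x then a x else 1 - a x) *
          ((if η x then a x else 1 - a x) / (if η x then b x else 1 - b x))) := fun η => by
      rw [Real.exp_sub, Real.exp_log (bweight_pos ha hε η), Real.exp_log (bweight_pos hb hε η),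
        Finset.prod_mul_distrib, Finset.prod_div_distrib]
      rfl
    simp only [h2]
    rw [← h]
    refine Finset.prod_congr rfl fun x _ => ?_
    have h3 := (hb.pos hε x).ne'
    have h4 := (hb.one_sub_pos hε x).ne'
    simp only [Fintype.sum_bool, if_true, Bool.false_eq_true, if_false]
    field_simp
    ring
  have h5 : ∏ x, (1 + (b x - a x) ^ 2 / (b x * (1 - b x))) ≤ Real.exp (n * (δ * ε⁻¹) ^ 2) := by
    have h6 : ∀ x ∈ Finset.univ, 1 + (b x - a x) ^ 2 / (b x * (1 - b x)) ≤
        Real.exp ((δ * ε⁻¹) ^ 2) := by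
      intro x _
      have hx1 := hb.pos hε x
      have hx2 := hb.one_sub_pos hε x
      have h7 : (b x - a x) ^ 2 ≤ δ ^ 2 := by
        rw [← sq_abs]; exact pow_le_pow_left₀ (abs_nonneg _) (hab x) 2
      have h8 : ε ^ 2 ≤ b x * (1 - b x) := by
        rw [pow_two]
        exact mul_le_mul (hb x).1 (by linarith [(hb x).2]) hε.le hx1.le
      have h9 : (b x - a x) ^ 2 / (b x * (1 - b x)) ≤ (δ * ε⁻¹) ^ 2 := by
        rw [mul_pow, inv_pow, ← div_eq_mul_inv]
        exact div_le_div₀ (sq_nonneg _) h7 (by positivity) h8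
      linarith [Real.add_one_le_exp ((δ * ε⁻¹) ^ 2)]
    refine (Finset.prod_le_prod (fun x _ => ?_) h6).trans (le_of_eq ?_)
    · have hx1 := hb.pos hε x
      have hx2 := hb.one_sub_pos hε x
      positivity
    · rw [Finset.prod_const, Finset.card_univ, ZMod.card, ← Real.exp_nat_mul]
  have h10 : Real.log (bmean a fun η =>
      Real.exp (Real.log (bweight a η) - Real.log (bweight b η))) ≤ n * (δ * ε⁻¹) ^ 2 := by
    have hpos := bmean_pos ha hε
      (f := fun η => Real.exp (Real.log (bweight a η) - Real.log (bweight b η)))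
      fun η => Real.exp_pos _
    rw [Real.log_le_iff_le_exp hpos, e2]
    exact h5
  linarith

end InitialEntropy

/-! ### Occupation times as additive functionals -/

section OccupationTime

set_option linter.unusedSectionVars false

variable {n : ℕ} [NeZero n] {F : ℝ → ℝ} {T M : ℝ} {ρ : ℝ → ℝ → ℝ} {q : ℝ → ℝ}

/-- The observable whose time integral is the occupation time. -/
def occObservable (n : ℕ) (T : ℝ) (ρ : ℝ → ℝ → ℝ) (q : ℝ → ℝ) (r : ℝ) (η : Config n) : ℝ :=
  √n * (q (clampTime T r))⁻¹ * (occ η 0 - ρ (clampTime T r) 0)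

lemma IsWeight.inv_mem (hq : IsWeight T M q) (hT : 0 ≤ T) (hM : 1 ≤ M) (r : ℝ) :
    0 < q (clampTime T r) ∧ |(q (clampTime T r))⁻¹| ≤ M := by
  have hM0 : 0 < M := by linarith
  have h1 := hq.lower _ (clampTime_mem hT r)
  have h2 : 0 < q (clampTime T r) := lt_of_lt_of_le (by positivity) h1
  refine ⟨h2, ?_⟩
  rw [abs_of_pos (inv_pos.2 h2), inv_le_comm₀ h2 hM0, ← one_div]
  exact h1

lemma IsWeight.continuous_inv (hq : IsWeight T M q) (hT : 0 ≤ T) (hM : 1 ≤ M) :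
    Continuous fun r => (q (clampTime T r))⁻¹ :=
  (hq.smooth.continuousOn.comp_continuous (continuous_clampTime T) (clampTime_mem hT)).inv₀
    fun r => (hq.inv_mem hT hM r).1.ne'

lemma continuous_occObservable (hρ : IsHydrodynamicSolution F T ρ) (hq : IsWeight T M q)
    (hT : 0 ≤ T) (hM : 1 ≤ M) (η : Config n) : Continuous fun r => occObservable n T ρ q r η := by
  have h1 := hq.continuous_inv hT hM
  have h2 : Continuous fun r => ρ (clampTime T r) 0 :=
    (continuous_clamp hT hρ.smooth.continuousOn).comp (Continuous.prodMk_left 0)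
  exact (continuous_const.mul h1).mul (continuous_const.sub h2)

lemma occupationTime_eq {t : ℝ} (ht : t ∈ Icc 0 T) (w : Path n) :
    occupationTime n ρ q w t = ∫ r in (0 : ℝ)..t, occObservable n T ρ q r (obs w r) := by
  unfold occupationTime
  rw [← intervalIntegral.integral_const_mul]
  refine intervalIntegral.integral_congr fun r hr => ?_
  rw [uIcc_of_le ht.1] at hr
  have hr' : clampTime T r = r := clampTime_of_mem ⟨hr.1, hr.2.trans ht.2⟩
  simp only [occObservable, hr', obs]
  ring

lemma occupationTime_sub (hρ : IsHydrodynamicSolution F T ρ) (hq : IsWeight T M q) (hM : 1 ≤ M)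
    {s t : ℝ} (hs : 0 ≤ s) (hst : s ≤ t) (ht : t ≤ T) (w : Path n) :
    occupationTime n ρ q w t - occupationTime n ρ q w s =
      ∫ r in s..t, occObservable n T ρ q r (obs w r) := by
  have hc := continuous_occObservable (n := n) hρ hq (hs.trans (hst.trans ht)) hM
  rw [occupationTime_eq ⟨hs.trans hst, ht⟩, occupationTime_eq ⟨hs, hst.trans ht⟩,
    ← intervalIntegral.integral_add_adjacent_intervals (intervalIntegrable_observable hc w hs)
      (intervalIntegrable_observable hc w hst)]
  ring

end OccupationTime

/-! ### The uniform second moment estimate -/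

section UniformMoment

set_option linter.unusedSectionVars false

lemma exists_bound_of_periodic {f : ℝ → ℝ} (hf : Continuous f) (hper : Function.Periodic f 1) :
    ∃ C, 0 ≤ C ∧ ∀ u, |f u| ≤ C := by
  obtain ⟨C, hC⟩ := isCompact_Icc.exists_bound_of_continuousOn (s := Icc (0 : ℝ) 1) hf.continuousOn
  refine ⟨max C 0, le_max_right _ _, fun u => ?_⟩
  obtain ⟨y, hy, e⟩ := hper.exists_mem_Ico₀ one_pos u
  rw [e]
  exact (hC y ⟨hy.1, hy.2.le⟩).trans (le_max_left _ _)

lemma exists_drift_bound {F : ℝ → ℝ} (hF : ContDiff ℝ ∞ F) (hFper : Function.Periodic F 1) :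
    ∃ C, 0 ≤ C ∧ (∀ u, |F u| ≤ C) ∧ ∀ u, |deriv F u| ≤ C := by
  obtain ⟨C₁, h1, h1'⟩ := exists_bound_of_periodic hF.continuous hFper
  have hd : Function.Periodic (deriv F) 1 := fun u => by
    have : (fun v => F (v + 1)) = F := funext hFper
    rw [← deriv_comp_add_const, this]
  obtain ⟨C₂, h2, h2'⟩ := exists_bound_of_periodic (hF.continuous_deriv (by simp)) hd
  exact ⟨max C₁ C₂, h1.trans (le_max_left _ _), fun u => (h1' u).trans (le_max_left _ _),
    fun u => (h2' u).trans (le_max_right _ _)⟩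

/-- The entropy bound for the initial measure with respect to the cell averages. -/
def uniformEntropy (T ε κ C K : ℝ) : ℝ :=
  entropyBound T ε κ (κ + 2 * C) (2 * max K 0 + (κ * ε⁻¹) ^ 2) (fluxErrorBound T C κ)

/-- The constant of the second moment estimate, uniform in the initial profile. -/
def uniformMoment (T ε κ C M K : ℝ) : ℝ :=
  2 * momentConst T ε C M (fluxErrorBound T C κ) (uniformEntropy T ε κ C K) +
    2 * ((M * κ) ^ 2 * √T) + (3 + 2 * C) * M ^ 2 * √T

lemma sq_le_sqrt_mul {τ T : ℝ} (h0 : 0 ≤ τ) (h : τ ≤ T) : τ ^ 2 ≤ √T * √√τ ^ 6 := by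
  have hz2 : √√τ ^ 2 = √τ := Real.sq_sqrt (Real.sqrt_nonneg _)
  have h1 : √√τ ^ 6 = √τ ^ 3 := by
    rw [show √√τ ^ 6 = (√√τ ^ 2) ^ 3 by ring, hz2]
  have h2 : τ ^ 2 = √τ * √τ ^ 3 := by
    rw [show √τ * √τ ^ 3 = (√τ ^ 2) ^ 2 by ring, Real.sq_sqrt h0]
  rw [h1, h2]
  have := Real.sqrt_le_sqrt h
  gcongr

variable {n : ℕ} [NeZero n] {F : ℝ → ℝ} {P : Measure (Path n)} {T ε₀ κ M K C : ℝ}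
  {ρ : ℝ → ℝ → ℝ} {q : ℝ → ℝ}

lemma abs_additive_le {A : ℝ → Config n → ℝ} {B s t : ℝ} (hst : s ≤ t)
    (hB : ∀ r ∈ Icc s t, ∀ η, |A r η| ≤ B) (w : Path n) :
    |∫ r in s..t, A r (obs w r)| ≤ B * (t - s) := by
  have := intervalIntegral.norm_integral_le_of_norm_le_const (a := s) (b := t) (C := B)
    (f := fun r => A r (obs w r)) fun r hr => by
      rw [uIoc_of_le hst] at hr
      exact hB r ⟨hr.1.le, hr.2⟩ _
  rwa [Real.norm_eq_abs, abs_of_nonneg (by linarith : 0 ≤ t - s)] at this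

lemma IsHydrodynamicSolution.ellipticity_le (hρ : IsHydrodynamicSolution F T ρ)
    (hF : ContDiff ℝ ∞ F) (hT : 0 < T) (hF' : ∀ u, |deriv F u| ≤ C)
    (hε₀ : ε₀ ∈ Ioo (0 : ℝ) (1 / 2)) (h0 : ∀ u, ρ 0 u ∈ Ioo ε₀ (1 - ε₀)) {t : ℝ}
    (ht : t ∈ Icc 0 T) (u : ℝ) :
    ellipticity C T ε₀ ≤ ρ t u ∧ ρ t u ≤ 1 - ellipticity C T ε₀ := by
  obtain ⟨ρc, ρu, ρuu, ρt, ρtu, hc, he⟩ := hρ.exists_classical hF hT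
  rw [← he t ht]
  exact hc.mem_Icc hF' hε₀ (fun u => by rw [he 0 (left_mem_Icc.2 hT.le)]; exact h0 u) ht u

/-- All constants pass through C, the ellipticity, κ, M, K and T. The initial entropy is transferred
from point values to cell averages at a cost of order 1/n, and recentring the integrand from ρ to
the cell average at the origin changes it by at most Mκ, which contributes only τ² to the second
moment. -/
theorem IsAdmissibleLaw.second_moment_le (hP : IsAdmissibleLaw n F (ρ 0) K P)
    (hF : ContDiff ℝ ∞ F) (hFper : Function.Periodic F 1) (hT : 0 < T)
    (hε₀ : ε₀ ∈ Ioo (0 : ℝ) (1 / 2)) (hM : 1 ≤ M) (hFC : ∀ u, |F u| ≤ C)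
    (hF' : ∀ u, |deriv F u| ≤ C) (hρ : IsHydrodynamicSolution F T ρ)
    (h0 : ∀ u, ρ 0 u ∈ Ioo ε₀ (1 - ε₀)) (hκ : GradientBound T κ ρ) (hq : IsWeight T M q)
    {s t : ℝ} (hs : 0 ≤ s) (hst : s < t) (ht : t ≤ T) :
    ∫ w, (∫ r in s..t, occObservable n T ρ q r (obs w r)) ^ 2 ∂P ≤
      uniformMoment T (ellipticity C T ε₀) κ C M K * √√(t - s) ^ 6 := by
  obtain ⟨-, μ, hμ, hK, hlaw⟩ := hP
  have := hlaw.isProbabilityMeasure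
  set ε := ellipticity C T ε₀ with hε
  have hε0 : 0 < ε := mul_pos hε₀.1 (Real.exp_pos _)
  have hC : 0 ≤ C := (abs_nonneg _).trans (hFC 0)
  have hM0 : 0 ≤ M := by linarith
  have hτ : 0 ≤ t - s := by linarith
  have hτT : t - s ≤ T := by linarith
  have hell : ∀ t ∈ Icc 0 T, ∀ u, ε ≤ ρ t u ∧ ρ t u ≤ 1 - ε := fun t ht u =>
    hρ.ellipticity_le hF hT hF' hε₀ h0 ht u
  have h0T : (0 : ℝ) ∈ Icc 0 T := left_mem_Icc.2 hT.le
  set z := √√(t - s) with hz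
  have hz0 : 0 ≤ z := Real.sqrt_nonneg _
  have hsq : (t - s) ^ 2 ≤ √T * z ^ 6 := sq_le_sqrt_mul hτ hτT
  have hcont := continuous_occObservable (n := n) hρ hq hT.le hM
  obtain ⟨ρc, ρu, ρuu, ρt, ρtu, hc, he⟩ := hρ.exists_classical hF hT
  have hκc : ∀ t ∈ Icc 0 T, ∀ u, |ρu t u| ≤ κ := fun t ht u =>
    hc.abs_deriv_le (fun t ht n hn x => by rw [he t ht]; exact hκ t ht n hn x) ht u
  have hκ0 : 0 ≤ κ := (abs_nonneg _).trans (hκc 0 h0T 0)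
  have hellc : ∀ t ∈ Icc 0 T, ∀ u, ε ≤ ρc t u ∧ ρc t u ≤ 1 - ε := fun t ht u => by
    rw [he t ht]; exact hell t ht u
  have hS0 : 0 ≤ fluxErrorBound T C κ := by unfold fluxErrorBound; positivity
  have hH0 : 0 ≤ uniformEntropy T ε κ C K := by
    unfold uniformEntropy entropyBound
    have := le_max_right K 0
    positivity
  have hmc : 0 ≤ momentConst T ε C M (fluxErrorBound T C κ) (uniformEntropy T ε κ C K) := by
    have := heatConst_nonneg T M
    unfold momentConst
    positivity
  -- The condition n ≥ 2C makes |F|/n ≤ 1/2, so that the rates stay between 1/2 and 3/2; n ≥ 3 is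
  -- required by the replacement estimate. The sizes left out are bounded, and the pointwise bound
  -- √n M suffices for them.
  by_cases hsmall : n < 3 ∨ (n : ℝ) < 2 * C
  · -- finitely many sizes
    have hn : (n : ℝ) ≤ 3 + 2 * C := by
      rcases hsmall with h | h
      · have : (n : ℝ) ≤ 3 := by exact_mod_cast h.le
        linarith
      · linarith
    have hb : ∀ r ∈ Icc s t, ∀ η : Config n, |occObservable n T ρ q r η| ≤ √n * M := by
      intro r _ η
      have h1 := (hq.inv_mem hT.le hM r).2
      have h2 := hell _ (clampTime_mem hT.le r) 0
      have h3 : |occ η 0 - ρ (clampTime T r) 0| ≤ 1 := by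
        unfold occ
        rw [abs_le]
        split_ifs <;> constructor <;> linarith
      unfold occObservable
      rw [abs_mul, abs_mul, abs_of_nonneg (Real.sqrt_nonneg _)]
      calc _ ≤ √n * M * 1 := by gcongr
        _ = _ := mul_one _
    have hpt : ∀ w : Path n, (∫ r in s..t, occObservable n T ρ q r (obs w r)) ^ 2 ≤
        (3 + 2 * C) * M ^ 2 * √T * z ^ 6 := by
      intro w
      have h1 := pow_le_pow_left₀ (abs_nonneg _) (abs_additive_le hst.le hb w) 2
      rw [sq_abs, mul_pow, mul_pow, Real.sq_sqrt (by positivity)] at h1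
      calc _ ≤ _ := h1
        _ ≤ (3 + 2 * C) * M ^ 2 * (√T * z ^ 6) := by gcongr
        _ = _ := by ring
    have h1 := integral_mono (μ := P) (integrable_sq_additive hcont hst.le) (integrable_const _) hpt
    rw [integral_const, probReal_univ, one_smul] at h1
    refine h1.trans ?_
    gcongr
    unfold uniformMoment
    have : 0 ≤ (M * κ) ^ 2 * √T := by positivity
    linarith
  · rw [not_or, not_lt, not_lt] at hsmall
    obtain ⟨hn, hnC⟩ := hsmall
    have hn0 : (0 : ℝ) < n := by exact_mod_cast (by omega : 0 < n)
    have hn1 : (1 : ℝ) ≤ n := by exact_mod_cast (by omega : 1 ≤ n)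
    have hFn : ∀ u, |F u / n| ≤ 1 / 2 := fun u => by
      rw [abs_div, abs_of_pos hn0, div_le_iff₀ hn0]
      linarith [hFC u]
    have hR : ∀ x, 1 / 2 ≤ rateRight n F x := fun x => by
      unfold rateRight; linarith [(abs_le.1 (hFn (site n x))).1]
    have hL : ∀ x, 0 ≤ rateLeft n F x := fun x => by
      unfold rateLeft; linarith [(abs_le.1 (hFn (site n (x + 1)))).2]
    have hR2 : ∀ x, |rateRight n F x| ≤ 2 := fun x => by
      rw [abs_of_nonneg (by linarith [hR x])]
      unfold rateRight; linarith [(abs_le.1 (hFn (site n x))).2]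
    have hL2 : ∀ x, |rateLeft n F x| ≤ 2 := fun x => by
      rw [abs_of_nonneg (hL x)]
      unfold rateLeft; linarith [(abs_le.1 (hFn (site n (x + 1)))).1]
    have hFd : Differentiable ℝ F := hF.differentiable (by simp)
    set a := cellProfile n ρc with ha
    set J := cellFlux n F ρc ρu with hJ
    have href : ReferenceProfile n T ε κ (κ + 2 * C) a J :=
      hc.referenceProfile hT (by omega) hFd hFper hFC hε0 hellc hκc
    have hfe := hc.integral_fluxError_le hT (n := n) (by omega) hFd hFper hFC hF'
      (fun t ht u => ⟨by linarith [(hellc t ht u).1], by linarith [(hellc t ht u).2]⟩) hκc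
      (href.continuousOn_fluxError F)
    have hp0 : ∀ η : Config n, 0 ≤ μ.real {η} := fun η => measureReal_nonneg
    have hp1 : ∑ η : Config n, μ.real {η} = 1 := sum_measureReal_eq_one μ
    have hent0 : ent (a 0) (fun η => μ.real {η}) ≤ 2 * max K 0 + (κ * ε⁻¹) ^ 2 := by
      have hE : Elliptic ε fun x : ZMod n => ρ 0 (site n x) := fun x => hell 0 h0T _
      have h1 := ent_le_of_klDiv_le hε0 hE hK
      have h2 := ent_le_of_close hε0 hE (href.elliptic 0 h0T) (δ := κ / n) (fun x => by
        have := hc.abs_cellProfile_sub_le (n := n) (by omega) hκc h0T x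
        rwa [he 0 h0T] at this) hp0 hp1
      have h3 : n * (κ / n * ε⁻¹) ^ 2 ≤ (κ * ε⁻¹) ^ 2 := by
        have e : n * (κ / n * ε⁻¹) ^ 2 = (κ * ε⁻¹) ^ 2 / n := by field_simp
        rw [e]
        exact div_le_self (sq_nonneg _) hn1
      linarith
    have hent : ∀ r ∈ Icc 0 T, ent (a r) (lawAt n F (fun η => μ.real {η}) r) ≤
        uniformEntropy T ε κ C K := fun r hr => by
      refine (ent_lawAt_le hT.le hε0 hκ0 (by positivity) hn href hR hL hfe hp0 hp1 hr).trans ?_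
      unfold uniformEntropy entropyBound
      gcongr
    have hac : ∀ x, Continuous fun r => a r x := fun x => by
      simp only [ha, cellProfile, cellAvg]
      refine continuous_const.mul ?_
      refine intervalIntegral.continuous_parametric_intervalIntegral_of_continuous'
        (f := fun r y => ρc r (site n x + y)) ?_ 0 (1 / (n : ℝ))
      exact hc.cont.comp (f := fun p : ℝ × ℝ => (p.1, site n x + p.2)) (by fun_prop)
    have hJc : ∀ x, Continuous fun r => J r x := fun x => by
      have h1 : Continuous fun r => ρc r (site n x + 1 / n) :=
        hc.cont.comp (Continuous.prodMk_left _)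
      have h2 : Continuous fun r => ρu r (site n x + 1 / n) :=
        hc.cont_u.comp (Continuous.prodMk_left _)
      simp only [hJ, cellFlux, macroFlux]
      fun_prop
    set v : ℝ → ℝ := fun r => (q (clampTime T r))⁻¹ with hv
    have hvc : Continuous v := hq.continuous_inv hT.le hM
    have hvM : ∀ r, |v r| ≤ M := fun r => (hq.inv_mem hT.le hM r).2
    have hmain := hlaw.second_moment_le hε0 hn href hac hJc hFC (fun x => by linarith [hR x]) hL
      hR2 hL2 hfe hent hvc (fun r _ => hvM r) hs hst ht
    -- the difference of the profiles at the origin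
    set V : ℝ → Config n → ℝ := fun r η => √n * v r * (occ η 0 - a r 0) with hV
    have hVc : ∀ η, Continuous fun r => V r η := fun η => by
      have := hac 0
      simp only [hV]; fun_prop
    set U : ℝ → Config n → ℝ := fun r η => occObservable n T ρ q r η - V r η with hU
    have hUc : ∀ η, Continuous fun r => U r η := fun η => (hcont η).sub (hVc η)
    have hUb : ∀ r ∈ Icc s t, ∀ η, |U r η| ≤ M * κ := by
      intro r hr η
      have hr' : r ∈ Icc 0 T := ⟨hs.trans hr.1, hr.2.trans ht⟩
      have e : U r η = √n * v r * (a r 0 - ρ r 0) := by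
        simp only [hU, hV, hv, occObservable, clampTime_of_mem hr']; ring
      have h1 := hc.abs_cellProfile_sub_le (n := n) (by omega) hκc hr' 0
      rw [he r hr', show site n (0 : ZMod n) = 0 by simp [site]] at h1
      rw [e, abs_mul, abs_mul, abs_of_nonneg (Real.sqrt_nonneg _)]
      have h2 : √(n : ℝ) ≤ n := by
        rw [Real.sqrt_le_left (by positivity)]; nlinarith
      calc _ ≤ n * M * (κ / n) := by
            refine mul_le_mul ?_ h1 (abs_nonneg _) (by positivity)
            exact mul_le_mul h2 (hvM r) (abs_nonneg _) (by positivity)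
        _ = M * κ := by field_simp
    have hpt : ∀ w : Path n, (∫ r in s..t, occObservable n T ρ q r (obs w r)) ^ 2 ≤
        2 * (∫ r in s..t, V r (obs w r)) ^ 2 + 2 * ((M * κ) ^ 2 * √T) * z ^ 6 := by
      intro w
      have iV := intervalIntegrable_observable hVc w hst.le
      have iU := intervalIntegrable_observable hUc w hst.le
      have e : ∫ r in s..t, occObservable n T ρ q r (obs w r) =
          (∫ r in s..t, V r (obs w r)) + ∫ r in s..t, U r (obs w r) := by
        rw [← intervalIntegral.integral_add iV iU]
        exact intervalIntegral.integral_congr fun r _ => by simp only [hU]; ring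
      have h1 := pow_le_pow_left₀ (abs_nonneg _) (abs_additive_le hst.le hUb w) 2
      rw [sq_abs, mul_pow] at h1
      have h2 : (M * κ) ^ 2 * (t - s) ^ 2 ≤ (M * κ) ^ 2 * (√T * z ^ 6) := by gcongr
      rw [e]
      set x := ∫ r in s..t, V r (obs w r)
      set y := ∫ r in s..t, U r (obs w r)
      nlinarith [sq_nonneg (x - y)]
    have iV2 := (integrable_sq_additive (P := P) hVc hst.le).const_mul 2
    have h1 := integral_mono (μ := P) (integrable_sq_additive hcont hst.le)
      (iV2.add (integrable_const _)) hpt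
    refine h1.trans ?_
    simp only [Pi.add_apply]
    rw [integral_add iV2 (integrable_const _), integral_const_mul, integral_const, probReal_univ,
      one_smul]
    unfold uniformMoment
    have h4 : 0 ≤ (3 + 2 * C) * M ^ 2 * √T * z ^ 6 := by positivity
    linarith

end UniformMoment

/-! ### Compact sets and measurability in `C([0,T])` -/

section ContinuousPaths

/-- A closed ball for the uniform distance is a countable intersection of conditions on evaluations
at a dense set of times, and every open set is a countable union of closed balls. -/
lemma measurable_of_measurable_apply {Ω : Type*} [MeasurableSpace Ω] {T : ℝ}
    {f : Ω → C(Icc (0 : ℝ) T, ℝ)} (hf : ∀ x, Measurable fun w => f w x) : Measurable f := by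
  have hball : ∀ (g : C(Icc (0 : ℝ) T, ℝ)) (r : ℝ), 0 ≤ r →
      MeasurableSet (f ⁻¹' Metric.closedBall g r) := by
    intro g r hr
    obtain ⟨D, hDc, hDd⟩ := TopologicalSpace.exists_countable_dense (Icc (0 : ℝ) T)
    have e : f ⁻¹' Metric.closedBall g r = ⋂ x ∈ D, {w | dist (f w x) (g x) ≤ r} := by
      ext w
      simp only [mem_preimage, Metric.mem_closedBall, mem_iInter, ContinuousMap.dist_le hr]
      refine ⟨fun h x _ => h x, fun h x => ?_⟩
      have hcl : IsClosed {x | dist (f w x) (g x) ≤ r} :=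
        isClosed_le (by fun_prop) continuous_const
      exact hcl.closure_subset_iff.2 (fun x hx => h x hx) (hDd x)
    rw [e]
    refine MeasurableSet.biInter hDc fun x _ => ?_
    exact measurableSet_le ((hf x).dist measurable_const) measurable_const
  refine measurable_of_isOpen fun U hU => ?_
  have hr : ∀ g : U, ∃ r, 0 < r ∧ Metric.closedBall (g : C(Icc (0 : ℝ) T, ℝ)) r ⊆ U := fun g =>
    Metric.nhds_basis_closedBall.mem_iff.1 (hU.mem_nhds g.2)
  choose r hr0 hrU using hr
  obtain ⟨S, hSc, hS⟩ := TopologicalSpace.isOpen_iUnion_countable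
    (fun g : U => Metric.ball (g : C(Icc (0 : ℝ) T, ℝ)) (r g)) fun _ => Metric.isOpen_ball
  have e : U = ⋃ g ∈ S, Metric.closedBall (g : C(Icc (0 : ℝ) T, ℝ)) (r g) := by
    refine Subset.antisymm (fun g hg => ?_) (iUnion₂_subset fun g _ => hrU g)
    have h1 : g ∈ ⋃ g : U, Metric.ball (g : C(Icc (0 : ℝ) T, ℝ)) (r g) :=
      mem_iUnion.2 ⟨⟨g, hg⟩, Metric.mem_ball_self (hr0 _)⟩
    rw [← hS] at h1
    exact iUnion₂_mono (fun g _ => Metric.ball_subset_closedBall) h1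
  rw [e]
  simp only [preimage_iUnion]
  exact MeasurableSet.biUnion hSc fun g _ => hball g _ (hr0 g).le

/-- Functions bounded by `A` with a prescribed modulus of continuity at dyadic scales. -/
def modulusSet (T A x : ℝ) : Set C(Icc (0 : ℝ) T, ℝ) :=
  {f | (∀ s, |f s| ≤ A) ∧ ∀ (m : ℕ) s t, dist s t ≤ T / 2 ^ m → |f s - f t| ≤ A * x ^ m}

/-- Arzelà–Ascoli. The defining inequalities force continuity by themselves and are closed under
pointwise limits, so the set is compact already in the product topology. -/
lemma isCompact_modulusSet {T A x : ℝ} (hT : 0 < T) (hx0 : 0 ≤ x) (hx1 : x < 1) :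
    IsCompact (modulusSet T A x) := by
  have hlim : Tendsto (fun m : ℕ => A * x ^ m) atTop (𝓝 0) := by
    simpa using (tendsto_pow_atTop_nhds_zero_of_lt_one hx0 hx1).const_mul A
  have key : ∀ ε > 0, ∃ δ > 0, ∀ f : Icc (0 : ℝ) T → ℝ,
      (∀ (m : ℕ) s t, dist s t ≤ T / 2 ^ m → |f s - f t| ≤ A * x ^ m) →
      ∀ s t, dist s t < δ → |f s - f t| < ε := by
    intro ε hε
    obtain ⟨m, hm⟩ := (hlim.eventually (gt_mem_nhds hε)).exists
    exact ⟨T / 2 ^ m, by positivity, fun f hf s t hst => (hf m s t hst.le).trans_lt hm⟩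
  have himage : ContinuousMap.toFun '' modulusSet T A x =
      {f : Icc (0 : ℝ) T → ℝ | (∀ s, |f s| ≤ A) ∧
        ∀ (m : ℕ) s t, dist s t ≤ T / 2 ^ m → |f s - f t| ≤ A * x ^ m} := by
    ext f
    constructor
    · rintro ⟨g, hg, rfl⟩
      exact hg
    · intro hf
      have hc : Continuous f := by
        rw [Metric.continuous_iff]
        intro s ε hε
        obtain ⟨δ, hδ, h⟩ := key ε hε
        exact ⟨δ, hδ, fun t hts => h f hf.2 t s hts⟩
      exact ⟨⟨f, hc⟩, hf, rfl⟩
  refine ArzelaAscoli.isCompact_of_equicontinuous _ ?_ ?_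
  · rw [himage]
    refine IsCompact.of_isClosed_subset (isCompact_univ_pi fun _ : Icc (0 : ℝ) T =>
      isCompact_Icc (a := -A) (b := A)) ?_ fun f hf s _ => abs_le.1 (hf.1 s)
    have h1 : IsClosed {f : Icc (0 : ℝ) T → ℝ | ∀ s, |f s| ≤ A} := by
      simp only [ofPred_forall]
      exact isClosed_iInter fun s => isClosed_le (by fun_prop) continuous_const
    have h2 : IsClosed {f : Icc (0 : ℝ) T → ℝ | ∀ (m : ℕ) s t, dist s t ≤ T / 2 ^ m →
        |f s - f t| ≤ A * x ^ m} := by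
      simp only [ofPred_forall]
      exact isClosed_iInter fun m => isClosed_iInter fun s => isClosed_iInter fun t =>
        isClosed_iInter fun _ => isClosed_le (by fun_prop) continuous_const
    exact h1.inter h2
  · intro s
    rw [Metric.equicontinuousAt_iff_right]
    intro ε hε
    obtain ⟨δ, hδ, h⟩ := key ε hε
    filter_upwards [Metric.ball_mem_nhds s hδ] with t ht f
    rw [Real.dist_eq]
    exact h f.1 f.2.2 s t (by rw [dist_comm]; exact ht)

lemma floor_two_mul (y : ℝ) (hy : 0 ≤ y) :
    ⌊2 * y⌋₊ = 2 * ⌊y⌋₊ ∨ ⌊2 * y⌋₊ = 2 * ⌊y⌋₊ + 1 := by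
  have h1 := Nat.floor_le hy
  have h2 := Nat.lt_floor_add_one y
  have h3 : 2 * ⌊y⌋₊ ≤ ⌊2 * y⌋₊ := Nat.le_floor (by push_cast; linarith)
  have h4 : ⌊2 * y⌋₊ < 2 * ⌊y⌋₊ + 2 := by
    rw [Nat.floor_lt (by positivity)]
    push_cast; linarith
  omega

/-- Chaining along dyadic points. -/
lemma chaining {T c x : ℝ} (hT : 0 < T) (hx0 : 0 ≤ x) (hx1 : x < 1) (hc : 0 ≤ c)
    {f : ℝ → ℝ} (hf : ContinuousOn f (Icc 0 T))
    (hinc : ∀ k i : ℕ, i < 2 ^ k →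
      |f ((i + 1 : ℕ) * (T / 2 ^ k)) - f (i * (T / 2 ^ k))| ≤ c * x ^ k)
    (m : ℕ) {s t : ℝ} (hs : s ∈ Icc 0 T) (ht : t ∈ Icc 0 T) (hst : |s - t| ≤ T / 2 ^ m) :
    |f s - f t| ≤ c * (1 + 2 / (1 - x)) * x ^ m := by
  -- `pt s k` is the largest multiple of T/2^k below s. Consecutive levels give equal or adjacent
  -- points, hence a geometric series from level m on; two times at distance at most T/2^m have
  -- equal or adjacent points at level m. This yields the constant 1 + 2/(1 - x).
  set I : ℝ → ℕ → ℕ := fun s k => ⌊2 ^ k * (s / T)⌋₊ with hI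
  set pt : ℝ → ℕ → ℝ := fun s k => (I s k : ℝ) * (T / 2 ^ k) with hpt
  have hn0 : ∀ s ∈ Icc 0 T, ∀ k : ℕ, 0 ≤ 2 ^ k * (s / T) := fun s hs k => by
    have := hs.1
    positivity
  have hpt_le : ∀ s ∈ Icc 0 T, ∀ k, pt s k ≤ s := fun s hs k => by
    have h1 := Nat.floor_le (hn0 s hs k)
    calc pt s k ≤ (2 ^ k * (s / T)) * (T / 2 ^ k) := by
          simp only [hpt, hI]; gcongr
      _ = s := by field_simp
  have hlt_pt : ∀ s ∈ Icc 0 T, ∀ k, s - T / 2 ^ k ≤ pt s k := fun s hs k => by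
    have h1 := (Nat.lt_floor_add_one (2 ^ k * (s / T))).le
    have h2 : (2 ^ k * (s / T)) * (T / 2 ^ k) ≤ ((I s k : ℝ) + 1) * (T / 2 ^ k) := by
      simp only [hI]; gcongr
    have h3 : (2 ^ k * (s / T)) * (T / 2 ^ k) = s := by field_simp
    simp only [hpt]
    linarith
  have hI_le : ∀ s ∈ Icc 0 T, ∀ k, I s k ≤ 2 ^ k := fun s hs k => by
    have h1 : (2 : ℝ) ^ k * (s / T) ≤ 2 ^ k := by
      have : s / T ≤ 1 := (div_le_one hT).2 hs.2
      exact mul_le_of_le_one_right (by positivity) this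
    have h2 : (I s k : ℝ) ≤ ((2 ^ k : ℕ) : ℝ) := by
      push_cast
      exact (Nat.floor_le (hn0 s hs k)).trans h1
    exact Nat.cast_le.1 h2
  have hmem : ∀ s ∈ Icc 0 T, ∀ k, pt s k ∈ Icc 0 T := fun s hs k =>
    ⟨by simp only [hpt]; positivity, (hpt_le s hs k).trans hs.2⟩
  have happrox : ∀ s ∈ Icc 0 T, |f (pt s m) - f s| ≤ c * x ^ m / (1 - x) := by
    intro s hs
    have hstep : ∀ k, dist (f (pt s k)) (f (pt s (k + 1))) ≤ c * x ^ k := by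
      intro k
      have e : 2 ^ (k + 1) * (s / T) = 2 * (2 ^ k * (s / T)) := by ring
      have hcx : c * x ^ (k + 1) ≤ c * x ^ k := by
        have := pow_le_pow_of_le_one hx0 hx1.le (Nat.le_succ k)
        gcongr
      have hp : pt s k = ((2 * I s k : ℕ) : ℝ) * (T / 2 ^ (k + 1)) := by
        simp only [hpt]; push_cast; field_simp; ring
      rcases floor_two_mul _ (hn0 s hs k) with h | h
      · have h1 : pt s (k + 1) = pt s k := by
          rw [hp]; simp only [hpt, hI, e, h]
        rw [h1, dist_self]
        positivity
      · have h1 : I s (k + 1) = 2 * I s k + 1 := by simp only [hI, e, h]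
        have h2 : pt s (k + 1) = ((2 * I s k + 1 : ℕ) : ℝ) * (T / 2 ^ (k + 1)) := by
          simp only [hpt, h1]
        have h3 := hI_le s hs (k + 1)
        rw [hp, h2, dist_comm, Real.dist_eq]
        exact (hinc (k + 1) (2 * I s k) (by omega)).trans hcx
    have hlim : Tendsto (fun k => pt s k) atTop (𝓝 s) := by
      have h1 : Tendsto (fun k : ℕ => s - T / 2 ^ k) atTop (𝓝 s) := by
        have h2 := (tendsto_pow_atTop_nhds_zero_of_lt_one (r := (1 / 2 : ℝ)) (by norm_num)
          (by norm_num)).const_mul T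
        have h3 := h2.const_sub s
        rw [mul_zero, sub_zero] at h3
        refine h3.congr fun k => ?_
        rw [one_div, inv_pow]; rfl
      exact tendsto_of_tendsto_of_tendsto_of_le_of_le h1 tendsto_const_nhds (hlt_pt s hs)
        (hpt_le s hs)
    have hlim' : Tendsto (fun k => f (pt s k)) atTop (𝓝 (f s)) :=
      (hf s hs).tendsto.comp (tendsto_nhdsWithin_iff.2 ⟨hlim, Eventually.of_forall (hmem s hs)⟩)
    exact dist_le_of_le_geometric_of_tendsto x c hx1 hstep hlim' m
  have hadj : ∀ s ∈ Icc 0 T, ∀ t ∈ Icc 0 T, s ≤ t → t - s ≤ T / 2 ^ m →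
      |f (pt t m) - f (pt s m)| ≤ c * x ^ m := by
    intro s hs t ht hst hd
    have h1 : I s m ≤ I t m := Nat.floor_le_floor (by gcongr)
    have h2 : I t m ≤ I s m + 1 := by
      have h3 : 2 ^ m * (t / T) ≤ 2 ^ m * (s / T) + 1 := by
        have : 2 ^ m * (t / T) - 2 ^ m * (s / T) = (t - s) / (T / 2 ^ m) := by field_simp
        have h4 : (t - s) / (T / 2 ^ m) ≤ 1 := (div_le_one (by positivity)).2 hd
        linarith
      calc I t m ≤ ⌊2 ^ m * (s / T) + 1⌋₊ := Nat.floor_le_floor h3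
        _ = I s m + 1 := Nat.floor_add_one (hn0 s hs m)
    rcases h1.eq_or_lt with h | h
    · have : pt t m = pt s m := by simp only [hpt, h]
      rw [this, sub_self, abs_zero]
      positivity
    · have h3 : I t m = I s m + 1 := by omega
      have h4 := hI_le t ht m
      have h5 := hinc m (I s m) (by omega)
      simp only [hpt, h3]
      exact h5
  have hadj' : |f (pt t m) - f (pt s m)| ≤ c * x ^ m := by
    rcases le_total s t with h | h
    · exact hadj s hs t ht h (by rwa [abs_sub_comm, abs_of_nonneg (by linarith)] at hst)
    · rw [abs_sub_comm]
      exact hadj t ht s hs h (by rwa [abs_of_nonneg (by linarith)] at hst)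
  have h1 := happrox s hs
  have h2 := happrox t ht
  rw [abs_sub_comm] at h1 hadj'
  calc |f s - f t| = |(f s - f (pt s m)) + (f (pt s m) - f (pt t m)) + (f (pt t m) - f t)| := by
        congr 1; ring
    _ ≤ |f s - f (pt s m)| + |f (pt s m) - f (pt t m)| + |f (pt t m) - f t| :=
        abs_add_three _ _ _
    _ ≤ c * x ^ m / (1 - x) + c * x ^ m + c * x ^ m / (1 - x) := by gcongr
    _ = _ := by ring

end ContinuousPaths

/-! ### Tightness of the occupation times -/

section Tightness

set_option linter.unusedSectionVars false

variable {n : ℕ} [NeZero n] {F : ℝ → ℝ} {T M : ℝ} {ρ : ℝ → ℝ → ℝ} {q : ℝ → ℝ}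

lemma continuousOn_occupationTime (hρ : IsHydrodynamicSolution F T ρ) (hq : IsWeight T M q)
    (hT : 0 ≤ T) (hM : 1 ≤ M) (w : Path n) :
    ContinuousOn (occupationTime n ρ q w) (Icc 0 T) := by
  have h1 := intervalIntegral.continuousOn_primitive_interval'
    (intervalIntegrable_observable (continuous_occObservable (n := n) hρ hq hT hM) w hT)
    (left_mem_uIcc)
  rw [uIcc_of_le hT] at h1
  exact h1.congr fun t ht => occupationTime_eq ht w

lemma occupationPath_apply (hρ : IsHydrodynamicSolution F T ρ) (hq : IsWeight T M q)
    (hT : 0 ≤ T) (hM : 1 ≤ M) (w : Path n) (t : Icc (0 : ℝ) T) :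
    occupationPath n T ρ q w t = occupationTime n ρ q w t :=
  ContinuousMap.mkD_apply_of_continuous
    (continuousOn_iff_continuous_domRestrict.1 (continuousOn_occupationTime hρ hq hT hM w))

lemma measurable_occupationPath (hρ : IsHydrodynamicSolution F T ρ) (hq : IsWeight T M q)
    (hT : 0 ≤ T) (hM : 1 ≤ M) : Measurable (occupationPath n T ρ q) := by
  refine measurable_of_measurable_apply fun t => ?_
  simp only [occupationPath_apply hρ hq hT hM, occupationTime_eq t.2]
  exact measurable_additive (continuous_occObservable hρ hq hT hM) t.2.1

/-- The sum of the squared increments over the dyadic intervals of level `k`. -/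
def dyadicSum (n : ℕ) [NeZero n] (T : ℝ) (ρ : ℝ → ℝ → ℝ) (q : ℝ → ℝ) (k : ℕ) (w : Path n) : ℝ :=
  ∑ i ∈ Finset.range (2 ^ k), (∫ r in (i * (T / 2 ^ k))..((i + 1 : ℕ) * (T / 2 ^ k)),
    occObservable n T ρ q r (obs w r)) ^ 2

/-- The square of `decay` is `1/√2`. -/
def decay : ℝ := √(√2)⁻¹

lemma decay_pos : 0 < decay := by unfold decay; positivity

lemma decay_sq : decay ^ 2 = (√2)⁻¹ := Real.sq_sqrt (by positivity)

lemma decay_lt_one : decay < 1 := by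
  have h1 : (√2)⁻¹ < 1 := inv_lt_one_of_one_lt₀ (by
    rw [Real.lt_sqrt (by norm_num)]; norm_num)
  unfold decay
  rw [Real.sqrt_lt' one_pos]
  simpa using h1

/-- The sum of 2^k second moments of order (T/2^k)^(3/2) decays like 2^(-k/2). It is split into two
equal factors, one for the Chebyshev threshold and one for the summability of the probabilities. -/
lemma two_pow_mul_sqrt (hT : 0 ≤ T) (k : ℕ) :
    2 ^ k * √√(T / 2 ^ k) ^ 6 = √T ^ 3 * (decay ^ k * decay ^ k) := by
  have h1 : √√(T / 2 ^ k) ^ 6 = √(T / 2 ^ k) ^ 3 := by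
    rw [show √√(T / 2 ^ k) ^ 6 = (√√(T / 2 ^ k) ^ 2) ^ 3 by ring,
      Real.sq_sqrt (Real.sqrt_nonneg _)]
  have h2 : √((2 : ℝ) ^ k) = √2 ^ k := by
    rw [Real.sqrt_eq_iff_mul_self_eq (by positivity) (by positivity), ← mul_pow,
      Real.mul_self_sqrt (by norm_num)]
  have h3 : (2 : ℝ) ^ k = √2 ^ k * √2 ^ k := by
    rw [← mul_pow, Real.mul_self_sqrt (by norm_num)]
  have h4 : decay ^ k * decay ^ k = (√2 ^ k)⁻¹ := by
    rw [← mul_pow, ← pow_two, decay_sq, inv_pow]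
  rw [h1, Real.sqrt_div hT, h2, h4, div_pow]
  nth_rw 1 [h3]
  field_simp

lemma dyadic_bounds (hT : 0 < T) {k i : ℕ} (hi : i < 2 ^ k) :
    0 ≤ i * (T / 2 ^ k) ∧ i * (T / 2 ^ k) < (i + 1 : ℕ) * (T / 2 ^ k) ∧
      (i + 1 : ℕ) * (T / 2 ^ k) ≤ T ∧ (i + 1 : ℕ) * (T / 2 ^ k) - i * (T / 2 ^ k) = T / 2 ^ k := by
  have h1 : (0 : ℝ) < T / 2 ^ k := by positivity
  refine ⟨by positivity, by push_cast; linarith, ?_, by push_cast; ring⟩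
  have h2 : ((i + 1 : ℕ) : ℝ) ≤ 2 ^ k := by exact_mod_cast hi
  calc ((i + 1 : ℕ) : ℝ) * (T / 2 ^ k) ≤ 2 ^ k * (T / 2 ^ k) := by gcongr
    _ = T := by field_simp

variable {P : Measure (Path n)}

lemma integral_dyadicSum_le [IsProbabilityMeasure P] (hT : 0 < T) (hM : 1 ≤ M)
    (hρ : IsHydrodynamicSolution F T ρ) (hq : IsWeight T M q) {C : ℝ}
    (hC : ∀ s t, 0 ≤ s → s < t → t ≤ T →
      ∫ w, (∫ r in s..t, occObservable n T ρ q r (obs w r)) ^ 2 ∂P ≤ C * √√(t - s) ^ 6) (k : ℕ) :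
    Integrable (dyadicSum n T ρ q k) P ∧
      ∫ w, dyadicSum n T ρ q k w ∂P ≤ C * √T ^ 3 * (decay ^ k * decay ^ k) := by
  have hc := continuous_occObservable (n := n) hρ hq hT.le hM
  have hi : ∀ i ∈ Finset.range (2 ^ k), Integrable (fun w : Path n =>
      (∫ r in (i * (T / 2 ^ k))..((i + 1 : ℕ) * (T / 2 ^ k)),
        occObservable n T ρ q r (obs w r)) ^ 2) P := fun i hi =>
    integrable_sq_additive hc (dyadic_bounds hT (Finset.mem_range.1 hi)).2.1.le
  refine ⟨integrable_finsetSum _ hi, ?_⟩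
  unfold dyadicSum
  rw [integral_finsetSum _ hi]
  calc _ ≤ ∑ i ∈ Finset.range (2 ^ k), C * √√(T / 2 ^ k) ^ 6 := by
        refine Finset.sum_le_sum fun i hi => ?_
        obtain ⟨h1, h2, h3, h4⟩ := dyadic_bounds hT (Finset.mem_range.1 hi)
        have := hC _ _ h1 h2 h3
        rwa [h4] at this
    _ = C * (2 ^ k * √√(T / 2 ^ k) ^ 6) := by
        rw [Finset.sum_const, Finset.card_range, nsmul_eq_mul]; push_cast; ring
    _ = _ := by rw [two_pow_mul_sqrt hT.le]; ring

/-- Each squared dyadic increment is at most the sum over its level, and chaining turns this into a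
modulus of continuity. The uniform bound is the case m = 0, as the path starts at 0. -/
lemma occupationPath_mem_modulusSet (hT : 0 < T) (hM : 1 ≤ M)
    (hρ : IsHydrodynamicSolution F T ρ) (hq : IsWeight T M q) {B : ℝ} (hB : 0 ≤ B) {w : Path n}
    (hw : ∀ k, dyadicSum n T ρ q k w ≤ B * decay ^ k) :
    occupationPath n T ρ q w ∈ modulusSet T (√B * (1 + 2 / (1 - √decay))) √decay := by
  have hx0 : 0 ≤ √decay := Real.sqrt_nonneg _
  have hx1 : √decay < 1 := by
    rw [Real.sqrt_lt' one_pos]; simpa using decay_lt_one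
  have hcont := continuousOn_occupationTime (n := n) hρ hq hT.le hM w
  have hinc : ∀ k i : ℕ, i < 2 ^ k → |occupationTime n ρ q w ((i + 1 : ℕ) * (T / 2 ^ k)) -
      occupationTime n ρ q w (i * (T / 2 ^ k))| ≤ √B * √decay ^ k := by
    intro k i hi
    obtain ⟨h1, h2, h3, -⟩ := dyadic_bounds hT hi
    rw [occupationTime_sub hρ hq hM h1 h2.le h3]
    have h4 : (∫ r in (i * (T / 2 ^ k))..((i + 1 : ℕ) * (T / 2 ^ k)),
        occObservable n T ρ q r (obs w r)) ^ 2 ≤ B * decay ^ k :=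
      (Finset.single_le_sum (f := fun i : ℕ => (∫ r in (i * (T / 2 ^ k))..((i + 1 : ℕ) *
        (T / 2 ^ k)), occObservable n T ρ q r (obs w r)) ^ 2) (fun _ _ => sq_nonneg _)
        (Finset.mem_range.2 hi)).trans (hw k)
    refine abs_le_of_sq_le_sq (h4.trans (le_of_eq ?_)) (by positivity)
    rw [mul_pow, Real.sq_sqrt hB, ← pow_mul, mul_comm k 2, pow_mul, Real.sq_sqrt decay_pos.le]
  have hmod := chaining hT hx0 hx1 (Real.sqrt_nonneg B) hcont hinc
  refine ⟨fun s => ?_, fun m s t hst => ?_⟩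
  · rw [occupationPath_apply hρ hq hT.le hM]
    have h1 := hmod 0 s.2 (left_mem_Icc.2 hT.le) (by
      rw [sub_zero, abs_of_nonneg s.2.1, pow_zero, div_one]; exact s.2.2)
    have h2 : occupationTime n ρ q w 0 = 0 := by simp [occupationTime]
    rwa [h2, sub_zero, pow_zero, mul_one] at h1
  · rw [occupationPath_apply hρ hq hT.le hM, occupationPath_apply hρ hq hT.le hM]
    exact hmod m s.2 t.2 hst

/-- Chebyshev's inequality at every dyadic level and a union bound over the levels. The compact set
depends only on T, C and δ, hence serves all n and all laws simultaneously. -/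
theorem exists_compact_of_second_moment (hT : 0 < T) (C : ℝ) {δ : ℝ≥0∞} (hδ : 0 < δ) :
    ∃ S : Set C(Icc (0 : ℝ) T, ℝ), IsCompact S ∧
      ∀ (F : ℝ → ℝ) (M : ℝ) (ρ : ℝ → ℝ → ℝ) (q : ℝ → ℝ), 1 ≤ M →
        IsHydrodynamicSolution F T ρ → IsWeight T M q →
        ∀ (n : ℕ) [NeZero n] (P : Measure (Path n)) [IsProbabilityMeasure P],
          (∀ s t, 0 ≤ s → s < t → t ≤ T →
            ∫ w, (∫ r in s..t, occObservable n T ρ q r (obs w r)) ^ 2 ∂P ≤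
              C * √√(t - s) ^ 6) →
          P.map (occupationPath n T ρ q) Sᶜ ≤ δ := by
  obtain ⟨d, hd0, hdδ⟩ : ∃ d : ℝ, 0 < d ∧ ENNReal.ofReal d ≤ δ := by
    obtain ⟨d, hd, hdδ⟩ := ENNReal.lt_iff_exists_nnreal_btwn.1 hδ
    exact ⟨d, by exact_mod_cast hd, by rw [ENNReal.ofReal_coe_nnreal]; exact hdδ.le⟩
  have hy := decay_lt_one
  have hy0 := decay_pos
  set C' := max C 0 * √T ^ 3 with hC'
  have hC'0 : 0 ≤ C' := by positivity
  -- Chosen so that the geometric series of probabilities with ratio `decay` and first term C'/B has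
  -- sum at most d; the added 1 keeps B positive when C' = 0.
  set B := C' / (d * (1 - decay)) + 1 with hB
  have hden : 0 < d * (1 - decay) := mul_pos hd0 (by linarith)
  have hB0 : 0 < B := by positivity
  have hCB : C' / B ≤ d * (1 - decay) := by
    rw [div_le_iff₀ hB0, hB, mul_add, mul_div_cancel₀ _ hden.ne', mul_one]
    linarith
  have hx1 : √decay < 1 := by
    rw [Real.sqrt_lt' one_pos]; simpa using decay_lt_one
  have hcomp : IsCompact (modulusSet T (√B * (1 + 2 / (1 - √decay))) √decay) :=
    isCompact_modulusSet hT (Real.sqrt_nonneg _) hx1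
  refine ⟨_, hcomp, fun F M ρ q hM hρ hq n _ P _ hmom => ?_⟩
  rw [Measure.map_apply (measurable_occupationPath hρ hq hT.le hM)
    hcomp.isClosed.measurableSet.compl]
  have hsub : occupationPath n T ρ q ⁻¹' (modulusSet T (√B * (1 + 2 / (1 - √decay))) √decay)ᶜ ⊆
      ⋃ k, {w | B * decay ^ k ≤ dyadicSum n T ρ q k w} := by
    intro w hw
    by_contra hcon
    simp only [mem_iUnion, not_exists, mem_ofPred_eq, not_le] at hcon
    exact hw (occupationPath_mem_modulusSet hT hM hρ hq hB0.le fun k => (hcon k).le)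
  have hk : ∀ k, P {w | B * decay ^ k ≤ dyadicSum n T ρ q k w} ≤
      ENNReal.ofReal (d * (1 - decay) * decay ^ k) := by
    intro k
    obtain ⟨hi, hle⟩ := integral_dyadicSum_le hT hM hρ hq hmom k
    have h1 := mul_meas_ge_le_integral_of_nonneg (μ := P) (f := dyadicSum n T ρ q k)
      (ae_of_all _ fun w => Finset.sum_nonneg fun _ _ => sq_nonneg _) hi (B * decay ^ k)
    have hyk : 0 < decay ^ k := by positivity
    rw [← ofReal_measureReal]
    refine ENNReal.ofReal_le_ofReal ?_
    have h2 : C * √T ^ 3 * (decay ^ k * decay ^ k) ≤ C' * (decay ^ k * decay ^ k) := by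
      rw [hC']
      gcongr
      exact le_max_left _ _
    have h3 : P.real {w | B * decay ^ k ≤ dyadicSum n T ρ q k w} ≤ C' / B * decay ^ k := by
      have h4 := h1.trans (hle.trans h2)
      rw [div_mul_eq_mul_div, le_div_iff₀ hB0]
      refine le_of_mul_le_mul_right ?_ hyk
      calc _ = B * decay ^ k * P.real {w | B * decay ^ k ≤ dyadicSum n T ρ q k w} := by ring
        _ ≤ _ := h4
        _ = _ := by ring
    exact h3.trans (by gcongr)
  refine le_trans ?_ hdδ
  calc P _ ≤ P (⋃ k, {w | B * decay ^ k ≤ dyadicSum n T ρ q k w}) := measure_mono hsub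
    _ ≤ ∑' k, P {w | B * decay ^ k ≤ dyadicSum n T ρ q k w} := measure_iUnion_le _
    _ ≤ ∑' k : ℕ, ENNReal.ofReal (d * (1 - decay) * decay ^ k) := ENNReal.tsum_le_tsum hk
    _ = ENNReal.ofReal d := by
        rw [← ENNReal.ofReal_tsum_of_nonneg (fun k => by positivity)
          ((summable_geometric_of_lt_one hy0.le hy).mul_left _), tsum_mul_left,
          tsum_geometric_of_lt_one hy0.le hy, mul_assoc, mul_inv_cancel₀ (by linarith), mul_one]

end Tightness

/-! ### Interpolation of moments -/

section Moments

lemma rpow_le_one_add_sq {y lam : ℝ} (hy : 0 ≤ y) (h0 : 0 ≤ lam) (h2 : lam ≤ 2) :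
    y ^ lam ≤ 1 + y ^ 2 := by
  rcases le_total y 1 with h | h
  · have := Real.rpow_le_one hy h h0
    nlinarith [sq_nonneg y]
  · have := Real.rpow_le_rpow_of_exponent_le h h2
    rw [Real.rpow_two] at this
    linarith

lemma sqrt_sqrt_pow_rpow {τ : ℝ} (hτ : 0 ≤ τ) (lam : ℝ) :
    (√√τ ^ 3) ^ lam = τ ^ (3 * lam / 4) := by
  rw [Real.sqrt_eq_rpow, Real.sqrt_eq_rpow, ← Real.rpow_mul hτ, ← Real.rpow_natCast,
    ← Real.rpow_mul hτ, ← Real.rpow_mul hτ]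
  congr 1
  push_cast
  ring

variable {Ω : Type*} [MeasurableSpace Ω] {P : Measure Ω} [IsProbabilityMeasure P]

/-- After division by b = τ^(3/4), the elementary bound |y|^λ ≤ 1 + y² replaces Hölder's inequality,
and b^λ = τ^(3λ/4). -/
lemma integral_rpow_le_of_sq {X : Ω → ℝ} (hX : Measurable X) {B : ℝ} (hB : ∀ w, |X w| ≤ B)
    {C τ lam : ℝ} (hτ : 0 < τ) (hlam : lam ∈ Ioo (1 : ℝ) 2)
    (h2 : ∫ w, X w ^ 2 ∂P ≤ C * √√τ ^ 6) :
    Integrable (fun w => |X w| ^ lam) P ∧ ∫ w, |X w| ^ lam ∂P ≤ (1 + C) * τ ^ (3 * lam / 4) := by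
  have hl0 : 0 ≤ lam := by linarith [hlam.1]
  set b := √√τ ^ 3 with hb
  have hb0 : 0 < b := by positivity
  have hbl : 0 < b ^ lam := Real.rpow_pos_of_pos hb0 _
  have hb2 : √√τ ^ 6 = b ^ 2 := by rw [hb]; ring
  have hi : Integrable (fun w => |X w| ^ lam) P := by
    refine Integrable.of_bound (hX.abs.pow_const lam).aestronglyMeasurable (B ^ lam)
      (ae_of_all _ fun w => ?_)
    rw [Real.norm_of_nonneg (Real.rpow_nonneg (abs_nonneg _) _)]
    exact Real.rpow_le_rpow (abs_nonneg _) (hB w) hl0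
  have hi2 : Integrable (fun w => X w ^ 2) P := by
    refine Integrable.of_bound (hX.pow_const 2).aestronglyMeasurable (B ^ 2)
      (ae_of_all _ fun w => ?_)
    rw [Real.norm_eq_abs, abs_pow]
    exact pow_le_pow_left₀ (abs_nonneg _) (hB w) 2
  refine ⟨hi, ?_⟩
  have hpt : ∀ w, |X w| ^ lam ≤ b ^ lam * (1 + (b ^ 2)⁻¹ * X w ^ 2) := by
    intro w
    have h1 := rpow_le_one_add_sq (y := |X w| / b) (by positivity) hl0 hlam.2.le
    rw [Real.div_rpow (abs_nonneg _) hb0.le, div_le_iff₀ hbl, div_pow, sq_abs] at h1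
    calc _ ≤ _ := h1
      _ = _ := by ring
  have hi3 : Integrable (fun w => (b ^ 2)⁻¹ * X w ^ 2) P := hi2.const_mul _
  calc ∫ w, |X w| ^ lam ∂P ≤ ∫ w, b ^ lam * (1 + (b ^ 2)⁻¹ * X w ^ 2) ∂P :=
        integral_mono hi (((integrable_const _).add hi3).const_mul _) hpt
    _ = b ^ lam * (1 + (b ^ 2)⁻¹ * ∫ w, X w ^ 2 ∂P) := by
        rw [integral_const_mul, integral_add (integrable_const _) hi3, integral_const_mul]
        simp
    _ ≤ b ^ lam * (1 + (b ^ 2)⁻¹ * (C * b ^ 2)) := by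
        rw [hb2] at h2
        gcongr
    _ = (1 + C) * τ ^ (3 * lam / 4) := by
        rw [← sqrt_sqrt_pow_rpow hτ.le, ← hb]
        field_simp

end Moments

end WASEP

end

/-! ### The moment bound and tightness -/

theorem theorem4p4
    (F : ℝ → ℝ) (hF : ContDiff ℝ ∞ F) (hFper : Function.Periodic F 1)
    (T : ℝ) (hT : 0 < T) (ε₀ : ℝ) (hε₀ : ε₀ ∈ Ioo (0 : ℝ) (1 / 2)) (κ : ℝ)
    (M : ℝ) (hM : 1 ≤ M) (K : ℝ) :
    -- the moment bound
    (∀ lam ∈ Ioo (1 : ℝ) 2, ∃ C : ℝ, 0 < C ∧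
      ∀ (ρ : ℝ → ℝ → ℝ) (q : ℝ → ℝ),
        WASEP.IsHydrodynamicSolution F T ρ →
        (∀ u, ρ 0 u ∈ Ioo ε₀ (1 - ε₀)) → WASEP.GradientBound T κ ρ → WASEP.IsWeight T M q →
        ∀ (n : ℕ) [NeZero n] (P : Measure (WASEP.Path n)),
          WASEP.IsAdmissibleLaw n F (ρ 0) K P →
          ∀ s t : ℝ, 0 ≤ s → s < t → t ≤ T →
            Integrable (fun w => |WASEP.occupationTime n ρ q w t
              - WASEP.occupationTime n ρ q w s| ^ lam) P ∧
            ∫ w, |WASEP.occupationTime n ρ q w t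
              - WASEP.occupationTime n ρ q w s| ^ lam ∂P ≤ C * |t - s| ^ (3 * lam / 4)) ∧
    -- tightness in `C([0,T], ℝ)` with the uniform topology
    (∀ (ρ : ℝ → ℝ → ℝ) (q : ℝ → ℝ),
        WASEP.IsHydrodynamicSolution F T ρ →
        (∀ u, ρ 0 u ∈ Ioo ε₀ (1 - ε₀)) → WASEP.GradientBound T κ ρ → WASEP.IsWeight T M q →
        (∀ (n : ℕ) [NeZero n],
          (∀ w : WASEP.Path n, ContinuousOn (WASEP.occupationTime n ρ q w) (Icc 0 T)) ∧
          Measurable (WASEP.occupationPath n T ρ q)) ∧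
        IsTightMeasureSet {ν : Measure C(Icc (0 : ℝ) T, ℝ) |
          ∃ (n : ℕ) (_ : NeZero n) (P : Measure (WASEP.Path n)),
            WASEP.IsAdmissibleLaw n F (ρ 0) K P ∧
            ν = P.map (WASEP.occupationPath n T ρ q)}) := by
  obtain ⟨C, -, hFC, hF'⟩ := WASEP.exists_drift_bound hF hFper
  -- This constant is fixed before ρ, q, n and the law are introduced, which is the required
  -- uniformity.
  set D := WASEP.uniformMoment T (WASEP.ellipticity C T ε₀) κ C M K with hD
  refine ⟨fun lam hlam => ⟨1 + |D|, by positivity, ?_⟩, ?_⟩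
  · intro ρ q hρ h0 hκ hq n _ P hP s t hs hst ht
    have : IsProbabilityMeasure P := by
      obtain ⟨-, μ, -, -, hlaw⟩ := hP
      exact hlaw.isProbabilityMeasure
    have hc := WASEP.continuous_occObservable (n := n) hρ hq hT.le hM
    obtain ⟨B, hB⟩ := WASEP.exists_bound_additive hc hst.le
    have h2 := hP.second_moment_le hF hFper hT hε₀ hM hFC hF' hρ h0 hκ hq hs hst ht
    have h3 : D * √√(t - s) ^ 6 ≤ |D| * √√(t - s) ^ 6 := by
      gcongr
      exact le_abs_self D
    have hτ : 0 < t - s := by linarith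
    rw [abs_of_pos hτ]
    simp only [WASEP.occupationTime_sub hρ hq hM hs hst.le ht]
    exact WASEP.integral_rpow_le_of_sq (WASEP.measurable_additive hc hst.le) hB hτ hlam
      (h2.trans h3)
  · intro ρ q hρ h0 hκ hq
    refine ⟨fun n _ => ⟨WASEP.continuousOn_occupationTime hρ hq hT.le hM,
      WASEP.measurable_occupationPath hρ hq hT.le hM⟩, ?_⟩
    rw [isTightMeasureSet_iff_exists_isCompact_measure_compl_le]
    intro δ hδ
    obtain ⟨S, hS, hSle⟩ := WASEP.exists_compact_of_second_moment hT D hδ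
    refine ⟨S, hS, ?_⟩
    rintro _ ⟨n, _, P, hP, rfl⟩
    have : IsProbabilityMeasure P := by
      obtain ⟨-, μ, -, -, hlaw⟩ := hP
      exact hlaw.isProbabilityMeasure
    exact hSle F M ρ q hM hρ hq n P fun s t hs hst ht =>
      hP.second_moment_le hF hFper hT hε₀ hM hFC hF' hρ h0 hκ hq hs hst ht
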